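/- Let $k$ be a field, $\Gamma$ a Hopf algebra over $k$ with bijective antipode $S$, $A$ a $\Gamma$-module algebra, $A\#\Gamma$ the smash product and $\varphi: A\#\Gamma\to B$ a homomorphism of $k$-algebras. (Tensor products without subscript are over $k$; $R^e=R\otimes R^{op}$; Sweedler notation is used.) **Data.** * $K$ is a complex of $\Gamma$-equivariant $A$-bimodules with a $\Gamma$-linear quasi-isomorphism $\tau:K\to A$ of complexes of bimodules, concentrated in nonnegative homological degrees; $K$ is free over $A^e$ on a graded subspace $\bar K\subset K$ which is a $\Gamma$-submodule; and $\omega:K\to K\otimes_A K$ is a $\Gamma$-linear diagonal map. * $L$ is a projective resolution $\xi:L\to k$ of the trivial right $\Gamma$-module, with a diagonal map $\sigma:L\to L\otimes L$ of complexes of right $\Gamma$-modules. * $P$ is a $\Gamma$-equivariant bimodule resolution of $A$ that is projective over $A^e$ in each degree, with a $\Gamma$-linear diagonal map $P\to P\otimes_A P$. Here a *diagonal map* is a morphism of complexes of bimodules (respectively of right $\Gamma$-modules) that is compatible with the augmentations to $A$ (respectively $k$); on these complexes it is then a quasi-isomorphism. **Complexes.** Let $L^\uparrow=L\otimes_\Gamma(\Gamma\otimes\Gamma)$,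 where $\delta\cdot(\gamma\otimes\gamma')=\gamma S(\delta_1)\otimes\delta_2\gamma'$; it is a complex of $\Gamma$-bimodules by the outer multiplications, with left coaction $l\otimes\gamma\otimes\gamma'\mapsto\gamma_1\gamma'_1\otimes(l\otimes\gamma_2\otimes\gamma'_2)$ and augmentation $l\otimes\gamma\otimes\gamma'\mapsto\xi(l)\gamma\gamma'$ to $\Gamma$. Write $l$ also for $l\otimes 1\otimes 1\in L^\uparrow$. Let $K\#L^\uparrow=K\otimes L^\uparrow$ be the complex of $A\#\Gamma$-bimodules with augmentation $\tau\otimes\xi^\uparrow$ and $$a(x\otimes y)=ax\otimes y,\quad \gamma(x\otimes y)=\gamma_1x\otimes\gamma_2y,\quad (x\otimes y)a=x(y_{-1}\cdot a)\otimes y_0,\quad (x\otimes y)\gamma=x\otimes y\gamma .$$ For a complex $X$ of bimodules over $R=A\#\Gamma$ (respectively $R=A$) with diagonal map $\Delta$, $\mathrm{Hom}_{R^e}(X,B)$ is a dg algebra (not necessarily associative) with differential $f\mapsto -(-1)^{|f|}f d$ and product $f\cup g=\mu_B(f\otimes_R g)\Delta$ (with Koszul sign). $\Gamma$ acts on the right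 of $\mathrm{Hom}_{A^e}(P,B)$ by $(f\cdot\gamma)(x)=\varphi(S(\gamma_1))f(\gamma_2x)\varphi(\gamma_3)$, and $\mathrm{Hom}_\Gamma(L,\mathrm{Hom}_{A^e}(P,B))$ is a dg algebra (not necessarily associative) with differential $F\mapsto dF-(-1)^{|F|}Fd$ and product $F\cdot G=\cup\,(F\otimes G)\,\sigma$. **Claim.** 1. There is a unique diagonal map $\Delta$ of $K\#L^\uparrow$, linear over $A\#\Gamma$-bimodules, with $$\Delta(x\otimes l)=\sum(-1)^{|l_1||x_2|}(x_1\otimes l_1)\otimes_{A\#\Gamma}(x_2\otimes l_2),\qquad x\in K,\ l\in L,$$ where $\omega(x)=\sum x_1\otimes x_2$ and $\sigma(l)=\sum l_1\otimes l_2$. 2. For this $\Delta$ there are a (not necessarily associative) dg algebra $\mathscr A$ and quasi-isomorphisms $$\mathrm{Hom}_{(A\#\Gamma)^e}(K\#L^\uparrow,B)\xrightarrow{\ \eta_1\ }\mathscr A\xleftarrow{\ \eta_2\ }\mathrm{Hom}_\Gamma(L,\mathrm{Hom}_{A^e}(P,B))$$ that are algebra maps up to homotopy: for $\eta=\eta_1,\eta_2$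 the chain maps $f\otimes g\mapsto\eta(fg)$ and $f\otimes g\mapsto\eta(f)\eta(g)$ are chain homotopic. 3. Both complexes compute the algebra $\mathrm{HH}(A\#\Gamma,B)$ with the cup product: let $Q$ be any projective bimodule resolution of $A\#\Gamma$ with any diagonal map, so that $\mathrm{HH}(A\#\Gamma,B)=\mathrm H(\mathrm{Hom}_{(A\#\Gamma)^e}(Q,B))$ with cup product. Then there are morphisms $c:Q\to K\#L^\uparrow$ of augmented complexes of bimodules, and there are isomorphisms of graded algebras $$\Psi_1:\mathrm H(\mathrm{Hom}_{(A\#\Gamma)^e}(K\#L^\uparrow,B))\to\mathrm{HH}(A\#\Gamma,B),\qquad \Psi_2:\mathrm H(\mathrm{Hom}_\Gamma(L,\mathrm{Hom}_{A^e}(P,B)))\to\mathrm{HH}(A\#\Gamma,B)$$ such that $\Psi_1[f]=[f\circ c]$ for every such $c$, and $\Psi_1(u)=\Psi_2(v)$ whenever $\mathrm H(\eta_1)(u)=\mathrm H(\eta_2)(v)$. -/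

import Mathlib

universe u

set_option linter.unusedSectionVars false

noncomputable section

open TensorProduct Coalgebra

namespace SmashHH

/-- The sign `(-1)^n`. -/
def sg (n : ℤ) : ℤ := (n.negOnePow : ℤˣ)

lemma sg_add (m n : ℤ) : sg (m + n) = sg m * sg n := by simp [sg, Int.negOnePow_add]
lemma sg_zero : sg 0 = 1 := by simp [sg]
lemma sg_one : sg 1 = -1 := by simp [sg]
lemma sg_mul_self (n : ℤ) : sg n * sg n = 1 := by
  rw [← sg_add, sg, Int.negOnePow_even _ (Even.add_self n)]; rfl
lemma sg_neg (n : ℤ) : sg (-n) = sg n := by simp [sg]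
lemma sg_even {n : ℤ} (h : Even n) : sg n = 1 := by simp [sg, Int.negOnePow_even _ h]
lemma sg_odd {n : ℤ} (h : Odd n) : sg n = -1 := by simp [sg, Int.negOnePow_odd _ h]

lemma sg_cases (n : ℤ) : sg n = 1 ∨ sg n = -1 := by
  rcases Int.even_or_odd n with h | h
  · exact Or.inl (sg_even h)
  · exact Or.inr (sg_odd h)

section Graded
variable {k X Y : Type u} [Field k] [AddCommGroup X] [Module k X] [AddCommGroup Y] [Module k Y]

lemma zsmul_tmul (m : ℤ) (x : X) (y : Y) : (m • x) ⊗ₜ[k] y = m • (x ⊗ₜ[k] y) :=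
  map_zsmul ((TensorProduct.mk k X Y).flip y) m x

lemma tmul_zsmul (m : ℤ) (x : X) (y : Y) : x ⊗ₜ[k] (m • y) = m • (x ⊗ₜ[k] y) :=
  map_zsmul (TensorProduct.mk k X Y x) m y

/-- The decomposition isomorphism of an internal direct sum. -/
def decompEquiv {gr : ℕ → Submodule k X} (h : DirectSum.IsInternal gr) :
    DirectSum ℕ (fun n => gr n) ≃ₗ[k] X :=
  LinearEquiv.ofBijective (DirectSum.coeLinearMap gr) (id h)

/-- Multiplication of the `n`-th homogeneous component by the integer `c n`. -/
def scaleOf {gr : ℕ → Submodule k X} (h : DirectSum.IsInternal gr) (c : ℕ → ℤ) : X →ₗ[k] X :=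
  DirectSum.toModule k ℕ X (fun n => c n • (gr n).subtype) ∘ₗ
    (decompEquiv h).symm.toLinearMap

lemma scaleOf_mem {gr : ℕ → Submodule k X} (h : DirectSum.IsInternal gr) (c : ℕ → ℤ) {n : ℕ}
    {x : X} (hx : x ∈ gr n) : scaleOf h c x = c n • x := by
  have : (decompEquiv h).symm x = DirectSum.lof k ℕ (fun i => gr i) n ⟨x, hx⟩ := by
    rw [LinearEquiv.symm_apply_eq]
    exact (DirectSum.coeLinearMap_lof gr n ⟨x, hx⟩).symm
  simp only [scaleOf, LinearMap.comp_apply, LinearEquiv.coe_coe, this, DirectSum.toModule_lof]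
  simp

lemma ext_gr {gr : ℕ → Submodule k X} (h : DirectSum.IsInternal gr) {M : Type*}
    [AddCommGroup M] [Module k M] {f g : X →ₗ[k] M}
    (hfg : ∀ n, ∀ x ∈ gr n, f x = g x) : f = g := by
  ext x
  have hx : x ∈ ⨆ n, gr n := by rw [h.submodule_iSup_eq_top]; trivial
  induction hx using Submodule.iSup_induction' with
  | mem i x hx => exact hfg i x hx
  | zero => simp
  | add x y _ _ hx hy => simp [hx, hy]

lemma isInternal_of_proj {gr : ℕ → Submodule k X} (π : ℕ → X →ₗ[k] X)
    (h1 : ∀ n, ∀ x ∈ gr n, π n x = x) (h2 : ∀ m n, m ≠ n → ∀ x ∈ gr m, π n x = 0)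
    (h3 : ⨆ n, gr n = ⊤) : DirectSum.IsInternal gr := by
  constructor
  · have key : ∀ v : DirectSum ℕ (fun i => gr i), ∀ n,
        π n (DirectSum.coeLinearMap gr v) = (v n : X) := by
      intro v n
      induction v using DirectSum.induction_on with
      | zero => simp
      | of i x =>
        have : DirectSum.coeLinearMap gr (DirectSum.of (fun i => gr i) i x) = (x : X) :=
          DirectSum.coeLinearMap_lof gr i x
        rw [this]
        by_cases hin : i = n
        · subst hin; rw [h1 i x x.2, DirectSum.of_eq_same]
        · rw [h2 i n hin x x.2, DirectSum.of_eq_of_ne _ _ _ (Ne.symm hin)]; rfl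
      | add x y hx hy => simp only [map_add, hx, hy]; rfl
    intro v w hvw
    ext n
    have := congrArg (π n) hvw
    erw [key, key] at this
    exact this
  · intro x
    have hx : x ∈ ⨆ n, gr n := by rw [h3]; trivial
    have := (DirectSum.range_coeLinearMap (A := gr))
    rw [← this] at hx
    exact hx

/-- A complex of vector spaces `⋯ → X₂ → X₁ → X₀ → 0`, presented by its total space
`X = ⨁ₙ Xₙ`; the homological degree `n` corresponds to the cohomological degree `-n`. -/
structure GrCx (k X : Type u) [Field k] [AddCommGroup X] [Module k X] where
  gr : ℕ → Submodule k X
  isInternal : DirectSum.IsInternal gr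
  d : X →ₗ[k] X
  d_mem : ∀ n x, x ∈ gr (n + 1) → d x ∈ gr n
  d_gr_zero : ∀ x ∈ gr 0, d x = 0
  d_d : ∀ x, d (d x) = 0

namespace GrCx

/-- The sign operator `x ↦ (-1)^|x| x`. -/
def sgn (C : GrCx k X) : X →ₗ[k] X := scaleOf C.isInternal fun n => sg n

/-- The projection onto the even part. -/
def even (C : GrCx k X) : X →ₗ[k] X := scaleOf C.isInternal fun n => if Even n then 1 else 0

/-- The projection onto the odd part. -/
def odd (C : GrCx k X) : X →ₗ[k] X := scaleOf C.isInternal fun n => if Even n then 0 else 1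

/-- The projection onto the `m`-th homogeneous component. -/
def proj (C : GrCx k X) (m : ℕ) : X →ₗ[k] X := scaleOf C.isInternal fun n => if n = m then 1 else 0

lemma sgn_mem (C : GrCx k X) {n : ℕ} {x : X} (hx : x ∈ C.gr n) :
    C.sgn x = sg n • x := scaleOf_mem _ _ hx

lemma proj_mem (C : GrCx k X) {n : ℕ} {x : X} (hx : x ∈ C.gr n) : C.proj n x = x := by
  simp [proj, scaleOf_mem _ _ hx]

lemma proj_mem_ne (C : GrCx k X) {m n : ℕ} (h : m ≠ n) {x : X} (hx : x ∈ C.gr m) :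
    C.proj n x = 0 := by
  simp [proj, scaleOf_mem _ _ hx, h]

/-- A degree zero map commutes with the scaling operators. -/
lemma scale_comm (C : GrCx k X) (D : GrCx k Y) (c : ℕ → ℤ) {f : X →ₗ[k] Y}
    (hf : ∀ n, ∀ x ∈ C.gr n, f x ∈ D.gr n) (x : X) :
    f (scaleOf C.isInternal c x) = scaleOf D.isInternal c (f x) := by
  suffices h : f ∘ₗ scaleOf C.isInternal c = scaleOf D.isInternal c ∘ₗ f from
    LinearMap.congr_fun h x
  refine ext_gr C.isInternal fun n x hx => ?_
  simp [scaleOf_mem _ _ hx, scaleOf_mem _ _ (hf n x hx)]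

lemma d_sgn (C : GrCx k X) (x : X) : C.d (C.sgn x) = - C.sgn (C.d x) := by
  suffices h : C.d ∘ₗ C.sgn = - (C.sgn ∘ₗ C.d) from LinearMap.congr_fun h x
  refine ext_gr C.isInternal fun n x hx => ?_
  rcases n with _ | n
  · simp [C.sgn_mem hx, C.d_gr_zero x hx]
  · simp [C.sgn_mem hx, C.sgn_mem (C.d_mem n x hx), sg_add, sg_one]

lemma sgn_sgn (C : GrCx k X) (x : X) : C.sgn (C.sgn x) = x := by
  suffices h : C.sgn ∘ₗ C.sgn = LinearMap.id from LinearMap.congr_fun h x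
  refine ext_gr C.isInternal fun n x hx => ?_
  simp [C.sgn_mem hx, smul_smul, sg_mul_self]

/-- The differential `x ⊗ y ↦ dx ⊗ y + (-1)^|x| x ⊗ dy` of a tensor product over `k`. -/
def tensorD (C : GrCx k X) (D : GrCx k Y) : X ⊗[k] Y →ₗ[k] X ⊗[k] Y :=
  TensorProduct.map C.d LinearMap.id + TensorProduct.map C.sgn D.d

/-- The homogeneous components of a tensor product over `k`. -/
def tensorGr (C : GrCx k X) (D : GrCx k Y) (n : ℕ) : Submodule k (X ⊗[k] Y) :=
  Submodule.span k {t | ∃ i j, i + j = n ∧ ∃ x ∈ C.gr i, ∃ y ∈ D.gr j, t = x ⊗ₜ[k] y}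

lemma tensorGr_isInternal (C : GrCx k X) (D : GrCx k Y) :
    DirectSum.IsInternal (C.tensorGr D) := by
  refine isInternal_of_proj (fun n => ∑ p ∈ Finset.HasAntidiagonal.antidiagonal n,
    TensorProduct.map (C.proj p.1) (D.proj p.2)) ?_ ?_ ?_
  · intro n x hx
    induction hx using Submodule.span_induction with
    | mem t ht =>
      obtain ⟨i, j, rfl, x, hx, y, hy, rfl⟩ := ht
      rw [LinearMap.sum_apply, Finset.sum_eq_single (i, j)]
      · simp [C.proj_mem hx, D.proj_mem hy]
      · rintro ⟨a, b⟩ _ hne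
        by_cases hia : i = a
        · have : j ≠ b := fun h => hne (by rw [hia, h])
          simp [D.proj_mem_ne this hy]
        · simp [C.proj_mem_ne hia hx]
      · intro h; simp at h
    | zero => simp
    | add x y _ _ hx hy => rw [map_add, hx, hy]
    | smul a x _ hx => rw [map_smul, hx]
  · intro m n hmn x hx
    induction hx using Submodule.span_induction with
    | mem t ht =>
      obtain ⟨i, j, rfl, x, hx, y, hy, rfl⟩ := ht
      rw [LinearMap.sum_apply]
      refine Finset.sum_eq_zero ?_
      rintro ⟨a, b⟩ hab
      rw [Finset.HasAntidiagonal.mem_antidiagonal] at hab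
      by_cases hia : i = a
      · have : j ≠ b := fun h => hmn (by rw [hia, h]; exact hab)
        simp [D.proj_mem_ne this hy]
      · simp [C.proj_mem_ne hia hx]
    | zero => simp
    | add x y _ _ hx hy => rw [map_add, hx, hy, add_zero]
    | smul a x _ hx => rw [map_smul, hx, smul_zero]
  · rw [eq_top_iff]
    intro t _
    have hpure : ∀ (x : X) (y : Y), x ⊗ₜ[k] y ∈ ⨆ n, C.tensorGr D n := by
      intro x y
      have hx : x ∈ ⨆ n, C.gr n := by rw [C.isInternal.submodule_iSup_eq_top]; trivial
      have hy : y ∈ ⨆ n, D.gr n := by rw [D.isInternal.submodule_iSup_eq_top]; trivial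
      induction hx using Submodule.iSup_induction' with
      | mem i x hx =>
        induction hy using Submodule.iSup_induction' with
        | mem j y hy =>
          exact Submodule.mem_iSup_of_mem (i + j)
            (Submodule.subset_span ⟨i, j, rfl, x, hx, y, hy, rfl⟩)
        | zero => simp
        | add y z _ _ hy hz => rw [TensorProduct.tmul_add]; exact add_mem hy hz
      | zero => simp
      | add x z _ _ hx hz => rw [TensorProduct.add_tmul]; exact add_mem hx hz
    induction t using TensorProduct.induction_on with
    | zero => exact zero_mem _
    | tmul x y => exact hpure x y
    | add x y hx hy => exact add_mem (hx trivial) (hy trivial)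

/-- The tensor product of two complexes over `k`. -/
def tensor (C : GrCx k X) (D : GrCx k Y) : GrCx k (X ⊗[k] Y) where
  gr := C.tensorGr D
  isInternal := C.tensorGr_isInternal D
  d := C.tensorD D
  d_mem := by
    intro n t ht
    induction ht using Submodule.span_induction with
    | mem t ht =>
      obtain ⟨i, j, hij, x, hx, y, hy, rfl⟩ := ht
      simp only [tensorD, LinearMap.add_apply, TensorProduct.map_tmul, LinearMap.id_coe, id_eq,
        C.sgn_mem hx]
      refine add_mem ?_ ?_
      · rcases i with _ | i
        · simp [C.d_gr_zero x hx]
        · exact Submodule.subset_span ⟨i, j, by omega, _, C.d_mem i x hx, y, hy, rfl⟩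
      · rcases j with _ | j
        · simp [D.d_gr_zero y hy]
        · exact Submodule.subset_span ⟨i, j, by omega, _, zsmul_mem hx _, _, D.d_mem j y hy, rfl⟩
    | zero => simp
    | add x y _ _ hx hy => rw [map_add]; exact add_mem hx hy
    | smul a x _ hx => rw [map_smul]; exact Submodule.smul_mem _ _ hx
  d_gr_zero := by
    intro t ht
    induction ht using Submodule.span_induction with
    | mem t ht =>
      obtain ⟨i, j, hij, x, hx, y, hy, rfl⟩ := ht
      obtain ⟨rfl, rfl⟩ : i = 0 ∧ j = 0 := by omega
      simp [tensorD, C.d_gr_zero x hx, D.d_gr_zero y hy]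
    | zero => simp
    | add x y _ _ hx hy => rw [map_add, hx, hy, add_zero]
    | smul a x _ hx => rw [map_smul, hx, smul_zero]
  d_d := by
    intro t
    induction t using TensorProduct.induction_on with
    | zero => simp
    | tmul x y => simp [tensorD, C.d_d, D.d_d, C.d_sgn, TensorProduct.neg_tmul]
    | add x y hx hy => rw [map_add, map_add, hx, hy, add_zero]

end GrCx
end Graded

section Actions
variable (k R X : Type u) [Field k] [Ring R] [Algebra k R] [AddCommGroup X] [Module k X]

/-- An `R`-bimodule over the ground field `k`: commuting `k`-linear left and right actions. -/
class IsBimod [Module R X] [Module Rᵐᵒᵖ X] : Prop where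
  tower_left : IsScalarTower k R X
  tower_right : IsScalarTower k Rᵐᵒᵖ X
  comm : SMulCommClass R Rᵐᵒᵖ X

attribute [instance] IsBimod.tower_left IsBimod.tower_right

instance isBimod_self : IsBimod k R R := ⟨inferInstance, inferInstance, inferInstance⟩

/-- The left action `r ↦ (x ↦ r x)`. -/
def lact [Module R X] [IsScalarTower k R X] : R →ₗ[k] Module.End k X :=
  (Algebra.lsmul k k X : R →ₐ[k] Module.End k X).toLinearMap

/-- The right action `r ↦ (x ↦ x r)`. -/
def ract [Module Rᵐᵒᵖ X] [IsScalarTower k Rᵐᵒᵖ X] : R →ₗ[k] Module.End k X :=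
  (Algebra.lsmul k k X : Rᵐᵒᵖ →ₐ[k] Module.End k X).toLinearMap ∘ₗ
    (MulOpposite.opLinearEquiv k).toLinearMap

variable {k R X}

@[simp] lemma lact_apply [Module R X] [IsScalarTower k R X] (r : R) (x : X) :
    lact k R X r x = r • x := rfl

@[simp] lemma ract_apply [Module Rᵐᵒᵖ X] [IsScalarTower k Rᵐᵒᵖ X] (r : R) (x : X) :
    ract k R X r x = MulOpposite.op r • x := rfl

lemma lact_mul [Module R X] [IsScalarTower k R X] (r s : R) :
    lact k R X (r * s) = lact k R X r ∘ₗ lact k R X s := by ext x; simp [mul_smul]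

lemma lact_one [Module R X] [IsScalarTower k R X] : lact k R X 1 = LinearMap.id := by ext x; simp

lemma ract_mul [Module Rᵐᵒᵖ X] [IsScalarTower k Rᵐᵒᵖ X] (r s : R) :
    ract k R X (r * s) = ract k R X s ∘ₗ ract k R X r := by ext x; simp [mul_smul]

lemma ract_one [Module Rᵐᵒᵖ X] [IsScalarTower k Rᵐᵒᵖ X] : ract k R X 1 = LinearMap.id := by
  ext x; simp

variable (k) in
lemma lact_ract [Module R X] [Module Rᵐᵒᵖ X] [h : IsBimod k R X] (r s : R) (x : X) :
    r • (MulOpposite.op s • x) = MulOpposite.op s • (r • x) :=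
  h.comm.smul_comm _ _ _

end Actions

section Diag
variable {k Γ X Y Z X' Y' : Type u} [Field k] [Ring Γ] [HopfAlgebra k Γ]
  [AddCommGroup X] [Module k X] [AddCommGroup Y] [Module k Y] [AddCommGroup Z] [Module k Z]
  [AddCommGroup X'] [Module k X'] [AddCommGroup Y'] [Module k Y']

/-- The diagonal action `γ ↦ (x ⊗ y ↦ u(γ₁) x ⊗ v(γ₂) y)` for given actions `u` on `X`
and `v` on `Y`. -/
def diagOp (u : Γ →ₗ[k] Module.End k X) (v : Γ →ₗ[k] Module.End k Y) :
    Γ →ₗ[k] Module.End k (X ⊗[k] Y) :=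
  TensorProduct.map₂ u v ∘ₗ comul

lemma diagOp_mul {u : Γ →ₗ[k] Module.End k X} {v : Γ →ₗ[k] Module.End k Y}
    (hu : ∀ a b, u (a * b) = u a ∘ₗ u b) (hv : ∀ a b, v (a * b) = v a ∘ₗ v b) (a b : Γ) :
    diagOp u v (a * b) = diagOp u v a ∘ₗ diagOp u v b := by
  have key : ∀ s t : Γ ⊗[k] Γ, TensorProduct.map₂ u v (s * t)
      = TensorProduct.map₂ u v s ∘ₗ TensorProduct.map₂ u v t := by
    intro s t
    induction s using TensorProduct.induction_on with
    | zero => simp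
    | add x y hx hy => rw [add_mul, map_add, hx, hy, map_add, LinearMap.add_comp]
    | tmul a b =>
      induction t using TensorProduct.induction_on with
      | zero => simp
      | add x y hx hy => rw [mul_add, map_add, hx, hy, map_add, LinearMap.comp_add]
      | tmul c e => ext x y; simp [hu, hv]
  simp only [diagOp, LinearMap.comp_apply, Bialgebra.comul_mul, key]

lemma diagOp_antimul {u : Γ →ₗ[k] Module.End k X} {v : Γ →ₗ[k] Module.End k Y}
    (hu : ∀ a b, u (a * b) = u b ∘ₗ u a) (hv : ∀ a b, v (a * b) = v b ∘ₗ v a) (a b : Γ) :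
    diagOp u v (a * b) = diagOp u v b ∘ₗ diagOp u v a := by
  have key : ∀ s t : Γ ⊗[k] Γ, TensorProduct.map₂ u v (s * t)
      = TensorProduct.map₂ u v t ∘ₗ TensorProduct.map₂ u v s := by
    intro s t
    induction s using TensorProduct.induction_on with
    | zero => simp
    | add x y hx hy => rw [add_mul, map_add, hx, hy, map_add, LinearMap.comp_add]
    | tmul a b =>
      induction t using TensorProduct.induction_on with
      | zero => simp
      | add x y hx hy => rw [mul_add, map_add, hx, hy, map_add, LinearMap.add_comp]
      | tmul c e => ext x y; simp [hu, hv]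
  simp only [diagOp, LinearMap.comp_apply, Bialgebra.comul_mul, key]

lemma diagOp_one {u : Γ →ₗ[k] Module.End k X} {v : Γ →ₗ[k] Module.End k Y}
    (hu : u 1 = LinearMap.id) (hv : v 1 = LinearMap.id) : diagOp u v 1 = LinearMap.id := by
  ext x y
  simp [diagOp, Algebra.TensorProduct.one_def, hu, hv]

lemma diagOp_nat {u : Γ →ₗ[k] Module.End k X} {v : Γ →ₗ[k] Module.End k Y}
    {u' : Γ →ₗ[k] Module.End k X'} {v' : Γ →ₗ[k] Module.End k Y'}
    {f : X →ₗ[k] X'} {g : Y →ₗ[k] Y'} (hf : ∀ γ x, f (u γ x) = u' γ (f x))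
    (hg : ∀ γ y, g (v γ y) = v' γ (g y)) (γ : Γ) (t : X ⊗[k] Y) :
    TensorProduct.map f g (diagOp u v γ t) = diagOp u' v' γ (TensorProduct.map f g t) := by
  simp only [diagOp, LinearMap.comp_apply]
  generalize (comul γ : Γ ⊗[k] Γ) = s
  induction s using TensorProduct.induction_on with
  | zero => simp
  | add x y hx hy => simp only [map_add, LinearMap.add_apply, hx, hy]
  | tmul a b =>
    induction t using TensorProduct.induction_on with
    | zero => simp
    | add x y hx hy => simp only [map_add, hx, hy]
    | tmul c e => simp [hf, hg]

/-- Coassociativity, as a statement on diagonal actions. -/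
lemma diagOp_assoc (u : Γ →ₗ[k] Module.End k X) (v : Γ →ₗ[k] Module.End k Y)
    (w : Γ →ₗ[k] Module.End k Z) (γ : Γ) (t : (X ⊗[k] Y) ⊗[k] Z) :
    TensorProduct.assoc k X Y Z (diagOp (diagOp u v) w γ t)
      = diagOp u (diagOp v w) γ (TensorProduct.assoc k X Y Z t) := by
  have h1 : ∀ s : Γ ⊗[k] Γ, TensorProduct.map₂ (diagOp u v) w s
      = TensorProduct.map₂ (TensorProduct.map₂ u v) w (comul.rTensor Γ s) := by
    intro s
    induction s using TensorProduct.induction_on with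
    | zero => simp
    | add x y hx hy => simp only [map_add, hx, hy]
    | tmul a b => ext; simp [diagOp]
  have h2 : ∀ s : Γ ⊗[k] Γ, TensorProduct.map₂ u (diagOp v w) s
      = TensorProduct.map₂ u (TensorProduct.map₂ v w) (comul.lTensor Γ s) := by
    intro s
    induction s using TensorProduct.induction_on with
    | zero => simp
    | add x y hx hy => simp only [map_add, hx, hy]
    | tmul a b => ext; simp [diagOp]
  have h3 : ∀ s : (Γ ⊗[k] Γ) ⊗[k] Γ, ∀ t : (X ⊗[k] Y) ⊗[k] Z,
      TensorProduct.assoc k X Y Z (TensorProduct.map₂ (TensorProduct.map₂ u v) w s t)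
      = TensorProduct.map₂ u (TensorProduct.map₂ v w) (TensorProduct.assoc k Γ Γ Γ s)
        (TensorProduct.assoc k X Y Z t) := by
    intro s t
    induction s using TensorProduct.induction_on with
    | zero => simp
    | add x y hx hy => simp only [map_add, LinearMap.add_apply, hx, hy]
    | tmul a c =>
      induction a using TensorProduct.induction_on with
      | zero => simp
      | add x y hx hy =>
        simp only [TensorProduct.add_tmul, map_add, LinearMap.add_apply, hx, hy]
      | tmul a b =>
        induction t using TensorProduct.induction_on with
        | zero => simp
        | add x y hx hy => simp only [map_add, hx, hy]
        | tmul x z =>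
          induction x using TensorProduct.induction_on with
          | zero => simp
          | add x y hx hy => simp only [TensorProduct.add_tmul, map_add, hx, hy]
          | tmul x y => simp
  rw [diagOp, LinearMap.comp_apply, h1, h3, coassoc_apply, ← h2]
  rfl

/-- The trivial action through the counit. -/
def triv (k Γ X : Type u) [Field k] [Ring Γ] [HopfAlgebra k Γ] [AddCommGroup X] [Module k X] :
    Γ →ₗ[k] Module.End k X :=
  LinearMap.lsmul k X ∘ₗ counit

lemma diagOp_triv_left (v : Γ →ₗ[k] Module.End k Y) (γ : Γ) (x : X) (y : Y) :
    diagOp (triv k Γ X) v γ (x ⊗ₜ y) = x ⊗ₜ v γ y := by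
  have h : ∀ s : Γ ⊗[k] Γ, TensorProduct.map₂ (triv k Γ X) v s (x ⊗ₜ y)
      = x ⊗ₜ v (TensorProduct.lid k Γ (counit.rTensor Γ s)) y := by
    intro s
    induction s using TensorProduct.induction_on with
    | zero => simp
    | add a b hx hy => simp only [map_add, LinearMap.add_apply, hx, hy, TensorProduct.tmul_add]
    | tmul a b => simp [triv, TensorProduct.smul_tmul]
  rw [diagOp, LinearMap.comp_apply, h]
  simp

lemma diagOp_triv_right (u : Γ →ₗ[k] Module.End k X) (γ : Γ) (x : X) (y : Y) :
    diagOp u (triv k Γ Y) γ (x ⊗ₜ y) = u γ x ⊗ₜ y := by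
  have h : ∀ s : Γ ⊗[k] Γ, TensorProduct.map₂ u (triv k Γ Y) s (x ⊗ₜ y)
      = u (TensorProduct.rid k Γ (counit.lTensor Γ s)) x ⊗ₜ y := by
    intro s
    induction s using TensorProduct.induction_on with
    | zero => simp
    | add a b hx hy => simp only [map_add, LinearMap.add_apply, hx, hy, TensorProduct.add_tmul]
    | tmul a b => simp [triv, TensorProduct.smul_tmul']
  rw [diagOp, LinearMap.comp_apply, h]
  simp

end Diag

section SmashProduct
variable (k A Γ : Type u) [Field k] [Ring A] [Algebra k A] [Ring Γ] [HopfAlgebra k Γ]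

/-- `A` is a `Γ`-module algebra: unit and multiplication of `A` are `Γ`-linear. -/
class ModuleAlgebra [Module Γ A] [IsScalarTower k Γ A] : Prop where
  smul_one : ∀ γ : Γ, γ • (1 : A) = (counit γ : k) • (1 : A)
  smul_mul : ∀ (γ : Γ) (a b : A),
    γ • (a * b) = LinearMap.mul' k A (diagOp (lact k Γ A) (lact k Γ A) γ (a ⊗ₜ b))

/-- The smash product algebra `A # Γ`, with underlying space `A ⊗ Γ`. -/
def Smash : Type u := A ⊗[k] Γ

namespace Smash

instance : AddCommGroup (Smash k A Γ) := inferInstanceAs (AddCommGroup (A ⊗[k] Γ))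
instance : Module k (Smash k A Γ) := inferInstanceAs (Module k (A ⊗[k] Γ))

variable {k A Γ}

/-- The map `A ⊗ Γ → E`, `a ⊗ γ ↦ i(a) j(γ)`. -/
def mm {E : Type u} [Ring E] [Algebra k E] (i : A →ₗ[k] E) (j : Γ →ₗ[k] E) : A ⊗[k] Γ →ₗ[k] E :=
  TensorProduct.lift ((LinearMap.mul k E).compl₁₂ i j)

@[simp] lemma mm_tmul {E : Type u} [Ring E] [Algebra k E] (i : A →ₗ[k] E) (j : Γ →ₗ[k] E)
    (a : A) (γ : Γ) : mm i j (a ⊗ₜ γ) = i a * j γ := by simp [mm]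

/-- Left multiplication of `A` on `A ⊗ Γ`. -/
def la : A →ₗ[k] Module.End k (A ⊗[k] Γ) := LinearMap.rTensorHom Γ ∘ₗ lact k A A

@[simp] lemma la_tmul (a b : A) (γ : Γ) : la (k := k) a (b ⊗ₜ γ) = (a * b) ⊗ₜ γ := rfl

variable [Module Γ A] [IsScalarTower k Γ A]

/-- The diagonal action of `Γ` on `A ⊗ Γ`. -/
def D : Γ →ₗ[k] Module.End k (A ⊗[k] Γ) := diagOp (lact k Γ A) (lact k Γ Γ)

lemma D_mul (γ δ : Γ) : D (k := k) (A := A) (γ * δ) = D γ ∘ₗ D δ :=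
  diagOp_mul lact_mul lact_mul γ δ

lemma D_one : D (k := k) (A := A) (1 : Γ) = LinearMap.id := diagOp_one lact_one lact_one

/-- The multiplication `(a ⊗ γ)(b ⊗ δ) = a (γ₁ b) ⊗ γ₂ δ`. -/
def mulOp : A ⊗[k] Γ →ₗ[k] Module.End k (A ⊗[k] Γ) :=
  mm (la (Γ := Γ)) (D (A := A))

lemma D_la [ModuleAlgebra k A Γ] (γ : Γ) (b : A) (z : A ⊗[k] Γ) :
    D γ (la b z) = TensorProduct.lift la (diagOp (lact k Γ A) D γ (b ⊗ₜ z)) := by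
  induction z using TensorProduct.induction_on with
  | zero => simp
  | add x y hx hy => simp only [map_add, hx, hy, TensorProduct.tmul_add]
  | tmul c e =>
    have h1 : la b (c ⊗ₜ e) = TensorProduct.map (LinearMap.mul' k A) LinearMap.id
        ((b ⊗ₜ[k] c) ⊗ₜ[k] e) := by simp
    have h2 : ∀ s : (A ⊗[k] A) ⊗[k] Γ, TensorProduct.map (LinearMap.mul' k A) LinearMap.id s
        = TensorProduct.lift la (TensorProduct.assoc k A A Γ s) := by
      intro s
      refine LinearMap.congr_fun (f := TensorProduct.map (LinearMap.mul' k A) LinearMap.id)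
        (g := TensorProduct.lift la ∘ₗ (TensorProduct.assoc k A A Γ).toLinearMap) ?_ s
      ext a b c
      simp
    rw [h1, D, ← diagOp_nat (u := diagOp (lact k Γ A) (lact k Γ A)) (v := lact k Γ Γ)
      (f := LinearMap.mul' k A) (g := LinearMap.id) (u' := lact k Γ A) (v' := lact k Γ Γ),
      h2, diagOp_assoc]
    · rfl
    · intro γ x
      induction x using TensorProduct.induction_on with
      | zero => simp
      | add x y hx hy => simp only [map_add, hx, hy]
      | tmul a b => exact (ModuleAlgebra.smul_mul γ a b).symm
    · intro γ x; rfl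

/-- `Γ`-linearity of a map `A ⊗ Γ → E`, `a ⊗ γ ↦ i(a) j(γ)`, makes it multiplicative. -/
lemma mm_mul {E : Type u} [Ring E] [Algebra k E] {i : A →ₗ[k] E} {j : Γ →ₗ[k] E}
    (hi : ∀ a b, i (a * b) = i a * i b)
    (hj : ∀ γ t, mm i j (D γ t) = j γ * mm i j t) (s t : A ⊗[k] Γ) :
    mm i j (mulOp s t) = mm i j s * mm i j t := by
  have hla : ∀ a t, mm i j (la a t) = i a * mm i j t := by
    intro a t
    induction t using TensorProduct.induction_on with
    | zero => simp
    | add x y hx hy => simp only [map_add, hx, hy, mul_add]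
    | tmul a b => simp [hi, mul_assoc]
  induction s using TensorProduct.induction_on with
  | zero => simp
  | add x y hx hy => simp only [map_add, LinearMap.add_apply, hx, hy, add_mul]
  | tmul a γ => simp [mulOp, hla, hj, mul_assoc]

lemma mulOp_D [ModuleAlgebra k A Γ] (γ : Γ) (t w : A ⊗[k] Γ) :
    mulOp (D γ t) w = D γ (mulOp t w) := by
  have h : ∀ t : A ⊗[k] Γ, mulOp t w = TensorProduct.lift (la (Γ := Γ))
      (TensorProduct.map LinearMap.id ((D (A := A) (Γ := Γ)).flip w) t) := by
    intro t
    induction t using TensorProduct.induction_on with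
    | zero => simp
    | add x y hx hy => simp only [map_add, LinearMap.add_apply, hx, hy]
    | tmul a b => simp [mulOp]
  induction t using TensorProduct.induction_on with
  | zero => simp
  | add x y hx hy => simp only [map_add, LinearMap.add_apply, hx, hy]
  | tmul b δ =>
    rw [h, D, diagOp_nat (u' := lact k Γ A) (v' := D)]
    · simp only [mulOp, mm_tmul, Module.End.mul_apply]
      exact (D_la γ b _).symm
    · intro γ x; rfl
    · intro γ x
      exact LinearMap.congr_fun (D_mul γ x) w

lemma mulOp_assoc [ModuleAlgebra k A Γ] (s t : A ⊗[k] Γ) :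
    mulOp (mulOp s t) = mulOp s * mulOp t := by
  refine mm_mul (E := Module.End k (A ⊗[k] Γ)) (i := la) (j := D) (fun a b => ?_)
    (fun γ t => ?_) s t
  · ext c γ; simp [mul_assoc]
  · exact LinearMap.ext fun w => mulOp_D γ t w

lemma D_unit [ModuleAlgebra k A Γ] (γ δ : Γ) :
    D γ ((1 : A) ⊗ₜ[k] δ) = 1 ⊗ₜ (γ * δ) := by
  have h : (1 : A) ⊗ₜ[k] δ = TensorProduct.map (LinearMap.toSpanSingleton k A 1) LinearMap.id
      ((1 : k) ⊗ₜ[k] δ) := by simp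
  rw [h, D, ← diagOp_nat (u := triv k Γ k) (v := lact k Γ Γ), diagOp_triv_left]
  · simp
  · intro γ x
    change ((counit γ : k) * x) • (1 : A) = γ • (x • (1 : A))
    rw [← smul_one_smul Γ x (1 : A), ← mul_smul, mul_smul_one, smul_assoc,
      ModuleAlgebra.smul_one (k := k) γ, smul_smul, mul_comm]
  · intro γ x; rfl

lemma mulOp_one_left (t : A ⊗[k] Γ) : mulOp ((1 : A) ⊗ₜ[k] (1 : Γ)) t = t := by
  simp only [mulOp, mm_tmul, D_one, la, LinearMap.comp_apply, lact_one]
  simp [Module.End.mul_apply]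

lemma mulOp_one_right [ModuleAlgebra k A Γ] (t : A ⊗[k] Γ) :
    mulOp t ((1 : A) ⊗ₜ[k] (1 : Γ)) = t := by
  induction t using TensorProduct.induction_on with
  | zero => simp
  | add x y hx hy => rw [map_add, LinearMap.add_apply, hx, hy]
  | tmul a γ => simp [mulOp, D_unit]

instance [ModuleAlgebra k A Γ] : Ring (Smash k A Γ) where
  __ := (inferInstance : AddCommGroup (Smash k A Γ))
  mul s t := mulOp (k := k) (A := A) (Γ := Γ) s t
  one := (1 : A) ⊗ₜ[k] (1 : Γ)
  mul_assoc s t w := LinearMap.congr_fun (mulOp_assoc (k := k) (A := A) (Γ := Γ) s t) w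
  one_mul := mulOp_one_left (k := k) (A := A) (Γ := Γ)
  mul_one := mulOp_one_right (k := k) (A := A) (Γ := Γ)
  zero_mul t := LinearMap.congr_fun (map_zero (mulOp (k := k) (A := A) (Γ := Γ))) t
  mul_zero s := map_zero (mulOp (k := k) (A := A) (Γ := Γ) s)
  left_distrib s t w := map_add (mulOp (k := k) (A := A) (Γ := Γ) s) t w
  right_distrib s t w := LinearMap.congr_fun (map_add (mulOp (k := k) (A := A) (Γ := Γ)) s t) w

instance [ModuleAlgebra k A Γ] : Algebra k (Smash k A Γ) :=
  Algebra.ofModule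
    (fun c s t => LinearMap.congr_fun (map_smul (mulOp (k := k) (A := A) (Γ := Γ)) c s) t)
    (fun c s t => map_smul (mulOp (k := k) (A := A) (Γ := Γ) s) c t)

variable (k A Γ) in
/-- The inclusion `A → A # Γ`, `a ↦ a ⊗ 1`. -/
def inA [ModuleAlgebra k A Γ] : A →ₐ[k] Smash k A Γ :=
  AlgHom.ofLinearMap ((TensorProduct.mk k A Γ).flip 1) rfl fun a b => by
    change (a * b) ⊗ₜ 1 = mulOp (a ⊗ₜ 1) (b ⊗ₜ 1)
    simp [mulOp, D_one]

variable (k A Γ) in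
/-- The inclusion `Γ → A # Γ`, `γ ↦ 1 ⊗ γ`. -/
def inΓ [ModuleAlgebra k A Γ] : Γ →ₐ[k] Smash k A Γ :=
  AlgHom.ofLinearMap (TensorProduct.mk k A Γ 1) rfl fun a b => by
    change 1 ⊗ₜ (a * b) = mulOp (1 ⊗ₜ a) (1 ⊗ₜ b)
    simp [mulOp, D_unit]


end Smash
end SmashProduct

section Balanced
variable {k R X Y X' Y' M : Type u} [Field k]
  [AddCommGroup X] [Module k X] [AddCommGroup Y] [Module k Y]
  [AddCommGroup X'] [Module k X'] [AddCommGroup Y'] [Module k Y'] [AddCommGroup M] [Module k M]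

/-- The relations `x r ⊗ y = x ⊗ r y`. -/
def balRel (u : R → Module.End k X) (v : R → Module.End k Y) : Submodule k (X ⊗[k] Y) :=
  Submodule.span k {t | ∃ r x y, t = u r x ⊗ₜ[k] y - x ⊗ₜ[k] v r y}

/-- The tensor product `X ⊗_R Y`, for a right action `u` of `R` on `X` and a left action `v` of
`R` on `Y`. -/
abbrev BTen (u : R → Module.End k X) (v : R → Module.End k Y) : Type u :=
  (X ⊗[k] Y) ⧸ balRel u v

namespace BTen
variable {u : R → Module.End k X} {v : R → Module.End k Y}
  {u' : R → Module.End k X'} {v' : R → Module.End k Y'}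

variable (u v) in
/-- The class in `X ⊗_R Y` of an element of `X ⊗ Y`. -/
def mk : X ⊗[k] Y →ₗ[k] BTen u v := (balRel u v).mkQ

lemma mk_surj (t : BTen u v) : ∃ s, mk u v s = t := Submodule.mkQ_surjective _ t

lemma mk_bal (r : R) (x : X) (y : Y) : mk u v (u r x ⊗ₜ y) = mk u v (x ⊗ₜ v r y) := by
  rw [← sub_eq_zero, ← map_sub, mk, Submodule.mkQ_apply, Submodule.Quotient.mk_eq_zero]
  exact Submodule.subset_span ⟨r, x, y, rfl⟩

/-- The universal property of `X ⊗_R Y`. -/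
def lift (f : X ⊗[k] Y →ₗ[k] M) (hf : ∀ r x y, f (u r x ⊗ₜ y) = f (x ⊗ₜ v r y)) :
    BTen u v →ₗ[k] M :=
  (balRel u v).liftQ f <| Submodule.span_le.2 <| by
    rintro _ ⟨r, x, y, rfl⟩
    simp [hf]

@[simp] lemma lift_mk (f : X ⊗[k] Y →ₗ[k] M) (hf : ∀ r x y, f (u r x ⊗ₜ y) = f (x ⊗ₜ v r y))
    (t : X ⊗[k] Y) : lift f hf (mk u v t) = f t := rfl

/-- The map induced by `f : X ⊗ Y → X' ⊗ Y'` on tensor products over `R`. -/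
def map (f : X ⊗[k] Y →ₗ[k] X' ⊗[k] Y')
    (hf : ∀ r x y, mk u' v' (f (u r x ⊗ₜ y)) = mk u' v' (f (x ⊗ₜ v r y))) :
    BTen u v →ₗ[k] BTen u' v' :=
  lift (mk u' v' ∘ₗ f) hf

@[simp] lemma map_mk (f : X ⊗[k] Y →ₗ[k] X' ⊗[k] Y')
    (hf : ∀ r x y, mk u' v' (f (u r x ⊗ₜ y)) = mk u' v' (f (x ⊗ₜ v r y))) (t : X ⊗[k] Y) :
    map f hf (mk u v t) = mk u' v' (f t) := rfl

lemma hom_ext {f g : BTen u v →ₗ[k] M}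
    (h : ∀ x y, f (mk u v (x ⊗ₜ y)) = g (mk u v (x ⊗ₜ y))) : f = g := by
  refine Submodule.linearMap_qext _ (TensorProduct.ext' h)

end BTen
end Balanced

section Bimodules
variable {k R X Y B : Type u} [Field k] [Ring R] [Algebra k R] [AddCommGroup X] [Module k X]
  [AddCommGroup Y] [Module k Y] [Module R X] [Module Rᵐᵒᵖ X] [IsBimod k R X]
  [Module R Y] [Module Rᵐᵒᵖ Y] [IsBimod k R Y]
  [Ring B] [Algebra k B]

variable (k R X) in
/-- The tensor square `X ⊗_R X` of a bimodule. -/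
abbrev Sq : Type u := BTen (ract k R X) (lact k R X)

variable (k R X) in
/-- The class in `X ⊗_R X` of an element of `X ⊗ X`. -/
abbrev sqMk : X ⊗[k] X →ₗ[k] Sq k R X := BTen.mk (ract k R X) (lact k R X)

variable (X) in
/-- The left action of `R` on `X ⊗_R X`. -/
def sqL (r : R) : Sq k R X →ₗ[k] Sq k R X :=
  BTen.map (TensorProduct.map (lact k R X r) LinearMap.id) fun s x y => by
    simp only [TensorProduct.map_tmul, ract_apply, lact_apply, LinearMap.id_coe, id_eq, lact_ract k]
    exact BTen.mk_bal s (r • x) y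

variable (X) in
/-- The right action of `R` on `X ⊗_R X`. -/
def sqR (r : R) : Sq k R X →ₗ[k] Sq k R X :=
  BTen.map (TensorProduct.map LinearMap.id (ract k R X r)) fun s x y => by
    simp only [TensorProduct.map_tmul, ract_apply, lact_apply, LinearMap.id_coe, id_eq, ← lact_ract k]
    exact BTen.mk_bal s x _

/-- A complex of `R`-bimodules `⋯ → X₁ → X₀ → 0` with an augmentation `X₀ → R`. -/
structure AugBimodCx (k R X : Type u) [Field k] [Ring R] [Algebra k R] [AddCommGroup X]
    [Module k X] [Module R X] [Module Rᵐᵒᵖ X] [IsBimod k R X] extends GrCx k X where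
  smul_mem : ∀ n (r : R) x, x ∈ gr n → r • x ∈ gr n
  op_smul_mem : ∀ n (r : R) x, x ∈ gr n → MulOpposite.op r • x ∈ gr n
  d_smul : ∀ (r : R) x, d (r • x) = r • d x
  d_op_smul : ∀ (r : R) x, d (MulOpposite.op r • x) = MulOpposite.op r • d x
  aug : X →ₗ[k] R
  aug_smul : ∀ (r : R) x, aug (r • x) = r * aug x
  aug_op_smul : ∀ (r : R) x, aug (MulOpposite.op r • x) = aug x * r
  aug_pos : ∀ n, ∀ x ∈ gr (n + 1), aug x = 0
  aug_d : ∀ x, aug (d x) = 0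

namespace AugBimodCx

/-- The augmentation is a quasi-isomorphism `X → R`. -/
structure IsResolution (C : AugBimodCx k R X) : Prop where
  surj : ∀ r : R, ∃ x ∈ C.gr 0, C.aug x = r
  exact_zero : ∀ x ∈ C.gr 0, C.aug x = 0 → ∃ y ∈ C.gr 1, C.d y = x
  exact_succ : ∀ n, ∀ x ∈ C.gr (n + 1), C.d x = 0 → ∃ y ∈ C.gr (n + 2), C.d y = x

/-- `X` is projective over the enveloping algebra `R ⊗ Rᵒᵖ`; as `X` is the direct sum of its
homogeneous components, this says that each of them is projective. -/
def IsProjective (_C : AugBimodCx k R X) : Prop :=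
  letI : SMulCommClass R Rᵐᵒᵖ X := IsBimod.comm (k := k)
  letI : Module (R ⊗[k] Rᵐᵒᵖ) X := TensorProduct.Algebra.module
  Module.Projective (R ⊗[k] Rᵐᵒᵖ) X

variable (C : AugBimodCx k R X)

lemma scale_smul (c : ℕ → ℤ) (r : R) (x : X) :
    scaleOf C.isInternal c (r • x) = r • scaleOf C.isInternal c x :=
  (C.scale_comm C.toGrCx c (f := lact k R X r) (fun n x hx => C.smul_mem n r x hx) x).symm

lemma scale_op (c : ℕ → ℤ) (r : R) (x : X) :
    scaleOf C.isInternal c (MulOpposite.op r • x) = MulOpposite.op r • scaleOf C.isInternal c x :=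
  (C.scale_comm C.toGrCx c (f := ract k R X r) (fun n x hx => C.op_smul_mem n r x hx) x).symm

/-- The differential of `X ⊗_R X`. -/
def sqD : Sq k R X →ₗ[k] Sq k R X :=
  BTen.map (C.tensorD C.toGrCx) fun r x y => by
    simp only [GrCx.tensorD, LinearMap.add_apply, TensorProduct.map_tmul, map_add,
      LinearMap.id_coe, id_eq, ract_apply, lact_apply, C.d_op_smul, C.d_smul, GrCx.sgn, C.scale_op]
    exact congrArg₂ (· + ·) (BTen.mk_bal r _ _) (BTen.mk_bal r _ _)

/-- The map `X ⊗_R X → R ⊗_R R = R` induced by the augmentation. -/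
def sqAug : Sq k R X →ₗ[k] R :=
  BTen.lift (LinearMap.mul' k R ∘ₗ TensorProduct.map C.aug C.aug) fun r x y => by
    simp [C.aug_smul, C.aug_op_smul, mul_assoc]

/-- A diagonal map `X → X ⊗_R X`: a morphism of complexes of `R`-bimodules that is compatible
with the augmentations. (If `X` is a projective resolution of `R`, so is `X ⊗_R X`, and such a
morphism is a quasi-isomorphism.) -/
structure Diagonal where
  toFun : X →ₗ[k] Sq k R X
  left_lin : ∀ (r : R) x, toFun (r • x) = sqL X r (toFun x)
  right_lin : ∀ (r : R) x, toFun (MulOpposite.op r • x) = sqR X r (toFun x)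
  map_gr : ∀ n, ∀ x ∈ C.gr n, toFun x ∈ (C.tensorGr C.toGrCx n).map (sqMk k R X)
  map_d : ∀ x, toFun (C.d x) = C.sqD (toFun x)
  aug_comp : ∀ x, C.sqAug (toFun x) = C.aug x

instance : AddCommGroup (X →ₗ[k] B) := LinearMap.addCommGroup

variable (X) in
/-- The space of `R`-bimodule maps `X → B`, for an algebra extension `φ : R → B`. -/
def _root_.SmashHH.BHom (φ : R →ₐ[k] B) : Submodule k (X →ₗ[k] B) where
  carrier := {f | (∀ (r : R) x, f (r • x) = φ r * f x) ∧
    ∀ (r : R) x, f (MulOpposite.op r • x) = f x * φ r}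
  add_mem' := by
    rintro f g ⟨hf, hf'⟩ ⟨hg, hg'⟩
    exact ⟨fun r x => by simp [hf, hg, mul_add], fun r x => by simp [hf', hg', add_mul]⟩
  zero_mem' := ⟨fun r x => by simp, fun r x => by simp⟩
  smul_mem' := by
    rintro c f ⟨hf, hf'⟩
    exact ⟨fun r x => by simp [hf], fun r x => by simp [hf']⟩

variable {φ : R →ₐ[k] B}

/-- `f ∘ T` for a bimodule map `f` and an operator `T` that commutes with both actions. -/
def _root_.SmashHH.BHom.precomp (T : X →ₗ[k] X) (h1 : ∀ (r : R) x, T (r • x) = r • T x)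
    (h2 : ∀ (r : R) x, T (MulOpposite.op r • x) = MulOpposite.op r • T x) :
    BHom X φ →ₗ[k] BHom X φ :=
  ((LinearMap.lcomp k B T) ∘ₗ (BHom X φ).subtype).codRestrict _ fun f =>
    ⟨fun r x => by simp [h1, f.2.1], fun r x => by simp [h2, f.2.2]⟩

variable (φ) in
/-- The differential `f ↦ -(-1)^|f| f ∘ d` on bimodule maps to `B`; as `f` lowers the homological
degree by `|f|`, it is `f ↦ f ∘ d ∘ (x ↦ (-1)^|x| x)`. -/
def dHom : BHom X φ →ₗ[k] BHom X φ :=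
  BHom.precomp (C.d ∘ₗ C.sgn) (fun r x => by simp [GrCx.sgn, C.scale_smul, C.d_smul])
    (fun r x => by simp [GrCx.sgn, C.scale_op, C.d_op_smul])

@[simp] lemma dHom_apply (f : BHom X φ) (x : X) :
    (C.dHom φ f : X →ₗ[k] B) x = (f : X →ₗ[k] B) (C.d (C.sgn x)) := rfl

/-- `f ↦ (-1)^|f| f`. -/
def sHom : BHom X φ →ₗ[k] BHom X φ :=
  BHom.precomp C.sgn (fun r x => by simp [GrCx.sgn, C.scale_smul])
    (fun r x => by simp [GrCx.sgn, C.scale_op])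

@[simp] lemma sHom_apply (f : BHom X φ) (x : X) :
    (C.sHom f : X →ₗ[k] B) x = (f : X →ₗ[k] B) (C.sgn x) := rfl

/-- The pairing `f ⊗ g ↦ (x ⊗ y ↦ (-1)^{|x||y|} f(x) g(y))`. For `f`, `g` homogeneous the sign
equals `(-1)^{|g||x|}`, as `f(x) g(y)` vanishes unless `|x| = -|f|` and `|y| = -|g|`. -/
def pairAux : (X →ₗ[k] B) →ₗ[k] (X →ₗ[k] B) →ₗ[k] (X ⊗[k] X →ₗ[k] B) :=
  LinearMap.mk₂ k
    (fun f g => LinearMap.mul' k B ∘ₗ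
      (TensorProduct.map (f ∘ₗ C.even) g + TensorProduct.map (f ∘ₗ C.odd) (g ∘ₗ C.sgn)))
    (fun f f' g => by ext; simp [add_mul]; abel)
    (fun c f g => by ext; simp)
    (fun f g g' => by ext; simp [mul_add]; abel)
    (fun c f g => by ext; simp)

lemma pairAux_tmul (f g : X →ₗ[k] B) (x y : X) :
    C.pairAux f g (x ⊗ₜ y) = f (C.even x) * g y + f (C.odd x) * g (C.sgn y) := by
  simp [pairAux]

lemma pairAux_hom (f g : X →ₗ[k] B) {i j : ℕ} {x y : X} (hx : x ∈ C.gr i) (hy : y ∈ C.gr j) :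
    C.pairAux f g (x ⊗ₜ y) = sg (i * j) • (f x * g y) := by
  rw [pairAux_tmul, C.sgn_mem hy, GrCx.even, GrCx.odd, scaleOf_mem _ _ hx, scaleOf_mem _ _ hx]
  by_cases h : Even i
  · rw [sg_even ((Int.even_coe_nat i).2 h |>.mul_right _)]
    simp [h]
  · have ho : Odd (i : ℤ) := by exact_mod_cast Nat.not_even_iff_odd.1 h
    have : sg (i * j) = sg j := by
      obtain ⟨m, hm⟩ := ho
      rw [hm, show (2 * m + 1) * (j : ℤ) = 2 * (m * j) + j by ring, sg_add,
        sg_even (even_two_mul _), one_mul]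
    simp only [h, if_false, zero_smul, one_smul, map_zero, zero_mul, zero_add, this, map_zsmul,
      mul_smul_comm]

/-- The pairing on `X ⊗_R X`. -/
def pair : BHom X φ →ₗ[k] BHom X φ →ₗ[k] (Sq k R X →ₗ[k] B) :=
  LinearMap.mk₂ k
    (fun f g => BTen.lift (C.pairAux f g) fun r x y => by
      simp only [pairAux_tmul, ract_apply, lact_apply, GrCx.even, GrCx.odd, GrCx.sgn, C.scale_op,
        C.scale_smul, f.2.2, g.2.1, mul_assoc])
    (fun f f' g => BTen.hom_ext fun x y => by simp)
    (fun c f g => BTen.hom_ext fun x y => by simp)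
    (fun f g g' => BTen.hom_ext fun x y => by simp)
    (fun c f g => BTen.hom_ext fun x y => by simp)

@[simp] lemma pair_mk (f g : BHom X φ) (t : X ⊗[k] X) :
    C.pair f g (sqMk k R X t) = C.pairAux f g t := rfl

lemma pair_sqL (f g : BHom X φ) (r : R) (t : Sq k R X) :
    C.pair f g (sqL X r t) = φ r * C.pair f g t := by
  refine LinearMap.congr_fun (f := C.pair f g ∘ₗ sqL X r)
    (g := LinearMap.mulLeft k (φ r) ∘ₗ C.pair f g) (BTen.hom_ext fun x y => ?_) t
  change C.pairAux _ _ ((r • x) ⊗ₜ y) = φ r * C.pairAux _ _ (x ⊗ₜ y)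
  simp only [pairAux_tmul, GrCx.even, GrCx.odd, GrCx.sgn, C.scale_smul, f.2.1, mul_assoc, mul_add]

lemma pair_sqR (f g : BHom X φ) (r : R) (t : Sq k R X) :
    C.pair f g (sqR X r t) = C.pair f g t * φ r := by
  refine LinearMap.congr_fun (f := C.pair f g ∘ₗ sqR X r)
    (g := LinearMap.mulRight k (φ r) ∘ₗ C.pair f g) (BTen.hom_ext fun x y => ?_) t
  change C.pairAux _ _ (x ⊗ₜ (MulOpposite.op r • y)) = C.pairAux _ _ (x ⊗ₜ y) * φ r
  simp only [pairAux_tmul, GrCx.even, GrCx.odd, GrCx.sgn, C.scale_op, g.2.2, mul_assoc, add_mul]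

variable {C} in
/-- The cup product `f ∪ g = μ_B (f ⊗_R g) Δ` on bimodule maps `X → B`. -/
def Diagonal.cup (Δ : C.Diagonal) : BHom X φ →ₗ[k] BHom X φ →ₗ[k] BHom X φ :=
  LinearMap.mk₂ k
    (fun f g => ⟨C.pair f g ∘ₗ Δ.toFun,
      fun r x => by simp [Δ.left_lin, pair_sqL], fun r x => by simp [Δ.right_lin, pair_sqR]⟩)
    (fun f f' g => by ext; simp)
    (fun c f g => by ext; simp)
    (fun f g g' => by ext; simp)
    (fun c f g => by ext; simp)

variable {C} in
lemma Diagonal.cup_apply (Δ : C.Diagonal) (f g : BHom X φ) (x : X) :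
    (Δ.cup f g : X →ₗ[k] B) x = C.pair f g (Δ.toFun x) := rfl

/-- `x ⊗ y ↦ (-1)^{|x|+|y|} x ⊗ y` on `X ⊗_R X`. -/
def sqS : Sq k R X →ₗ[k] Sq k R X :=
  BTen.map (TensorProduct.map C.sgn C.sgn) fun r x y => by
    simp only [TensorProduct.map_tmul, ract_apply, lact_apply, GrCx.sgn, C.scale_op, C.scale_smul]
    exact BTen.mk_bal r _ _

lemma sq_ext {M : Type u} [AddCommGroup M] [Module k M] {f g : Sq k R X →ₗ[k] M}
    (h : ∀ i j, ∀ x ∈ C.gr i, ∀ y ∈ C.gr j, f (sqMk k R X (x ⊗ₜ y)) = g (sqMk k R X (x ⊗ₜ y))) :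
    f = g := by
  refine BTen.hom_ext fun x y => ?_
  refine LinearMap.congr_fun (f := f ∘ₗ sqMk k R X ∘ₗ (TensorProduct.mk k X X).flip y)
    (g := g ∘ₗ sqMk k R X ∘ₗ (TensorProduct.mk k X X).flip y)
    (ext_gr C.isInternal fun i x hx => ?_) x
  refine LinearMap.congr_fun (f := f ∘ₗ sqMk k R X ∘ₗ TensorProduct.mk k X X x)
    (g := g ∘ₗ sqMk k R X ∘ₗ TensorProduct.mk k X X x)
    (ext_gr C.isInternal fun j y hy => ?_) y
  exact h i j x hx y hy

variable {C} in
lemma Diagonal.map_sgn (Δ : C.Diagonal) (x : X) : Δ.toFun (C.sgn x) = C.sqS (Δ.toFun x) := by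
  refine LinearMap.congr_fun (f := Δ.toFun ∘ₗ C.sgn) (g := C.sqS ∘ₗ Δ.toFun)
    (ext_gr C.isInternal fun n x hx => ?_) x
  obtain ⟨t, ht, hxt⟩ := Δ.map_gr n x hx
  simp only [LinearMap.comp_apply, C.sgn_mem hx, map_zsmul, ← hxt]
  rw [sqS, BTen.map_mk, ← map_zsmul]
  congr 1
  clear hxt
  induction ht using Submodule.span_induction with
  | mem t ht =>
    obtain ⟨i, j, rfl, x, hx, y, hy, rfl⟩ := ht
    rw [TensorProduct.map_tmul, C.sgn_mem hx, C.sgn_mem hy, zsmul_tmul, tmul_zsmul, smul_smul]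
    push_cast
    rw [sg_add]
  | zero => simp
  | add x y _ _ hx hy => rw [smul_add, map_add, hx, hy]
  | smul a x _ hx => rw [map_smul, ← hx, smul_comm]

variable {C} in
/-- The Leibniz rule for the cup product on bimodule maps. -/
lemma Diagonal.dHom_cup (Δ : C.Diagonal) (f g : BHom X φ) :
    C.dHom φ (Δ.cup f g) = Δ.cup (C.dHom φ f) g + Δ.cup (C.sHom f) (C.dHom φ g) := by
  ext x
  change C.pair f g (Δ.toFun (C.d (C.sgn x))) =
    C.pair (C.dHom φ f) g (Δ.toFun x) + C.pair (C.sHom f) (C.dHom φ g) (Δ.toFun x)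
  rw [Δ.map_d, Δ.map_sgn]
  refine LinearMap.congr_fun (f := C.pair f g ∘ₗ C.sqD ∘ₗ C.sqS)
    (g := C.pair (C.dHom φ f) g + C.pair (C.sHom f) (C.dHom φ g)) (C.sq_ext fun i j x hx y hy => ?_) _
  simp only [LinearMap.comp_apply, LinearMap.add_apply, sqS, sqD, BTen.map_mk, pair_mk,
    TensorProduct.map_tmul, C.sgn_mem hx, C.sgn_mem hy, GrCx.tensorD, LinearMap.id_coe, id_eq,
    map_zsmul, map_add]
  have e1 : C.pairAux (f : X →ₗ[k] B) g (C.d x ⊗ₜ y)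
      = (sg (i * j) * sg j) • ((f : X →ₗ[k] B) (C.d x) * (g : X →ₗ[k] B) y) := by
    rcases i with _ | i
    · simp [C.d_gr_zero x hx]
    · rw [C.pairAux_hom _ _ (C.d_mem i x hx) hy]
      congr 1
      push_cast
      rw [add_mul, sg_add, one_mul, mul_assoc, sg_mul_self, mul_one]
  have e2 : C.pairAux (f : X →ₗ[k] B) g (x ⊗ₜ C.d y)
      = (sg (i * j) * sg i) • ((f : X →ₗ[k] B) x * (g : X →ₗ[k] B) (C.d y)) := by
    rcases j with _ | j
    · simp [C.d_gr_zero y hy]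
    · rw [C.pairAux_hom _ _ hx (C.d_mem j y hy)]
      congr 1
      push_cast
      rw [mul_add, sg_add, mul_one, mul_assoc, sg_mul_self, mul_one]
  rw [C.pairAux_hom _ _ hx hy, C.pairAux_hom _ _ hx hy]
  simp only [dHom_apply, sHom_apply, C.sgn_mem hx, C.sgn_mem hy, map_zsmul,
    zsmul_tmul, tmul_zsmul, e1, e2]
  rcases sg_cases i with hi | hi <;> rcases sg_cases j with hj | hj <;> simp [hi, hj]

end AugBimodCx
end Bimodules

section DGAlgebras

/-- A (not necessarily associative or unital) dg algebra over `k`, in cohomological grading. -/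
structure DGAlg (k : Type u) [Field k] where
  X : ℤ → Type u
  [grp : ∀ n, AddCommGroup (X n)]
  [mod : ∀ n, Module k (X n)]
  d : ∀ {m n : ℤ}, m + 1 = n → X m →ₗ[k] X n
  d_d : ∀ {l m n : ℤ} (h : l + 1 = m) (h' : m + 1 = n) (x : X l), d h' (d h x) = 0
  mul : ∀ {p q r : ℤ}, p + q = r → X p →ₗ[k] X q →ₗ[k] X r
  leibniz : ∀ {p q r p' q' r' : ℤ} (h : p + q = r) (hp : p + 1 = p') (hq : q + 1 = q')
    (hr : r + 1 = r') (x : X p) (y : X q),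
    d hr (mul h x y) = mul (by omega) (d hp x) y + sg p • mul (by omega) x (d hq y)

namespace DGAlg
variable {k : Type u} [Field k]

attribute [instance] DGAlg.grp DGAlg.mod

/-- The cocycles of degree `n`. -/
def Z (D : DGAlg k) (n : ℤ) : Submodule k (D.X n) := LinearMap.ker (D.d (rfl : n + 1 = n + 1))

/-- The coboundaries of degree `n`. -/
def Bd (D : DGAlg k) (n : ℤ) : Submodule k (D.X n) :=
  LinearMap.range (D.d (sub_add_cancel n 1))

/-- The cohomology in degree `n`. -/
abbrev H (D : DGAlg k) (n : ℤ) : Type u := D.Z n ⧸ (D.Bd n).comap (D.Z n).subtype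

/-- The cohomology class of a cocycle. -/
abbrev cls (D : DGAlg k) (n : ℤ) : D.Z n →ₗ[k] D.H n := Submodule.mkQ _

lemma d_of_mem_Z (D : DGAlg k) {m n : ℤ} (h : m + 1 = n) {x : D.X m} (hx : x ∈ D.Z m) :
    D.d h x = 0 := by subst h; exact hx

lemma mem_Bd (D : DGAlg k) {m n : ℤ} (h : m + 1 = n) (x : D.X m) : D.d h x ∈ D.Bd n := by
  obtain rfl : m = n - 1 := by omega
  exact ⟨x, rfl⟩

lemma mul_mem_Z (D : DGAlg k) {p q r : ℤ} (h : p + q = r) {x : D.X p} {y : D.X q}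
    (hx : x ∈ D.Z p) (hy : y ∈ D.Z q) : D.mul h x y ∈ D.Z r := by
  change D.d rfl _ = 0
  rw [D.leibniz h rfl rfl rfl, D.d_of_mem_Z _ hx, D.d_of_mem_Z _ hy]
  simp

lemma mul_mem_Bd_left (D : DGAlg k) {p q r : ℤ} (h : p + q = r) {x : D.X p} {y : D.X q}
    (hx : x ∈ D.Bd p) (hy : y ∈ D.Z q) : D.mul h x y ∈ D.Bd r := by
  obtain ⟨w, rfl⟩ := hx
  have := D.leibniz (p := p - 1) (q := q) (r := r - 1) (by omega) (sub_add_cancel p 1) rfl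
    (sub_add_cancel r 1) w y
  rw [D.d_of_mem_Z _ hy, map_zero, smul_zero, add_zero] at this
  rw [← this]
  exact D.mem_Bd _ _

lemma mul_mem_Bd_right (D : DGAlg k) {p q r : ℤ} (h : p + q = r) {x : D.X p} {y : D.X q}
    (hx : x ∈ D.Z p) (hy : y ∈ D.Bd q) : D.mul h x y ∈ D.Bd r := by
  obtain ⟨w, rfl⟩ := hy
  have := D.leibniz (p := p) (q := q - 1) (r := r - 1) (by omega) rfl (sub_add_cancel q 1)
    (sub_add_cancel r 1) x w
  rw [D.d_of_mem_Z _ hx, map_zero, LinearMap.zero_apply, zero_add] at this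
  have h2 : D.mul h x (D.d (sub_add_cancel q 1) w)
      = sg p • D.d (sub_add_cancel r 1) (D.mul (by omega) x w) := by
    rw [this, smul_smul, sg_mul_self, one_smul]
  rw [h2]
  exact zsmul_mem (D.mem_Bd _ _) _

/-- The product on cohomology. -/
def Hmul (D : DGAlg k) {p q r : ℤ} (h : p + q = r) : D.H p →ₗ[k] D.H q →ₗ[k] D.H r :=
  let m : D.Z p →ₗ[k] D.Z q →ₗ[k] D.H r := LinearMap.mk₂ k
    (fun x y => D.cls r ⟨D.mul h x y, D.mul_mem_Z h x.2 y.2⟩)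
    (fun x x' y => by rw [← map_add]; congr 1; ext; simp)
    (fun c x y => by rw [← map_smul]; congr 1; ext; simp)
    (fun x y y' => by rw [← map_add]; congr 1; ext; simp)
    (fun c x y => by rw [← map_smul]; congr 1; ext; simp)
  Submodule.liftQ _
    { toFun := fun x => Submodule.liftQ _ (m x) fun y hy =>
        (Submodule.Quotient.mk_eq_zero _).2 (D.mul_mem_Bd_right h x.2 hy)
      map_add' := fun x x' => Submodule.linearMap_qext _ <| LinearMap.ext fun y => by
        change m (x + x') y = m x y + m x' y
        rw [map_add, LinearMap.add_apply]
      map_smul' := fun c x => Submodule.linearMap_qext _ <| LinearMap.ext fun y => by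
        change m (c • x) y = c • m x y
        rw [map_smul, LinearMap.smul_apply] }
    fun x hx => Submodule.linearMap_qext _ <| LinearMap.ext fun y =>
      (Submodule.Quotient.mk_eq_zero _).2 (D.mul_mem_Bd_left h hx y.2)

lemma Hmul_cls (D : DGAlg k) {p q r : ℤ} (h : p + q = r) (x : D.Z p) (y : D.Z q) :
    D.Hmul h (D.cls p x) (D.cls q y) = D.cls r ⟨D.mul h x y, D.mul_mem_Z h x.2 y.2⟩ := rfl

/-- A morphism of the underlying complexes of two dg algebras. -/
structure CxMap (D E : DGAlg k) where
  f : ∀ n, D.X n →ₗ[k] E.X n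
  comm : ∀ {m n : ℤ} (h : m + 1 = n) (x : D.X m), f n (D.d h x) = E.d h (f m x)

namespace CxMap
variable {D E : DGAlg k}

lemma map_Z (η : CxMap D E) {n : ℤ} {x : D.X n} (hx : x ∈ D.Z n) : η.f n x ∈ E.Z n := by
  change E.d rfl _ = 0
  rw [← η.comm, D.d_of_mem_Z _ hx, map_zero]

/-- The induced map on cohomology. -/
def H (η : CxMap D E) (n : ℤ) : D.H n →ₗ[k] E.H n :=
  Submodule.mapQ _ _ ((η.f n).restrict fun _ hx => η.map_Z hx) <| by
    rintro ⟨x, hx⟩ ⟨w, hw⟩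
    exact ⟨η.f _ w, by rw [← η.comm, hw]; rfl⟩

/-- A quasi-isomorphism. -/
def IsQuasiIso (η : CxMap D E) : Prop := ∀ n, Function.Bijective (η.H n)

/-- `η` is an algebra map up to homotopy: the chain maps `x ⊗ y ↦ η(xy)` and
`x ⊗ y ↦ η(x)η(y)` from `D ⊗ D` to `E` are chain homotopic. -/
def IsMulUpToHomotopy (η : CxMap D E) : Prop :=
  ∃ h : ∀ {p q s : ℤ}, p + q = s + 1 → D.X p →ₗ[k] D.X q →ₗ[k] E.X s,
    ∀ {p q r s p' q' : ℤ} (hr : p + q = r) (hs : s + 1 = r) (hp : p + 1 = p') (hq : q + 1 = q')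
      (x : D.X p) (y : D.X q),
      η.f r (D.mul hr x y) - E.mul hr (η.f p x) (η.f q y) =
        E.d hs (h (by omega) x y) + h (s := r) (by omega) (D.d hp x) y
          + sg p • h (s := r) (by omega) x (D.d hq y)

end CxMap

/-- An isomorphism between the graded cohomology algebras of two dg algebras. -/
structure HIso (D E : DGAlg k) where
  iso : ∀ n, D.H n ≃ₗ[k] E.H n
  mul : ∀ {p q r : ℤ} (h : p + q = r) (x : D.H p) (y : D.H q),
    iso r (D.Hmul h x y) = E.Hmul h (iso p x) (iso q y)

end DGAlg
end DGAlgebras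

section HomComplex
variable {k R X B : Type u} [Field k] [Ring R] [Algebra k R] [AddCommGroup X] [Module k X]
  [Module R X] [Module Rᵐᵒᵖ X] [IsBimod k R X] [Ring B] [Algebra k B]

namespace AugBimodCx
variable (C : AugBimodCx k R X) (φ : R →ₐ[k] B)

/-- The bimodule maps of cohomological degree `n`, i.e. those that vanish outside `X_n`. -/
def homDeg (n : ℤ) : Submodule k (BHom X φ) where
  carrier := {f | ∀ i : ℕ, (i : ℤ) ≠ n → ∀ x ∈ C.gr i, (f : X →ₗ[k] B) x = 0}
  add_mem' := fun hf hg i hi x hx => by simp [hf i hi x hx, hg i hi x hx]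
  zero_mem' := fun i hi x hx => by simp
  smul_mem' := fun c f hf i hi x hx => by simp [hf i hi x hx]

variable {C φ}

lemma dHom_mem {m n : ℤ} (h : m + 1 = n) {f : BHom X φ} (hf : f ∈ C.homDeg φ m) :
    C.dHom φ f ∈ C.homDeg φ n := by
  intro i hi x hx
  rw [dHom_apply, C.sgn_mem hx, map_zsmul, map_zsmul]
  rcases i with _ | i
  · simp [C.d_gr_zero x hx]
  · rw [hf i (by push_cast at hi; omega) _ (C.d_mem i x hx), smul_zero]

lemma dHom_dHom (f : BHom X φ) : C.dHom φ (C.dHom φ f) = 0 := by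
  ext x
  simp [C.d_sgn, C.d_d]

lemma sHom_of_mem {n : ℤ} {f : BHom X φ} (hf : f ∈ C.homDeg φ n) : C.sHom f = sg n • f := by
  ext1
  refine ext_gr C.isInternal fun i x hx => ?_
  rw [sHom_apply, C.sgn_mem hx]
  by_cases hi : (i : ℤ) = n
  · subst hi; simp
  · simp [hf i hi x hx]

lemma Diagonal.cup_mem (Δ : C.Diagonal) {p q r : ℤ} (h : p + q = r) {f g : BHom X φ}
    (hf : f ∈ C.homDeg φ p) (hg : g ∈ C.homDeg φ q) : Δ.cup f g ∈ C.homDeg φ r := by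
  intro n hn x hx
  rw [Δ.cup_apply]
  obtain ⟨t, ht, hxt⟩ := Δ.map_gr n x hx
  rw [← hxt, pair_mk]
  clear hxt
  induction ht using Submodule.span_induction with
  | mem t ht =>
    obtain ⟨i, j, rfl, x, hx, y, hy, rfl⟩ := ht
    rw [C.pairAux_hom _ _ hx hy]
    by_cases hi : (i : ℤ) = p
    · rw [hg j (by push_cast at hn; omega) y hy]; simp
    · rw [hf i hi x hx]; simp
  | zero => simp
  | add x y _ _ hx hy => rw [map_add, hx, hy, add_zero]
  | smul a x _ hx => rw [map_smul, hx, smul_zero]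

/-- The dg algebra `Hom_{Rᵉ}(X, B)` with the cup product defined by a diagonal map of `X`. -/
def Diagonal.homDGAlg (Δ : C.Diagonal) (φ : R →ₐ[k] B) : DGAlg k where
  X n := C.homDeg φ n
  grp n := inferInstanceAs (AddCommGroup (C.homDeg φ n))
  mod n := inferInstanceAs (Module k (C.homDeg φ n))
  d h := (C.dHom φ).restrict fun _ hf => dHom_mem h hf
  d_d h h' f := Subtype.ext (dHom_dHom f.1)
  mul h := LinearMap.mk₂ k (fun f g => ⟨Δ.cup f.1 g.1, Δ.cup_mem h f.2 g.2⟩)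
    (fun f f' g => Subtype.ext <| by
      change Δ.cup (f.1 + f'.1) g.1 = Δ.cup f.1 g.1 + Δ.cup f'.1 g.1
      rw [map_add, LinearMap.add_apply])
    (fun c f g => Subtype.ext <| by
      change Δ.cup (c • f.1) g.1 = c • Δ.cup f.1 g.1
      rw [map_smul, LinearMap.smul_apply])
    (fun f g g' => Subtype.ext (map_add (Δ.cup f.1) g.1 g'.1))
    (fun c f g => Subtype.ext (map_smul (Δ.cup f.1) c g.1))
  leibniz {p _ _ _ _ _} h hp hq hr f g := by
    refine Subtype.ext ?_
    have := Δ.dHom_cup f.1 g.1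
    rw [sHom_of_mem f.2, map_zsmul (Δ.cup (φ := φ)) (sg p) f.1, LinearMap.smul_apply] at this
    exact this

end AugBimodCx
end HomComplex

section Equivariant
variable (k A Γ X : Type u) [Field k] [Ring A] [Algebra k A] [Ring Γ] [HopfAlgebra k Γ]
  [Module Γ A] [IsScalarTower k Γ A] [AddCommGroup X] [Module k X]
  [Module A X] [Module Aᵐᵒᵖ X] [IsBimod k A X] [Module Γ X] [IsScalarTower k Γ X]

/-- `X` is a `Γ`-equivariant `A`-bimodule: the structure maps `A ⊗ X → X` and `X ⊗ A → X` are
`Γ`-linear for the diagonal actions, i.e. `γ(ax) = (γ₁a)(γ₂x)` and `γ(xa) = (γ₁x)(γ₂a)`. -/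
class EqBimod : Prop where
  smul_smul : ∀ (γ : Γ) (a : A) (x : X),
    γ • (a • x) = TensorProduct.lift (lact k A X) (diagOp (lact k Γ A) (lact k Γ X) γ (a ⊗ₜ x))
  smul_op_smul : ∀ (γ : Γ) (a : A) (x : X), γ • (MulOpposite.op a • x)
    = TensorProduct.lift (ract k A X).flip (diagOp (lact k Γ X) (lact k Γ A) γ (x ⊗ₜ a))

variable {k A Γ X}

/-- The diagonal action of `Γ` on `X ⊗_A X`. -/
def sqΓ [EqBimod k A Γ X] (γ : Γ) : Sq k A X →ₗ[k] Sq k A X :=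
  BTen.map (diagOp (lact k Γ X) (lact k Γ X) γ) fun a x y => by
    let f : X ⊗[k] A →ₗ[k] X := TensorProduct.lift (ract k A X).flip
    let g : A ⊗[k] X →ₗ[k] X := TensorProduct.lift (lact k A X)
    have h1 : ract k A X a x ⊗ₜ[k] y = TensorProduct.map f LinearMap.id ((x ⊗ₜ a) ⊗ₜ[k] y) := by
      simp [f]
    have h2 : x ⊗ₜ[k] lact k A X a y = TensorProduct.map LinearMap.id g (x ⊗ₜ[k] (a ⊗ₜ y)) := by
      simp [g]
    have hf : ∀ γ t, f (diagOp (lact k Γ X) (lact k Γ A) γ t) = lact k Γ X γ (f t) := by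
      intro γ t
      induction t using TensorProduct.induction_on with
      | zero => simp
      | add x y hx hy => simp only [map_add, hx, hy]
      | tmul x a => exact (EqBimod.smul_op_smul γ a x).symm
    have hg : ∀ γ t, g (diagOp (lact k Γ A) (lact k Γ X) γ t) = lact k Γ X γ (g t) := by
      intro γ t
      induction t using TensorProduct.induction_on with
      | zero => simp
      | add x y hx hy => simp only [map_add, hx, hy]
      | tmul a x => exact (EqBimod.smul_smul γ a x).symm
    rw [h1, h2, ← diagOp_nat hf (g := LinearMap.id) (v := lact k Γ X) (fun _ _ => rfl),
      ← diagOp_nat (f := LinearMap.id) (u := lact k Γ X) (fun _ _ => rfl) hg,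
      ← TensorProduct.assoc_tmul, ← diagOp_assoc]
    refine LinearMap.congr_fun (f := sqMk k A X ∘ₗ TensorProduct.map f LinearMap.id)
      (g := sqMk k A X ∘ₗ TensorProduct.map LinearMap.id g ∘ₗ
        (TensorProduct.assoc k X A X).toLinearMap) ?_ _
    refine TensorProduct.ext_threefold fun x a y => ?_
    exact BTen.mk_bal a x y

namespace AugBimodCx

/-- `Γ` acts on the complex `X` by morphisms of complexes, and the augmentation is `Γ`-linear. -/
structure IsEquivariant (C : AugBimodCx k A X) (Γ : Type u) [Ring Γ] [HopfAlgebra k Γ]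
    [Module Γ A] [IsScalarTower k Γ A] [Module Γ X] [IsScalarTower k Γ X] : Prop where
  smul_mem : ∀ n (γ : Γ) x, x ∈ C.gr n → γ • x ∈ C.gr n
  d_smul : ∀ (γ : Γ) x, C.d (γ • x) = γ • C.d x
  aug_smul : ∀ (γ : Γ) x, C.aug (γ • x) = γ • C.aug x

/-- The diagonal map `X → X ⊗_A X` is `Γ`-linear. -/
def Diagonal.IsEquivariant {C : AugBimodCx k A X} (Δ : C.Diagonal) (Γ : Type u) [Ring Γ]
    [HopfAlgebra k Γ] [Module Γ A] [IsScalarTower k Γ A] [Module Γ X] [IsScalarTower k Γ X]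
    [EqBimod k A Γ X] : Prop :=
  ∀ (γ : Γ) x, Δ.toFun (γ • x) = sqΓ γ (Δ.toFun x)

variable (Γ) in
/-- `X` is free over `A ⊗ Aᵒᵖ` on a graded `Γ`-submodule `V ⊆ X`: the map
`A ⊗ V ⊗ A → X`, `a ⊗ v ⊗ b ↦ a v b`, is bijective. -/
def IsFreeOnΓ (C : AugBimodCx k A X) : Prop :=
  ∃ V : Submodule k X, (∀ (γ : Γ), ∀ v ∈ V, γ • v ∈ V) ∧ (∀ n, ∀ v ∈ V, C.proj n v ∈ V) ∧
    Function.Bijective (TensorProduct.lift ((ract k A X).compl₂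
      (TensorProduct.lift ((lact k A X).compl₂ V.subtype))).flip :
        (A ⊗[k] V) ⊗[k] A →ₗ[k] X)

end AugBimodCx
end Equivariant

section RightComplexes
variable {k Γ L : Type u} [Field k] [Ring Γ] [HopfAlgebra k Γ]
  [AddCommGroup L] [Module k L] [Module Γᵐᵒᵖ L] [IsScalarTower k Γᵐᵒᵖ L]

/-- A complex of right `Γ`-modules `⋯ → L₁ → L₀ → 0` with an augmentation to the trivial
module `k`. -/
structure AugRightCx (k Γ L : Type u) [Field k] [Ring Γ] [HopfAlgebra k Γ]
    [AddCommGroup L] [Module k L] [Module Γᵐᵒᵖ L] [IsScalarTower k Γᵐᵒᵖ L]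
    extends GrCx k L where
  op_smul_mem : ∀ n (γ : Γ) x, x ∈ gr n → MulOpposite.op γ • x ∈ gr n
  d_op_smul : ∀ (γ : Γ) x, d (MulOpposite.op γ • x) = MulOpposite.op γ • d x
  aug : L →ₗ[k] k
  aug_op_smul : ∀ (γ : Γ) x, aug (MulOpposite.op γ • x) = counit γ * aug x
  aug_pos : ∀ n, ∀ x ∈ gr (n + 1), aug x = 0
  aug_d : ∀ x, aug (d x) = 0

namespace AugRightCx

/-- The augmentation is a quasi-isomorphism `L → k`, and `L` is projective over `Γ`; as `L` is the
direct sum of its homogeneous components, this says that each of them is projective. -/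
structure IsProjRes (C : AugRightCx k Γ L) : Prop where
  surj : ∀ r : k, ∃ x ∈ C.gr 0, C.aug x = r
  exact_zero : ∀ x ∈ C.gr 0, C.aug x = 0 → ∃ y ∈ C.gr 1, C.d y = x
  exact_succ : ∀ n, ∀ x ∈ C.gr (n + 1), C.d x = 0 → ∃ y ∈ C.gr (n + 2), C.d y = x
  proj : Module.Projective Γᵐᵒᵖ L

/-- A diagonal map `L → L ⊗ L`: a morphism of complexes of right `Γ`-modules, for the diagonal
action on `L ⊗ L`, that is compatible with the augmentations. -/
structure Diagonal (C : AugRightCx k Γ L) where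
  toFun : L →ₗ[k] L ⊗[k] L
  lin : ∀ (γ : Γ) x, toFun (MulOpposite.op γ • x)
    = diagOp (ract k Γ L) (ract k Γ L) γ (toFun x)
  map_gr : ∀ n, ∀ x ∈ C.gr n, toFun x ∈ C.tensorGr C.toGrCx n
  map_d : ∀ x, toFun (C.d x) = C.tensorD C.toGrCx (toFun x)
  aug_comp : ∀ x, LinearMap.mul' k k (TensorProduct.map C.aug C.aug (toFun x)) = C.aug x

end AugRightCx
end RightComplexes

section TwistedAction
variable {k Γ X B : Type u} [Field k] [Ring Γ] [HopfAlgebra k Γ]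
  [AddCommGroup X] [Module k X] [Module Γ X] [IsScalarTower k Γ X] [Ring B] [Algebra k B]

/-- For an algebra map `ψ : Γ → B` and a linear map `h : Γ → B`, the linear map
`γ ↦ ψ(S(γ₁)) h(γ₂) ψ(γ₃)`, as a triple convolution product. -/
def conjConv (ψ : Γ →ₐ[k] B) (h : Γ →ₗ[k] B) : WithConv (Γ →ₗ[k] B) :=
  WithConv.toConv (ψ.toLinearMap ∘ₗ HopfAlgebra.antipode k) * WithConv.toConv h
    * WithConv.toConv ψ.toLinearMap

/-- The right action of `Γ` on linear maps `f : X → B`, for an algebra map `ψ : Γ → B`: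
`(f · γ)(x) = ψ(S(γ₁)) f(γ₂ x) ψ(γ₃)`. -/
def twAct (ψ : Γ →ₐ[k] B) (f : X →ₗ[k] B) (γ : Γ) (x : X) : B :=
  (conjConv ψ (f ∘ₗ (lact k Γ X).flip x)).ofConv γ

lemma conjConv_add (ψ : Γ →ₐ[k] B) (h h' : Γ →ₗ[k] B) :
    conjConv ψ (h + h') = conjConv ψ h + conjConv ψ h' := by
  simp [conjConv, mul_add, add_mul]

lemma conjConv_smul (ψ : Γ →ₐ[k] B) (c : k) (h : Γ →ₗ[k] B) :
    conjConv ψ (c • h) = c • conjConv ψ h := by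
  simp [conjConv]

lemma conjConv_zero (ψ : Γ →ₐ[k] B) : conjConv ψ (0 : Γ →ₗ[k] B) = 0 := by
  simp [conjConv]

lemma twAct_zero (ψ : Γ →ₐ[k] B) (γ : Γ) (x : X) : twAct ψ (0 : X →ₗ[k] B) γ x = 0 := by
  rw [twAct, LinearMap.zero_comp, conjConv_zero]; rfl

lemma twAct_add (ψ : Γ →ₐ[k] B) (f g : X →ₗ[k] B) (γ : Γ) (x : X) :
    twAct ψ (f + g) γ x = twAct ψ f γ x + twAct ψ g γ x := by
  rw [twAct, LinearMap.add_comp, conjConv_add]; rfl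

lemma twAct_smul (ψ : Γ →ₐ[k] B) (c : k) (f : X →ₗ[k] B) (γ : Γ) (x : X) :
    twAct ψ (c • f) γ x = c • twAct ψ f γ x := by
  rw [twAct, LinearMap.smul_comp, conjConv_smul]; rfl

lemma twAct_zsmul (ψ : Γ →ₐ[k] B) (c : ℤ) (f : X →ₗ[k] B) (γ : Γ) (x : X) :
    twAct ψ (c • f) γ x = c • twAct ψ f γ x := by
  rw [← Int.cast_smul_eq_zsmul k, twAct_smul, Int.cast_smul_eq_zsmul]

lemma conv_psi (ψ : Γ →ₐ[k] B) : WithConv.toConv ψ.toLinearMap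
    * WithConv.toConv (ψ.toLinearMap ∘ₗ HopfAlgebra.antipode k) = 1 := by
  have h := LinearMap.algHom_comp_convMul_distrib ψ
    (WithConv.toConv (LinearMap.id (R := k) (M := Γ))) (WithConv.toConv (HopfAlgebra.antipode k))
  rw [LinearMap.id_mul_antipode] at h
  apply WithConv.ext
  refine Eq.trans h.symm ?_
  ext γ
  simp [LinearMap.convOne_def]

lemma conjConv_mul (ψ : Γ →ₐ[k] B) (h h' : Γ →ₗ[k] B) :
    conjConv ψ h * conjConv ψ h'
      = conjConv ψ (WithConv.toConv h * WithConv.toConv h').ofConv := by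
  simp only [conjConv, WithConv.toConv_ofConv]
  calc _ = WithConv.toConv (ψ.toLinearMap ∘ₗ HopfAlgebra.antipode k) * WithConv.toConv h
      * (WithConv.toConv ψ.toLinearMap
      * WithConv.toConv (ψ.toLinearMap ∘ₗ HopfAlgebra.antipode k)) * WithConv.toConv h'
      * WithConv.toConv ψ.toLinearMap := by simp only [mul_assoc]
    _ = _ := by rw [conv_psi, mul_one]; simp only [mul_assoc]

end TwistedAction

section TotalComplex
variable {k A Γ X L B : Type u} [Field k] [Ring A] [Algebra k A] [Ring Γ] [HopfAlgebra k Γ]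
  [AddCommGroup X] [Module k X] [Module A X] [Module Aᵐᵒᵖ X] [IsBimod k A X]
  [AddCommGroup L] [Module k L] [Module Γᵐᵒᵖ L] [IsScalarTower k Γᵐᵒᵖ L]
  [Ring B] [Algebra k B]

instance (φ : A →ₐ[k] B) : AddCommGroup (L →ₗ[k] BHom X φ) := LinearMap.addCommGroup

variable (CL : AugRightCx k Γ L) (C : AugBimodCx k A X) {φ : A →ₐ[k] B} {ψ : Γ →ₐ[k] B}

/-- The differential `F ↦ d F - (-1)^n F d` in total degree `n`. -/
def totD (φ : A →ₐ[k] B) (n : ℤ) : (L →ₗ[k] BHom X φ) →ₗ[k] (L →ₗ[k] BHom X φ) :=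
  LinearMap.compRight k (C.dHom φ) - sg n • LinearMap.lcomp k _ CL.d

lemma totD_apply (n : ℤ) (F : L →ₗ[k] BHom X φ) (l : L) :
    totD CL C φ n F l = C.dHom φ (F l) - sg n • F (CL.d l) := by
  simp [totD]

variable {C} in
/-- The map `l ⊗ m ↦ F(l) ∪ G(m)`. -/
def cupT (Δ : C.Diagonal) (F G : L →ₗ[k] BHom X φ) : L ⊗[k] L →ₗ[k] BHom X φ :=
  TensorProduct.lift ((Δ.cup (φ := φ)).compl₁₂ F G)

variable {C CL} in
/-- The product `l ↦ ∑ (-1)^(q |l₁|) F(l₁) ∪ G(l₂)`, for `G` of degree `q`. -/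
def totMul (Δ : C.Diagonal) (σ : CL.Diagonal) (φ : A →ₐ[k] B) (q : ℤ) :
    (L →ₗ[k] BHom X φ) →ₗ[k] (L →ₗ[k] BHom X φ) →ₗ[k] (L →ₗ[k] BHom X φ) :=
  LinearMap.mk₂ k
    (fun F G => cupT Δ (F ∘ₗ scaleOf CL.isInternal fun i => sg (q * i)) G ∘ₗ σ.toFun)
    (fun F F' G => by
      rw [← LinearMap.add_comp]; congr 1; ext; simp [cupT, LinearMap.add_comp])
    (fun c F G => by
      rw [← LinearMap.smul_comp]; congr 1; ext; simp [cupT, LinearMap.smul_comp])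
    (fun F G G' => by
      rw [← LinearMap.add_comp]; congr 1; ext; simp [cupT])
    (fun c F G => by
      rw [← LinearMap.smul_comp]; congr 1; ext; simp [cupT])

variable {C CL} in
lemma totMul_apply (Δ : C.Diagonal) (σ : CL.Diagonal) (q : ℤ) (F G : L →ₗ[k] BHom X φ) (l : L) :
    totMul Δ σ φ q F G l
      = cupT Δ (F ∘ₗ scaleOf CL.isInternal fun i => sg (q * i)) G (σ.toFun l) := rfl

lemma CL_scale_op (c : ℕ → ℤ) (γ : Γ) (l : L) : scaleOf CL.isInternal c (MulOpposite.op γ • l)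
    = MulOpposite.op γ • scaleOf CL.isInternal c l :=
  (CL.scale_comm CL.toGrCx c (f := ract k Γ L γ) (fun n x hx => CL.op_smul_mem n γ x hx) l).symm

lemma totD_totD {m n : ℤ} (h : m + 1 = n) (F : L →ₗ[k] BHom X φ) :
    totD CL C φ n (totD CL C φ m F) = 0 := by
  subst h
  ext1 l
  rw [totD_apply, totD_apply, totD_apply, CL.d_d, sg_add, sg_one]
  simp [AugBimodCx.dHom_dHom]

variable {C CL} in
/-- The Leibniz rule in the total complex. -/
lemma totD_totMul (Δ : C.Diagonal) (σ : CL.Diagonal) {p q r : ℤ} (h : p + q = r)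
    {F G : L →ₗ[k] BHom X φ}
    (hF : ∀ i, ∀ l ∈ CL.gr i, C.sHom (F l) = sg (p - i) • F l) :
    totD CL C φ r (totMul Δ σ φ q F G) = totMul Δ σ φ q (totD CL C φ p F) G
      + sg p • totMul Δ σ φ (q + 1) F (totD CL C φ q G) := by
  subst h
  ext1 l
  simp only [totD_apply, totMul_apply, LinearMap.add_apply, LinearMap.smul_apply, σ.map_d]
  generalize σ.toFun l = w
  let K := cupT Δ (F ∘ₗ scaleOf CL.isInternal fun i => sg (q * i)) G
  refine LinearMap.congr_fun (f := C.dHom φ ∘ₗ K - sg (p + q) • (K ∘ₗ CL.tensorD CL.toGrCx))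
    (g := cupT Δ ((totD CL C φ p F) ∘ₗ scaleOf CL.isInternal fun i => sg (q * i)) G
      + sg p • cupT Δ (F ∘ₗ scaleOf CL.isInternal fun i => sg ((q + 1) * i)) (totD CL C φ q G))
    ?_ w
  refine TensorProduct.ext ?_
  refine ext_gr CL.isInternal fun i l hl => LinearMap.ext fun m => ?_
  have e1 : ∀ (F G : L →ₗ[k] BHom X φ) l m, cupT Δ F G (l ⊗ₜ m) = Δ.cup (F l) (G m) :=
    fun _ _ _ _ => rfl
  have e2 : F (scaleOf CL.isInternal (fun i => sg (q * i)) (CL.d l))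
      = (sg q * sg (q * i)) • F (CL.d l) := by
    rcases i with _ | i
    · simp [CL.d_gr_zero l hl]
    · rw [scaleOf_mem _ _ (CL.d_mem i l hl), map_zsmul]
      congr 1
      push_cast
      rw [mul_add, sg_add, mul_one, mul_left_comm, sg_mul_self, mul_one]
  have z1 : ∀ (c : ℤ) (f g : BHom X φ), Δ.cup (c • f) g = c • Δ.cup f g := fun c f g => by
    rw [map_zsmul (Δ.cup (φ := φ)) c f, LinearMap.smul_apply]
  have z2 : ∀ (c : ℤ) (f g : BHom X φ), Δ.cup f (c • g) = c • Δ.cup f g := fun c f g =>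
    map_zsmul _ _ _
  have z0 : ∀ (c : ℤ) (f : BHom X φ), C.dHom φ (c • f) = c • C.dHom φ f := fun c f =>
    map_zsmul _ _ _
  have z3 : ∀ (c : ℤ) (l : L), F (c • l) = c • F l := fun c l => map_zsmul _ _ _
  have z4 : ∀ (c : ℤ) (w : L ⊗[k] L) (F : L →ₗ[k] BHom X φ),
      cupT Δ F G (c • w) = c • cupT Δ F G w := fun c w F => map_zsmul _ _ _
  change C.dHom φ (K (l ⊗ₜ m)) - sg (p + q) • K (CL.tensorD CL.toGrCx (l ⊗ₜ m)) =
    cupT Δ _ G (l ⊗ₜ m) + sg p • cupT Δ _ _ (l ⊗ₜ m)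
  simp only [K, GrCx.tensorD, LinearMap.add_apply, TensorProduct.map_tmul, LinearMap.id_coe, id_eq,
    map_add, e1, LinearMap.comp_apply, e2, scaleOf_mem _ _ hl, CL.sgn_mem hl,
    zsmul_tmul, z4, z0, z1, z2, z3, AugBimodCx.Diagonal.dHom_cup, hF i l hl, totD_apply, map_sub,
    LinearMap.sub_apply]
  rw [show (q + 1) * (i : ℤ) = q * i + i by ring, sg_add p q, sg_add (q * i) i, sub_eq_add_neg p,
    sg_add p, sg_neg]
  rcases sg_cases p with hp | hp <;> rcases sg_cases q with hq | hq <;>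
    rcases sg_cases i with hi | hi <;> rcases sg_cases (q * i) with hqi | hqi <;>
    simp [hp, hq, hi, hqi] <;> abel

variable [Module Γ X] [IsScalarTower k Γ X]

/-- The total degree `n` part of `Hom_Γ(L, Hom_{Aᵉ}(X, B))`: the `Γ`-linear maps `F` with
`F(l)(x) = 0` unless `|l| + |x| = n`. -/
def totDeg (CL : AugRightCx k Γ L) (C : AugBimodCx k A X) (φ : A →ₐ[k] B) (ψ : Γ →ₐ[k] B) (n : ℤ) :
    Submodule k (L →ₗ[k] BHom X φ) where
  carrier := {F | (∀ (γ : Γ) l x, (F (MulOpposite.op γ • l) : X →ₗ[k] B) x = twAct ψ (F l) γ x) ∧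
    ∀ i j : ℕ, (i + j : ℤ) ≠ n → ∀ l ∈ CL.gr i, ∀ x ∈ C.gr j, (F l : X →ₗ[k] B) x = 0}
  add_mem' := by
    rintro F G ⟨hF, hF'⟩ ⟨hG, hG'⟩
    refine ⟨fun γ l x => ?_, fun i j h l hl x hx => ?_⟩
    · simp [hF, hG, twAct_add]
    · simp [hF' i j h l hl x hx, hG' i j h l hl x hx]
  zero_mem' := ⟨fun γ l x => by simp [twAct_zero], fun i j h l hl x hx => by simp⟩
  smul_mem' := by
    rintro c F ⟨hF, hF'⟩
    refine ⟨fun γ l x => ?_, fun i j h l hl x hx => ?_⟩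
    · simp [hF, twAct_smul]
    · simp [hF' i j h l hl x hx]

variable {C CL} in
lemma sHom_of_mem_totDeg {p : ℤ} {F : L →ₗ[k] BHom X φ} (hF : F ∈ totDeg CL C φ ψ p) (i : ℕ) (l : L)
    (hl : l ∈ CL.gr i) : C.sHom (F l) = sg (p - i) • F l := by
  refine AugBimodCx.sHom_of_mem fun j hj x hx => hF.2 i j (by omega) l hl x hx

variable [Module Γ A] [IsScalarTower k Γ A]

variable {C CL} in
lemma pairAux_conj (hC : C.IsEquivariant Γ) {F G : L →ₗ[k] BHom X φ}
    (hF : ∀ (γ : Γ) l x, (F (MulOpposite.op γ • l) : X →ₗ[k] B) x = twAct ψ (F l) γ x)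
    (hG : ∀ (γ : Γ) l x, (G (MulOpposite.op γ • l) : X →ₗ[k] B) x = twAct ψ (G l) γ x)
    (γ : Γ) (l m : L) (t : X ⊗[k] X) :
    TensorProduct.lift (C.pairAux.compl₁₂ ((BHom X φ).subtype ∘ₗ F) ((BHom X φ).subtype ∘ₗ G))
        (diagOp (ract k Γ L) (ract k Γ L) γ (l ⊗ₜ m)) t
      = (conjConv ψ (C.pairAux (F l : X →ₗ[k] B) (G m) ∘ₗ
          (diagOp (lact k Γ X) (lact k Γ X)).flip t)).ofConv γ := by
  have hs : ∀ (c : ℕ → ℤ) (γ : Γ) (x : X), scaleOf C.isInternal c (γ • x)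
      = γ • scaleOf C.isInternal c x := fun c γ x =>
    (C.scale_comm C.toGrCx c (f := lact k Γ X γ) (fun n x hx => hC.smul_mem n γ x hx) x).symm
  induction t using TensorProduct.induction_on with
  | zero => simp [conjConv_zero]
  | add t t' h h' =>
    rw [map_add, h, h', map_add, LinearMap.comp_add, conjConv_add]; rfl
  | tmul x y =>
    let o : (X →ₗ[k] B) → X → (Γ →ₗ[k] B) := fun f x => f ∘ₗ (lact k Γ X).flip x
    have h1 : ∀ s : Γ ⊗[k] Γ, TensorProduct.lift
        (C.pairAux.compl₁₂ ((BHom X φ).subtype ∘ₗ F) ((BHom X φ).subtype ∘ₗ G))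
        (TensorProduct.map₂ (ract k Γ L) (ract k Γ L) s (l ⊗ₜ m)) (x ⊗ₜ y)
        = LinearMap.mul' k B (TensorProduct.map (conjConv ψ (o (F l) (C.even x))).ofConv
            (conjConv ψ (o (G m) y)).ofConv s)
          + LinearMap.mul' k B (TensorProduct.map (conjConv ψ (o (F l) (C.odd x))).ofConv
            (conjConv ψ (o (G m) (C.sgn y))).ofConv s) := by
      intro s
      induction s using TensorProduct.induction_on with
      | zero => simp
      | add s s' h h' => simp only [map_add, LinearMap.add_apply, h, h']; abel
      | tmul a b =>
        simp only [TensorProduct.map₂_apply_tmul, TensorProduct.map_tmul, TensorProduct.lift.tmul,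
          LinearMap.compl₁₂_apply, LinearMap.comp_apply, Submodule.subtype_apply, C.pairAux_tmul,
          ract_apply, hF, hG, LinearMap.mul'_apply]
        rfl
    have h2 : C.pairAux (F l : X →ₗ[k] B) (G m) ∘ₗ
          (diagOp (lact k Γ X) (lact k Γ X)).flip (x ⊗ₜ y)
        = (WithConv.toConv (o (F l) (C.even x)) * WithConv.toConv (o (G m) y)).ofConv
          + (WithConv.toConv (o (F l) (C.odd x)) * WithConv.toConv (o (G m) (C.sgn y))).ofConv := by
      have h3 : ∀ s : Γ ⊗[k] Γ, C.pairAux (F l : X →ₗ[k] B) (G m)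
          (TensorProduct.map₂ (lact k Γ X) (lact k Γ X) s (x ⊗ₜ y))
          = LinearMap.mul' k B (TensorProduct.map (o (F l) (C.even x)) (o (G m) y) s)
          + LinearMap.mul' k B (TensorProduct.map (o (F l) (C.odd x)) (o (G m) (C.sgn y)) s) := by
        intro s
        induction s using TensorProduct.induction_on with
        | zero => simp
        | add s s' h h' => simp only [map_add, LinearMap.add_apply, h, h']; abel
        | tmul a b =>
          simp only [TensorProduct.map₂_apply_tmul, TensorProduct.map_tmul, C.pairAux_tmul,
            lact_apply, GrCx.even, GrCx.odd, GrCx.sgn, hs, LinearMap.mul'_apply]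
          rfl
      ext δ
      exact h3 _
    rw [h2, conjConv_add, ← conjConv_mul, ← conjConv_mul]
    exact h1 _

variable {C CL} in
lemma totD_mem (hC : C.IsEquivariant Γ) {m n : ℤ} (h : m + 1 = n) {F : L →ₗ[k] BHom X φ}
    (hF : F ∈ totDeg CL C φ ψ m) : totD CL C φ m F ∈ totDeg CL C φ ψ n := by
  constructor
  · intro γ l x
    have h1 : (C.dHom φ (F (MulOpposite.op γ • l)) : X →ₗ[k] B) x
        = twAct ψ (C.dHom φ (F l) : X →ₗ[k] B) γ x := by
      have hs : ∀ (γ : Γ) (x : X), C.d (C.sgn (γ • x)) = γ • C.d (C.sgn x) := by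
        intro γ x
        rw [GrCx.sgn, ← hC.d_smul]
        congr 1
        exact (C.scale_comm C.toGrCx _ (f := lact k Γ X γ)
          (fun n x hx => hC.smul_mem n γ x hx) x).symm
      have h2 : (F l : X →ₗ[k] B) ∘ₗ (lact k Γ X).flip (C.d (C.sgn x))
          = (C.dHom φ (F l) : X →ₗ[k] B) ∘ₗ (lact k Γ X).flip x := by
        refine LinearMap.ext fun δ => ?_
        change (F l : X →ₗ[k] B) (δ • C.d (C.sgn x)) = (F l : X →ₗ[k] B) (C.d (C.sgn (δ • x)))
        rw [hs]
      rw [AugBimodCx.dHom_apply, hF.1, twAct, twAct, h2]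
    rw [totD_apply, totD_apply, CL.d_op_smul, sub_eq_add_neg, sub_eq_add_neg, ← neg_smul, ← neg_smul,
      Submodule.coe_add, Submodule.coe_add, LinearMap.add_apply, twAct_add, h1]
    congr 1
    refine Eq.trans ?_ (twAct_zsmul ψ (-sg m) (F (CL.d l) : X →ₗ[k] B) γ x).symm
    rw [← hF.1]
    rfl
  · intro i j hij l hl x hx
    rw [totD_apply, Submodule.coe_sub, LinearMap.sub_apply]
    have h1 : (C.dHom φ (F l) : X →ₗ[k] B) x = 0 := by
      rw [AugBimodCx.dHom_apply, C.sgn_mem hx, map_zsmul, map_zsmul]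
      rcases j with _ | j
      · simp [C.d_gr_zero x hx]
      · rw [hF.2 i j (by push_cast at hij; omega) l hl _ (C.d_mem j x hx), smul_zero]
    have h2 : (F (CL.d l) : X →ₗ[k] B) x = 0 := by
      rcases i with _ | i
      · simp [CL.d_gr_zero l hl]
      · exact hF.2 i j (by push_cast at hij; omega) _ (CL.d_mem i l hl) x hx
    rw [h1]
    simp [h2]

variable [EqBimod k A Γ X]

variable {C CL} in
lemma totMul_mem (Δ : C.Diagonal) (σ : CL.Diagonal) (hC : C.IsEquivariant Γ)
    (hΔ : Δ.IsEquivariant Γ) {p q r : ℤ} (h : p + q = r) {F G : L →ₗ[k] BHom X φ}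
    (hF : F ∈ totDeg CL C φ ψ p) (hG : G ∈ totDeg CL C φ ψ q) :
    totMul Δ σ φ q F G ∈ totDeg CL C φ ψ r := by
  constructor
  · intro γ l x
    set F' := F ∘ₗ scaleOf CL.isInternal fun i => sg (q * i) with hF'
    have hFΓ : ∀ (γ : Γ) l x, (F' (MulOpposite.op γ • l) : X →ₗ[k] B) x = twAct ψ (F' l) γ x := by
      intro γ l x
      rw [hF', LinearMap.comp_apply, CL_scale_op, hF.1, LinearMap.comp_apply]
    rw [totMul_apply, totMul_apply, σ.lin, ← hF']
    obtain ⟨t, ht⟩ := BTen.mk_surj (Δ.toFun x)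
    generalize σ.toFun l = w
    induction w using TensorProduct.induction_on with
    | zero => simp [twAct_zero]
    | add w w' h h' => 
      rw [map_add, map_add, map_add, Submodule.coe_add, Submodule.coe_add, twAct_add,
        LinearMap.add_apply, h, h']
    | tmul l m =>
      refine Eq.trans ?_ ((pairAux_conj hC hFΓ hG.1 γ l m t).trans ?_)
      · generalize (diagOp (ract k Γ L) (ract k Γ L) γ (l ⊗ₜ m)) = w
        induction w using TensorProduct.induction_on with
        | zero => simp
        | add w w' h h' => 
          rw [map_add, map_add, Submodule.coe_add, LinearMap.add_apply, LinearMap.add_apply, h, h']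
        | tmul l m =>
          change C.pair _ _ (Δ.toFun x) = C.pairAux _ _ t
          rw [← ht]
          rfl
      · have h1 : C.pairAux (F' l : X →ₗ[k] B) (G m) ∘ₗ
            (diagOp (lact k Γ X) (lact k Γ X)).flip t
            = (cupT Δ F' G (l ⊗ₜ m) : X →ₗ[k] B) ∘ₗ (lact k Γ X).flip x := by
          refine LinearMap.ext fun δ => ?_
          change C.pairAux (F' l : X →ₗ[k] B) (G m) (diagOp (lact k Γ X) (lact k Γ X) δ t)
            = C.pair (F' l) (G m) (Δ.toFun (δ • x))
          rw [hΔ δ x, ← ht]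
          rfl
        rw [twAct, h1]
  · intro i j hij l hl x hx
    rw [totMul_apply]
    have ht := σ.map_gr i l hl
    generalize σ.toFun l = w at ht ⊢
    induction ht using Submodule.span_induction with
    | zero => simp
    | add w w' _ _ h h' => rw [map_add, Submodule.coe_add, LinearMap.add_apply, h, h', add_zero]
    | smul c w _ h => rw [map_smul, Submodule.coe_smul, LinearMap.smul_apply, h, smul_zero]
    | mem w hw =>
      obtain ⟨a, b, rfl, l, hl, m, hm, rfl⟩ := hw
      change C.pair _ _ (Δ.toFun x) = 0
      obtain ⟨t, ht, hxt⟩ := Δ.map_gr j x hx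
      rw [← hxt, AugBimodCx.pair_mk]
      clear hxt
      induction ht using Submodule.span_induction with
      | mem t ht =>
        obtain ⟨c, e, rfl, x, hx, y, hy, rfl⟩ := ht
        rw [C.pairAux_hom _ _ hx hy]
        by_cases hc : (a + c : ℤ) = p
        · rw [hG.2 b e (by push_cast at hij; omega) m hm y hy]; simp
        · rw [LinearMap.comp_apply, scaleOf_mem _ _ hl, map_zsmul]
          simp [hF.2 a c hc l hl x hx]
      | zero => simp
      | add x y _ _ hx hy => rw [map_add, hx, hy, add_zero]
      | smul a x _ hx => rw [map_smul, hx, smul_zero]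

variable {C CL} in
/-- The dg algebra `Hom_Γ(L, Hom_{Aᵉ}(X, B))`. -/
def totDGAlg (σ : CL.Diagonal) (hC : C.IsEquivariant Γ) (Δ : C.Diagonal) (hΔ : Δ.IsEquivariant Γ)
    (φ : A →ₐ[k] B) (ψ : Γ →ₐ[k] B) : DGAlg k where
  X n := totDeg CL C φ ψ n
  grp n := inferInstanceAs (AddCommGroup (totDeg CL C φ ψ n))
  mod n := inferInstanceAs (Module k (totDeg CL C φ ψ n))
  d {m n} h := (totD CL C φ m).restrict fun _ hf => totD_mem hC h hf
  d_d h h' F := Subtype.ext (totD_totD CL C h F.1)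
  mul {p q r} h := LinearMap.mk₂ k
    (fun F G => ⟨totMul Δ σ φ q F.1 G.1, totMul_mem Δ σ hC hΔ h F.2 G.2⟩)
    (fun F F' G => Subtype.ext <| by
      change totMul Δ σ φ q (F.1 + F'.1) G.1 = totMul Δ σ φ q F.1 G.1 + totMul Δ σ φ q F'.1 G.1
      rw [map_add, LinearMap.add_apply])
    (fun c F G => Subtype.ext <| by
      change totMul Δ σ φ q (c • F.1) G.1 = c • totMul Δ σ φ q F.1 G.1
      rw [map_smul, LinearMap.smul_apply])
    (fun F G G' => Subtype.ext (map_add (totMul Δ σ φ q F.1) G.1 G'.1))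
    (fun c F G => Subtype.ext (map_smul (totMul Δ σ φ q F.1) c G.1))
  leibniz {p q r p' q' r'} h hp hq hr F G := by
    subst hq
    exact Subtype.ext (totD_totMul Δ σ h (sHom_of_mem_totDeg F.2))

end TotalComplex

section Convolution
variable {k Γ E : Type u} [Field k] [Ring Γ] [HopfAlgebra k Γ] [Ring E] [Algebra k E]

lemma conv_psi' (ψ : Γ →ₐ[k] E) :
    WithConv.toConv (ψ.toLinearMap ∘ₗ HopfAlgebra.antipode k) * WithConv.toConv ψ.toLinearMap
      = 1 := by
  have h := LinearMap.algHom_comp_convMul_distrib ψ (WithConv.toConv (HopfAlgebra.antipode k))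
    (WithConv.toConv (LinearMap.id (R := k) (M := Γ)))
  rw [LinearMap.antipode_mul_id] at h
  apply WithConv.ext
  refine Eq.trans h.symm ?_
  ext γ
  simp [LinearMap.convOne_def]

/-- If `ψ = α * β` for algebra maps, then `ψS * α = βS`. -/
lemma conv_cancel (ψ α β : Γ →ₐ[k] E)
    (h : WithConv.toConv α.toLinearMap * WithConv.toConv β.toLinearMap
      = WithConv.toConv ψ.toLinearMap) :
    WithConv.toConv (ψ.toLinearMap ∘ₗ HopfAlgebra.antipode k) * WithConv.toConv α.toLinearMap
      = WithConv.toConv (β.toLinearMap ∘ₗ HopfAlgebra.antipode k) := by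
  have h1 := conv_psi' ψ
  rw [← h, ← mul_assoc] at h1
  calc _ = _ * (WithConv.toConv β.toLinearMap
        * WithConv.toConv (β.toLinearMap ∘ₗ HopfAlgebra.antipode k)) := by
        rw [conv_psi, mul_one]
    _ = _ := by rw [← mul_assoc, h1, one_mul]

end Convolution

section HopfBimodules
variable (k Γ Y : Type u) [Field k] [Ring Γ] [HopfAlgebra k Γ]
  [AddCommGroup Y] [Module k Y] [Module Γ Y] [Module Γᵐᵒᵖ Y] [IsBimod k Γ Y]

/-- A Hopf bimodule: a `Γ`-bimodule with a left coaction `y ↦ y₋₁ ⊗ y₀` that is a map of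
`Γ`-bimodules `Y → Γ ⊗ Y`. -/
class HopfBimod where
  coact : Y →ₗ[k] Γ ⊗[k] Y
  coassoc : ∀ y, TensorProduct.assoc k Γ Γ Y (LinearMap.rTensor Y comul (coact y))
    = LinearMap.lTensor Γ coact (coact y)
  counit_coact : ∀ y, TensorProduct.lid k Y (LinearMap.rTensor Y counit (coact y)) = y
  coact_smul : ∀ (γ : Γ) y, coact (γ • y) = diagOp (lact k Γ Γ) (lact k Γ Y) γ (coact y)
  coact_op_smul : ∀ (γ : Γ) y, coact (MulOpposite.op γ • y)
    = diagOp (ract k Γ Γ) (ract k Γ Y) γ (coact y)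

/-- A complex of Hopf bimodules `⋯ → Y₁ → Y₀ → 0` with an augmentation `Y₀ → Γ`. -/
structure AugHopfCx [HopfBimod k Γ Y] extends GrCx k Y where
  smul_mem : ∀ n (γ : Γ) y, y ∈ gr n → γ • y ∈ gr n
  op_smul_mem : ∀ n (γ : Γ) y, y ∈ gr n → MulOpposite.op γ • y ∈ gr n
  coact_mem : ∀ n, ∀ y ∈ gr n, HopfBimod.coact y
    ∈ LinearMap.range (LinearMap.lTensor Γ (gr n).subtype)
  d_smul : ∀ (γ : Γ) y, d (γ • y) = γ • d y
  d_op_smul : ∀ (γ : Γ) y, d (MulOpposite.op γ • y) = MulOpposite.op γ • d y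
  coact_d : ∀ y, HopfBimod.coact (Γ := Γ) (d y) = LinearMap.lTensor Γ d (HopfBimod.coact y)
  aug : Y →ₗ[k] Γ
  aug_smul : ∀ (γ : Γ) y, aug (γ • y) = γ * aug y
  aug_op_smul : ∀ (γ : Γ) y, aug (MulOpposite.op γ • y) = aug y * γ
  comul_aug : ∀ y, comul (aug y) = LinearMap.lTensor Γ aug (HopfBimod.coact y)
  aug_pos : ∀ n, ∀ y ∈ gr (n + 1), aug y = 0
  aug_d : ∀ y, aug (d y) = 0

end HopfBimodules

section Induced
variable (k Γ : Type u) [Field k] [Ring Γ] [HopfAlgebra k Γ]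

/-- The left action `δ · (γ ⊗ γ') = γ S(δ₁) ⊗ δ₂ γ'` on `Γ ⊗ Γ`. -/
def twL : Γ →ₗ[k] Module.End k (Γ ⊗[k] Γ) :=
  diagOp (ract k Γ Γ ∘ₗ HopfAlgebra.antipode k) (lact k Γ Γ)

/-- The left coaction `γ ⊗ γ' ↦ γ₁ γ'₁ ⊗ (γ₂ ⊗ γ'₂)` on `Γ ⊗ Γ`. -/
def coact₀ : Γ ⊗[k] Γ →ₗ[k] Γ ⊗[k] (Γ ⊗[k] Γ) :=
  LinearMap.rTensor (Γ ⊗[k] Γ) (LinearMap.mul' k Γ) ∘ₗ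
    (TensorProduct.tensorTensorTensorComm k Γ Γ Γ Γ).toLinearMap ∘ₗ
      TensorProduct.map comul comul

variable {k Γ}

lemma mul_twL (δ : Γ) (t : Γ ⊗[k] Γ) :
    LinearMap.mul' k Γ (twL k Γ δ t) = (counit δ : k) • LinearMap.mul' k Γ t := by
  induction t using TensorProduct.induction_on with
  | zero => simp
  | add x y hx hy => rw [map_add, map_add, hx, hy, map_add, smul_add]
  | tmul a b =>
    have h : ∀ s : Γ ⊗[k] Γ, LinearMap.mul' k Γ (TensorProduct.map₂
        (ract k Γ Γ ∘ₗ HopfAlgebra.antipode k) (lact k Γ Γ) s (a ⊗ₜ b))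
        = a * LinearMap.mul' k Γ (TensorProduct.map (HopfAlgebra.antipode k) LinearMap.id s) * b := by
      intro s
      induction s using TensorProduct.induction_on with
      | zero => simp
      | add x y hx hy => simp only [map_add, LinearMap.add_apply, hx, hy, mul_add, add_mul]
      | tmul c e => simp [mul_assoc]
    have h2 : LinearMap.mul' k Γ (TensorProduct.map (HopfAlgebra.antipode k) LinearMap.id (comul δ))
        = algebraMap k Γ (counit δ) :=
      congrArg (fun f : WithConv (Γ →ₗ[k] Γ) => f.ofConv δ) LinearMap.antipode_mul_id
    rw [twL, diagOp, LinearMap.comp_apply, h, h2, Algebra.algebraMap_eq_smul_one]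
    simp

lemma coact₀_tmul (a b : Γ) : coact₀ k Γ (a ⊗ₜ b) =
    Algebra.TensorProduct.map (AlgHom.id k Γ)
        (Algebra.TensorProduct.includeLeft : Γ →ₐ[k] Γ ⊗[k] Γ) (comul a) *
      Algebra.TensorProduct.map (AlgHom.id k Γ)
        (Algebra.TensorProduct.includeRight : Γ →ₐ[k] Γ ⊗[k] Γ) (comul b) := by
  simp only [coact₀, LinearMap.comp_apply, TensorProduct.map_tmul]
  generalize (comul a : Γ ⊗[k] Γ) = s
  generalize (comul b : Γ ⊗[k] Γ) = t
  induction s using TensorProduct.induction_on with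
  | zero => simp
  | add x y hx hy => simp only [TensorProduct.add_tmul, map_add, hx, hy, add_mul]
  | tmul a a' =>
    induction t using TensorProduct.induction_on with
    | zero => simp
    | add x y hx hy => simp only [TensorProduct.tmul_add, map_add, hx, hy, mul_add]
    | tmul b b' => simp

lemma coact₀_twL (δ : Γ) (t : Γ ⊗[k] Γ) :
    coact₀ k Γ (twL k Γ δ t) = LinearMap.lTensor Γ (twL k Γ δ) (coact₀ k Γ t) := by
  let i12 : Γ ⊗[k] Γ →ₐ[k] Γ ⊗[k] (Γ ⊗[k] Γ) := Algebra.TensorProduct.map (AlgHom.id k Γ)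
    (Algebra.TensorProduct.includeLeft : Γ →ₐ[k] Γ ⊗[k] Γ)
  let i13 : Γ ⊗[k] Γ →ₐ[k] Γ ⊗[k] (Γ ⊗[k] Γ) := Algebra.TensorProduct.map (AlgHom.id k Γ)
    (Algebra.TensorProduct.includeRight : Γ →ₐ[k] Γ ⊗[k] Γ)
  let e1 : Γ →ₐ[k] Γ ⊗[k] (Γ ⊗[k] Γ) := Algebra.TensorProduct.includeLeft
  let e2 : Γ →ₐ[k] Γ ⊗[k] (Γ ⊗[k] Γ) := Algebra.TensorProduct.includeRight.comp
    (Algebra.TensorProduct.includeLeft : Γ →ₐ[k] Γ ⊗[k] Γ)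
  let e3 : Γ →ₐ[k] Γ ⊗[k] (Γ ⊗[k] Γ) := Algebra.TensorProduct.includeRight.comp
    (Algebra.TensorProduct.includeRight : Γ →ₐ[k] Γ ⊗[k] Γ)
  let e12 := i12.comp (Bialgebra.comulAlgHom k Γ)
  let e13 := i13.comp (Bialgebra.comulAlgHom k Γ)
  have h12 : WithConv.toConv e1.toLinearMap * WithConv.toConv e2.toLinearMap
      = WithConv.toConv e12.toLinearMap := by
    apply WithConv.ext
    refine LinearMap.ext fun γ => ?_
    have : ∀ s : Γ ⊗[k] Γ, LinearMap.mul' k _ (TensorProduct.map e1.toLinearMap e2.toLinearMap s)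
        = i12 s := by
      intro s
      induction s using TensorProduct.induction_on with
      | zero => simp
      | add x y hx hy => simp only [map_add, hx, hy]
      | tmul a b => simp [e1, e2, i12]
    exact this _
  have h13 : WithConv.toConv e1.toLinearMap * WithConv.toConv e3.toLinearMap
      = WithConv.toConv e13.toLinearMap := by
    apply WithConv.ext
    refine LinearMap.ext fun γ => ?_
    have : ∀ s : Γ ⊗[k] Γ, LinearMap.mul' k _ (TensorProduct.map e1.toLinearMap e3.toLinearMap s)
        = i13 s := by
      intro s
      induction s using TensorProduct.induction_on with
      | zero => simp
      | add x y hx hy => simp only [map_add, hx, hy]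
      | tmul a b => simp [e1, e3, i13]
    exact this _
  have key : WithConv.toConv (e12.toLinearMap ∘ₗ HopfAlgebra.antipode k)
      * WithConv.toConv e13.toLinearMap
      = WithConv.toConv (e2.toLinearMap ∘ₗ HopfAlgebra.antipode k)
        * WithConv.toConv e3.toLinearMap := by
    rw [← h13, ← mul_assoc, conv_cancel e12 e1 e2 h12]
  have key' := congrArg (fun f : WithConv (Γ →ₗ[k] Γ ⊗[k] (Γ ⊗[k] Γ)) => f.ofConv δ) key
  change LinearMap.mul' k _ (TensorProduct.map _ _ (comul δ))
    = LinearMap.mul' k _ (TensorProduct.map _ _ (comul δ)) at key'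
  induction t using TensorProduct.induction_on with
  | zero => simp
  | add x y hx hy => simp only [map_add, hx, hy]
  | tmul a b =>
    have hL : ∀ s : Γ ⊗[k] Γ, coact₀ k Γ (TensorProduct.map₂
        (ract k Γ Γ ∘ₗ HopfAlgebra.antipode k) (lact k Γ Γ) s (a ⊗ₜ b))
        = i12 (comul a) * LinearMap.mul' k _ (TensorProduct.map
          (e12.toLinearMap ∘ₗ HopfAlgebra.antipode k) e13.toLinearMap s) * i13 (comul b) := by
      intro s
      induction s using TensorProduct.induction_on with
      | zero => simp
      | add x y hx hy => simp only [map_add, LinearMap.add_apply, hx, hy, mul_add, add_mul]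
      | tmul c e =>
        simp only [TensorProduct.map₂_apply_tmul, TensorProduct.map_tmul, coact₀_tmul,
          LinearMap.comp_apply, ract_apply, lact_apply, op_smul_eq_mul, smul_eq_mul,
          Bialgebra.comul_mul, map_mul, LinearMap.mul'_apply, mul_assoc]
        rfl
    have hR : ∀ s p q : Γ ⊗[k] Γ, LinearMap.lTensor Γ (TensorProduct.map₂
        (ract k Γ Γ ∘ₗ HopfAlgebra.antipode k) (lact k Γ Γ) s) (i12 p * i13 q)
        = i12 p * LinearMap.mul' k _ (TensorProduct.map
          (e2.toLinearMap ∘ₗ HopfAlgebra.antipode k) e3.toLinearMap s) * i13 q := by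
      intro s p q
      induction s using TensorProduct.induction_on with
      | zero => simp
      | add x y hx hy =>
        simp only [map_add, LinearMap.lTensor_add, LinearMap.add_apply, hx, hy, mul_add, add_mul]
      | tmul c e =>
        induction p using TensorProduct.induction_on with
        | zero => simp
        | add x y hx hy => simp only [map_add, hx, hy, add_mul]
        | tmul p p' =>
          induction q using TensorProduct.induction_on with
          | zero => simp
          | add x y hx hy => simp only [map_add, hx, hy, mul_add]
          | tmul q q' => simp [i12, i13, e2, e3]
    rw [coact₀_tmul]
    exact (hL _).trans ((congrArg (fun z => _ * z * _) key').trans (hR _ _ _).symm)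

lemma coact₀_eq : coact₀ k Γ = LinearMap.rTensor (Γ ⊗[k] Γ) (LinearMap.mul' k Γ) ∘ₗ comul := rfl

lemma comul_mul' : (comul : Γ →ₗ[k] Γ ⊗[k] Γ) ∘ₗ LinearMap.mul' k Γ
    = TensorProduct.map (LinearMap.mul' k Γ) (LinearMap.mul' k Γ) ∘ₗ comul := by
  refine TensorProduct.ext' fun a b => ?_
  simp only [LinearMap.comp_apply, LinearMap.mul'_apply, Bialgebra.comul_mul,
    TensorProduct.comul_tmul]
  generalize (comul a : Γ ⊗[k] Γ) = s
  generalize (comul b : Γ ⊗[k] Γ) = t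
  induction s using TensorProduct.induction_on with
  | zero => simp
  | add x y hx hy => simp only [TensorProduct.add_tmul, map_add, hx, hy, add_mul]
  | tmul a a' =>
    induction t using TensorProduct.induction_on with
    | zero => simp
    | add x y hx hy => simp only [TensorProduct.tmul_add, map_add, hx, hy, mul_add]
    | tmul b b' => simp

lemma coassoc_of_map {C D : Type u} [AddCommGroup C] [Module k C] [Coalgebra k C]
    [AddCommGroup D] [Module k D] [Coalgebra k D] (m : C →ₗ[k] D)
    (hm : (comul : D →ₗ[k] D ⊗[k] D) ∘ₗ m = TensorProduct.map m m ∘ₗ comul) (t : C) :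
    TensorProduct.assoc k D D C (LinearMap.rTensor C comul (LinearMap.rTensor C m (comul t)))
      = LinearMap.lTensor D (LinearMap.rTensor C m ∘ₗ comul) (LinearMap.rTensor C m (comul t)) := by
  rw [← LinearMap.comp_apply (LinearMap.rTensor C comul), ← LinearMap.rTensor_comp, hm]
  have h := Coalgebra.coassoc_apply (R := k) t
  generalize (comul t : C ⊗[k] C) = z at h ⊢
  have h1 : ∀ z : C ⊗[k] C, TensorProduct.assoc k D D C (LinearMap.rTensor C
      (TensorProduct.map m m ∘ₗ comul) z)
      = TensorProduct.map m (LinearMap.rTensor C m)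
        (TensorProduct.assoc k C C C (LinearMap.rTensor C comul z)) := by
    intro z
    induction z using TensorProduct.induction_on with
    | zero => simp
    | add x y hx hy => simp only [map_add, hx, hy]
    | tmul a b =>
      simp only [LinearMap.rTensor_tmul, LinearMap.comp_apply]
      generalize (comul a : C ⊗[k] C) = s
      induction s using TensorProduct.induction_on with
      | zero => simp
      | add x y hx hy => simp only [TensorProduct.add_tmul, map_add, hx, hy]
      | tmul c e => simp
  rw [h1, h]
  clear h
  induction z using TensorProduct.induction_on with
  | zero => simp
  | add x y hx hy => simp only [map_add, hx, hy]
  | tmul a b => simp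

lemma coact₀_coassoc (t : Γ ⊗[k] Γ) :
    TensorProduct.assoc k Γ Γ _ (LinearMap.rTensor _ comul (coact₀ k Γ t))
      = LinearMap.lTensor Γ (coact₀ k Γ) (coact₀ k Γ t) :=
  coassoc_of_map (LinearMap.mul' k Γ) comul_mul' t

lemma coact₀_counit (t : Γ ⊗[k] Γ) :
    TensorProduct.lid k _ (LinearMap.rTensor _ counit (coact₀ k Γ t)) = t := by
  have h : (counit : Γ →ₗ[k] k) ∘ₗ LinearMap.mul' k Γ = counit := by
    refine TensorProduct.ext' fun a b => ?_
    simp [mul_comm]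
  rw [coact₀_eq, LinearMap.comp_apply, ← LinearMap.comp_apply, ← LinearMap.rTensor_comp, h]
  simp

variable (k Γ) in
/-- The left action of `Γ` on the first factor of `Γ ⊗ Γ`. -/
def outL : Γ →ₗ[k] Module.End k (Γ ⊗[k] Γ) := LinearMap.rTensorHom Γ ∘ₗ lact k Γ Γ

variable (k Γ) in
/-- The right action of `Γ` on the second factor of `Γ ⊗ Γ`. -/
def outR : Γ →ₗ[k] Module.End k (Γ ⊗[k] Γ) := LinearMap.lTensorHom Γ ∘ₗ ract k Γ Γ

@[simp] lemma outL_tmul (γ a b : Γ) : outL k Γ γ (a ⊗ₜ b) = (γ * a) ⊗ₜ b := rfl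
@[simp] lemma outR_tmul (γ a b : Γ) : outR k Γ γ (a ⊗ₜ b) = a ⊗ₜ (b * γ) := rfl

lemma outL_twL (γ δ : Γ) (t : Γ ⊗[k] Γ) : outL k Γ γ (twL k Γ δ t) = twL k Γ δ (outL k Γ γ t) :=
  diagOp_nat (f := lact k Γ Γ γ) (g := LinearMap.id) (fun δ x => by simp [mul_assoc])
    (fun _ _ => rfl) δ t

lemma outR_twL (γ δ : Γ) (t : Γ ⊗[k] Γ) : outR k Γ γ (twL k Γ δ t) = twL k Γ δ (outR k Γ γ t) :=
  diagOp_nat (f := LinearMap.id) (g := ract k Γ Γ γ) (fun _ _ => rfl)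
    (fun δ x => by simp [mul_assoc]) δ t

lemma coact₀_outL (γ : Γ) (t : Γ ⊗[k] Γ) :
    coact₀ k Γ (outL k Γ γ t) = diagOp (lact k Γ Γ) (outL k Γ) γ (coact₀ k Γ t) := by
  induction t using TensorProduct.induction_on with
  | zero => simp
  | add x y hx hy => simp only [map_add, hx, hy]
  | tmul a b =>
    rw [outL_tmul, coact₀_tmul, coact₀_tmul, Bialgebra.comul_mul, map_mul, mul_assoc, diagOp,
      LinearMap.comp_apply]
    have key : ∀ (s : Γ ⊗[k] Γ) (z : Γ ⊗[k] (Γ ⊗[k] Γ)),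
        Algebra.TensorProduct.map (AlgHom.id k Γ)
        (Algebra.TensorProduct.includeLeft : Γ →ₐ[k] Γ ⊗[k] Γ) s * z
        = TensorProduct.map₂ (lact k Γ Γ) (outL k Γ) s z := by
      intro s z
      induction s using TensorProduct.induction_on with
      | zero => simp
      | add x y hx hy => simp only [map_add, LinearMap.add_apply, hx, hy, add_mul]
      | tmul a b =>
        induction z using TensorProduct.induction_on with
        | zero => simp
        | add x y hx hy => simp only [map_add, hx, hy, mul_add]
        | tmul x z =>
          induction z using TensorProduct.induction_on with
          | zero => simp
          | add x y hx hy => simp only [TensorProduct.tmul_add, map_add, hx, hy, mul_add]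
          | tmul y z => simp
    exact key _ _

lemma coact₀_outR (γ : Γ) (t : Γ ⊗[k] Γ) :
    coact₀ k Γ (outR k Γ γ t) = diagOp (ract k Γ Γ) (outR k Γ) γ (coact₀ k Γ t) := by
  induction t using TensorProduct.induction_on with
  | zero => simp
  | add x y hx hy => simp only [map_add, hx, hy]
  | tmul a b =>
    rw [outR_tmul, coact₀_tmul, coact₀_tmul, Bialgebra.comul_mul, map_mul, ← mul_assoc, diagOp,
      LinearMap.comp_apply]
    have key : ∀ (s : Γ ⊗[k] Γ) (z : Γ ⊗[k] (Γ ⊗[k] Γ)),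
        z * Algebra.TensorProduct.map (AlgHom.id k Γ)
        (Algebra.TensorProduct.includeRight : Γ →ₐ[k] Γ ⊗[k] Γ) s
        = TensorProduct.map₂ (ract k Γ Γ) (outR k Γ) s z := by
      intro s z
      induction s using TensorProduct.induction_on with
      | zero => simp
      | add x y hx hy => simp only [map_add, LinearMap.add_apply, hx, hy, mul_add]
      | tmul a b =>
        induction z using TensorProduct.induction_on with
        | zero => simp
        | add x y hx hy => simp only [map_add, hx, hy, add_mul]
        | tmul x z =>
          induction z using TensorProduct.induction_on with
          | zero => simp
          | add x y hx hy => simp only [TensorProduct.tmul_add, map_add, hx, hy, add_mul]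
          | tmul y z => simp
    exact key _ _

end Induced

section InducedComplex
variable (k Γ L : Type u) [Field k] [Ring Γ] [HopfAlgebra k Γ]
  [AddCommGroup L] [Module k L] [Module Γᵐᵒᵖ L] [IsScalarTower k Γᵐᵒᵖ L]

/-- The induced bimodule `L ⊗_Γ (Γ ⊗ Γ)`. -/
def Ind : Type u := BTen (ract k Γ L) (twL k Γ)

namespace Ind

instance : AddCommGroup (Ind k Γ L) := inferInstanceAs (AddCommGroup (BTen (ract k Γ L) (twL k Γ)))
instance : Module k (Ind k Γ L) := inferInstanceAs (Module k (BTen (ract k Γ L) (twL k Γ)))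

variable {k Γ L}

/-- The element `l ⊗ t` of `L ⊗_Γ (Γ ⊗ Γ)`. -/
def mk (l : L) : Γ ⊗[k] Γ →ₗ[k] Ind k Γ L :=
  BTen.mk (ract k Γ L) (twL k Γ) ∘ₗ TensorProduct.mk k L (Γ ⊗[k] Γ) l

lemma mk_op (γ : Γ) (l : L) (t : Γ ⊗[k] Γ) :
    mk (MulOpposite.op γ • l) t = mk l (twL k Γ γ t) := BTen.mk_bal γ l t

lemma hom_ext {M : Type u} [AddCommGroup M] [Module k M] {f g : Ind k Γ L →ₗ[k] M}
    (h : ∀ l t, f (mk l t) = g (mk l t)) : f = g := BTen.hom_ext h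

/-- The universal property of `L ⊗_Γ (Γ ⊗ Γ)`. -/
def lift {M : Type u} [AddCommGroup M] [Module k M] (f : L →ₗ[k] Γ ⊗[k] Γ →ₗ[k] M)
    (hf : ∀ (γ : Γ) l t, f (MulOpposite.op γ • l) t = f l (twL k Γ γ t)) : Ind k Γ L →ₗ[k] M :=
  BTen.lift (TensorProduct.lift f) fun γ l t => by simpa using hf γ l t

@[simp] lemma lift_mk {M : Type u} [AddCommGroup M] [Module k M] (f : L →ₗ[k] Γ ⊗[k] Γ →ₗ[k] M)
    (hf : ∀ (γ : Γ) l t, f (MulOpposite.op γ • l) t = f l (twL k Γ γ t)) (l : L) (t : Γ ⊗[k] Γ) :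
    lift f hf (mk l t) = f l t := rfl

/-- `l ⊗ t ↦ l` in the first variable: the map `L → Hom(Γ ⊗ Γ, L ⊗_Γ (Γ ⊗ Γ))`. -/
def mkₗ : L →ₗ[k] Γ ⊗[k] Γ →ₗ[k] Ind k Γ L :=
  TensorProduct.curry (BTen.mk (ract k Γ L) (twL k Γ))

@[simp] lemma mkₗ_apply (l : L) (t : Γ ⊗[k] Γ) : mkₗ l t = mk l t := rfl

/-- An operator on `Γ ⊗ Γ` that commutes with the twisted action acts on `L ⊗_Γ (Γ ⊗ Γ)`. -/
def opMap (T : Module.End k (Γ ⊗[k] Γ)) (hT : ∀ δ t, T (twL k Γ δ t) = twL k Γ δ (T t)) :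
    Module.End k (Ind k Γ L) :=
  lift (LinearMap.lcomp k _ T ∘ₗ mkₗ) fun γ l t => by
    simp [mk_op, hT]

@[simp] lemma opMap_mk (T : Module.End k (Γ ⊗[k] Γ)) (hT : ∀ δ t, T (twL k Γ δ t) = twL k Γ δ (T t))
    (l : L) (t : Γ ⊗[k] Γ) : opMap T hT (mk l t) = mk l (T t) := rfl

instance : Module Γ (Ind k Γ L) where
  smul γ y := opMap (outL k Γ γ) (outL_twL γ) y
  one_smul y := by
    refine LinearMap.congr_fun (f := opMap (outL k Γ 1) (outL_twL 1)) (g := LinearMap.id)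
      (hom_ext fun l t => ?_) y
    simp [outL, lact_one]
  mul_smul γ δ y := by
    refine LinearMap.congr_fun (f := opMap (outL k Γ (γ * δ)) (outL_twL _))
      (g := opMap (outL k Γ γ) (outL_twL _) ∘ₗ opMap (outL k Γ δ) (outL_twL _))
      (hom_ext fun l t => ?_) y
    simp [outL, lact_mul, LinearMap.rTensor_comp]
  smul_zero γ := map_zero _
  smul_add γ := map_add _
  add_smul γ δ y := by
    refine LinearMap.congr_fun (f := opMap (outL k Γ (γ + δ)) (outL_twL _))
      (g := opMap (outL k Γ γ) (outL_twL _) + opMap (outL k Γ δ) (outL_twL _))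
      (hom_ext fun l t => ?_) y
    simp
  zero_smul y := by
    refine LinearMap.congr_fun (f := opMap (outL k Γ 0) (outL_twL _)) (g := 0)
      (hom_ext fun l t => ?_) y
    simp

instance : Module Γᵐᵒᵖ (Ind k Γ L) where
  smul γ y := opMap (outR k Γ γ.unop) (outR_twL γ.unop) y
  one_smul y := by
    refine LinearMap.congr_fun (f := opMap (outR k Γ 1) (outR_twL 1)) (g := LinearMap.id)
      (hom_ext fun l t => ?_) y
    simp [outR, ract_one]
  mul_smul γ δ y := by
    refine LinearMap.congr_fun (f := opMap (outR k Γ (δ.unop * γ.unop)) (outR_twL _))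
      (g := opMap (outR k Γ γ.unop) (outR_twL _) ∘ₗ opMap (outR k Γ δ.unop) (outR_twL _))
      (hom_ext fun l t => ?_) y
    simp [outR, ract_mul, LinearMap.lTensor_comp]
  smul_zero γ := map_zero _
  smul_add γ := map_add _
  add_smul γ δ y := by
    refine LinearMap.congr_fun (f := opMap (outR k Γ (γ.unop + δ.unop)) (outR_twL _))
      (g := opMap (outR k Γ γ.unop) (outR_twL _) + opMap (outR k Γ δ.unop) (outR_twL _))
      (hom_ext fun l t => ?_) y
    simp
  zero_smul y := by
    refine LinearMap.congr_fun (f := opMap (outR k Γ 0) (outR_twL _)) (g := 0)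
      (hom_ext fun l t => ?_) y
    simp

@[simp] lemma smul_mk (γ : Γ) (l : L) (t : Γ ⊗[k] Γ) : γ • mk l t = mk l (outL k Γ γ t) := rfl
@[simp] lemma op_smul_mk (γ : Γ) (l : L) (t : Γ ⊗[k] Γ) :
    MulOpposite.op γ • mk l t = mk l (outR k Γ γ t) := rfl

instance : IsBimod k Γ (Ind k Γ L) where
  tower_left := ⟨fun c γ y => by
    refine LinearMap.congr_fun (f := opMap (outL k Γ (c • γ)) (outL_twL _))
      (g := c • opMap (outL k Γ γ) (outL_twL _)) (hom_ext fun l t => ?_) y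
    simp⟩
  tower_right := ⟨fun c γ y => by
    refine LinearMap.congr_fun (f := opMap (outR k Γ (c • γ.unop)) (outR_twL _))
      (g := c • opMap (outR k Γ γ.unop) (outR_twL _)) (hom_ext fun l t => ?_) y
    simp⟩
  comm := ⟨fun γ δ y => by
    refine LinearMap.congr_fun
      (f := opMap (outL k Γ γ) (outL_twL _) ∘ₗ opMap (outR k Γ δ.unop) (outR_twL _))
      (g := opMap (outR k Γ δ.unop) (outR_twL _) ∘ₗ opMap (outL k Γ γ) (outL_twL _))
      (hom_ext fun l t => ?_) y
    simp only [LinearMap.comp_apply, opMap_mk]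
    congr 1
    induction t using TensorProduct.induction_on with
    | zero => simp
    | add x y hx hy => simp only [map_add, hx, hy]
    | tmul a b => rfl⟩

lemma lTensor_mk_op (γ : Γ) (l : L) (z : Γ ⊗[k] (Γ ⊗[k] Γ)) :
    LinearMap.lTensor Γ (mk (MulOpposite.op γ • l)) z
      = LinearMap.lTensor Γ (mk l) (LinearMap.lTensor Γ (twL k Γ γ) z) := by
  rw [← LinearMap.comp_apply, ← LinearMap.lTensor_comp]
  congr 2
  exact LinearMap.ext fun t => mk_op γ l t

/-- The coaction `l ⊗ (γ ⊗ γ') ↦ γ₁ γ'₁ ⊗ (l ⊗ (γ₂ ⊗ γ'₂))`. -/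
def coact : Ind k Γ L →ₗ[k] Γ ⊗[k] Ind k Γ L :=
  lift (LinearMap.lcomp k _ (coact₀ k Γ) ∘ₗ LinearMap.lTensorHom Γ ∘ₗ mkₗ) fun γ l t => by
    simp only [LinearMap.comp_apply, LinearMap.lcomp_apply, LinearMap.coe_lTensorHom, coact₀_twL]
    exact lTensor_mk_op γ l _

@[simp] lemma coact_mk (l : L) (t : Γ ⊗[k] Γ) :
    coact (mk l t) = LinearMap.lTensor Γ (mk l) (coact₀ k Γ t) := rfl

instance : HopfBimod k Γ (Ind k Γ L) where
  coact := coact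
  coassoc y := by
    refine LinearMap.congr_fun (f := (TensorProduct.assoc k Γ Γ (Ind k Γ L)).toLinearMap ∘ₗ
      LinearMap.rTensor _ comul ∘ₗ coact) (g := LinearMap.lTensor Γ coact ∘ₗ coact)
      (hom_ext fun l t => ?_) y
    simp only [LinearMap.comp_apply, coact_mk]
    have h1 : ∀ z : Γ ⊗[k] (Γ ⊗[k] Γ), TensorProduct.assoc k Γ Γ (Ind k Γ L)
        (LinearMap.rTensor _ comul (LinearMap.lTensor Γ (mk l) z))
        = LinearMap.lTensor Γ (LinearMap.lTensor Γ (mk l))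
          (TensorProduct.assoc k Γ Γ _ (LinearMap.rTensor _ comul z)) := by
      intro z
      induction z using TensorProduct.induction_on with
      | zero => simp
      | add x y hx hy => simp only [map_add, hx, hy]
      | tmul a t =>
        simp only [LinearMap.lTensor_tmul, LinearMap.rTensor_tmul]
        generalize (comul a : Γ ⊗[k] Γ) = s
        induction s using TensorProduct.induction_on with
        | zero => simp
        | add x y hx hy => simp only [TensorProduct.add_tmul, map_add, hx, hy]
        | tmul c e => simp
    rw [LinearEquiv.coe_coe, h1, coact₀_coassoc, ← LinearMap.comp_apply (LinearMap.lTensor Γ _),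
      ← LinearMap.comp_apply (LinearMap.lTensor Γ _), ← LinearMap.lTensor_comp,
      ← LinearMap.lTensor_comp]
    rfl
  counit_coact y := by
    refine LinearMap.congr_fun (f := (TensorProduct.lid k (Ind k Γ L)).toLinearMap ∘ₗ
      LinearMap.rTensor _ counit ∘ₗ coact) (g := LinearMap.id) (hom_ext fun l t => ?_) y
    simp only [LinearMap.comp_apply, coact_mk, LinearMap.id_apply]
    have h1 : ∀ z : Γ ⊗[k] (Γ ⊗[k] Γ), TensorProduct.lid k (Ind k Γ L)
        (LinearMap.rTensor _ counit (LinearMap.lTensor Γ (mk l) z))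
        = mk l (TensorProduct.lid k _ (LinearMap.rTensor _ counit z)) := by
      intro z
      induction z using TensorProduct.induction_on with
      | zero => simp
      | add x y hx hy => simp only [map_add, hx, hy]
      | tmul a t => simp
    rw [LinearEquiv.coe_coe, h1, coact₀_counit]
  coact_smul γ y := by
    have h : coact ∘ₗ lact k Γ (Ind k Γ L) γ
        = diagOp (lact k Γ Γ) (lact k Γ (Ind k Γ L)) γ ∘ₗ coact := by
      refine hom_ext fun l t => ?_
      simp only [LinearMap.comp_apply, coact_mk, lact_apply, smul_mk, coact₀_outL]
      exact diagOp_nat (u := lact k Γ Γ) (v := outL k Γ) (u' := lact k Γ Γ)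
        (v' := lact k Γ (Ind k Γ L)) (f := LinearMap.id) (g := mk l) (fun _ _ => rfl)
        (fun _ _ => rfl) γ _
    exact LinearMap.congr_fun h y
  coact_op_smul γ y := by
    have h : coact ∘ₗ ract k Γ (Ind k Γ L) γ
        = diagOp (ract k Γ Γ) (ract k Γ (Ind k Γ L)) γ ∘ₗ coact := by
      refine hom_ext fun l t => ?_
      simp only [LinearMap.comp_apply, coact_mk, ract_apply, op_smul_mk, coact₀_outR]
      exact diagOp_nat (u := ract k Γ Γ) (v := outR k Γ) (u' := ract k Γ Γ)
        (v' := ract k Γ (Ind k Γ L)) (f := LinearMap.id) (g := mk l) (fun _ _ => rfl)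
        (fun _ _ => rfl) γ _
    exact LinearMap.congr_fun h y

end Ind
end InducedComplex

section InducedComplex
variable {k Γ L : Type u} [Field k] [Ring Γ] [HopfAlgebra k Γ]
  [AddCommGroup L] [Module k L] [Module Γᵐᵒᵖ L] [IsScalarTower k Γᵐᵒᵖ L]

namespace Ind

/-- A `Γ`-linear operator on `L` acts on `L ⊗_Γ (Γ ⊗ Γ)`. -/
def mapL (T : Module.End k L) (hT : ∀ (γ : Γ) l, T (MulOpposite.op γ • l)
    = MulOpposite.op γ • T l) : Module.End k (Ind k Γ L) :=
  lift (mkₗ ∘ₗ T) fun γ l t => by simp [hT, mk_op]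

@[simp] lemma mapL_mk (T : Module.End k L) (hT : ∀ (γ : Γ) l, T (MulOpposite.op γ • l)
    = MulOpposite.op γ • T l) (l : L) (t : Γ ⊗[k] Γ) : mapL T hT (mk l t) = mk (T l) t := rfl

variable (C : AugRightCx k Γ L)

/-- The homogeneous components of `L ⊗_Γ (Γ ⊗ Γ)`. -/
def gr (n : ℕ) : Submodule k (Ind k Γ L) :=
  Submodule.span k {y | ∃ l ∈ C.gr n, ∃ t, y = mk l t}

lemma mk_mem {n : ℕ} {l : L} (hl : l ∈ C.gr n) (t : Γ ⊗[k] Γ) : mk l t ∈ gr C n :=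
  Submodule.subset_span ⟨l, hl, t, rfl⟩

lemma gr_induction {n : ℕ} {M : Type u} [AddCommGroup M] [Module k M] {f g : Ind k Γ L →ₗ[k] M}
    (h : ∀ l ∈ C.gr n, ∀ t, f (mk l t) = g (mk l t)) {y : Ind k Γ L} (hy : y ∈ gr C n) :
    f y = g y := by
  refine LinearMap.eqOn_span (s := {y | ∃ l ∈ C.gr n, ∃ t, y = mk l t}) ?_ hy
  rintro _ ⟨l, hl, t, rfl⟩
  exact h l hl t

lemma gr_le {n : ℕ} {S : Submodule k (Ind k Γ L)} (h : ∀ l ∈ C.gr n, ∀ t, mk l t ∈ S) :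
    gr C n ≤ S := by
  refine Submodule.span_le.2 ?_
  rintro _ ⟨l, hl, t, rfl⟩
  exact h l hl t

lemma gr_isInternal : DirectSum.IsInternal (gr C) := by
  have hp : ∀ n (γ : Γ) l, C.proj n (MulOpposite.op γ • l) = MulOpposite.op γ • C.proj n l :=
    fun n γ l => CL_scale_op C _ γ l
  refine isInternal_of_proj (fun n => mapL (C.proj n) (hp n)) ?_ ?_ ?_
  · intro n y hy
    exact gr_induction C (g := LinearMap.id) (fun l hl t => by simp [C.proj_mem hl]) hy
  · intro m n hmn y hy
    exact gr_induction C (g := 0) (fun l hl t => by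
      rw [mapL_mk, C.proj_mem_ne hmn hl, ← mkₗ_apply, map_zero]; rfl) hy
  · rw [eq_top_iff]
    intro y hy
    clear hy
    obtain ⟨s, rfl⟩ := BTen.mk_surj (u := ract k Γ L) (v := twL k Γ) y
    induction s using TensorProduct.induction_on with
    | zero => rw [map_zero]; exact zero_mem _
    | add x z hx hz => rw [map_add]; exact add_mem hx hz
    | tmul l t =>
      have hl : l ∈ ⨆ n, C.gr n := by rw [C.isInternal.submodule_iSup_eq_top]; trivial
      change mkₗ l t ∈ _
      induction hl using Submodule.iSup_induction' with
      | mem i l hl => exact Submodule.mem_iSup_of_mem i (mk_mem C hl t)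
      | zero => rw [map_zero]; exact zero_mem _
      | add x z _ _ hx hz => rw [map_add]; exact add_mem hx hz

/-- The differential of `L ⊗_Γ (Γ ⊗ Γ)`. -/
def dInd : Module.End k (Ind k Γ L) := mapL C.d C.d_op_smul

/-- The augmentation `l ⊗ (γ ⊗ γ') ↦ ξ(l) γ γ'`. -/
def augInd : Ind k Γ L →ₗ[k] Γ :=
  lift (LinearMap.toSpanSingleton k (Γ ⊗[k] Γ →ₗ[k] Γ) (LinearMap.mul' k Γ) ∘ₗ C.aug)
    fun γ l t => by
      simp [C.aug_op_smul, mul_twL, smul_smul, mul_comm]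

@[simp] lemma augInd_mk (l : L) (t : Γ ⊗[k] Γ) :
    augInd C (mk l t) = C.aug l • LinearMap.mul' k Γ t := rfl

lemma mul'_outL (γ : Γ) (t : Γ ⊗[k] Γ) :
    LinearMap.mul' k Γ (outL k Γ γ t) = γ * LinearMap.mul' k Γ t := by
  refine LinearMap.congr_fun (f := LinearMap.mul' k Γ ∘ₗ outL k Γ γ)
    (g := LinearMap.mulLeft k γ ∘ₗ LinearMap.mul' k Γ) (TensorProduct.ext' fun a b => ?_) t
  simp [mul_assoc]

lemma mul'_outR (γ : Γ) (t : Γ ⊗[k] Γ) :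
    LinearMap.mul' k Γ (outR k Γ γ t) = LinearMap.mul' k Γ t * γ := by
  refine LinearMap.congr_fun (f := LinearMap.mul' k Γ ∘ₗ outR k Γ γ)
    (g := LinearMap.mulRight k γ ∘ₗ LinearMap.mul' k Γ) (TensorProduct.ext' fun a b => ?_) t
  simp [mul_assoc]

/-- The complex of Hopf bimodules `L ⊗_Γ (Γ ⊗ Γ)`, for a complex `L` of right `Γ`-modules. -/
def cx : AugHopfCx k Γ (Ind k Γ L) where
  gr := gr C
  isInternal := gr_isInternal C
  d := dInd C
  d_mem n := gr_le (S := (gr C n).comap (dInd C)) C fun l hl t => mk_mem C (C.d_mem n l hl) t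
  d_gr_zero y hy := gr_induction C (f := dInd C) (g := 0) (fun l hl t => by
    rw [dInd, mapL_mk, C.d_gr_zero l hl, ← mkₗ_apply, map_zero]; rfl) hy
  d_d y := LinearMap.congr_fun (f := dInd C ∘ₗ dInd C) (g := 0) (hom_ext fun l t => by
    rw [dInd, LinearMap.comp_apply, mapL_mk, mapL_mk, C.d_d, ← mkₗ_apply, map_zero]; rfl) y
  smul_mem n γ := gr_le (S := (gr C n).comap (lact k Γ _ γ)) C fun l hl t => mk_mem C hl _
  op_smul_mem n γ := gr_le (S := (gr C n).comap (ract k Γ _ γ)) C fun l hl t => mk_mem C hl _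
  coact_mem n := gr_le (S := (LinearMap.range (LinearMap.lTensor Γ (gr C n).subtype)).comap coact) C
    fun l hl t => by
      refine ⟨LinearMap.lTensor Γ ((mk l).codRestrict (gr C n) fun t => mk_mem C hl t)
        (coact₀ k Γ t), ?_⟩
      rw [← LinearMap.comp_apply, ← LinearMap.lTensor_comp]
      rfl
  d_smul γ y := LinearMap.congr_fun (f := dInd C ∘ₗ lact k Γ _ γ) (g := lact k Γ _ γ ∘ₗ dInd C)
    (hom_ext fun l t => rfl) y
  d_op_smul γ y := LinearMap.congr_fun (f := dInd C ∘ₗ ract k Γ _ γ) (g := ract k Γ _ γ ∘ₗ dInd C)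
    (hom_ext fun l t => rfl) y
  coact_d y := by
    have h : coact ∘ₗ dInd C = LinearMap.lTensor Γ (dInd C) ∘ₗ coact := by
      refine hom_ext fun l t => ?_
      rw [LinearMap.comp_apply, LinearMap.comp_apply, dInd, mapL_mk, coact_mk, coact_mk]
      exact LinearMap.congr_fun (LinearMap.lTensor_comp Γ (dInd C) (mk l)) (coact₀ k Γ t)
    exact LinearMap.congr_fun h y
  aug := augInd C
  aug_smul γ y := by
    have h : augInd C ∘ₗ lact k Γ _ γ = LinearMap.mulLeft k γ ∘ₗ augInd C :=
      hom_ext fun l t => by simp [mul'_outL]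
    exact LinearMap.congr_fun h y
  aug_op_smul γ y := by
    have h : augInd C ∘ₗ ract k Γ _ γ = LinearMap.mulRight k γ ∘ₗ augInd C :=
      hom_ext fun l t => by simp [mul'_outR]
    exact LinearMap.congr_fun h y
  comul_aug y := by
    have h : comul ∘ₗ augInd C = LinearMap.lTensor Γ (augInd C) ∘ₗ coact := by
      refine hom_ext fun l t => ?_
      have h1 : augInd C ∘ₗ mk l = C.aug l • LinearMap.mul' k Γ := LinearMap.ext fun t => rfl
      rw [LinearMap.comp_apply, LinearMap.comp_apply, coact_mk, augInd_mk,
        ← LinearMap.comp_apply (LinearMap.lTensor Γ _), ← LinearMap.lTensor_comp, h1, map_smul,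
        LinearMap.lTensor_smul, LinearMap.smul_apply, ← LinearMap.comp_apply, comul_mul', coact₀_eq,
        LinearMap.comp_apply, LinearMap.comp_apply, ← LinearMap.comp_apply (LinearMap.lTensor Γ _),
        LinearMap.lTensor_comp_rTensor]
    exact LinearMap.congr_fun h y
  aug_pos n y hy := gr_induction C (f := augInd C) (g := 0) (fun l hl t => by
    rw [augInd_mk, C.aug_pos n l hl, zero_smul]; rfl) hy
  aug_d y := LinearMap.congr_fun (f := augInd C ∘ₗ dInd C) (g := 0) (hom_ext fun l t => by
    rw [LinearMap.comp_apply, dInd, mapL_mk, augInd_mk, C.aug_d, zero_smul]; rfl) y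

end Ind
end InducedComplex

section SmashOperators
variable {k A Γ K Y : Type u} [Field k] [Ring A] [Algebra k A] [Ring Γ] [HopfAlgebra k Γ]
  [AddCommGroup K] [Module k K] [Module A K] [Module Aᵐᵒᵖ K] [IsBimod k A K]
  [AddCommGroup Y] [Module k Y] [Module Γ Y] [Module Γᵐᵒᵖ Y] [IsBimod k Γ Y]

namespace SmashOp

variable (k K Y) in
/-- The operator `x ⊗ y ↦ a x ⊗ y`. -/
def lA : A →ₗ[k] Module.End k (K ⊗[k] Y) := LinearMap.rTensorHom Y ∘ₗ lact k A K

variable (k K Y) in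
/-- The operator `x ⊗ y ↦ x ⊗ y γ`. -/
def rΓ : Γ →ₗ[k] Module.End k (K ⊗[k] Y) := LinearMap.lTensorHom K ∘ₗ ract k Γ Y

@[simp] lemma lA_tmul (a : A) (x : K) (y : Y) : lA k K Y a (x ⊗ₜ y) = (a • x) ⊗ₜ y := rfl
@[simp] lemma rΓ_tmul (γ : Γ) (x : K) (y : Y) :
    rΓ k K Y γ (x ⊗ₜ y) = x ⊗ₜ (MulOpposite.op γ • y) := rfl

lemma lA_rΓ (a : A) (γ : Γ) (z : K ⊗[k] Y) :
    lA k K Y a (rΓ k K Y γ z) = rΓ k K Y γ (lA k K Y a z) := by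
  induction z using TensorProduct.induction_on with
  | zero => simp
  | add x y hx hy => simp only [map_add, hx, hy]
  | tmul x y => rfl

section
variable [HopfBimod k Γ Y]

/-- The operator `x ⊗ y ↦ T(y₋₁) x ⊗ y₀`. -/
def coOp (T : Γ →ₗ[k] Module.End k K) : Module.End k (K ⊗[k] Y) :=
  TensorProduct.lift (LinearMap.lcomp k _ HopfBimod.coact ∘ₗ LinearMap.rTensorHom Y ∘ₗ T.flip)

lemma coOp_tmul (T : Γ →ₗ[k] Module.End k K) (x : K) (y : Y) :
    coOp T (x ⊗ₜ y) = LinearMap.rTensor Y (T.flip x) (HopfBimod.coact y) := rfl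

lemma coOp_coOp (T U : Γ →ₗ[k] Module.End k K) (z : K ⊗[k] Y) :
    coOp T (coOp U z) = coOp (TensorProduct.lift
      (((LinearMap.mul k (Module.End k K)).flip).compl₁₂ U T) ∘ₗ comul) z := by
  set W : Γ ⊗[k] Γ →ₗ[k] Module.End k K :=
    TensorProduct.lift (((LinearMap.mul k (Module.End k K)).flip).compl₁₂ U T) with hW
  induction z using TensorProduct.induction_on with
  | zero => simp
  | add x y hx hy => simp only [map_add, hx, hy]
  | tmul x y =>
    have h1 : ∀ c : Γ ⊗[k] Y, coOp T (LinearMap.rTensor Y (U.flip x) c)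
        = LinearMap.rTensor Y (W.flip x)
          ((TensorProduct.assoc k Γ Γ Y).symm (LinearMap.lTensor Γ HopfBimod.coact c)) := by
      intro c
      induction c using TensorProduct.induction_on with
      | zero => simp
      | add x y hx hy => simp only [map_add, hx, hy]
      | tmul γ y =>
        rw [LinearMap.rTensor_tmul, coOp_tmul, LinearMap.lTensor_tmul]
        generalize (HopfBimod.coact y : Γ ⊗[k] Y) = c
        induction c using TensorProduct.induction_on with
        | zero => simp
        | add x y hx hy => simp only [map_add, hx, hy, TensorProduct.tmul_add]
        | tmul δ y => simp [hW]
    rw [coOp_tmul, h1, ← HopfBimod.coassoc, LinearEquiv.symm_apply_apply, coOp_tmul,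
      ← LinearMap.comp_apply, ← LinearMap.rTensor_comp]
    rfl

lemma coOp_id (T : Γ →ₗ[k] Module.End k K) (hT : ∀ γ x, T γ x = (counit γ : k) • x)
    (z : K ⊗[k] Y) : coOp T z = z := by
  induction z using TensorProduct.induction_on with
  | zero => simp
  | add x y hx hy => simp only [map_add, hx, hy]
  | tmul x y =>
    rw [coOp_tmul]
    have h : ∀ c : Γ ⊗[k] Y, LinearMap.rTensor Y (T.flip x) c
        = x ⊗ₜ TensorProduct.lid k Y (LinearMap.rTensor Y counit c) := by
      intro c
      induction c using TensorProduct.induction_on with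
      | zero => simp
      | add x y hx hy => simp only [map_add, hx, hy, TensorProduct.tmul_add]
      | tmul γ y => simp [hT, TensorProduct.smul_tmul]
    rw [h, HopfBimod.counit_coact]

lemma coOp_map (T : Γ →ₗ[k] Module.End k K) {f : K →ₗ[k] K} {g : Y →ₗ[k] Y}
    (hf : ∀ γ x, f (T γ x) = T γ (f x))
    (hg : ∀ y, HopfBimod.coact (Γ := Γ) (g y) = LinearMap.lTensor Γ g (HopfBimod.coact y))
    (z : K ⊗[k] Y) : TensorProduct.map f g (coOp T z) = coOp T (TensorProduct.map f g z) := by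
  induction z using TensorProduct.induction_on with
  | zero => simp
  | add x y hx hy => simp only [map_add, hx, hy]
  | tmul x y =>
    rw [coOp_tmul, TensorProduct.map_tmul, coOp_tmul, hg]
    generalize (HopfBimod.coact y : Γ ⊗[k] Y) = c
    induction c using TensorProduct.induction_on with
    | zero => simp
    | add x y hx hy => simp only [map_add, hx, hy]
    | tmul γ y => simp [hf]

lemma coOp_add (T U : Γ →ₗ[k] Module.End k K) :
    (coOp (T + U) : Module.End k (K ⊗[k] Y)) = coOp T + coOp U := by
  refine TensorProduct.ext' fun x y => ?_
  rw [coOp_tmul, LinearMap.add_apply, coOp_tmul, coOp_tmul, ← LinearMap.add_apply,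
    ← LinearMap.rTensor_add]
  rfl

lemma coOp_smul (c : k) (T : Γ →ₗ[k] Module.End k K) :
    (coOp (c • T) : Module.End k (K ⊗[k] Y)) = c • coOp T := by
  refine TensorProduct.ext' fun x y => ?_
  rw [coOp_tmul, LinearMap.smul_apply, coOp_tmul, ← LinearMap.smul_apply,
    ← LinearMap.rTensor_smul]
  rfl

variable [Module Γ A] [IsScalarTower k Γ A]

/-- The map `γ ↦ (x ↦ x (γ a))`. -/
def tA : A →ₗ[k] Γ →ₗ[k] Module.End k K :=
  LinearMap.llcomp k Γ A (Module.End k K) (ract k A K) ∘ₗ (lact k Γ A).flip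

@[simp] lemma tA_apply (a : A) (γ : Γ) (x : K) :
    tA (k := k) a γ x = MulOpposite.op (γ • a) • x := rfl

variable (k Γ K Y) in
/-- The operator `x ⊗ y ↦ x (y₋₁ a) ⊗ y₀`. -/
def rA : A →ₗ[k] Module.End k (K ⊗[k] Y) where
  toFun a := coOp (tA (Γ := Γ) a)
  map_add' a b := by rw [map_add, coOp_add]
  map_smul' c a := by rw [map_smul, coOp_smul]; rfl

lemma rA_apply (a : A) : rA k Γ K Y a = coOp (tA (k := k) (Γ := Γ) a) := rfl

lemma rA_tmul (a : A) (x : K) (y : Y) : rA k Γ K Y a (x ⊗ₜ y)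
    = LinearMap.rTensor Y ((tA (k := k) (Γ := Γ) a).flip x) (HopfBimod.coact y) := rfl

lemma rA_one [ModuleAlgebra k A Γ] : rA k Γ K Y (1 : A) = 1 := by
  refine LinearMap.ext fun z => coOp_id _ (fun γ x => ?_) z
  rw [tA_apply, ModuleAlgebra.smul_one (k := k) γ, MulOpposite.op_smul, MulOpposite.op_one,
    smul_assoc, one_smul]

lemma rA_mul [ModuleAlgebra k A Γ] (a b : A) :
    rA k Γ K Y (a * b) = rA k Γ K Y b * rA k Γ K Y a := by
  refine LinearMap.ext fun z => ?_
  rw [Module.End.mul_apply, rA_apply, rA_apply, rA_apply, coOp_coOp]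
  congr 1
  congr 1
  refine LinearMap.ext fun γ => LinearMap.ext fun x => ?_
  rw [tA_apply, ModuleAlgebra.smul_mul (k := k), diagOp, LinearMap.comp_apply, LinearMap.comp_apply]
  generalize (comul γ : Γ ⊗[k] Γ) = s
  induction s using TensorProduct.induction_on with
  | zero => simp
  | add x y hx hy => simp only [map_add, LinearMap.add_apply, MulOpposite.op_add, add_smul, hx, hy]
  | tmul c e => simp [mul_smul]

variable (k A Γ K Y) in
/-- The operator `z ↦ z (a ⊗ γ) = (z a) γ`. -/
def rS : A ⊗[k] Γ →ₗ[k] Module.End k (K ⊗[k] Y) :=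
  TensorProduct.lift ((LinearMap.mul k (Module.End k (K ⊗[k] Y))).flip.compl₁₂
    (rA k Γ K Y) (rΓ k K Y))

lemma rS_tmul (a : A) (γ : Γ) (z : K ⊗[k] Y) :
    rS k A Γ K Y (a ⊗ₜ γ) z = rΓ k K Y γ (rA k Γ K Y a z) := by
  simp [rS]

lemma right_cond (γ : Γ) (t : A ⊗[k] Γ) :
    rS k A Γ K Y (Smash.D γ t) = rS k A Γ K Y t * rΓ k K Y γ := by
  induction t using TensorProduct.induction_on with
  | zero => simp
  | add x y hx hy => simp only [map_add, hx, hy, add_mul]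
  | tmul b δ =>
    refine TensorProduct.ext' fun x y => ?_
    rw [Module.End.mul_apply, rS_tmul, rΓ_tmul, rA_tmul, HopfBimod.coact_op_smul, Smash.D, diagOp,
      diagOp, LinearMap.comp_apply, LinearMap.comp_apply]
    generalize (comul γ : Γ ⊗[k] Γ) = s
    induction s using TensorProduct.induction_on with
    | zero => simp
    | add x y hx hy => simp only [map_add, LinearMap.add_apply, hx, hy]
    | tmul c e =>
      rw [TensorProduct.map₂_apply_tmul, TensorProduct.map₂_apply_tmul, TensorProduct.map_tmul,
        rS_tmul, rA_tmul]
      generalize (HopfBimod.coact y : Γ ⊗[k] Y) = w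
      induction w using TensorProduct.induction_on with
      | zero => simp
      | add x y hx hy => simp only [map_add, hx, hy]
      | tmul g y => simp [mul_smul]

lemma rS_mul [ModuleAlgebra k A Γ] (s t : A ⊗[k] Γ) :
    rS k A Γ K Y (Smash.mulOp s t) = rS k A Γ K Y t * rS k A Γ K Y s := by
  let i : A →ₗ[k] (Module.End k (K ⊗[k] Y))ᵐᵒᵖ :=
    (MulOpposite.opLinearEquiv k).toLinearMap ∘ₗ rA k Γ K Y
  let j : Γ →ₗ[k] (Module.End k (K ⊗[k] Y))ᵐᵒᵖ :=
    (MulOpposite.opLinearEquiv k).toLinearMap ∘ₗ rΓ k K Y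
  have h : ∀ t, Smash.mm i j t = MulOpposite.op (rS k A Γ K Y t) := fun t => by
    refine LinearMap.congr_fun (f := Smash.mm i j)
      (g := (MulOpposite.opLinearEquiv k).toLinearMap ∘ₗ rS k A Γ K Y) ?_ t
    refine TensorProduct.ext' fun a γ => ?_
    rw [Smash.mm_tmul]
    rfl
  apply MulOpposite.op_injective
  rw [MulOpposite.op_mul, ← h, ← h, ← h]
  refine Smash.mm_mul (fun a b => ?_) (fun γ t => ?_) s t
  · change MulOpposite.op _ = MulOpposite.op _
    rw [rA_mul]
    rfl
  · rw [h, h]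
    change MulOpposite.op _ = MulOpposite.op _
    rw [right_cond]
    rfl

lemma rS_one [ModuleAlgebra k A Γ] : rS k A Γ K Y ((1 : A) ⊗ₜ[k] (1 : Γ)) = 1 := by
  refine LinearMap.ext fun z => ?_
  rw [rS_tmul, rA_one, rΓ, LinearMap.comp_apply, ract_one]
  simp

lemma lA_rA (a b : A) (z : K ⊗[k] Y) :
    lA k K Y a (rA k Γ K Y b z) = rA k Γ K Y b (lA k K Y a z) :=
  coOp_map (tA (k := k) (Γ := Γ) b) (f := lact k A K a) (g := LinearMap.id)
    (fun γ x => by simp only [tA_apply, lact_apply, lact_ract k]) (fun y => by simp) z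

end

variable [Module Γ K] [IsScalarTower k Γ K]

variable (k K Y) in
/-- The operator `x ⊗ y ↦ γ₁ x ⊗ γ₂ y`. -/
def lΓ : Γ →ₗ[k] Module.End k (K ⊗[k] Y) := diagOp (lact k Γ K) (lact k Γ Y)

lemma lA_mul (a b : A) : lA k K Y (a * b) = lA k K Y a * lA k K Y b := by
  ext x y; simp [mul_smul]

lemma lΓ_mul (γ δ : Γ) : lΓ k K Y (γ * δ) = lΓ k K Y γ * lΓ k K Y δ :=
  diagOp_mul lact_mul lact_mul γ δ

lemma lΓ_rΓ (δ : Γ) (γ : Γ) (z : K ⊗[k] Y) :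
    lΓ k K Y δ (rΓ k K Y γ z) = rΓ k K Y γ (lΓ k K Y δ z) :=
  (diagOp_nat (f := LinearMap.id) (g := ract k Γ Y γ) (fun _ _ => rfl)
    (fun δ y => by simp only [ract_apply, lact_apply, lact_ract k]) δ z).symm

variable [Module Γ A] [IsScalarTower k Γ A]

lemma lΓ_lA [EqBimod k A Γ K] (γ : Γ) (a : A) (z : K ⊗[k] Y) :
    lΓ k K Y γ (lA k K Y a z)
      = TensorProduct.lift (lA k K Y) (diagOp (lact k Γ A) (lΓ k K Y) γ (a ⊗ₜ z)) := by
  induction z using TensorProduct.induction_on with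
  | zero => simp
  | add x y hx hy => simp only [map_add, hx, hy, TensorProduct.tmul_add]
  | tmul x y =>
    let g : A ⊗[k] K →ₗ[k] K := TensorProduct.lift (lact k A K)
    have h1 : lA k K Y a (x ⊗ₜ y) = TensorProduct.map g LinearMap.id ((a ⊗ₜ[k] x) ⊗ₜ[k] y) := by
      simp [g]
    have h2 : ∀ s : (A ⊗[k] K) ⊗[k] Y, TensorProduct.map g LinearMap.id s
        = TensorProduct.lift (lA k K Y) (TensorProduct.assoc k A K Y s) := by
      intro s
      refine LinearMap.congr_fun (f := TensorProduct.map g LinearMap.id)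
        (g := TensorProduct.lift (lA k K Y) ∘ₗ (TensorProduct.assoc k A K Y).toLinearMap) ?_ s
      ext a b c
      simp [g]
    rw [h1, lΓ, ← diagOp_nat (u := diagOp (lact k Γ A) (lact k Γ K)) (v := lact k Γ Y)
      (f := g) (g := LinearMap.id) (u' := lact k Γ K) (v' := lact k Γ Y),
      h2, diagOp_assoc]
    · rfl
    · intro γ x
      induction x using TensorProduct.induction_on with
      | zero => simp
      | add x y hx hy => simp only [map_add, hx, hy]
      | tmul a b => exact (EqBimod.smul_smul γ a b).symm
    · intro γ x; rfl

lemma left_cond [EqBimod k A Γ K] (γ : Γ) (t : A ⊗[k] Γ) :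
    Smash.mm (lA k K Y) (lΓ k K Y) (Smash.D γ t)
      = lΓ k K Y γ * Smash.mm (lA k K Y) (lΓ k K Y) t := by
  refine LinearMap.ext fun z => ?_
  have h : ∀ t : A ⊗[k] Γ, Smash.mm (lA k K Y) (lΓ k K Y) t z = TensorProduct.lift (lA k K Y)
      (TensorProduct.map LinearMap.id ((lΓ k K Y).flip z) t) := by
    intro t
    induction t using TensorProduct.induction_on with
    | zero => simp
    | add x y hx hy => simp only [map_add, LinearMap.add_apply, hx, hy]
    | tmul a b => simp
  induction t using TensorProduct.induction_on with
  | zero => simp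
  | add x y hx hy => simp only [map_add, LinearMap.add_apply, hx, hy, mul_add]
  | tmul b δ =>
    rw [h, Smash.D, diagOp_nat (u' := lact k Γ A) (v' := lΓ k K Y)]
    · simp only [Smash.mm_tmul, Module.End.mul_apply]
      exact (lΓ_lA γ b _).symm
    · intro γ x; rfl
    · intro γ x
      exact LinearMap.congr_fun (lΓ_mul γ x) z

variable (k A Γ K Y) in
/-- The operator `z ↦ (a ⊗ γ) z = a (γ z)`. -/
def lS : A ⊗[k] Γ →ₗ[k] Module.End k (K ⊗[k] Y) := Smash.mm (lA k K Y) (lΓ k K Y)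

lemma lS_tmul (a : A) (γ : Γ) (z : K ⊗[k] Y) :
    lS k A Γ K Y (a ⊗ₜ γ) z = lA k K Y a (lΓ k K Y γ z) := by
  simp [lS]

lemma lS_mul [EqBimod k A Γ K] (s t : A ⊗[k] Γ) :
    lS k A Γ K Y (Smash.mulOp s t) = lS k A Γ K Y s * lS k A Γ K Y t :=
  Smash.mm_mul lA_mul left_cond s t

lemma lS_one : lS k A Γ K Y ((1 : A) ⊗ₜ[k] (1 : Γ)) = 1 := by
  refine LinearMap.ext fun z => ?_
  rw [lS_tmul, lΓ, diagOp_one lact_one lact_one, lA, LinearMap.comp_apply, lact_one]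
  simp

variable [HopfBimod k Γ Y]

lemma lΓ_rA [EqBimod k A Γ K] (δ : Γ) (b : A) (z : K ⊗[k] Y) :
    lΓ k K Y δ (rA k Γ K Y b z) = rA k Γ K Y b (lΓ k K Y δ z) := by
  let p : K ⊗[k] Γ →ₗ[k] K := TensorProduct.lift (tA (k := k) (Γ := Γ) b).flip
  let q : K ⊗[k] A →ₗ[k] K := TensorProduct.lift (ract k A K).flip
  have hq : ∀ γ t, q (diagOp (lact k Γ K) (lact k Γ A) γ t) = lact k Γ K γ (q t) := by
    intro γ t
    induction t using TensorProduct.induction_on with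
    | zero => simp
    | add x y hx hy => simp only [map_add, hx, hy]
    | tmul x a => exact (EqBimod.smul_op_smul γ a x).symm
  have hpq : ∀ t, p t = q (TensorProduct.map LinearMap.id ((lact k Γ A).flip b) t) := by
    intro t
    refine LinearMap.congr_fun (f := p) (g := q ∘ₗ TensorProduct.map _ _)
      (TensorProduct.ext' fun x γ => ?_) t
    simp [p, q]
  have hp : ∀ γ t, p (diagOp (lact k Γ K) (lact k Γ Γ) γ t) = lact k Γ K γ (p t) := by
    intro γ t
    rw [hpq, hpq, ← hq, diagOp_nat (u' := lact k Γ K) (v' := lact k Γ A) (fun _ _ => rfl)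
      (fun γ δ => by simp [mul_smul])]
  have h1 : ∀ z : K ⊗[k] Y, rA k Γ K Y b z = TensorProduct.map p LinearMap.id
      ((TensorProduct.assoc k K Γ Y).symm (TensorProduct.map LinearMap.id HopfBimod.coact z)) := by
    intro z
    induction z using TensorProduct.induction_on with
    | zero => simp
    | add x y hx hy => simp only [map_add, hx, hy]
    | tmul x y =>
      rw [rA_tmul, TensorProduct.map_tmul]
      generalize (HopfBimod.coact y : Γ ⊗[k] Y) = w
      induction w using TensorProduct.induction_on with
      | zero => simp
      | add x y hx hy => simp only [map_add, hx, hy, TensorProduct.tmul_add]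
      | tmul g y => simp [p]
  rw [h1, h1, lΓ, diagOp_nat (u' := lact k Γ K) (v' := diagOp (lact k Γ Γ) (lact k Γ Y))
    (f := LinearMap.id) (g := HopfBimod.coact) (fun _ _ => rfl) HopfBimod.coact_smul]
  have h2 : ∀ w, (TensorProduct.assoc k K Γ Y).symm
      (diagOp (lact k Γ K) (diagOp (lact k Γ Γ) (lact k Γ Y)) δ w)
      = diagOp (diagOp (lact k Γ K) (lact k Γ Γ)) (lact k Γ Y) δ
        ((TensorProduct.assoc k K Γ Y).symm w) := by
    intro w
    rw [LinearEquiv.symm_apply_eq, diagOp_assoc, LinearEquiv.apply_symm_apply]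
  rw [h2, diagOp_nat (u' := lact k Γ K) (v' := lact k Γ Y) hp (fun _ _ => rfl)]

lemma left_right [EqBimod k A Γ K] (s t : A ⊗[k] Γ) (z : K ⊗[k] Y) :
    lS k A Γ K Y s (rS k A Γ K Y t z) = rS k A Γ K Y t (lS k A Γ K Y s z) := by
  induction s using TensorProduct.induction_on with
  | zero => simp
  | add x y hx hy => simp only [map_add, LinearMap.add_apply, hx, hy]
  | tmul a γ =>
    induction t using TensorProduct.induction_on with
    | zero => simp
    | add x y hx hy => simp only [map_add, LinearMap.add_apply, hx, hy]
    | tmul b δ =>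
      simp only [lS_tmul, rS_tmul, lΓ_rΓ, lΓ_rA, lA_rΓ, lA_rA]

end SmashOp
end SmashOperators

section SmashComplex
variable {k A Γ K Y : Type u} [Field k] [Ring A] [Algebra k A] [Ring Γ] [HopfAlgebra k Γ]
  [Module Γ A] [IsScalarTower k Γ A]
  [AddCommGroup K] [Module k K] [Module A K] [Module Aᵐᵒᵖ K] [IsBimod k A K]
  [Module Γ K] [IsScalarTower k Γ K]
  [AddCommGroup Y] [Module k Y] [Module Γ Y] [Module Γᵐᵒᵖ Y] [IsBimod k Γ Y] [HopfBimod k Γ Y]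

/-- The smash product `K # Y`, with underlying space `K ⊗ Y`. -/
def SmashMod (k K Y : Type u) [Field k] [AddCommGroup K] [Module k K] [AddCommGroup Y]
    [Module k Y] : Type u := K ⊗[k] Y

namespace SmashMod

instance : AddCommGroup (SmashMod k K Y) := inferInstanceAs (AddCommGroup (K ⊗[k] Y))
instance : Module k (SmashMod k K Y) := inferInstanceAs (Module k (K ⊗[k] Y))

variable (k) in
/-- The element `x ⊗ y` of `K # Y`. -/
def tmul (x : K) (y : Y) : SmashMod k K Y := x ⊗ₜ[k] y

variable [ModuleAlgebra k A Γ] [EqBimod k A Γ K]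

/-- The left action: `a (x ⊗ y) = a x ⊗ y` and `γ (x ⊗ y) = γ₁ x ⊗ γ₂ y`. -/
instance : Module (Smash k A Γ) (SmashMod k K Y) where
  smul s z := SmashOp.lS k A Γ K Y s z
  one_smul z := LinearMap.congr_fun (SmashOp.lS_one (k := k) (A := A) (Γ := Γ)) z
  mul_smul s t z := LinearMap.congr_fun (SmashOp.lS_mul (k := k) (A := A) (Γ := Γ) s t) z
  smul_zero _ := map_zero _
  smul_add _ := map_add _
  add_smul s t z := LinearMap.congr_fun (map_add (SmashOp.lS k A Γ K Y) s t) z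
  zero_smul z := LinearMap.congr_fun (map_zero (SmashOp.lS k A Γ K Y)) z

/-- The right action: `(x ⊗ y) a = x (y₋₁ a) ⊗ y₀` and `(x ⊗ y) γ = x ⊗ y γ`. -/
instance : Module (Smash k A Γ)ᵐᵒᵖ (SmashMod k K Y) where
  smul s z := SmashOp.rS k A Γ K Y s.unop z
  one_smul z := LinearMap.congr_fun (SmashOp.rS_one (k := k) (A := A) (Γ := Γ)) z
  mul_smul s t z :=
    LinearMap.congr_fun (SmashOp.rS_mul (k := k) (A := A) (Γ := Γ) t.unop s.unop) z
  smul_zero _ := map_zero _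
  smul_add _ := map_add _
  add_smul s t z := LinearMap.congr_fun (map_add (SmashOp.rS k A Γ K Y) s.unop t.unop) z
  zero_smul z := LinearMap.congr_fun (map_zero (SmashOp.rS k A Γ K Y)) z

instance : IsBimod k (Smash k A Γ) (SmashMod k K Y) where
  tower_left := ⟨fun c s z => LinearMap.congr_fun (map_smul (SmashOp.lS k A Γ K Y) c s) z⟩
  tower_right := ⟨fun c s z => LinearMap.congr_fun (map_smul (SmashOp.rS k A Γ K Y) c s.unop) z⟩
  comm := ⟨fun s t z => SmashOp.left_right (k := k) (A := A) (Γ := Γ) s t.unop z⟩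

end SmashMod

namespace AugBimodCx

variable (C : AugBimodCx k A K) (E : AugHopfCx k Γ Y)

lemma tensorGr_le {n : ℕ} {S : Submodule k (K ⊗[k] Y)}
    (h : ∀ i j, i + j = n → ∀ x ∈ C.gr i, ∀ y ∈ E.gr j, x ⊗ₜ[k] y ∈ S) :
    C.tensorGr E.toGrCx n ≤ S := by
  refine Submodule.span_le.2 ?_
  rintro _ ⟨i, j, hij, x, hx, y, hy, rfl⟩
  exact h i j hij x hx y hy

lemma tmul_mem {i j n : ℕ} (h : i + j = n) {x : K} (hx : x ∈ C.gr i) {y : Y} (hy : y ∈ E.gr j) :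
    x ⊗ₜ[k] y ∈ C.tensorGr E.toGrCx n :=
  Submodule.subset_span ⟨i, j, h, x, hx, y, hy, rfl⟩

lemma lS_mem (hC : C.IsEquivariant Γ) (n : ℕ) (s : A ⊗[k] Γ) (z : K ⊗[k] Y)
    (hz : z ∈ C.tensorGr E.toGrCx n) : SmashOp.lS k A Γ K Y s z ∈ C.tensorGr E.toGrCx n := by
  revert z
  refine C.tensorGr_le E (S := (C.tensorGr E.toGrCx n).comap (SmashOp.lS k A Γ K Y s))
    fun i j hij x hx y hy => ?_
  rw [Submodule.mem_comap]
  induction s using TensorProduct.induction_on with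
  | zero => simp
  | add s t hs ht => rw [map_add]; exact add_mem hs ht
  | tmul a γ =>
    rw [SmashOp.lS_tmul, SmashOp.lΓ, diagOp, LinearMap.comp_apply]
    generalize (comul γ : Γ ⊗[k] Γ) = s
    induction s using TensorProduct.induction_on with
    | zero => simp
    | add s t hs ht => rw [map_add, LinearMap.add_apply, map_add]; exact add_mem hs ht
    | tmul c e =>
      exact C.tmul_mem E hij (C.smul_mem _ _ _ (hC.smul_mem _ _ _ hx)) (E.smul_mem _ _ _ hy)

lemma rS_mem (n : ℕ) (s : A ⊗[k] Γ) (z : K ⊗[k] Y)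
    (hz : z ∈ C.tensorGr E.toGrCx n) : SmashOp.rS k A Γ K Y s z ∈ C.tensorGr E.toGrCx n := by
  revert z
  refine C.tensorGr_le E (S := (C.tensorGr E.toGrCx n).comap (SmashOp.rS k A Γ K Y s))
    fun i j hij x hx y hy => ?_
  rw [Submodule.mem_comap]
  induction s using TensorProduct.induction_on with
  | zero => simp
  | add s t hs ht => rw [map_add]; exact add_mem hs ht
  | tmul a γ =>
    rw [SmashOp.rS_tmul, SmashOp.rA_tmul]
    obtain ⟨w, hw⟩ := E.coact_mem j y hy
    rw [← hw]
    clear hw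
    induction w using TensorProduct.induction_on with
    | zero => simp
    | add s t hs ht => rw [map_add, map_add, map_add]; exact add_mem hs ht
    | tmul c y => exact C.tmul_mem E hij (C.op_smul_mem _ _ _ hx) (E.op_smul_mem _ _ _ y.2)

lemma tensorD_lS (hC : C.IsEquivariant Γ) (s : A ⊗[k] Γ) (z : K ⊗[k] Y) :
    C.tensorD E.toGrCx (SmashOp.lS k A Γ K Y s z)
      = SmashOp.lS k A Γ K Y s (C.tensorD E.toGrCx z) := by
  have hs : ∀ (γ : Γ) (x : K), C.sgn (γ • x) = γ • C.sgn x := fun γ x =>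
    (C.scale_comm C.toGrCx _ (f := lact k Γ K γ) (fun n x hx => hC.smul_mem n γ x hx) x).symm
  induction s using TensorProduct.induction_on with
  | zero => simp
  | add s t hs ht => simp only [map_add, LinearMap.add_apply, hs, ht]
  | tmul a γ =>
    have h1 : ∀ z, C.tensorD E.toGrCx (SmashOp.lΓ k K Y γ z)
        = SmashOp.lΓ k K Y γ (C.tensorD E.toGrCx z) := by
      intro z
      rw [GrCx.tensorD, LinearMap.add_apply, LinearMap.add_apply, map_add, SmashOp.lΓ]
      exact congrArg₂ (· + ·) (diagOp_nat (fun γ x => hC.d_smul γ x) (fun _ _ => rfl) γ z)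
        (diagOp_nat (fun γ x => hs γ x) (fun γ y => E.d_smul γ y) γ z)
    have h2 : ∀ z, C.tensorD E.toGrCx (SmashOp.lA k K Y a z)
        = SmashOp.lA k K Y a (C.tensorD E.toGrCx z) := by
      intro z
      induction z using TensorProduct.induction_on with
      | zero => simp
      | add x y hx hy => simp only [map_add, hx, hy]
      | tmul x y =>
        simp only [GrCx.tensorD, LinearMap.add_apply, TensorProduct.map_tmul, SmashOp.lA_tmul,
          map_add, C.d_smul, GrCx.sgn, C.scale_smul, LinearMap.id_coe, id_eq]
    rw [SmashOp.lS_tmul, SmashOp.lS_tmul, h2, h1]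

lemma tensorD_rS (s : A ⊗[k] Γ) (z : K ⊗[k] Y) :
    C.tensorD E.toGrCx (SmashOp.rS k A Γ K Y s z)
      = SmashOp.rS k A Γ K Y s (C.tensorD E.toGrCx z) := by
  induction s using TensorProduct.induction_on with
  | zero => simp
  | add s t hs ht => simp only [map_add, LinearMap.add_apply, hs, ht]
  | tmul a γ =>
    have h1 : ∀ z, C.tensorD E.toGrCx (SmashOp.rΓ k K Y γ z)
        = SmashOp.rΓ k K Y γ (C.tensorD E.toGrCx z) := by
      intro z
      induction z using TensorProduct.induction_on with
      | zero => simp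
      | add x y hx hy => simp only [map_add, hx, hy]
      | tmul x y =>
        simp only [GrCx.tensorD, LinearMap.add_apply, TensorProduct.map_tmul, SmashOp.rΓ_tmul,
          map_add, E.d_op_smul, LinearMap.id_coe, id_eq]
    have h2 : C.tensorD E.toGrCx (SmashOp.rA k Γ K Y a z)
        = SmashOp.rA k Γ K Y a (C.tensorD E.toGrCx z) := by
      rw [GrCx.tensorD, LinearMap.add_apply, LinearMap.add_apply, map_add, SmashOp.rA_apply]
      exact congrArg₂ (· + ·)
        (SmashOp.coOp_map _ (fun γ x => C.d_op_smul _ _) (fun y => by simp) z)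
        (SmashOp.coOp_map _ (fun γ x => C.scale_op _ _ _) E.coact_d z)
    rw [SmashOp.rS_tmul, SmashOp.rS_tmul, h1, h2]

variable [ModuleAlgebra k A Γ]

lemma aug_lS (hC : C.IsEquivariant Γ) (s : A ⊗[k] Γ) (z : K ⊗[k] Y) :
    TensorProduct.map C.aug E.aug (SmashOp.lS k A Γ K Y s z)
      = Smash.mulOp s (TensorProduct.map C.aug E.aug z) := by
  induction s using TensorProduct.induction_on with
  | zero => simp
  | add s t hs ht => simp only [map_add, LinearMap.add_apply, hs, ht]
  | tmul a γ =>
    have h2 : ∀ z, TensorProduct.map C.aug E.aug (SmashOp.lA k K Y a z)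
        = Smash.la a (TensorProduct.map C.aug E.aug z) := by
      intro z
      induction z using TensorProduct.induction_on with
      | zero => simp
      | add x y hx hy => simp only [map_add, hx, hy]
      | tmul x y => simp [C.aug_smul]
    rw [SmashOp.lS_tmul, h2, SmashOp.lΓ, diagOp_nat (u' := lact k Γ A) (v' := lact k Γ Γ)
      (fun γ x => hC.aug_smul γ x) (fun γ y => E.aug_smul γ y), Smash.mulOp, Smash.mm_tmul]
    rfl

lemma aug_rS (s : A ⊗[k] Γ) (z : K ⊗[k] Y) :
    TensorProduct.map C.aug E.aug (SmashOp.rS k A Γ K Y s z)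
      = Smash.mulOp (TensorProduct.map C.aug E.aug z) s := by
  induction z using TensorProduct.induction_on with
  | zero => simp
  | add x y hx hy => simp only [map_add, LinearMap.add_apply, hx, hy]
  | tmul x y =>
    induction s using TensorProduct.induction_on with
    | zero => simp
    | add s t hs ht => simp only [map_add, LinearMap.add_apply, hs, ht]
    | tmul b δ =>
      rw [SmashOp.rS_tmul, SmashOp.rA_tmul, TensorProduct.map_tmul, Smash.mulOp, Smash.mm_tmul,
        Module.End.mul_apply, Smash.D, diagOp, LinearMap.comp_apply, E.comul_aug]
      generalize (HopfBimod.coact y : Γ ⊗[k] Y) = w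
      induction w using TensorProduct.induction_on with
      | zero => simp
      | add x y hx hy => simp only [map_add, LinearMap.add_apply, hx, hy]
      | tmul g y =>
        simp only [LinearMap.rTensor_tmul, LinearMap.flip_apply, SmashOp.tA_apply, SmashOp.rΓ_tmul,
          TensorProduct.map_tmul, LinearMap.lTensor_tmul, TensorProduct.map₂_apply_tmul,
          lact_apply, Smash.la_tmul, C.aug_op_smul, E.aug_op_smul, smul_eq_mul]

/-- The complex of `A # Γ`-bimodules `K # Y`, with the augmentation `τ ⊗ ξ`. -/
def smash [EqBimod k A Γ K] (hC : C.IsEquivariant Γ) :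
    AugBimodCx k (Smash k A Γ) (SmashMod k K Y) where
  toGrCx := C.toGrCx.tensor E.toGrCx
  smul_mem := C.lS_mem E hC
  op_smul_mem := C.rS_mem E
  d_smul := C.tensorD_lS E hC
  d_op_smul := C.tensorD_rS E
  aug := TensorProduct.map C.aug E.aug
  aug_smul := C.aug_lS E hC
  aug_op_smul s z := C.aug_rS E s z
  aug_pos n := C.tensorGr_le E (S := LinearMap.ker (TensorProduct.map C.aug E.aug))
    fun i j hij x hx y hy => by
      rw [LinearMap.mem_ker, TensorProduct.map_tmul]
      rcases i with _ | i
      · rcases j with _ | j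
        · omega
        · rw [E.aug_pos j y hy, TensorProduct.tmul_zero]
      · rw [C.aug_pos i x hx, TensorProduct.zero_tmul]
  aug_d z := by
    refine LinearMap.congr_fun (f := TensorProduct.map C.aug E.aug ∘ₗ C.tensorD E.toGrCx) (g := 0)
      (TensorProduct.ext' fun x y => ?_) z
    simp [GrCx.tensorD, C.aug_d, E.aug_d]

end AugBimodCx
end SmashComplex

section Comparison
variable {k R X X' B : Type u} [Field k] [Ring R] [Algebra k R] [AddCommGroup X] [Module k X]
  [Module R X] [Module Rᵐᵒᵖ X] [IsBimod k R X] [AddCommGroup X'] [Module k X']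
  [Module R X'] [Module Rᵐᵒᵖ X'] [IsBimod k R X'] [Ring B] [Algebra k B]

namespace AugBimodCx

/-- A morphism of augmented complexes of `R`-bimodules. -/
structure Hom (C : AugBimodCx k R X) (C' : AugBimodCx k R X') where
  toFun : X →ₗ[k] X'
  map_smul : ∀ (r : R) x, toFun (r • x) = r • toFun x
  map_op_smul : ∀ (r : R) x, toFun (MulOpposite.op r • x) = MulOpposite.op r • toFun x
  map_gr : ∀ n, ∀ x ∈ C.gr n, toFun x ∈ C'.gr n
  map_d : ∀ x, toFun (C.d x) = C'.d (toFun x)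
  aug_comp : ∀ x, C'.aug (toFun x) = C.aug x

variable {C : AugBimodCx k R X} {C' : AugBimodCx k R X'}

/-- The map `f ↦ f ∘ c` on complexes of bimodule maps to `B`. -/
def Hom.pullback (c : C.Hom C') (Δ' : C'.Diagonal) (Δ : C.Diagonal) (φ : R →ₐ[k] B) :
    DGAlg.CxMap (Δ'.homDGAlg φ) (Δ.homDGAlg φ) where
  f n := (((LinearMap.lcomp k B c.toFun) ∘ₗ (BHom X' φ).subtype).codRestrict (BHom X φ)
      (fun f => ⟨fun r x => by simp [c.map_smul, f.2.1],
        fun r x => by simp [c.map_op_smul, f.2.2]⟩)).restrict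
      (p := C'.homDeg φ n) (q := C.homDeg φ n) fun f hf i hi x hx => hf i hi _ (c.map_gr i x hx)
  comm h f := by
    refine Subtype.ext (Subtype.ext (LinearMap.ext fun x => ?_))
    change (f.1 : X' →ₗ[k] B) (C'.d (C'.sgn (c.toFun x)))
      = (f.1 : X' →ₗ[k] B) (c.toFun (C.d (C.sgn x)))
    rw [c.map_d, GrCx.sgn, GrCx.sgn, C.scale_comm C'.toGrCx _ c.map_gr]

end AugBimodCx
end Comparison

section SmashDiagonal
variable {k A Γ K L : Type u} [Field k] [Ring A] [Algebra k A] [Ring Γ] [HopfAlgebra k Γ]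
  [Module Γ A] [IsScalarTower k Γ A] [ModuleAlgebra k A Γ]
  [AddCommGroup K] [Module k K] [Module A K] [Module Aᵐᵒᵖ K] [IsBimod k A K]
  [Module Γ K] [IsScalarTower k Γ K] [EqBimod k A Γ K]
  [AddCommGroup L] [Module k L] [Module Γᵐᵒᵖ L] [IsScalarTower k Γᵐᵒᵖ L]

/-- The smash product resolution `K # L↑`, where `L↑ = L ⊗_Γ (Γ ⊗ Γ)`. -/
abbrev smashRes (CK : AugBimodCx k A K) (hK : CK.IsEquivariant Γ) (CL : AugRightCx k Γ L) :
    AugBimodCx k (Smash k A Γ) (SmashMod k K (Ind k Γ L)) :=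
  CK.smash (Ind.cx CL) hK

variable (k Γ K L) in
/-- The inclusion `K ⊗ L → K # L↑`, `x ⊗ l ↦ x ⊗ (l ⊗ (1 ⊗ 1))`. -/
def inKL : K →ₗ[k] L →ₗ[k] SmashMod k K (Ind k Γ L) :=
  (TensorProduct.mk k K (Ind k Γ L)).compl₂ (Ind.mkₗ.flip ((1 : Γ) ⊗ₜ[k] (1 : Γ)))

variable (k A Γ K L) in
/-- The map `(x ⊗ y) ⊗ (l ⊗ m) ↦ (x ⊗ l) ⊗ (y ⊗ m)`, without sign. -/
def shuffle₀ : (K ⊗[k] K) ⊗[k] (L ⊗[k] L) →ₗ[k] Sq k (Smash k A Γ) (SmashMod k K (Ind k Γ L)) :=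
  sqMk k (Smash k A Γ) (SmashMod k K (Ind k Γ L)) ∘ₗ
    TensorProduct.map (TensorProduct.lift (inKL k Γ K L)) (TensorProduct.lift (inKL k Γ K L)) ∘ₗ
      (TensorProduct.tensorTensorTensorComm k K K L L).toLinearMap

/-- The map `(x ⊗ y) ⊗ (l ⊗ m) ↦ (-1)^{|l||y|} (x ⊗ l) ⊗ (y ⊗ m)`. -/
def shuffle (CK : AugBimodCx k A K) (CL : AugRightCx k Γ L) :
    (K ⊗[k] K) ⊗[k] (L ⊗[k] L) →ₗ[k] Sq k (Smash k A Γ) (SmashMod k K (Ind k Γ L)) :=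
  shuffle₀ k A Γ K L ∘ₗ
    (TensorProduct.map (TensorProduct.map LinearMap.id CK.even) LinearMap.id
      + TensorProduct.map (TensorProduct.map LinearMap.id CK.odd)
        (TensorProduct.map CL.sgn LinearMap.id))

/-- `Δ` is the diagonal map of `K # L↑` that extends
`x ⊗ l ↦ ∑ (-1)^{|l₁||x₂|} (x₁ ⊗ l₁) ⊗ (x₂ ⊗ l₂)`, for `x` in `K` and `l` in `L`, where
`ω(x) = ∑ x₁ ⊗ x₂` and `σ(l) = ∑ l₁ ⊗ l₂`. -/
def IsSmashDiagonal {CK : AugBimodCx k A K} (hK : CK.IsEquivariant Γ) {CL : AugRightCx k Γ L}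
    (ω : CK.Diagonal) (σ : CL.Diagonal) (Δ : (smashRes CK hK CL).Diagonal) : Prop :=
  ∀ (x : K) (l : L) (t : K ⊗[k] K), sqMk k A K t = ω.toFun x →
    Δ.toFun (inKL k Γ K L x l) = shuffle CK CL (t ⊗ₜ σ.toFun l)

end SmashDiagonal

end SmashHH

end

open SmashHH TensorProduct

set_option linter.unusedSectionVars false

noncomputable section

open TensorProduct Coalgebra

/-! Everything rests on one adjunction. Let Z be a Γ-equivariant A-bimodule and M a bimodule over
A#Γ. In Z#L↑ one has x ⊗ (l ⊗ γ ⊗ δ) = γ₂ · (S⁻¹(γ₁)x ⊗ l) · δ, so a bimodule map F on Z#L↑ is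
determined by the maps G(l) = F(- ⊗ l). These are A-bimodule maps, and they satisfy G(lγ) = G(l)·γ
for the twisted right action (f·γ)(x) = S(γ₁) f(γ₂x) γ₃. Conversely, every such G extends. Thus Hom
over (A#Γ)ᵉ from Z#L↑ to M is Hom_Γ(L, Hom_{Aᵉ}(Z, M)). Extension is `extF` with `extF_isBiHom`, the
twisted linearity of a restriction is `restrict_twisted`, and uniqueness is `SmashMod.hom_ext`.
Bijectivity of the antipode is what makes the elements γ₁x ⊗ γ₂ span Z ⊗ Γ.

The adjunction is used three times. With M arbitrary it shows that Z#L↑ inherits the lifting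
property of a projective bimodule from Z and from the projectivity of L (`LiftProp.smash`). With M
the tensor square of K#L↑ it reduces the existence and uniqueness of Δ to the twisted linearity of
the shuffle formula, which in Sweedler notation is a passage of γ from left to right through two
tensor factors (`sw_shuf₀`, `smashGen_twisted`). With M = B and Z = P, corrected by the sign
(-1)^{|x||l|}, it is an isomorphism from Hom(P#L↑, B), with the product given by the smash diagonal,
to the total complex Hom_Γ(L, Hom_{Aᵉ}(P, B)), strictly compatible with differentials and products
(`totMap`, `totMap_mul`).

Exactness of Z#L↑ is a statement about vector spaces: L↑ is a retract of Γ ⊗ L as a complex, so a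
contraction of L induces one of L↑, and contractions can be tensored
(`AugBimodCx.IsResolution.smash`).

The rest is the comparison theorem. If X and X' have the lifting property and X' is a resolution,
then X' ⊗_R X' is exact as well, so a comparison map c : X → X' respects diagonal maps up to
homotopy, and pulling back along c is multiplicative up to homotopy
(`Hom.pullback_isMulUpToHomotopy`). When both are resolutions it is a quasi-isomorphism.

Hence take for 𝒜 the algebra Hom(P#L↑, B), for η₁ the pullback along a comparison map P#L↑ → K#L↑,
and for η₂ the inverse of `totMap`. For any Q, the map Ψ₁ is the pullback along Q → K#L↑, and Ψ₂ is
Ψ₁ after H(η₁)⁻¹ after H(η₂). -/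

namespace SmashHH

/-! ### Bimodules as commuting families of operators, and the lifting property -/

section BimoduleActions

/-- Commuting left and right actions of `R` on a vector space `M`, as families of operators. -/
structure BimAct (k R M : Type u) [Field k] [Ring R] [Algebra k R] [AddCommGroup M]
    [Module k M] where
  l : R →ₐ[k] Module.End k M
  r : R →ₗ[k] Module.End k M
  r_one : r 1 = LinearMap.id
  r_mul : ∀ a b, r (a * b) = r b ∘ₗ r a
  comm : ∀ a b m, l a (r b m) = r b (l a m)

variable {k R X Y M N : Type u} [Field k] [Ring R] [Algebra k R] [AddCommGroup X] [Module k X]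
  [AddCommGroup Y] [Module k Y] [AddCommGroup M] [Module k M] [AddCommGroup N] [Module k N]

namespace BimAct

variable (k R X) in
/-- The actions of `R` on a bimodule. -/
def of [Module R X] [Module Rᵐᵒᵖ X] [IsBimod k R X] : BimAct k R X where
  l := Algebra.lsmul k k X
  r := ract k R X
  r_one := ract_one
  r_mul := ract_mul
  comm a b m := lact_ract k a b m

@[simp] lemma of_l [Module R X] [Module Rᵐᵒᵖ X] [IsBimod k R X] (r : R) (x : X) :
    (of k R X).l r x = r • x := rfl

@[simp] lemma of_r [Module R X] [Module Rᵐᵒᵖ X] [IsBimod k R X] (r : R) (x : X) :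
    (of k R X).r r x = MulOpposite.op r • x := rfl

/-- Restriction of the actions along an algebra map. -/
def comap {R' : Type u} [Ring R'] [Algebra k R'] (a : BimAct k R M) (φ : R' →ₐ[k] R) :
    BimAct k R' M where
  l := a.l.comp φ
  r := a.r ∘ₗ φ.toLinearMap
  r_one := by simp [a.r_one]
  r_mul x y := by simp [a.r_mul]
  comm x y m := a.comm _ _ m

@[simp] lemma comap_l {R' : Type u} [Ring R'] [Algebra k R'] (a : BimAct k R M) (φ : R' →ₐ[k] R)
    (r : R') : (a.comap φ).l r = a.l (φ r) := rfl

@[simp] lemma comap_r {R' : Type u} [Ring R'] [Algebra k R'] (a : BimAct k R M) (φ : R' →ₐ[k] R)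
    (r : R') : (a.comap φ).r r = a.r (φ r) := rfl

/-- An algebra acts on itself by left and right multiplication. -/
def self (k B : Type u) [Field k] [Ring B] [Algebra k B] : BimAct k B B := of k B B

/-- The actions on a stable subspace. -/
def sub (a : BimAct k R M) (S : Submodule k M) (hl : ∀ r, ∀ m ∈ S, a.l r m ∈ S)
    (hr : ∀ r, ∀ m ∈ S, a.r r m ∈ S) : BimAct k R S where
  l := AlgHom.ofLinearMap
    { toFun := fun r => (a.l r).restrict (hl r)
      map_add' := fun r s => by ext; simp
      map_smul' := fun c r => by ext; simp }
    (by ext; simp) (fun r s => by ext; simp)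
  r :=
    { toFun := fun r => (a.r r).restrict (hr r)
      map_add' := fun r s => by ext; simp
      map_smul' := fun c r => by ext; simp }
  r_one := by ext; simp [a.r_one]
  r_mul x y := by ext; simp [a.r_mul]
  comm x y m := Subtype.ext (a.comm x y m)

/-- The coinduced bimodule of a left module: `R` acts on `Hom(R, M)` by `(r h)(t) = r h(t)` and
`(h r)(t) = h(r t)`. -/
def coind (l : R →ₐ[k] Module.End k M) : BimAct k R (R →ₗ[k] M) where
  l := AlgHom.ofLinearMap
    { toFun := fun r => LinearMap.compRight k (l r)
      map_add' := fun r s => by ext; simp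
      map_smul' := fun c r => by ext; simp }
    (by ext; simp) (fun r s => by ext; simp)
  r :=
    { toFun := fun r => LinearMap.lcomp k M (LinearMap.mulLeft k r)
      map_add' := fun r s => by ext; simp [add_mul]
      map_smul' := fun c r => by ext; simp }
  r_one := by ext; simp
  r_mul x y := by ext; simp
  comm x y m := by ext; simp

/-- The actions as one action of the enveloping algebra. -/
def env (a : BimAct k R M) : R ⊗[k] Rᵐᵒᵖ →ₐ[k] Module.End k M :=
  Algebra.TensorProduct.lift a.l
    (AlgHom.ofLinearMap (a.r ∘ₗ (MulOpposite.opLinearEquiv k).symm.toLinearMap) a.r_one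
      fun x y => a.r_mul y.unop x.unop)
    fun x y => LinearMap.ext fun m => a.comm x y.unop m

lemma env_tmul (a : BimAct k R M) (r : R) (s : Rᵐᵒᵖ) (m : M) :
    a.env (r ⊗ₜ s) m = a.l r (a.r s.unop m) := by
  exact LinearMap.congr_fun (Algebra.TensorProduct.lift_tmul _ _ _ r s) m

end BimAct

/-- Bimodule maps, for unbundled actions. -/
structure IsBiHom (a : BimAct k R X) (b : BimAct k R Y) (f : X →ₗ[k] Y) : Prop where
  left : ∀ r x, f (a.l r x) = b.l r (f x)
  right : ∀ r x, f (a.r r x) = b.r r (f x)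

lemma IsBiHom.comp {a : BimAct k R X} {b : BimAct k R Y} {c : BimAct k R M} {g : Y →ₗ[k] M}
    {f : X →ₗ[k] Y} (hg : IsBiHom b c g) (hf : IsBiHom a b f) : IsBiHom a c (g ∘ₗ f) :=
  ⟨fun r x => by simp [hf.left, hg.left], fun r x => by simp [hf.right, hg.right]⟩

/-- The space of bimodule maps. -/
def biHom (a : BimAct k R X) (b : BimAct k R Y) : Submodule k (X →ₗ[k] Y) where
  carrier := {f | IsBiHom a b f}
  add_mem' hf hg := ⟨fun r x => by simp [hf.left, hg.left], fun r x => by simp [hf.right, hg.right]⟩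
  zero_mem' := ⟨fun r x => by simp, fun r x => by simp⟩
  smul_mem' c f hf := ⟨fun r x => by simp [hf.left], fun r x => by simp [hf.right]⟩

/-- The space of maps that commute with two left actions. -/
def leftHom (l : R →ₐ[k] Module.End k X) (l' : R →ₐ[k] Module.End k Y) :
    Submodule k (X →ₗ[k] Y) where
  carrier := {f | ∀ r x, f (l r x) = l' r (f x)}
  add_mem' hf hg r x := by
    rw [LinearMap.add_apply, LinearMap.add_apply, hf, hg, map_add]
  zero_mem' r x := by simp
  smul_mem' c f hf r x := by rw [LinearMap.smul_apply, LinearMap.smul_apply, hf, map_smul]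

/-- The lifting property of a projective bimodule. -/
def LiftProp (a : BimAct k R X) : Prop :=
  ∀ ⦃M N : Type u⦄ [AddCommGroup M] [Module k M] [AddCommGroup N] [Module k N]
    (b : BimAct k R M) (c : BimAct k R N) (p : M →ₗ[k] N) (f : X →ₗ[k] N),
    IsBiHom b c p → IsBiHom a c f → (∀ x, ∃ m, p m = f x) →
      ∃ h : X →ₗ[k] M, IsBiHom a b h ∧ ∀ x, p (h x) = f x

/-- Linear maps with values in the range of `p` lift along `p`. -/
lemma exists_linear_lift (p : M →ₗ[k] N) (f : X →ₗ[k] N) (h : ∀ x, ∃ m, p m = f x) :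
    ∃ g : X →ₗ[k] M, ∀ x, p (g x) = f x := by
  obtain ⟨g, hg⟩ := Module.projective_lifting_property p.rangeRestrict
    (f.codRestrict (LinearMap.range p) h) p.surjective_rangeRestrict
  exact ⟨g, fun x => congrArg Subtype.val (LinearMap.congr_fun hg x)⟩

/-- Both targets become modules over the enveloping algebra through `BimAct.env`, and projectivity
is applied to the corestriction of p to its range, because p itself need not be onto. Linearity over
k comes back from linearity over R, since scalars act through `algebraMap`. -/
lemma AugBimodCx.IsProjective.liftProp [Module R X] [Module Rᵐᵒᵖ X] [IsBimod k R X]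
    {C : AugBimodCx k R X} (hC : C.IsProjective) : LiftProp (BimAct.of k R X) := by
  intro M N _ _ _ _ b c p f hp hf h
  let : SMulCommClass R Rᵐᵒᵖ X := IsBimod.comm (k := k)
  let : Module (R ⊗[k] Rᵐᵒᵖ) X := TensorProduct.Algebra.module
  have : Module.Projective (R ⊗[k] Rᵐᵒᵖ) X := hC
  let : Module (R ⊗[k] Rᵐᵒᵖ) M := Module.compHom M b.env.toRingHom
  let : Module (R ⊗[k] Rᵐᵒᵖ) N := Module.compHom N c.env.toRingHom
  have hM : ∀ r s (m : M), (r ⊗ₜ[k] s : R ⊗[k] Rᵐᵒᵖ) • m = b.l r (b.r s.unop m) := b.env_tmul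
  have hN : ∀ r s (m : N), (r ⊗ₜ[k] s : R ⊗[k] Rᵐᵒᵖ) • m = c.l r (c.r s.unop m) := c.env_tmul
  have hX : ∀ (r : R) (s : Rᵐᵒᵖ) (x : X), (r ⊗ₜ[k] s : R ⊗[k] Rᵐᵒᵖ) • x = r • s • x := fun r s x =>
    TensorProduct.Algebra.smul_def r s x
  have hps : ∀ (t : R ⊗[k] Rᵐᵒᵖ) m, p (t • m) = t • p m := by
    intro t m
    induction t using TensorProduct.induction_on with
    | zero =>
      have h1 := zero_smul (R ⊗[k] Rᵐᵒᵖ) m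
      have h2 := zero_smul (R ⊗[k] Rᵐᵒᵖ) (p m)
      exact (congrArg p h1).trans ((map_zero p).trans h2.symm)
    | add s t hs ht => simp only [add_smul, map_add, hs, ht]
    | tmul r s => rw [hM, hN, hp.left, hp.right]
  have hfs : ∀ (t : R ⊗[k] Rᵐᵒᵖ) m, f (t • m) = t • f m := by
    intro t m
    induction t using TensorProduct.induction_on with
    | zero =>
      have h1 := zero_smul (R ⊗[k] Rᵐᵒᵖ) m
      have h2 := zero_smul (R ⊗[k] Rᵐᵒᵖ) (f m)
      exact (congrArg f h1).trans ((map_zero f).trans h2.symm)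
    | add s t hs ht => simp only [add_smul, map_add, hs, ht]
    | tmul r s => rw [hX, hN, ← hf.right, ← hf.left]; rfl
  let p' : M →ₗ[R ⊗[k] Rᵐᵒᵖ] N := { toFun := p, map_add' := map_add p, map_smul' := hps }
  let f' : X →ₗ[R ⊗[k] Rᵐᵒᵖ] N := { toFun := f, map_add' := map_add f, map_smul' := hfs }
  obtain ⟨g, hg⟩ := Module.projective_lifting_property p'.rangeRestrict
    (f'.codRestrict (LinearMap.range p') h) p'.surjective_rangeRestrict
  have hg' : ∀ x, p (g x) = f x := fun x => congrArg Subtype.val (LinearMap.congr_fun hg x)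
  have hl : ∀ (r : R) x, g (r • x) = b.l r (g x) := fun r x => by
    have := g.map_smul (r ⊗ₜ[k] (1 : Rᵐᵒᵖ)) x
    rw [hX, hM, one_smul] at this
    rw [this, MulOpposite.unop_one, b.r_one]; rfl
  have hr : ∀ (r : R) x, g (MulOpposite.op r • x) = b.r r (g x) := fun r x => by
    have := g.map_smul ((1 : R) ⊗ₜ[k] MulOpposite.op r) x
    rw [hX, hM, one_smul] at this
    rw [this, map_one]; rfl
  refine ⟨{ toFun := g, map_add' := map_add g, map_smul' := fun c x => ?_ }, ⟨hl, hr⟩, hg'⟩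
  have := hl (algebraMap k R c) x
  rw [algebraMap_smul] at this
  rw [this, AlgHom.commutes, Module.algebraMap_end_apply]; rfl

/-- A lift on the generating space V exists by linear algebra over the field, and freeness extends
it to all products a v b. Every identity is then checked on such products, which is the role of
`key`. -/
lemma AugBimodCx.IsFreeOnΓ.liftProp {A Γ : Type u} [Ring A] [Algebra k A] [Ring Γ] [HopfAlgebra k Γ]
    [Module A X] [Module Aᵐᵒᵖ X] [IsBimod k A X] [Module Γ X] [IsScalarTower k Γ X]
    {C : AugBimodCx k A X} (hC : C.IsFreeOnΓ Γ) : LiftProp (BimAct.of k A X) := by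
  intro M N _ _ _ _ b c p f hp hf h
  obtain ⟨V, -, -, hV⟩ := hC
  obtain ⟨g, hg⟩ := exists_linear_lift p (f ∘ₗ V.subtype) fun v => h v
  set μ : (A ⊗[k] V) ⊗[k] A →ₗ[k] X := TensorProduct.lift ((ract k A X).compl₂
      (TensorProduct.lift ((lact k A X).compl₂ V.subtype))).flip with hμ
  have hμt : ∀ a v s, μ ((a ⊗ₜ v) ⊗ₜ s) = MulOpposite.op s • a • (v : X) := fun a v s => by
    simp [hμ]
  let G : (A ⊗[k] V) ⊗[k] A →ₗ[k] M := TensorProduct.lift (b.r.compl₂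
      (TensorProduct.lift (b.l.toLinearMap.compl₂ g))).flip
  have hGt : ∀ a v s, G ((a ⊗ₜ v) ⊗ₜ s) = b.r s (b.l a (g v)) := fun a v s => by
    simp [G]
  let e := LinearEquiv.ofBijective μ hV
  have he : ∀ t, e t = μ t := fun t => rfl
  have hs : ∀ t, G (e.symm (μ t)) = G t := fun t => by rw [← he, LinearEquiv.symm_apply_apply]
  have key : ∀ {Y : Type u} [AddCommGroup Y] [Module k Y] (F F' : X →ₗ[k] Y),
      (∀ a v s, F (μ ((a ⊗ₜ v) ⊗ₜ s)) = F' (μ ((a ⊗ₜ v) ⊗ₜ s))) → ∀ x, F x = F' x := by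
    intro Y _ _ F F' hF x
    obtain ⟨t, rfl⟩ := hV.2 x
    refine LinearMap.congr_fun (f := F ∘ₗ μ) (g := F' ∘ₗ μ) (TensorProduct.ext_threefold ?_) t
    exact hF
  refine ⟨G ∘ₗ e.symm.toLinearMap, ⟨fun r => key ((G ∘ₗ e.symm.toLinearMap) ∘ₗ (BimAct.of k A X).l r)
    (b.l r ∘ₗ G ∘ₗ e.symm.toLinearMap) ?_,
    fun r => key ((G ∘ₗ e.symm.toLinearMap) ∘ₗ (BimAct.of k A X).r r)
    (b.r r ∘ₗ G ∘ₗ e.symm.toLinearMap) ?_⟩, key (p ∘ₗ G ∘ₗ e.symm.toLinearMap) f ?_⟩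
  · intro a v s
    have h1 : (BimAct.of k A X).l r (μ ((a ⊗ₜ v) ⊗ₜ s)) = μ (((r * a) ⊗ₜ v) ⊗ₜ s) := by
      simp only [hμt, BimAct.of_l, lact_ract k, mul_smul]
    simp only [LinearMap.comp_apply, LinearEquiv.coe_coe, h1, hs, hGt, b.comm, map_mul,
      Module.End.mul_apply]
  · intro a v s
    have h1 : (BimAct.of k A X).r r (μ ((a ⊗ₜ v) ⊗ₜ s)) = μ ((a ⊗ₜ v) ⊗ₜ (s * r)) := by
      simp only [hμt, BimAct.of_r, MulOpposite.op_mul, mul_smul]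
    simp only [LinearMap.comp_apply, LinearEquiv.coe_coe, h1, hs, hGt, b.r_mul]
  · intro a v s
    change p (G (e.symm (μ _))) = f (μ _)
    rw [hs, hGt, hp.right, hp.left, hg, hμt]
    exact ((hf.right s _).trans (congrArg _ (hf.left a _))).symm

/-- A projective bimodule has the lifting property for left modules. -/
lemma LiftProp.left {a : BimAct k R X} (ha : LiftProp a) (l : R →ₐ[k] Module.End k M)
    (l' : R →ₐ[k] Module.End k N) (p : M →ₗ[k] N) (f : X →ₗ[k] N) (hp : p ∈ leftHom l l')
    (hf : f ∈ leftHom a.l l') (h : ∀ x, ∃ m, p m = f x) :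
    ∃ g ∈ leftHom a.l l, ∀ x, p (g x) = f x := by
  -- Coinduction is right adjoint to forgetting the right action: a left linear f corresponds to the
  -- bimodule map x ↦ (t ↦ f(xt)), and f is recovered by evaluation at 1.
  obtain ⟨g, hg, hpg⟩ := ha (BimAct.coind l) (BimAct.coind l') (LinearMap.compRight k p)
    (LinearMap.compRight k f ∘ₗ a.r.flip) ⟨fun r x => by ext t; exact hp r (x t), fun r x => rfl⟩
    ⟨fun r x => by
      ext t
      change f (a.r t (a.l r x)) = l' r (f (a.r t x))
      rw [← a.comm]
      exact hf r _, fun r x => by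
      ext t
      change f (a.r t (a.r r x)) = f (a.r (r * t) x)
      rw [a.r_mul]; rfl⟩ (fun x => by
      -- Elements of the coinduced module are merely k-linear, so this preimage needs no
      -- equivariance.
      obtain ⟨g, hg⟩ := exists_linear_lift p (f ∘ₗ a.r.flip x) fun t => h _
      exact ⟨g, LinearMap.ext hg⟩)
  refine ⟨LinearMap.applyₗ 1 ∘ₗ g, fun r x => ?_, fun x => ?_⟩
  · change g (a.l r x) 1 = l r (g x 1)
    rw [hg.left]; rfl
  · refine (LinearMap.congr_fun (hpg x) 1).trans ?_
    change f (a.r 1 x) = f x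
    rw [a.r_one]; rfl

end BimoduleActions

/-! ### Degree by degree construction of chain maps and homotopies -/

section Recursion
variable {k X Y : Type u} [Field k] [AddCommGroup X] [Module k X] [AddCommGroup Y] [Module k Y]

namespace GrCx

/-- The linear map with prescribed restrictions to the homogeneous components. -/
def glue (C : GrCx k X) (h : ℕ → X →ₗ[k] Y) : X →ₗ[k] Y :=
  DirectSum.toModule k ℕ Y (fun n => h n ∘ₗ (C.gr n).subtype) ∘ₗ
    (decompEquiv C.isInternal).symm.toLinearMap

lemma glue_mem (C : GrCx k X) (h : ℕ → X →ₗ[k] Y) {n : ℕ} {x : X} (hx : x ∈ C.gr n) :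
    C.glue h x = h n x := by
  have : (decompEquiv C.isInternal).symm x = DirectSum.lof k ℕ (fun i => C.gr i) n ⟨x, hx⟩ := by
    rw [LinearEquiv.symm_apply_eq]
    exact (DirectSum.coeLinearMap_lof C.gr n ⟨x, hx⟩).symm
  simp [glue, this]

/-- Maps in the class `H` lift degreewise along `δ : T n → Y`. -/
def HasLifts (C : GrCx k X) (H : Submodule k (X →ₗ[k] Y)) (T : ℕ → Submodule k Y)
    (δ : Y →ₗ[k] Y) : Prop :=
  ∀ m n, ∀ f ∈ H, (∀ x ∈ C.gr m, f x ∈ (T n).map δ) →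
    ∃ h ∈ H, ∀ x ∈ C.gr m, h x ∈ T n ∧ δ (h x) = f x

/-- Degreewise construction of maps out of a complex of projectives: chain maps (`e = 0`,
`κ = 1`) and homotopies (`κ = -1`). -/
lemma exists_seq (C : GrCx k X) {H : Submodule k (X →ₗ[k] Y)} {T : ℕ → Submodule k Y}
    {δ : Y →ₗ[k] Y} (hH : ∀ f ∈ H, f ∘ₗ C.d ∈ H) (hl : C.HasLifts H T δ)
    (hT : ∀ n, ∀ y ∈ T (n + 1), δ y = 0 → y ∈ (T (n + 2)).map δ)
    {e : X →ₗ[k] Y} (he : e ∈ H) (κ : k) (hed : ∀ x, δ (e x) + κ • e (C.d x) = 0)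
    (heT : ∀ n, ∀ x ∈ C.gr (n + 1), e x ∈ T n) (h0 : X →ₗ[k] Y) (h0H : h0 ∈ H)
    (h0T : ∀ x ∈ C.gr 0, h0 x ∈ T 0)
    (h0d : ∀ x ∈ C.gr 1, e x + κ • h0 (C.d x) ∈ (T 1).map δ) :
    ∃ h : ℕ → X →ₗ[k] Y, h 0 = h0 ∧ (∀ n, h n ∈ H) ∧ (∀ n, ∀ x ∈ C.gr n, h n x ∈ T n) ∧
      ∀ n, ∀ x ∈ C.gr (n + 1), δ (h (n + 1) x) = e x + κ • h n (C.d x) := by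
  -- The invariant carries the solvability of the next equation, so each step solves one lifting
  -- problem and then restores solvability by exactness.
  let Q : ℕ → (X →ₗ[k] Y) → Prop := fun n h => h ∈ H ∧ (∀ x ∈ C.gr n, h x ∈ T n) ∧
    ∀ x ∈ C.gr (n + 1), e x + κ • h (C.d x) ∈ (T (n + 1)).map δ
  have step : ∀ n (h : {h // Q n h}), ∃ h' : {h // Q (n + 1) h}, ∀ x ∈ C.gr (n + 1),
      δ (h'.1 x) = e x + κ • h.1 (C.d x) := by
    rintro n ⟨h, hh, hhT, hhd⟩
    obtain ⟨h', hh', hx'⟩ := hl (n + 1) (n + 1) (e + κ • (h ∘ₗ C.d))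
      (add_mem he (H.smul_mem _ (hH h hh))) hhd
    refine ⟨⟨h', hh', fun x hx => (hx' x hx).1, fun x hx => ?_⟩, fun x hx => (hx' x hx).2⟩
    have hdx := C.d_mem _ x hx
    -- The new right-hand side is a cycle: since d² = 0, its image under δ is δ(e x) + κ e(dx),
    -- which vanishes by hypothesis.
    refine hT n _ (add_mem (heT _ x hx) (Submodule.smul_mem _ _ (hx' _ hdx).1)) ?_
    rw [map_add, map_smul, (hx' _ hdx).2]
    simp [C.d_d, hed]
  choose F hF using step
  let s : ∀ n, {h // Q n h} := fun n => Nat.rec ⟨h0, h0H, h0T, h0d⟩ (fun n h => F n h) n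
  exact ⟨fun n => (s n).1, rfl, fun n => (s n).2.1, fun n => (s n).2.2.1, fun n => hF n (s n)⟩

/-- Two chain maps that agree on the augmentation are homotopic. -/
lemma exists_nullhomotopy (C : GrCx k X) {H : Submodule k (X →ₗ[k] Y)} {T : ℕ → Submodule k Y}
    {δ : Y →ₗ[k] Y} (hH : ∀ f ∈ H, f ∘ₗ C.d ∈ H) (hg : ∀ h : ℕ → X →ₗ[k] Y, (∀ n, h n ∈ H) →
    C.glue h ∈ H) (hl : C.HasLifts H T δ)
    (hT : ∀ n, ∀ y ∈ T (n + 1), δ y = 0 → y ∈ (T (n + 2)).map δ)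
    {e : X →ₗ[k] Y} (he : e ∈ H) (hed : ∀ x, δ (e x) = e (C.d x))
    (heT : ∀ n, ∀ x ∈ C.gr n, e x ∈ T n) (he0 : ∀ x ∈ C.gr 0, e x ∈ (T 1).map δ) :
    ∃ s ∈ H, (∀ n, ∀ x ∈ C.gr n, s x ∈ T (n + 1)) ∧ ∀ x, δ (s x) + s (C.d x) = e x := by
  obtain ⟨h0, h0H, h0x⟩ := hl 0 1 e he he0
  -- A homotopy raises degrees by one, hence the shift of T; with κ = -1 the recursion reads δ hₙ₊₁
  -- = e - hₙ d.
  obtain ⟨h, rfl, hH', hhT, hhd⟩ := C.exists_seq (T := fun n => T (n + 1)) (κ := -1) hH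
    (fun m n => hl m (n + 1)) (fun n => hT (n + 1)) he (fun x => by simp [hed]) (fun n => heT (n + 1)) h0 h0H
    (fun x hx => (h0x x hx).1) (fun x hx => hT 0 _
      (add_mem (heT 1 x hx) (Submodule.smul_mem _ _ (h0x _ (C.d_mem 0 x hx)).1)) (by
        rw [map_add, map_smul, (h0x _ (C.d_mem 0 x hx)).2]
        simp [hed]))
  refine ⟨C.glue h, hg h hH', fun n x hx => by rw [C.glue_mem h hx]; exact hhT n x hx, fun x => ?_⟩
  refine LinearMap.congr_fun (f := δ ∘ₗ C.glue h + C.glue h ∘ₗ C.d) (g := e)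
    (ext_gr C.isInternal fun n x hx => ?_) x
  rw [LinearMap.add_apply, LinearMap.comp_apply, LinearMap.comp_apply, C.glue_mem h hx]
  rcases n with _ | n
  · rw [C.d_gr_zero x hx, (h0x x hx).2]; simp
  · rw [C.glue_mem h (C.d_mem n x hx), hhd n x hx]; simp

lemma proj_mem_gr (C : GrCx k X) (n : ℕ) (x : X) : C.proj n x ∈ C.gr n := by
  refine LinearMap.congr_fun (f := (C.gr n).mkQ ∘ₗ C.proj n) (g := 0)
    (ext_gr C.isInternal fun i y hy => ?_) x |> (Submodule.Quotient.mk_eq_zero _).1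
  by_cases him : i = n
  · subst him; simpa [C.proj_mem hy] using hy
  · simp [C.proj_mem_ne him hy]

/-- Over a field nothing obstructs a linear lift. Composing with the projection to degree m is
needed because values are known to lift only there. -/
lemma hasLifts_top (C : GrCx k X) (T : ℕ → Submodule k Y) (δ : Y →ₗ[k] Y) :
    C.HasLifts ⊤ T δ := by
  intro m n f _ hf
  obtain ⟨g, hg⟩ := exists_linear_lift (δ ∘ₗ (T n).subtype) (f ∘ₗ C.proj m) fun x => by
    obtain ⟨y, hy, hyx⟩ := hf _ (C.proj_mem_gr m x)
    exact ⟨⟨y, hy⟩, hyx⟩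
  refine ⟨(T n).subtype ∘ₗ g, trivial, fun x hx => ⟨(g x).2, ?_⟩⟩
  have := hg x
  rwa [LinearMap.comp_apply, LinearMap.comp_apply, C.proj_mem hx] at this

end GrCx
end Recursion

/-! ### Comparison theorem, and exactness of the tensor square of a resolution -/

section Resolutions
variable {k R X X' Y B : Type u} [Field k] [Ring R] [Algebra k R] [AddCommGroup X] [Module k X]
  [Module R X] [Module Rᵐᵒᵖ X] [IsBimod k R X] [AddCommGroup X'] [Module k X']
  [Module R X'] [Module Rᵐᵒᵖ X'] [IsBimod k R X'] [AddCommGroup Y] [Module k Y]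
  [Ring B] [Algebra k B]

variable (k R X) in
/-- The actions of `R` on `X ⊗_R X`. -/
def sqAct : BimAct k R (Sq k R X) where
  l := AlgHom.ofLinearMap
    { toFun := fun r => sqL X r
      map_add' := fun r s => BTen.hom_ext fun x y => by
        simp [sqL, TensorProduct.add_tmul]
      map_smul' := fun c r => BTen.hom_ext fun x y => by
        simp [sqL, ← TensorProduct.smul_tmul'] }
    (BTen.hom_ext fun x y => by simp [sqL])
    (fun r s => BTen.hom_ext fun x y => by simp [sqL, mul_smul])
  r :=
    { toFun := fun r => sqR X r
      map_add' := fun r s => BTen.hom_ext fun x y => by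
        simp [sqR, TensorProduct.tmul_add]
      map_smul' := fun c r => BTen.hom_ext fun x y => by
        simp [sqR] }
  r_one := BTen.hom_ext fun x y => by simp [sqR]
  r_mul a b := BTen.hom_ext fun x y => by simp [sqR, mul_smul]
  comm a b m := LinearMap.congr_fun (f := sqL X a ∘ₗ sqR X b) (g := sqR X b ∘ₗ sqL X a)
    (BTen.hom_ext fun x y => by simp [sqR, sqL]) m

namespace AugBimodCx
variable (C : AugBimodCx k R X)

lemma isBiHom_d : IsBiHom (BimAct.of k R X) (BimAct.of k R X) C.d := ⟨C.d_smul, C.d_op_smul⟩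

lemma isBiHom_proj (n : ℕ) : IsBiHom (BimAct.of k R X) (BimAct.of k R X) (C.proj n) :=
  ⟨C.scale_smul _, C.scale_op _⟩

lemma glue_mem_biHom (b : BimAct k R Y) {h : ℕ → X →ₗ[k] Y}
    (hh : ∀ n, h n ∈ biHom (BimAct.of k R X) b) : C.glue h ∈ biHom (BimAct.of k R X) b := by
  constructor
  · intro r
    refine LinearMap.congr_fun (f := C.glue h ∘ₗ (BimAct.of k R X).l r) (g := b.l r ∘ₗ C.glue h)
      (ext_gr C.isInternal fun n x hx => ?_)
    simp only [LinearMap.comp_apply, BimAct.of_l, C.glue_mem h hx,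
      C.glue_mem h (C.smul_mem n r x hx)]
    exact (hh n).left r x
  · intro r
    refine LinearMap.congr_fun (f := C.glue h ∘ₗ (BimAct.of k R X).r r) (g := b.r r ∘ₗ C.glue h)
      (ext_gr C.isInternal fun n x hx => ?_)
    simp only [LinearMap.comp_apply, BimAct.of_r, C.glue_mem h hx,
      C.glue_mem h (C.op_smul_mem n r x hx)]
    exact (hh n).right r x

lemma glue_mem_leftHom (l : R →ₐ[k] Module.End k Y) {h : ℕ → X →ₗ[k] Y}
    (hh : ∀ n, h n ∈ leftHom (BimAct.of k R X).l l) :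
    C.glue h ∈ leftHom (BimAct.of k R X).l l := by
  intro r
  refine LinearMap.congr_fun (f := C.glue h ∘ₗ (BimAct.of k R X).l r) (g := l r ∘ₗ C.glue h)
    (ext_gr C.isInternal fun n x hx => ?_)
  simp only [LinearMap.comp_apply, BimAct.of_l, C.glue_mem h hx,
    C.glue_mem h (C.smul_mem n r x hx)]
  exact hh n r x

/-- The lifting property concerns all of X, while the hypothesis concerns one degree, so f is first
composed with the projection to that degree. Restricting the source of δ to the stable subspace T n
forces the lift to have the right degree. -/
lemma hasLifts_biHom (hX : LiftProp (BimAct.of k R X)) (b : BimAct k R Y)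
    {T : ℕ → Submodule k Y} {δ : Y →ₗ[k] Y} (hl : ∀ n r, ∀ y ∈ T n, b.l r y ∈ T n)
    (hr : ∀ n r, ∀ y ∈ T n, b.r r y ∈ T n) (hδ : IsBiHom b b δ) :
    C.HasLifts (biHom (BimAct.of k R X) b) T δ := by
  intro m n f hf h
  obtain ⟨g, hg, hgx⟩ := hX (b.sub (T n) (hl n) (hr n)) b (δ ∘ₗ (T n).subtype) (f ∘ₗ C.proj m)
    ⟨fun r x => hδ.left r x, fun r x => hδ.right r x⟩
    (IsBiHom.comp hf (C.isBiHom_proj m)) fun x => by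
      obtain ⟨y, hy, hyx⟩ := h _ (C.proj_mem_gr m x)
      exact ⟨⟨y, hy⟩, hyx⟩
  refine ⟨(T n).subtype ∘ₗ g, ⟨fun r x => congrArg Subtype.val (hg.left r x),
    fun r x => congrArg Subtype.val (hg.right r x)⟩, fun x hx => ⟨(g x).2, ?_⟩⟩
  have := hgx x
  rwa [LinearMap.comp_apply, LinearMap.comp_apply, C.proj_mem hx] at this

/-- Same argument as for bimodule maps, with `LiftProp.left` in place of the lifting property. It
provides homotopies that are linear on one side only. -/
lemma hasLifts_leftHom (hX : LiftProp (BimAct.of k R X)) (b : BimAct k R Y)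
    {T : ℕ → Submodule k Y} {δ : Y →ₗ[k] Y} (hl : ∀ n r, ∀ y ∈ T n, b.l r y ∈ T n)
    (hr : ∀ n r, ∀ y ∈ T n, b.r r y ∈ T n) (hδ : IsBiHom b b δ) :
    C.HasLifts (leftHom (BimAct.of k R X).l b.l) T δ := by
  intro m n f hf h
  obtain ⟨g, hg, hgx⟩ := hX.left (b.sub (T n) (hl n) (hr n)).l b.l (δ ∘ₗ (T n).subtype)
    (f ∘ₗ C.proj m) (fun r x => hδ.left r x)
    (fun r x => by
      rw [LinearMap.comp_apply, LinearMap.comp_apply, ← hf, (C.isBiHom_proj m).left]) fun x => by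
      obtain ⟨y, hy, hyx⟩ := h _ (C.proj_mem_gr m x)
      exact ⟨⟨y, hy⟩, hyx⟩
  refine ⟨(T n).subtype ∘ₗ g, fun r x => congrArg Subtype.val (hg r x),
    fun x hx => ⟨(g x).2, ?_⟩⟩
  have := hgx x
  rwa [LinearMap.comp_apply, LinearMap.comp_apply, C.proj_mem hx] at this

/-- Bimodule chain maps from a projective complex to an exact one are null-homotopic if they
vanish on the augmentation. -/
lemma exists_biHom_nullhomotopy (hX : LiftProp (BimAct.of k R X)) (b : BimAct k R Y)
    {T : ℕ → Submodule k Y} {δ : Y →ₗ[k] Y} (hl : ∀ n r, ∀ y ∈ T n, b.l r y ∈ T n)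
    (hr : ∀ n r, ∀ y ∈ T n, b.r r y ∈ T n) (hδ : IsBiHom b b δ)
    (hT : ∀ n, ∀ y ∈ T (n + 1), δ y = 0 → y ∈ (T (n + 2)).map δ)
    {e : X →ₗ[k] Y} (he : IsBiHom (BimAct.of k R X) b e) (hed : ∀ x, δ (e x) = e (C.d x))
    (heT : ∀ n, ∀ x ∈ C.gr n, e x ∈ T n) (he0 : ∀ x ∈ C.gr 0, e x ∈ (T 1).map δ) :
    ∃ s : X →ₗ[k] Y, IsBiHom (BimAct.of k R X) b s ∧ (∀ n, ∀ x ∈ C.gr n, s x ∈ T (n + 1)) ∧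
      ∀ x, δ (s x) + s (C.d x) = e x :=
  C.exists_nullhomotopy (H := biHom (BimAct.of k R X) b) (fun _ hf => IsBiHom.comp hf C.isBiHom_d)
    (fun _ => C.glue_mem_biHom b) (C.hasLifts_biHom hX b hl hr hδ) hT he hed heT he0

/-- The comparison theorem. -/
lemma exists_hom (hX : LiftProp (BimAct.of k R X)) {C' : AugBimodCx k R X'}
    (hC' : C'.IsResolution) : Nonempty (C.Hom C') := by
  obtain ⟨w, hw0, hw1⟩ := hC'.surj 1
  obtain ⟨g, hg, hgx⟩ := hX ((BimAct.of k R X').sub (C'.gr 0) (C'.smul_mem 0)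
      (C'.op_smul_mem 0)) (BimAct.self k R) (C'.aug ∘ₗ (C'.gr 0).subtype) C.aug
      ⟨fun r x => C'.aug_smul _ _, fun r x => C'.aug_op_smul _ _⟩
      ⟨C.aug_smul, C.aug_op_smul⟩
      -- Only a preimage for each single x is asked for. Since w lies over 1, left multiples of w
      -- provide them, although this choice is not a bimodule map.
      (fun x => ⟨⟨C.aug x • w, C'.smul_mem 0 _ _ hw0⟩, by simp [C'.aug_smul, hw1]⟩)
  let h0 : X →ₗ[k] X' := (C'.gr 0).subtype ∘ₗ g
  have h0x : ∀ x, C'.aug (h0 x) = C.aug x := hgx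
  have h0H : IsBiHom (BimAct.of k R X) (BimAct.of k R X') h0 :=
    ⟨fun r x => congrArg Subtype.val (hg.left r x), fun r x => congrArg Subtype.val (hg.right r x)⟩
  -- With e = 0 and κ = 1 the recursion is the chain map equation.
  obtain ⟨h, h00, hH, hhT, hhd⟩ := C.exists_seq (H := biHom (BimAct.of k R X) (BimAct.of k R X'))
    (T := C'.gr) (δ := C'.d) (e := 0) (κ := 1) (fun _ hf => IsBiHom.comp hf C.isBiHom_d)
    (C.hasLifts_biHom hX _ C'.smul_mem C'.op_smul_mem C'.isBiHom_d) hC'.exact_succ (zero_mem _)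
    (by simp) (by simp) h0 h0H (fun x _ => (g x).2) (fun x hx => by
      rw [LinearMap.zero_apply, zero_add, one_smul]
      exact hC'.exact_zero _ (g _).2 ((h0x _).trans (C.aug_d x)))
  have hG := C.glue_mem_biHom _ hH
  refine ⟨⟨C.glue h, hG.left, hG.right, fun n x hx => by rw [C.glue_mem h hx]; exact hhT n x hx,
    fun x => ?_, fun x => ?_⟩⟩
  · refine LinearMap.congr_fun (f := C.glue h ∘ₗ C.d) (g := C'.d ∘ₗ C.glue h)
      (ext_gr C.isInternal fun n x hx => ?_) x
    rw [LinearMap.comp_apply, LinearMap.comp_apply, C.glue_mem h hx]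
    rcases n with _ | n
    · rw [C.d_gr_zero x hx, C'.d_gr_zero _ (hhT 0 x hx), map_zero]
    · rw [C.glue_mem h (C.d_mem n x hx), hhd n x hx]; simp
  · refine LinearMap.congr_fun (f := C'.aug ∘ₗ C.glue h) (g := C.aug)
      (ext_gr C.isInternal fun n x hx => ?_) x
    rw [LinearMap.comp_apply, C.glue_mem h hx]
    rcases n with _ | n
    · rw [h00, h0x]
    · rw [C'.aug_pos n _ (hhT _ x hx), C.aug_pos n x hx]

/-- The augmentation X → R splits left linearly by r ↦ r x₀, and the difference between the identity
and the resulting idempotent is a chain map that dies on the augmentation. Left linearity of the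
contraction is what lets it act on the second factor of X ⊗_R X; a homotopy linear on both sides is
not available. -/
lemma exists_left_contraction (hX : LiftProp (BimAct.of k R X)) (hC : C.IsResolution) :
    ∃ x₀ ∈ C.gr 0, C.aug x₀ = 1 ∧ ∃ s : X →ₗ[k] X, (∀ (r : R) x, s (r • x) = r • s x) ∧
      (∀ n, ∀ x ∈ C.gr n, s x ∈ C.gr (n + 1)) ∧ ∀ x, C.d (s x) + s (C.d x) = x - C.aug x • x₀ := by
  obtain ⟨w, hw0, hw1⟩ := hC.surj 1
  refine ⟨w, hw0, hw1, ?_⟩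
  let e : X →ₗ[k] X := LinearMap.id - (lact k R X).flip w ∘ₗ C.aug
  have he : ∀ x, e x = x - C.aug x • w := fun x => rfl
  obtain ⟨s, hs, hsg, hsd⟩ := C.exists_nullhomotopy (T := C.gr) (δ := C.d) (e := e)
    (H := leftHom (BimAct.of k R X).l (BimAct.of k R X).l)
    (fun f hf r x => by
      simp only [LinearMap.comp_apply, C.isBiHom_d.left]; exact hf r _)
    (fun _ => C.glue_mem_leftHom _)
    (C.hasLifts_leftHom hX _ C.smul_mem C.op_smul_mem C.isBiHom_d)
    hC.exact_succ (fun r x => by simp [he, C.aug_smul, mul_smul, smul_sub])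
    (fun x => by simp [he, C.aug_d, C.d_smul, C.d_gr_zero w hw0])
    (fun n x hx => by
      rcases n with _ | n
      · exact sub_mem hx (C.smul_mem 0 _ _ hw0)
      · rw [he, C.aug_pos n x hx, zero_smul, sub_zero]; exact hx)
    (fun x hx => hC.exact_zero _ (sub_mem hx (C.smul_mem 0 _ _ hw0))
      (by rw [he, map_sub, C.aug_smul, hw1, mul_one, sub_self]))
  exact ⟨s, hs, hsg, hsd⟩

/-- The homogeneous components of `X ⊗_R X`. -/
def sqGr (n : ℕ) : Submodule k (Sq k R X) := (C.tensorGr C.toGrCx n).map (sqMk k R X)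

variable {C}

lemma sqGr_le {n : ℕ} {S : Submodule k (Sq k R X)} (h : ∀ i j, i + j = n → ∀ x ∈ C.gr i,
    ∀ y ∈ C.gr j, sqMk k R X (x ⊗ₜ y) ∈ S) : C.sqGr n ≤ S := by
  refine Submodule.map_le_iff_le_comap.2 (Submodule.span_le.2 ?_)
  rintro _ ⟨i, j, hij, x, hx, y, hy, rfl⟩
  exact h i j hij x hx y hy

lemma sqMk_mem {i j n : ℕ} (h : i + j = n) {x y : X} (hx : x ∈ C.gr i) (hy : y ∈ C.gr j) :
    sqMk k R X (x ⊗ₜ y) ∈ C.sqGr n :=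
  Submodule.mem_map_of_mem (Submodule.subset_span ⟨i, j, h, x, hx, y, hy, rfl⟩)

lemma sqL_mem (n : ℕ) (r : R) (t : Sq k R X) (ht : t ∈ C.sqGr n) : sqL X r t ∈ C.sqGr n :=
  sqGr_le (S := (C.sqGr n).comap (sqL X r))
    (fun _ _ hij x hx _ hy => sqMk_mem hij (C.smul_mem _ r x hx) hy) ht

lemma sqR_mem (n : ℕ) (r : R) (t : Sq k R X) (ht : t ∈ C.sqGr n) : sqR X r t ∈ C.sqGr n :=
  sqGr_le (S := (C.sqGr n).comap (sqR X r))
    (fun _ _ hij _ hx y hy => sqMk_mem hij hx (C.op_smul_mem _ r y hy)) ht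

variable (C) in
lemma sqD_mk (x y : X) : C.sqD (sqMk k R X (x ⊗ₜ y)) =
    sqMk k R X (C.d x ⊗ₜ y) + sqMk k R X (C.sgn x ⊗ₜ C.d y) := by
  simp [sqD, GrCx.tensorD]

variable (C) in
lemma isBiHom_sqD : IsBiHom (sqAct k R X) (sqAct k R X) C.sqD := by
  constructor
  · intro r
    refine LinearMap.congr_fun (f := C.sqD ∘ₗ sqL X r) (g := sqL X r ∘ₗ C.sqD)
      (BTen.hom_ext fun x y => ?_)
    change C.sqD (sqMk k R X ((r • x) ⊗ₜ y)) = sqL X r (C.sqD (sqMk k R X (x ⊗ₜ y)))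
    rw [sqD_mk, sqD_mk, map_add, C.d_smul, GrCx.sgn, C.scale_smul]
    rfl
  · intro r
    refine LinearMap.congr_fun (f := C.sqD ∘ₗ sqR X r) (g := sqR X r ∘ₗ C.sqD)
      (BTen.hom_ext fun x y => ?_)
    change C.sqD (sqMk k R X (x ⊗ₜ (MulOpposite.op r • y)))
      = sqR X r (C.sqD (sqMk k R X (x ⊗ₜ y)))
    rw [sqD_mk, sqD_mk, map_add, C.d_op_smul]
    rfl

/-- The tensor square of a projective resolution is a resolution. -/
lemma IsResolution.sq (hX : LiftProp (BimAct.of k R X)) (hC : C.IsResolution) :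
    (∀ t ∈ C.sqGr 0, C.sqAug t = 0 → t ∈ (C.sqGr 1).map C.sqD) ∧
      ∀ n, ∀ t ∈ C.sqGr (n + 1), C.sqD t = 0 → t ∈ (C.sqGr (n + 2)).map C.sqD := by
  obtain ⟨w, hw0, hw1, s, hsl, hsg, hsd⟩ := C.exists_left_contraction hX hC
  -- The candidate homotopy is the contraction on the second factor, with the Koszul sign of moving
  -- a degree one operator past x. It descends to the balanced tensor product because s is left
  -- linear.
  let s2 : Sq k R X →ₗ[k] Sq k R X := BTen.map (TensorProduct.map C.sgn s) fun r x y => by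
    simp only [TensorProduct.map_tmul, ract_apply, lact_apply, GrCx.sgn, C.scale_op, hsl]
    exact BTen.mk_bal r _ _
  have hs2 : ∀ x y, s2 (sqMk k R X (x ⊗ₜ y)) = sqMk k R X (C.sgn x ⊗ₜ s y) := fun x y => rfl
  -- The maps q and j compare X ⊗_R X with X ⊗_R R = X, by the augmentation and by the chosen
  -- element w over 1.
  let q : Sq k R X →ₗ[k] X := BTen.lift (TensorProduct.lift ((ract k R X).flip.compl₂ C.aug))
    fun r x y => by simp [C.aug_smul, mul_smul]
  have hq : ∀ x y, q (sqMk k R X (x ⊗ₜ y)) = MulOpposite.op (C.aug y) • x := fun x y => rfl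
  let j : X →ₗ[k] Sq k R X := sqMk k R X ∘ₗ (TensorProduct.mk k X X).flip w
  have hj : ∀ x, j x = sqMk k R X (x ⊗ₜ w) := fun x => rfl
  have hjd : ∀ x, C.sqD (j x) = j (C.d x) := fun x => by
    rw [hj, sqD_mk, C.d_gr_zero w hw0, TensorProduct.tmul_zero, map_zero, add_zero, hj]
  have hqd : ∀ t, q (C.sqD t) = C.d (q t) := by
    refine LinearMap.congr_fun (f := q ∘ₗ C.sqD) (g := C.d ∘ₗ q) (BTen.hom_ext fun x y => ?_)
    change q (C.sqD (sqMk k R X (x ⊗ₜ y))) = C.d (q (sqMk k R X (x ⊗ₜ y)))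
    rw [sqD_mk, map_add, hq, hq, hq, C.aug_d, C.d_op_smul]
    simp
  have hqg : ∀ n, ∀ t ∈ C.sqGr n, q t ∈ C.gr n := by
    intro n
    refine sqGr_le (S := (C.gr n).comap q) fun i l hil x hx y hy => ?_
    rw [Submodule.mem_comap, hq]
    rcases l with _ | l
    · obtain rfl : i = n := by omega
      exact C.op_smul_mem i _ _ hx
    · rw [C.aug_pos l y hy]; simp
  have hs2g : ∀ n, ∀ t ∈ C.sqGr n, s2 t ∈ C.sqGr (n + 1) := by
    intro n
    refine sqGr_le (S := (C.sqGr (n + 1)).comap s2) fun i l hil x hx y hy => ?_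
    rw [Submodule.mem_comap, hs2]
    refine sqMk_mem (i := i) (j := l + 1) (by omega) ?_ (hsg l y hy)
    rw [C.sgn_mem hx]; exact zsmul_mem hx _
  have hjg : ∀ n, ∀ x ∈ C.gr n, j x ∈ C.sqGr n := fun n x hx => sqMk_mem (add_zero n) hx hw0
  have hqa : ∀ t, C.aug (q t) = C.sqAug t := by
    refine LinearMap.congr_fun (f := C.aug ∘ₗ q) (g := C.sqAug) (BTen.hom_ext fun x y => ?_)
    change C.aug (MulOpposite.op (C.aug y) • x) = _
    rw [C.aug_op_smul]; rfl
  -- Up to the homotopy s2 the tensor square is X itself, so its exactness reduces to that of X.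
  have key : ∀ t, C.sqD (s2 t) + s2 (C.sqD t) = t - j (q t) := by
    refine LinearMap.congr_fun (f := C.sqD ∘ₗ s2 + s2 ∘ₗ C.sqD) (g := LinearMap.id - j ∘ₗ q)
      (BTen.hom_ext fun x y => ?_)
    change C.sqD (s2 (sqMk k R X (x ⊗ₜ y))) + s2 (C.sqD (sqMk k R X (x ⊗ₜ y)))
      = sqMk k R X (x ⊗ₜ y) - j (q (sqMk k R X (x ⊗ₜ y)))
    have h1 : j (q (sqMk k R X (x ⊗ₜ y))) = sqMk k R X (x ⊗ₜ (C.aug y • w)) := by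
      rw [hq, hj]; exact BTen.mk_bal (C.aug y) x w
    rw [h1, ← map_sub, ← TensorProduct.tmul_sub, ← hsd y, hs2, sqD_mk, sqD_mk, map_add, hs2, hs2,
      C.sgn_sgn, C.d_sgn, TensorProduct.neg_tmul, map_neg, TensorProduct.tmul_add, map_add]
    abel
  constructor
  · intro t ht h0
    obtain ⟨v, hv, hvd⟩ := hC.exact_zero (q t) (hqg 0 t ht) (by rw [hqa, h0])
    have hD : C.sqD t = 0 := by
      have : C.sqGr 0 ≤ LinearMap.ker C.sqD := sqGr_le fun i l hil x hx y hy => by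
        obtain ⟨rfl, rfl⟩ : i = 0 ∧ l = 0 := by omega
        rw [LinearMap.mem_ker, sqD_mk, C.d_gr_zero x hx, C.d_gr_zero y hy]
        simp
      exact this ht
    -- For a cycle t the homotopy formula gives t = d(s2 t) + j(q t), and q t = dv by exactness of
    -- X.
    refine ⟨s2 t + j v, add_mem (hs2g 0 t ht) (hjg 1 v hv), ?_⟩
    have := key t
    rw [hD, map_zero, add_zero] at this
    rw [map_add, this, hjd, hvd, sub_add_cancel]
  · intro n t ht hD
    obtain ⟨v, hv, hvd⟩ := hC.exact_succ n (q t) (hqg _ t ht) (by rw [← hqd, hD, map_zero])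
    refine ⟨s2 t + j v, add_mem (hs2g _ t ht) (hjg _ v hv), ?_⟩
    have := key t
    rw [hD, map_zero, add_zero] at this
    rw [map_add, this, hjd, hvd, sub_add_cancel]

end AugBimodCx
end Resolutions

/-! ### Passage to cohomology of maps that are multiplicative up to homotopy -/

namespace DGAlg
variable {k : Type u} [Field k] {D E F : DGAlg k}

/-- Inverse of an isomorphism of cohomology algebras. -/
def HIso.symm (e : HIso D E) : HIso E D where
  iso n := (e.iso n).symm
  mul h x y := by
    rw [LinearEquiv.symm_apply_eq, e.mul]
    simp

/-- Composition of isomorphisms of cohomology algebras. -/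
def HIso.trans (e : HIso D E) (f : HIso E F) : HIso D F where
  iso n := (e.iso n).trans (f.iso n)
  mul h x y := by simp [e.mul, f.mul]

namespace CxMap

lemma H_eq_of_sub_mem {η θ : CxMap D E} {n : ℤ} (h : ∀ x ∈ D.Z n, η.f n x - θ.f n x ∈ E.Bd n) :
    η.H n = θ.H n := by
  refine Submodule.linearMap_qext _ (LinearMap.ext fun x => ?_)
  exact (Submodule.Quotient.eq _).2 (h x x.2)

/-- On cocycles two of the three terms of the homotopy formula vanish, and the remaining one is a
coboundary. -/
lemma H_mul (η : CxMap D E) (hη : η.IsMulUpToHomotopy) {p q r : ℤ} (h : p + q = r) (x : D.H p)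
    (y : D.H q) : η.H r (D.Hmul h x y) = E.Hmul h (η.H p x) (η.H q y) := by
  obtain ⟨x, rfl⟩ := Submodule.mkQ_surjective _ x
  obtain ⟨y, rfl⟩ := Submodule.mkQ_surjective _ y
  obtain ⟨c, hc⟩ := hη
  refine (Submodule.Quotient.eq _).2 ?_
  have := hc h (sub_add_cancel r 1) rfl rfl x.1 y.1
  rw [D.d_of_mem_Z rfl x.2, D.d_of_mem_Z rfl y.2, map_zero, map_zero, LinearMap.zero_apply,
    smul_zero, add_zero, add_zero] at this
  exact ⟨_, this.symm⟩

/-- A quasi-isomorphism that is multiplicative up to homotopy, on cohomology. -/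
def toHIso (η : CxMap D E) (hq : η.IsQuasiIso) (hη : η.IsMulUpToHomotopy) : HIso D E where
  iso n := LinearEquiv.ofBijective (η.H n) (hq n)
  mul h x y := η.H_mul hη h x y

/-- The inverse of a degreewise bijective morphism of complexes. -/
def ofBijective (η : CxMap D E) (h : ∀ n, Function.Bijective (η.f n)) : CxMap E D where
  f n := (LinearEquiv.ofBijective (η.f n) (h n)).symm.toLinearMap
  comm {m n} hmn x := by
    rw [LinearEquiv.coe_coe, LinearEquiv.symm_apply_eq]
    change _ = η.f n _
    rw [η.comm]
    congr 1
    exact ((LinearEquiv.ofBijective (η.f m) (h m)).apply_symm_apply x).symm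

lemma apply_ofBijective (η : CxMap D E) (h : ∀ n, Function.Bijective (η.f n)) (n : ℤ)
    (x : E.X n) : η.f n ((η.ofBijective h).f n x) = x :=
  (LinearEquiv.ofBijective (η.f n) (h n)).apply_symm_apply x

lemma ofBijective_apply (η : CxMap D E) (h : ∀ n, Function.Bijective (η.f n)) (n : ℤ)
    (x : D.X n) : (η.ofBijective h).f n (η.f n x) = x :=
  (LinearEquiv.ofBijective (η.f n) (h n)).symm_apply_apply x

lemma ofBijective_isQuasiIso (η : CxMap D E) (h : ∀ n, Function.Bijective (η.f n)) :
    (η.ofBijective h).IsQuasiIso := by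
  intro n
  refine Function.bijective_iff_has_inverse.2 ⟨η.H n, fun u => ?_, fun u => ?_⟩
  · obtain ⟨x, rfl⟩ := Submodule.mkQ_surjective _ u
    refine congrArg (E.cls n) (Subtype.ext ?_)
    exact η.apply_ofBijective h n x
  · obtain ⟨x, rfl⟩ := Submodule.mkQ_surjective _ u
    refine congrArg (D.cls n) (Subtype.ext ?_)
    exact η.ofBijective_apply h n x

/-- The inverse of a strictly multiplicative bijection is strictly multiplicative, so the zero
homotopy serves. -/
lemma ofBijective_isMul (η : CxMap D E) (h : ∀ n, Function.Bijective (η.f n))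
    (hη : ∀ {p q r : ℤ} (hr : p + q = r) (x : D.X p) (y : D.X q),
      η.f r (D.mul hr x y) = E.mul hr (η.f p x) (η.f q y)) :
    (η.ofBijective h).IsMulUpToHomotopy := by
  refine ⟨fun _ => 0, fun {p q r s p' q'} hr hs hp hq x y => ?_⟩
  have : (η.ofBijective h).f r (E.mul hr x y)
      = D.mul hr ((η.ofBijective h).f p x) ((η.ofBijective h).f q y) := by
    apply (h r).1
    rw [hη, apply_ofBijective, apply_ofBijective, apply_ofBijective]
  rw [this]
  simp

end CxMap
end DGAlg

/-! ### Pullback of cochains along comparison maps -/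

section Pullback
variable {k R X X' B : Type u} [Field k] [Ring R] [Algebra k R] [AddCommGroup X] [Module k X]
  [Module R X] [Module Rᵐᵒᵖ X] [IsBimod k R X] [AddCommGroup X'] [Module k X']
  [Module R X'] [Module Rᵐᵒᵖ X'] [IsBimod k R X'] [Ring B] [Algebra k B]

namespace AugBimodCx
variable {C : AugBimodCx k R X} {C' : AugBimodCx k R X'} {φ : R →ₐ[k] B}

lemma _root_.SmashHH.IsBiHom.sub {M N : Type u} [AddCommGroup M] [Module k M] [AddCommGroup N]
    [Module k N] {a : BimAct k R M} {b : BimAct k R N} {f g : M →ₗ[k] N} (hf : IsBiHom a b f)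
    (hg : IsBiHom a b g) : IsBiHom a b (f - g) :=
  Submodule.sub_mem (biHom a b) hf hg

/-- The composition of a bimodule map to `B` with a bimodule map. -/
def _root_.SmashHH.BHom.comp (f : BHom X' φ) (s : X →ₗ[k] X')
    (hs : IsBiHom (BimAct.of k R X) (BimAct.of k R X') s) : BHom X φ :=
  ⟨(f : X' →ₗ[k] B) ∘ₗ s, fun r x => (congrArg _ (hs.left r x)).trans (f.2.1 r _),
    fun r x => (congrArg _ (hs.right r x)).trans (f.2.2 r _)⟩

lemma homDeg_ext {n : ℤ} {f g : BHom X φ} (hf : f ∈ C.homDeg φ n) (hg : g ∈ C.homDeg φ n)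
    (h : ∀ i : ℕ, (i : ℤ) = n → ∀ x ∈ C.gr i, (f : X →ₗ[k] B) x = (g : X →ₗ[k] B) x) : f = g := by
  refine Subtype.ext (ext_gr C.isInternal fun i x hx => ?_)
  by_cases hi : (i : ℤ) = n
  · exact h i hi x hx
  · rw [hf i hi x hx, hg i hi x hx]

lemma apply_d_of_dHom_eq_zero {f : BHom X φ} (hf : C.dHom φ f = 0) (x : X) :
    (f : X →ₗ[k] B) (C.d x) = 0 := by
  have := LinearMap.congr_fun (congrArg Subtype.val hf) (C.sgn x)
  rw [dHom_apply, C.sgn_sgn] at this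
  exact this

/-- A null-homotopic map sends cocycles to coboundaries. -/
lemma exists_dHom_eq {e s : X →ₗ[k] X'} (hs : IsBiHom (BimAct.of k R X) (BimAct.of k R X') s)
    (hsg : ∀ n, ∀ x ∈ C.gr n, s x ∈ C'.gr (n + 1)) (he : ∀ x, C'.d (s x) + s (C.d x) = e x)
    {n : ℤ} {f : BHom X' φ} (hf : f ∈ C'.homDeg φ n) (hfd : C'.dHom φ f = 0) :
    ∃ g ∈ C.homDeg φ (n - 1), ∀ x, (C.dHom φ g : X →ₗ[k] B) x = (f : X' →ₗ[k] B) (e x) := by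
  have hfs : BHom.comp f s hs ∈ C.homDeg φ (n - 1) := fun i hi x hx =>
    hf (i + 1) (by push_cast; omega) _ (hsg i x hx)
  -- The differential on Hom carries the sign (-1)^i in degree i. Only i = n contributes, because f
  -- vanishes elsewhere, so the constant sign (-1)^n cancels it.
  refine ⟨sg n • BHom.comp f s hs, zsmul_mem hfs _, fun x => ?_⟩
  refine LinearMap.congr_fun (f := (C.dHom φ (sg n • BHom.comp f s hs) : X →ₗ[k] B))
    (g := (f : X' →ₗ[k] B) ∘ₗ e) (ext_gr C.isInternal fun i x hx => ?_) x
  rw [LinearMap.comp_apply, ← he, map_add, apply_d_of_dHom_eq_zero hfd, zero_add, dHom_apply,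
    C.sgn_mem hx, map_zsmul, map_zsmul]
  change sg i • sg n • (f : X' →ₗ[k] B) (s (C.d x)) = _
  by_cases hi : (i : ℤ) = n
  · rw [hi, smul_smul, sg_mul_self, one_smul]
  · rcases i with _ | i
    · rw [C.d_gr_zero x hx]; simp
    · rw [hf _ hi _ (hsg i _ (C.d_mem i x hx))]; simp

/-- Chain maps with the same augmentation out of a projective complex are homotopic. -/
lemma exists_homotopy (hX : LiftProp (BimAct.of k R X)) (hC' : C'.IsResolution)
    {c c' : X →ₗ[k] X'} (hc : IsBiHom (BimAct.of k R X) (BimAct.of k R X') c)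
    (hc' : IsBiHom (BimAct.of k R X) (BimAct.of k R X') c')
    (hcg : ∀ n, ∀ x ∈ C.gr n, c x ∈ C'.gr n) (hcg' : ∀ n, ∀ x ∈ C.gr n, c' x ∈ C'.gr n)
    (hcd : ∀ x, c (C.d x) = C'.d (c x)) (hcd' : ∀ x, c' (C.d x) = C'.d (c' x))
    (ha : ∀ x, C'.aug (c x) = C'.aug (c' x)) :
    ∃ s : X →ₗ[k] X', IsBiHom (BimAct.of k R X) (BimAct.of k R X') s ∧
      (∀ n, ∀ x ∈ C.gr n, s x ∈ C'.gr (n + 1)) ∧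
      ∀ x, C'.d (s x) + s (C.d x) = (c - c') x :=
  C.exists_biHom_nullhomotopy hX _ C'.smul_mem C'.op_smul_mem C'.isBiHom_d hC'.exact_succ
    (hc.sub hc') (fun x => by simp [hcd, hcd'])
    (fun n x hx => sub_mem (hcg n x hx) (hcg' n x hx))
    (fun x hx => hC'.exact_zero _ (sub_mem (hcg 0 x hx) (hcg' 0 x hx))
      (by rw [LinearMap.sub_apply, map_sub, ha, sub_self]))

lemma Hom.isBiHom (c : C.Hom C') : IsBiHom (BimAct.of k R X) (BimAct.of k R X') c.toFun :=
  ⟨c.map_smul, c.map_op_smul⟩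

/-- The map on cohomology does not depend on the comparison map. -/
lemma Hom.pullback_H_eq (hX : LiftProp (BimAct.of k R X)) (hC' : C'.IsResolution)
    (c c' : C.Hom C') (Δ' : C'.Diagonal) (Δ : C.Diagonal) (n : ℤ) :
    (c.pullback Δ' Δ φ).H n = (c'.pullback Δ' Δ φ).H n := by
  obtain ⟨s, hs, hsg, hsd⟩ := exists_homotopy hX hC' c.isBiHom c'.isBiHom c.map_gr c'.map_gr
    c.map_d c'.map_d fun x => by rw [c.aug_comp, c'.aug_comp]
  refine DGAlg.CxMap.H_eq_of_sub_mem fun f hf => ?_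
  have hf0 : C'.dHom φ f.1 = 0 := congrArg Subtype.val hf
  obtain ⟨g, hg, hgx⟩ := exists_dHom_eq hs hsg hsd f.2 hf0
  refine ⟨⟨g, hg⟩, Subtype.ext (Subtype.ext (LinearMap.ext fun x => ?_))⟩
  refine (hgx x).trans ?_
  exact map_sub (f.1 : X' →ₗ[k] B) _ _

/-- The composite of the two comparison maps is an endomorphism of a projective resolution lying
over the identity of R, hence homotopic to the identity. -/
lemma Hom.pullback_H_pullback_H (hX : LiftProp (BimAct.of k R X)) (hC : C.IsResolution)
    (c : C.Hom C') (c' : C'.Hom C) (Δ' : C'.Diagonal) (Δ : C.Diagonal) (n : ℤ)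
    (u : (Δ.homDGAlg φ).H n) :
    (c.pullback Δ' Δ φ).H n ((c'.pullback Δ Δ' φ).H n u) = u := by
  obtain ⟨f, rfl⟩ := Submodule.mkQ_surjective _ u
  obtain ⟨s, hs, hsg, hsd⟩ := exists_homotopy (c := c'.toFun ∘ₗ c.toFun) (c' := LinearMap.id)
    hX hC (c'.isBiHom.comp c.isBiHom) ⟨fun _ _ => rfl, fun _ _ => rfl⟩
    (fun n x hx => c'.map_gr n _ (c.map_gr n x hx)) (fun n x hx => hx)
    (fun x => by simp [c.map_d, c'.map_d]) (fun x => rfl)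
    fun x => by simp [c'.aug_comp, c.aug_comp]
  have hf0 : C.dHom φ f.1.1 = 0 := congrArg Subtype.val f.2
  obtain ⟨g, hg, hgx⟩ := exists_dHom_eq hs hsg hsd f.1.2 hf0
  refine (Submodule.Quotient.eq _).2 ⟨⟨g, hg⟩,
    Subtype.ext (Subtype.ext (LinearMap.ext fun x => ?_))⟩
  refine (hgx x).trans ?_
  exact map_sub (f.1.1 : X →ₗ[k] B) _ _

/-- Comparison maps between projective resolutions induce quasi-isomorphisms. -/
lemma Hom.pullback_isQuasiIso (hX : LiftProp (BimAct.of k R X)) (hC : C.IsResolution)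
    (hX' : LiftProp (BimAct.of k R X')) (hC' : C'.IsResolution) (c : C.Hom C')
    (Δ' : C'.Diagonal) (Δ : C.Diagonal) : (c.pullback Δ' Δ φ).IsQuasiIso := by
  obtain ⟨c'⟩ := C'.exists_hom hX' hC
  intro n
  exact Function.bijective_iff_has_inverse.2 ⟨(c'.pullback Δ Δ' φ).H n,
    fun u => pullback_H_pullback_H hX' hC' c' c Δ Δ' n u,
    fun u => pullback_H_pullback_H hX hC c c' Δ' Δ n u⟩

/-- The morphism `c ⊗ c` of tensor squares. -/
def Hom.sqMap (c : C.Hom C') : Sq k R X →ₗ[k] Sq k R X' :=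
  BTen.map (TensorProduct.map c.toFun c.toFun) fun r x y => by
    simp only [TensorProduct.map_tmul, ract_apply, lact_apply, c.map_smul, c.map_op_smul]
    exact BTen.mk_bal r _ _

lemma Hom.sqMap_mk (c : C.Hom C') (x y : X) :
    c.sqMap (sqMk k R X (x ⊗ₜ y)) = sqMk k R X' (c.toFun x ⊗ₜ c.toFun y) := rfl

lemma Hom.sqMap_isBiHom (c : C.Hom C') : IsBiHom (sqAct k R X) (sqAct k R X') c.sqMap := by
  constructor
  · intro r
    refine LinearMap.congr_fun (f := c.sqMap ∘ₗ sqL X r) (g := sqL X' r ∘ₗ c.sqMap)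
      (BTen.hom_ext fun x y => ?_)
    change sqMk k R X' (c.toFun (r • x) ⊗ₜ c.toFun y) = sqMk k R X' ((r • c.toFun x) ⊗ₜ c.toFun y)
    rw [c.map_smul]
  · intro r
    refine LinearMap.congr_fun (f := c.sqMap ∘ₗ sqR X r) (g := sqR X' r ∘ₗ c.sqMap)
      (BTen.hom_ext fun x y => ?_)
    change sqMk k R X' (c.toFun x ⊗ₜ c.toFun (MulOpposite.op r • y))
      = sqMk k R X' (c.toFun x ⊗ₜ (MulOpposite.op r • c.toFun y))
    rw [c.map_op_smul]

lemma Hom.map_sgn (c : C.Hom C') (x : X) : c.toFun (C.sgn x) = C'.sgn (c.toFun x) :=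
  C.scale_comm C'.toGrCx _ c.map_gr x

lemma Hom.sqMap_sqD (c : C.Hom C') (t : Sq k R X) : c.sqMap (C.sqD t) = C'.sqD (c.sqMap t) := by
  refine LinearMap.congr_fun (f := c.sqMap ∘ₗ C.sqD) (g := C'.sqD ∘ₗ c.sqMap)
    (BTen.hom_ext fun x y => ?_) t
  change c.sqMap (C.sqD (sqMk k R X (x ⊗ₜ y))) = C'.sqD (sqMk k R X' (c.toFun x ⊗ₜ c.toFun y))
  rw [sqD_mk, sqD_mk, map_add, c.sqMap_mk, c.sqMap_mk, c.map_sgn, c.map_d, c.map_d]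

lemma Hom.sqMap_mem (c : C.Hom C') (n : ℕ) {t : Sq k R X} (ht : t ∈ C.sqGr n) :
    c.sqMap t ∈ C'.sqGr n :=
  sqGr_le (S := (C'.sqGr n).comap c.sqMap)
    (fun _ _ hij x hx y hy => sqMk_mem hij (c.map_gr _ x hx) (c.map_gr _ y hy)) ht

lemma Hom.sqAug_sqMap (c : C.Hom C') (t : Sq k R X) : C'.sqAug (c.sqMap t) = C.sqAug t := by
  refine LinearMap.congr_fun (f := C'.sqAug ∘ₗ c.sqMap) (g := C.sqAug)
    (BTen.hom_ext fun x y => ?_) t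
  change C'.aug (c.toFun x) * C'.aug (c.toFun y) = C.aug x * C.aug y
  rw [c.aug_comp, c.aug_comp]

lemma Hom.pair_sqMap (c : C.Hom C') (f g : BHom X' φ) (t : Sq k R X) :
    C'.pair f g (c.sqMap t) = C.pair (BHom.comp f c.toFun c.isBiHom) (BHom.comp g c.toFun c.isBiHom) t := by
  refine LinearMap.congr_fun (f := C'.pair f g ∘ₗ c.sqMap) (g := C.pair _ _)
    (BTen.hom_ext fun x y => ?_) t
  change C'.pairAux _ _ (c.toFun x ⊗ₜ c.toFun y) = C.pairAux _ _ (x ⊗ₜ y)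
  rw [pairAux_tmul, pairAux_tmul, GrCx.even, GrCx.odd, GrCx.sgn, ← C.scale_comm C'.toGrCx _ c.map_gr,
    ← C.scale_comm C'.toGrCx _ c.map_gr, ← C.scale_comm C'.toGrCx _ c.map_gr]
  rfl

lemma Diagonal.isBiHom (Δ : C.Diagonal) : IsBiHom (BimAct.of k R X) (sqAct k R X) Δ.toFun :=
  ⟨Δ.left_lin, Δ.right_lin⟩

/-- A comparison map is compatible with the diagonal maps up to homotopy. -/
lemma Hom.exists_diagonal_homotopy (hX : LiftProp (BimAct.of k R X))
    (hX' : LiftProp (BimAct.of k R X')) (hC' : C'.IsResolution) (c : C.Hom C')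
    (Δ' : C'.Diagonal) (Δ : C.Diagonal) :
    ∃ s : X →ₗ[k] Sq k R X', IsBiHom (BimAct.of k R X) (sqAct k R X') s ∧
      (∀ n, ∀ x ∈ C.gr n, s x ∈ C'.sqGr (n + 1)) ∧
      ∀ x, C'.sqD (s x) + s (C.d x) = c.sqMap (Δ.toFun x) - Δ'.toFun (c.toFun x) := by
  have hg : ∀ n, ∀ x ∈ C.gr n, (c.sqMap ∘ₗ Δ.toFun - Δ'.toFun ∘ₗ c.toFun) x ∈ C'.sqGr n :=
    fun n x hx => sub_mem (c.sqMap_mem n (Δ.map_gr n x hx)) (Δ'.map_gr n _ (c.map_gr n x hx))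
  -- Both composites X → X' ⊗_R X' are chain maps with the same augmentation, and the target is
  -- exact by `IsResolution.sq`.
  exact C.exists_biHom_nullhomotopy hX (sqAct k R X') sqL_mem sqR_mem C'.isBiHom_sqD
    (hC'.sq hX').2 (e := c.sqMap ∘ₗ Δ.toFun - Δ'.toFun ∘ₗ c.toFun)
    ((c.sqMap_isBiHom.comp Δ.isBiHom).sub (Δ'.isBiHom.comp c.isBiHom))
    (fun x => by simp [Δ.map_d, Δ'.map_d, c.map_d, c.sqMap_sqD]) hg
    (fun x hx => (hC'.sq hX').1 _ (hg 0 x hx)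
      (by simp [c.sqAug_sqMap, Δ.aug_comp, Δ'.aug_comp, c.aug_comp]))

/-- This is the Leibniz rule before composition with a diagonal map. It is needed on arbitrary
elements of the tensor square, since the values of a homotopy between diagonals are not values of a
diagonal. -/
lemma pair_sqD_sqS (f g : BHom X φ) (t : Sq k R X) : C.pair f g (C.sqD (C.sqS t))
    = C.pair (C.dHom φ f) g t + C.pair (C.sHom f) (C.dHom φ g) t := by
  refine LinearMap.congr_fun (f := C.pair f g ∘ₗ C.sqD ∘ₗ C.sqS)
    (g := C.pair (C.dHom φ f) g + C.pair (C.sHom f) (C.dHom φ g)) (C.sq_ext fun i j x hx y hy => ?_) _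
  simp only [LinearMap.comp_apply, LinearMap.add_apply, sqS, sqD, BTen.map_mk, pair_mk,
    TensorProduct.map_tmul, C.sgn_mem hx, C.sgn_mem hy, GrCx.tensorD, LinearMap.id_coe, id_eq,
    map_zsmul, map_add]
  have e1 : C.pairAux (f : X →ₗ[k] B) g (C.d x ⊗ₜ y)
      = (sg (i * j) * sg j) • ((f : X →ₗ[k] B) (C.d x) * (g : X →ₗ[k] B) y) := by
    rcases i with _ | i
    · simp [C.d_gr_zero x hx]
    · rw [C.pairAux_hom _ _ (C.d_mem i x hx) hy]
      congr 1
      push_cast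
      rw [add_mul, sg_add, one_mul, mul_assoc, sg_mul_self, mul_one]
  have e2 : C.pairAux (f : X →ₗ[k] B) g (x ⊗ₜ C.d y)
      = (sg (i * j) * sg i) • ((f : X →ₗ[k] B) x * (g : X →ₗ[k] B) (C.d y)) := by
    rcases j with _ | j
    · simp [C.d_gr_zero y hy]
    · rw [C.pairAux_hom _ _ hx (C.d_mem j y hy)]
      congr 1
      push_cast
      rw [mul_add, sg_add, mul_one, mul_assoc, sg_mul_self, mul_one]
  rw [C.pairAux_hom _ _ hx hy, C.pairAux_hom _ _ hx hy]
  simp only [dHom_apply, sHom_apply, C.sgn_mem hx, C.sgn_mem hy, map_zsmul,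
    zsmul_tmul, tmul_zsmul, e1, e2]
  rcases sg_cases i with hi | hi <;> rcases sg_cases j with hj | hj <;> simp [hi, hj]

lemma pair_eq_zero {p q : ℤ} {f g : BHom X φ} (hf : f ∈ C.homDeg φ p) (hg : g ∈ C.homDeg φ q)
    {n : ℕ} (hn : (n : ℤ) ≠ p + q) {t : Sq k R X} (ht : t ∈ C.sqGr n) : C.pair f g t = 0 := by
  refine LinearMap.mem_ker.1 (sqGr_le (S := LinearMap.ker (C.pair f g))
    (fun i j hij x hx y hy => ?_) ht)
  subst hij
  rw [LinearMap.mem_ker, pair_mk, C.pairAux_hom _ _ hx hy]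
  by_cases hi : (i : ℤ) = p
  · rw [hg j (by push_cast at hn; omega) y hy]; simp
  · rw [hf i hi x hx]; simp

lemma sqS_of_mem {n : ℕ} {t : Sq k R X} (ht : t ∈ C.sqGr n) : C.sqS t = sg n • t := by
  refine sub_eq_zero.1 (LinearMap.mem_ker.1 (sqGr_le
    (S := LinearMap.ker (C.sqS - sg n • LinearMap.id)) (fun i j hij x hx y hy => ?_) ht))
  subst hij
  rw [LinearMap.mem_ker, LinearMap.sub_apply, sub_eq_zero, sqS, BTen.map_mk, TensorProduct.map_tmul,
    C.sgn_mem hx, C.sgn_mem hy, zsmul_tmul, tmul_zsmul, smul_smul, map_zsmul]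
  push_cast
  rw [sg_add]
  rfl

/-- The map `(f, g) ↦ μ_B (f ⊗ g) s`, for a bimodule map `s : X → X' ⊗_R X'`. -/
def pairComp (C' : AugBimodCx k R X') (s : X →ₗ[k] Sq k R X')
    (hs : IsBiHom (BimAct.of k R X) (sqAct k R X') s) :
    BHom X' φ →ₗ[k] BHom X' φ →ₗ[k] BHom X φ :=
  LinearMap.mk₂ k
    (fun f g => ⟨C'.pair f g ∘ₗ s,
      fun r x => (congrArg _ (hs.left r x)).trans (C'.pair_sqL f g r _),
      fun r x => (congrArg _ (hs.right r x)).trans (C'.pair_sqR f g r _)⟩)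
    (fun f f' g => by ext; simp)
    (fun c f g => by ext; simp)
    (fun f g g' => by ext; simp)
    (fun c f g => by ext; simp)

/-- The homotopy `(f, g) ↦ (-1)^s μ_B (f ⊗ g) S` defined by a map `S` of degree one. -/
def pairHtpy (C : AugBimodCx k R X) (C' : AugBimodCx k R X') (φ : R →ₐ[k] B)
    (S : X →ₗ[k] Sq k R X') (hS : IsBiHom (BimAct.of k R X) (sqAct k R X') S)
    (hSg : ∀ n, ∀ x ∈ C.gr n, S x ∈ C'.sqGr (n + 1)) {p q s : ℤ} (h : p + q = s + 1) :
    C'.homDeg φ p →ₗ[k] C'.homDeg φ q →ₗ[k] C.homDeg φ s :=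
  LinearMap.mk₂ k
    (fun f g => ⟨sg s • C'.pairComp S hS f.1 g.1, zsmul_mem (show _ ∈ C.homDeg φ s from
      fun i hi x hx => pair_eq_zero f.2 g.2 (by push_cast; omega) (hSg i x hx)) _⟩)
    (fun f f' g => Subtype.ext (by
      simp only [Submodule.coe_add, map_add, LinearMap.add_apply, smul_add]))
    (fun a f g => Subtype.ext (by
      simp only [Submodule.coe_smul, map_smul, LinearMap.smul_apply]; exact smul_comm _ _ _))
    (fun f g g' => Subtype.ext (by simp only [Submodule.coe_add, map_add, smul_add]))
    (fun a f g => Subtype.ext (by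
      simp only [Submodule.coe_smul, map_smul]; exact smul_comm _ _ _))

/-- Apply the pairing of f and g to the homotopy equation for the two diagonals, and rewrite the
term with the differential of S x by the Leibniz rule. As S x has degree i + 1, the sign operator
contributes (-1)^{i+1} there, and s = r - 1 accounts for the sign of the remaining term. -/
lemma Hom.pullback_cup_sub (c : C.Hom C') (Δ' : C'.Diagonal) (Δ : C.Diagonal)
    {S : X →ₗ[k] Sq k R X'} (hSg : ∀ n, ∀ x ∈ C.gr n, S x ∈ C'.sqGr (n + 1))
    (hSd : ∀ x, C'.sqD (S x) + S (C.d x) = c.sqMap (Δ.toFun x) - Δ'.toFun (c.toFun x))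
    {p r s : ℤ} (hs : s + 1 = r) {f g : BHom X' φ} (hf : f ∈ C'.homDeg φ p)
    {i : ℕ} (hi : (i : ℤ) = r) {x : X} (hx : x ∈ C.gr i) :
    C'.pair f g (Δ'.toFun (c.toFun x))
      - C.pair (BHom.comp f c.toFun c.isBiHom) (BHom.comp g c.toFun c.isBiHom) (Δ.toFun x)
    = sg s • C'.pair f g (S (C.d (C.sgn x))) + sg r • C'.pair (C'.dHom φ f) g (S x)
      + sg p • sg r • C'.pair f (C'.dHom φ g) (S x) := by
  have hs' : s = r - 1 := by omega
  have h1 := pair_sqD_sqS (C := C') f g (S x)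
  rw [sqS_of_mem (hSg i x hx), sHom_of_mem hf, map_zsmul, map_zsmul] at h1
  have h2 : C'.pair (sg p • f) (C'.dHom φ g) (S x) = sg p • C'.pair f (C'.dHom φ g) (S x) := by
    rw [map_zsmul]; rfl
  rw [← c.pair_sqMap, ← neg_sub, ← map_sub, ← hSd, C.sgn_mem hx, map_zsmul, map_zsmul, map_zsmul,
    map_add, smul_comm (sg p), add_assoc, ← smul_add, ← h2, ← h1, smul_smul, smul_smul, hs', ← hi]
  push_cast
  rw [sub_eq_add_neg (i : ℤ) 1, sg_add, sg_add, sg_neg, sg_one]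
  rcases sg_cases i with h | h <;> simp [h]

lemma Hom.pullback_isMulUpToHomotopy (hX : LiftProp (BimAct.of k R X))
    (hX' : LiftProp (BimAct.of k R X')) (hC' : C'.IsResolution) (c : C.Hom C')
    (Δ' : C'.Diagonal) (Δ : C.Diagonal) : (c.pullback Δ' Δ φ).IsMulUpToHomotopy := by
  obtain ⟨S, hS, hSg, hSd⟩ := c.exists_diagonal_homotopy hX hX' hC' Δ' Δ
  -- The homotopy of algebras is the pairing composed with the homotopy of diagonals, with the sign
  -- (-1)^s of its target degree.
  refine ⟨fun {p q s} hs => pairHtpy C C' φ S hS hSg hs,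
    fun {p q r s p' q'} hr hs hp hq f g => ?_⟩
  refine Subtype.ext (homDeg_ext (n := r) (C := C) (Subtype.prop _) (Subtype.prop _)
    fun i hi x hx => ?_)
  exact c.pullback_cup_sub Δ' Δ hSg hSd hs f.2 hi hx

end AugBimodCx
end Pullback

/-! ### The inverse antipode -/

section InverseAntipode
variable {k Γ : Type u} [Field k] [Ring Γ] [HopfAlgebra k Γ]

/-- The inverse of the antipode. -/
def invS (hS : Function.Bijective (HopfAlgebra.antipode k (A := Γ))) : Γ →ₗ[k] Γ :=
  (LinearEquiv.ofBijective (HopfAlgebra.antipode k (A := Γ)) hS).symm.toLinearMap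

variable (hS : Function.Bijective (HopfAlgebra.antipode k (A := Γ)))

@[simp] lemma invS_antipode (γ : Γ) : invS hS (HopfAlgebra.antipode k γ) = γ :=
  (LinearEquiv.ofBijective _ hS).symm_apply_apply γ

@[simp] lemma antipode_invS (γ : Γ) : HopfAlgebra.antipode k (invS hS γ) = γ :=
  (LinearEquiv.ofBijective _ hS).apply_symm_apply γ

@[simp] lemma invS_one : invS hS 1 = 1 := hS.1 (by simp)

lemma invS_mul (γ δ : Γ) : invS hS (γ * δ) = invS hS δ * invS hS γ :=
  hS.1 (by rw [HopfAlgebra.antipode_mul_antidistrib]; simp)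

variable (k Γ) in
/-- The antipode as an algebra map to the opposite algebra. -/
def opS : Γ →ₐ[k] Γᵐᵒᵖ :=
  AlgHom.ofLinearMap ((MulOpposite.opLinearEquiv k).toLinearMap ∘ₗ HopfAlgebra.antipode k)
    (by simp) fun γ δ => by simp [HopfAlgebra.antipode_mul_antidistrib]

end InverseAntipode

/-! ### The convolution algebra Hom(Γ, End V) acting on Hom(Γ, V) -/

section ConvolutionAction
variable {k Γ V W : Type u} [Field k] [Ring Γ] [HopfAlgebra k Γ] [AddCommGroup V] [Module k V]
  [AddCommGroup W] [Module k W]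

/-- The action `γ ↦ e(γ₁) (h γ₂)` of the convolution algebra. -/
def convAct (e : Γ →ₗ[k] Module.End k V) (h : Γ →ₗ[k] V) : Γ →ₗ[k] V :=
  TensorProduct.lift e ∘ₗ h.lTensor Γ ∘ₗ comul

/-- Coassociativity in disguise. It makes Hom(Γ, V) a module over the convolution algebra, so that
Sweedler computations with antipodes become cancellations of convolution inverses. -/
lemma convAct_convAct (e e' : Γ →ₗ[k] Module.End k V) (h : Γ →ₗ[k] V) :
    convAct e (convAct e' h) = convAct (WithConv.toConv e * WithConv.toConv e').ofConv h := by
  let Φ : Γ ⊗[k] (Γ ⊗[k] Γ) →ₗ[k] V :=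
    TensorProduct.lift e ∘ₗ (TensorProduct.lift e' ∘ₗ h.lTensor Γ).lTensor Γ
  have h1 : TensorProduct.lift e ∘ₗ (convAct e' h).lTensor Γ = Φ ∘ₗ comul.lTensor Γ := by
    ext γ δ; rfl
  have h2 : TensorProduct.lift (WithConv.toConv e * WithConv.toConv e').ofConv ∘ₗ h.lTensor Γ
      = Φ ∘ₗ (TensorProduct.assoc k Γ Γ Γ).toLinearMap ∘ₗ comul.rTensor Γ := by
    have h3 : ∀ (s : Γ ⊗[k] Γ) (δ : Γ), LinearMap.mul' k (Module.End k V)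
        (TensorProduct.map e e' s) (h δ) = Φ (TensorProduct.assoc k Γ Γ Γ (s ⊗ₜ δ)) := by
      intro s δ
      induction s using TensorProduct.induction_on with
      | zero => simp
      | add x y hx hy => simp only [map_add, LinearMap.add_apply, hx, hy, TensorProduct.add_tmul]
      | tmul a b => simp [Φ]
    refine TensorProduct.ext' fun γ δ => ?_
    exact h3 (comul γ) δ
  refine LinearMap.ext fun γ => ?_
  change (TensorProduct.lift e ∘ₗ (convAct e' h).lTensor Γ) (comul γ)
    = (TensorProduct.lift _ ∘ₗ h.lTensor Γ) (comul γ)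
  rw [h1, h2]
  simp only [LinearMap.comp_apply, LinearEquiv.coe_coe, coassoc_apply]

lemma convAct_one (h : Γ →ₗ[k] V) :
    convAct (1 : WithConv (Γ →ₗ[k] Module.End k V)).ofConv h = h := by
  have h1 : TensorProduct.lift (1 : WithConv (Γ →ₗ[k] Module.End k V)).ofConv ∘ₗ h.lTensor Γ
      = h ∘ₗ (TensorProduct.lid k Γ).toLinearMap ∘ₗ counit.rTensor Γ := by
    refine TensorProduct.ext' fun γ δ => ?_
    simp [LinearMap.convOne_def]
  refine LinearMap.ext fun γ => ?_
  change (TensorProduct.lift _ ∘ₗ h.lTensor Γ) (comul γ) = _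
  rw [h1]
  simp

/-- The maps γ ↦ e(γ)v form the orbit of γ ↦ ε(γ)v, by the counit axiom. Identities between such
maps therefore follow from identities between the families of operators. -/
lemma convAct_const (e : Γ →ₗ[k] Module.End k V) (v : V) :
    convAct e (LinearMap.toSpanSingleton k V v ∘ₗ counit (A := Γ)) = e.flip v := by
  have h1 : TensorProduct.lift e ∘ₗ (LinearMap.toSpanSingleton k V v ∘ₗ counit (A := Γ)).lTensor Γ
      = e.flip v ∘ₗ (TensorProduct.rid k Γ).toLinearMap ∘ₗ counit.lTensor Γ := by
    refine TensorProduct.ext' fun γ δ => ?_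
    simp
  refine LinearMap.ext fun γ => ?_
  change (TensorProduct.lift e ∘ₗ
    (LinearMap.toSpanSingleton k V v ∘ₗ counit (A := Γ)).lTensor Γ) (comul γ) = _
  rw [h1]
  simp

lemma convAct_smul (e f : Γ →ₗ[k] Module.End k V) (v : V) :
    convAct e (f.flip v) = (WithConv.toConv e * WithConv.toConv f).ofConv.flip v := by
  rw [← convAct_const, convAct_convAct, convAct_const]

end ConvolutionAction

/-! ### The twisted action of Γ on Hom(Z, M) as a convolution product -/

section HomActions
variable {k Γ Z M : Type u} [Field k] [Ring Γ] [HopfAlgebra k Γ] [AddCommGroup Z] [Module k Z]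
  [Module Γ Z] [IsScalarTower k Γ Z] [AddCommGroup M] [Module k M]
  (hS : Function.Bijective (HopfAlgebra.antipode k (A := Γ)))

namespace HomAct

variable (Γ Z M) in
/-- The operators `f ↦ f(γ ·)`. -/
def μ : Γ →ₗ[k] Module.End k (Z →ₗ[k] M) :=
  (LinearMap.llcomp k Z Z M).flip ∘ₗ lact k Γ Z

@[simp] lemma μ_apply (γ : Γ) (f : Z →ₗ[k] M) (x : Z) : μ Γ Z M γ f x = f (γ • x) := rfl

variable (Z M) in
/-- The operators `f ↦ f(S⁻¹(γ) ·)`. -/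
def ν : Γ →ₐ[k] Module.End k (Z →ₗ[k] M) :=
  AlgHom.ofLinearMap (μ Γ Z M ∘ₗ invS hS) (by ext; simp) fun γ δ => by
    ext; simp [invS_mul, mul_smul]

@[simp] lemma ν_apply (γ : Γ) (f : Z →ₗ[k] M) (x : Z) : ν Z M hS γ f x = f (invS hS γ • x) := rfl

lemma ν_antipode : (ν Z M hS).toLinearMap ∘ₗ HopfAlgebra.antipode k = μ Γ Z M := by
  ext; simp

/-- Precomposition by γ is antimultiplicative, so it is not an algebra map on Γ; precomposition by
S⁻¹(γ) is one, and composing it with S gives μ back. An algebra map and its composite with the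
antipode are convolution inverse to each other. -/
lemma ν_mul_μ : WithConv.toConv (ν Z M hS).toLinearMap * WithConv.toConv (μ Γ Z M) = 1 := by
  rw [← ν_antipode hS, conv_psi]

lemma μ_mul_ν : WithConv.toConv (μ Γ Z M) * WithConv.toConv (ν Z M hS).toLinearMap = 1 := by
  rw [← ν_antipode hS, conv_psi']

variable (Z) (b : BimAct k Γ M)

/-- The operators `f ↦ γ f`. -/
def lam : Γ →ₐ[k] Module.End k (Z →ₗ[k] M) :=
  AlgHom.ofLinearMap
    { toFun := fun γ => LinearMap.compRight k (b.l γ)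
      map_add' := fun r s => by ext; simp
      map_smul' := fun c r => by ext; simp }
    (by ext; simp) fun γ δ => by ext; simp

@[simp] lemma lam_apply (γ : Γ) (f : Z →ₗ[k] M) (x : Z) : lam Z b γ f x = b.l γ (f x) := rfl

/-- The operators `f ↦ f γ`. -/
def rho : Γ →ₗ[k] Module.End k (Z →ₗ[k] M) where
  toFun γ := LinearMap.compRight k (b.r γ)
  map_add' r s := by ext; simp
  map_smul' c r := by ext; simp

@[simp] lemma rho_apply (γ : Γ) (f : Z →ₗ[k] M) (x : Z) : rho Z b γ f x = b.r γ (f x) := rfl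

/-- `rho` as an algebra map to the opposite algebra. -/
def rhoOp : Γ →ₐ[k] (Module.End k (Z →ₗ[k] M))ᵐᵒᵖ :=
  AlgHom.ofLinearMap ((MulOpposite.opLinearEquiv k).toLinearMap ∘ₗ rho Z b)
    (congrArg MulOpposite.op (by ext; simp [b.r_one])) fun γ δ =>
      congrArg MulOpposite.op (by ext; simp [b.r_mul])

lemma ν_lam_comm (γ δ : Γ) : Commute (ν Z M hS γ) (lam Z b δ) := by
  ext; rfl

/-- The operators `f ↦ γ₂ f(S⁻¹(γ₁) ·)`. -/
def ad : Γ →ₐ[k] Module.End k (Z →ₗ[k] M) :=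
  (Algebra.TensorProduct.lift (ν Z M hS) (lam Z b) (ν_lam_comm Z hS b)).comp (Bialgebra.comulAlgHom k Γ)

lemma ν_mul_lam : WithConv.toConv (ν Z M hS).toLinearMap * WithConv.toConv (lam Z b).toLinearMap
    = WithConv.toConv (ad Z hS b).toLinearMap := by
  refine WithConv.ext (LinearMap.ext fun γ => ?_)
  change LinearMap.mul' k _ (TensorProduct.map _ _ (comul γ))
    = Algebra.TensorProduct.lift (ν Z M hS) (lam Z b) (ν_lam_comm Z hS b) (comul γ)
  generalize (comul γ : Γ ⊗[k] Γ) = s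
  induction s using TensorProduct.induction_on with
  | zero => simp
  | add x y hx hy => simp only [map_add, hx, hy]
  | tmul a b => simp

/-- In Sweedler terms, evaluating the operator of γ₂ on f at γ₁x gives γ f(x). This is the identity
forced on a left Γ-linear extension of f to Z ⊗ Γ, and the reason for the shape of `ad`. -/
lemma μ_mul_ad : WithConv.toConv (μ Γ Z M) * WithConv.toConv (ad Z hS b).toLinearMap
    = WithConv.toConv (lam Z b).toLinearMap := by
  rw [← ν_mul_lam, ← mul_assoc, μ_mul_ν, one_mul]

/-- The left and right actions on M commute, and precomposition does not touch the values of f. -/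
lemma ad_rho (γ δ : Γ) : ad Z hS b γ * rho Z b δ = rho Z b δ * ad Z hS b γ := by
  change Algebra.TensorProduct.lift (ν Z M hS) (lam Z b) (ν_lam_comm Z hS b) (comul γ) * _ = _ *
    Algebra.TensorProduct.lift (ν Z M hS) (lam Z b) (ν_lam_comm Z hS b) (comul γ)
  generalize (comul γ : Γ ⊗[k] Γ) = s
  induction s using TensorProduct.induction_on with
  | zero => simp
  | add x y hx hy => simp only [map_add, add_mul, mul_add, hx, hy]
  | tmul x y => ext; simp [b.comm]

lemma adOp_rhoOp_comm (γ δ : Γ) :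
    Commute ((AlgHom.op (ad Z hS b)).comp (opS k Γ) γ) (rhoOp Z b δ) :=
  congrArg MulOpposite.op (ad_rho Z hS b (HopfAlgebra.antipode k γ) δ).symm

/-- The twisted right action of `Γ` on `Hom(Z, M)` as an algebra map to the opposite algebra. -/
def twOp : Γ →ₐ[k] (Module.End k (Z →ₗ[k] M))ᵐᵒᵖ :=
  (Algebra.TensorProduct.lift ((AlgHom.op (ad Z hS b)).comp (opS k Γ)) (rhoOp Z b)
    (adOp_rhoOp_comm Z hS b)).comp (Bialgebra.comulAlgHom k Γ)

/-- The twisted right action `f ↦ S(γ₁) f(γ₂ ·) γ₃` of `Γ` on `Hom(Z, M)`. -/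
def tw : Γ →ₗ[k] Module.End k (Z →ₗ[k] M) :=
  (MulOpposite.opLinearEquiv k).symm.toLinearMap ∘ₗ (twOp Z hS b).toLinearMap

lemma tw_one : tw Z hS b 1 = 1 := congrArg MulOpposite.unop (map_one (twOp Z hS b))

lemma tw_mul (γ δ : Γ) : tw Z hS b (γ * δ) = tw Z hS b δ * tw Z hS b γ :=
  congrArg MulOpposite.unop (map_mul (twOp Z hS b) γ δ)

/-- `tw` as a convolution product. -/
lemma toConv_tw : WithConv.toConv (tw Z hS b)
    = WithConv.toConv ((ad Z hS b).toLinearMap ∘ₗ HopfAlgebra.antipode k)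
      * WithConv.toConv (rho Z b) := by
  refine WithConv.ext (LinearMap.ext fun γ => ?_)
  change MulOpposite.unop (Algebra.TensorProduct.lift ((AlgHom.op (ad Z hS b)).comp (opS k Γ))
    (rhoOp Z b) (adOp_rhoOp_comm Z hS b) (comul γ)) = LinearMap.mul' k _ (TensorProduct.map _ _ (comul γ))
  generalize (comul γ : Γ ⊗[k] Γ) = s
  induction s using TensorProduct.induction_on with
  | zero => simp
  | add x y hx hy => simp only [map_add, MulOpposite.unop_add, hx, hy]
  | tmul x y =>
    rw [Algebra.TensorProduct.lift_tmul, TensorProduct.map_tmul, LinearMap.mul'_apply]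
    exact (ad_rho Z hS b _ _).symm

/-- This recovers the explicit formula S(γ₁) f(γ₂ ·) γ₃. Instead of the anticomultiplicativity of S,
it uses that `ad` is the convolution product of ν and λ: `conv_cancel` then yields λS from (ad S) *
ν, and μ cancels ν. -/
lemma toConv_tw' : WithConv.toConv (tw Z hS b)
    = WithConv.toConv ((lam Z b).toLinearMap ∘ₗ HopfAlgebra.antipode k)
      * WithConv.toConv (μ Γ Z M) * WithConv.toConv (rho Z b) := by
  rw [toConv_tw, ← conv_cancel (ad Z hS b) (ν Z M hS) (lam Z b) (ν_mul_lam Z hS b),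
    mul_assoc (WithConv.toConv ((ad Z hS b).toLinearMap ∘ₗ HopfAlgebra.antipode k)), ν_mul_μ,
    mul_one]

/-- The relation between the twisted action and the induced bimodule. -/
lemma tw_eq_twL (γ : Γ) (f : Z →ₗ[k] M) (α β : Γ) :
    ad Z hS b α (rho Z b β (tw Z hS b γ f)) = TensorProduct.lift
      ((LinearMap.mul k (Module.End k (Z →ₗ[k] M))).compl₁₂ (ad Z hS b).toLinearMap (rho Z b))
      (twL k Γ γ (α ⊗ₜ β)) f := by
  have h : tw Z hS b γ = _ := LinearMap.congr_fun (congrArg WithConv.ofConv (toConv_tw Z hS b)) γ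
  rw [h]
  change ad Z hS b α (rho Z b β (LinearMap.mul' k (Module.End k (Z →ₗ[k] M))
      (TensorProduct.map ((ad Z hS b).toLinearMap ∘ₗ HopfAlgebra.antipode k) (rho Z b)
        (comul γ)) f))
    = TensorProduct.lift ((LinearMap.mul k (Module.End k (Z →ₗ[k] M))).compl₁₂
      (ad Z hS b).toLinearMap (rho Z b)) (TensorProduct.map₂ (ract k Γ Γ ∘ₗ HopfAlgebra.antipode k)
        (lact k Γ Γ) (comul γ) (α ⊗ₜ β)) f
  generalize (comul γ : Γ ⊗[k] Γ) = s
  induction s using TensorProduct.induction_on with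
  | zero => simp
  | add x y hx hy => simp only [map_add, LinearMap.add_apply, hx, hy]
  | tmul x y =>
    -- The first tensor factor uses multiplicativity of `ad`; the second uses that right actions
    -- reverse products.
    have h1 : rho Z b (y * β) = rho Z b β * rho Z b y := by ext; simp [b.r_mul]
    have h2 := LinearMap.congr_fun (ad_rho Z hS b (HopfAlgebra.antipode k x) β) (rho Z b y f)
    simp only [Module.End.mul_apply] at h2
    simp [h1, h2]

end HomAct
end HomActions

/-! ### Generators of Z ⊗ Γ, of A#Γ and of Z#L↑ -/

section Spanning
variable {k A Γ Z L W : Type u} [Field k] [Ring A] [Algebra k A] [Ring Γ] [HopfAlgebra k Γ]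
  [AddCommGroup W] [Module k W] [AddCommGroup Z] [Module k Z] [Module Γ Z] [IsScalarTower k Γ Z]
  (hS : Function.Bijective (HopfAlgebra.antipode k (A := Γ)))

/-- Regarding q as a family of maps Z → W indexed by Γ, convolution with μ means evaluation on
diagonal translates. This links the geometry of Z ⊗ Γ to the convolution calculus. -/
lemma convAct_μ_curry (q : Z ⊗[k] Γ →ₗ[k] W) (γ : Γ) (x : Z) (α : Γ) :
    convAct (HomAct.μ Γ Z W) ((TensorProduct.curry q).flip ∘ₗ LinearMap.mulRight k α) γ x
      = q (diagOp (lact k Γ Z) (lact k Γ Γ) γ (x ⊗ₜ α)) := by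
  change TensorProduct.lift (HomAct.μ Γ Z W) (LinearMap.lTensor Γ
      ((TensorProduct.curry q).flip ∘ₗ LinearMap.mulRight k α) (comul γ)) x
    = q (TensorProduct.map₂ (lact k Γ Z) (lact k Γ Γ) (comul γ) (x ⊗ₜ α))
  generalize (comul γ : Γ ⊗[k] Γ) = s
  induction s using TensorProduct.induction_on with
  | zero => simp
  | add x y hx hy => simp only [map_add, LinearMap.add_apply, hx, hy]
  | tmul a b => simp

include hS in
/-- The elements `γ₁ x ⊗ γ₂` span `Z ⊗ Γ`. -/
lemma hom_ext_diagOp {f g : Z ⊗[k] Γ →ₗ[k] W}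
    (h : ∀ (γ : Γ) (x : Z), f (diagOp (lact k Γ Z) (lact k Γ Γ) γ (x ⊗ₜ 1))
      = g (diagOp (lact k Γ Z) (lact k Γ Γ) γ (x ⊗ₜ 1))) : f = g := by
  -- Convolution with ν undoes convolution with μ, so q is recovered from its values on the elements
  -- γ₁x ⊗ γ₂.
  have h0 : ∀ q : Z ⊗[k] Γ →ₗ[k] W, convAct (HomAct.ν Z W hS).toLinearMap
      (convAct (HomAct.μ Γ Z W) ((TensorProduct.curry q).flip ∘ₗ LinearMap.mulRight k 1))
        = (TensorProduct.curry q).flip := by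
    intro q
    rw [convAct_convAct, HomAct.ν_mul_μ, convAct_one]
    ext; simp
  have h1 : (TensorProduct.curry f).flip = (TensorProduct.curry g).flip := by
    rw [← h0 f, ← h0 g]
    congr 1
    refine LinearMap.ext fun γ => LinearMap.ext fun x => ?_
    rw [convAct_μ_curry, convAct_μ_curry, h]
  refine TensorProduct.ext' fun x γ => ?_
  exact LinearMap.congr_fun (LinearMap.congr_fun h1 γ) x

variable [Module Γ A] [IsScalarTower k Γ A] [ModuleAlgebra k A Γ]

namespace Smash

lemma inA_mul_inΓ (a : A) (γ : Γ) : inA k A Γ a * inΓ k A Γ γ = (a ⊗ₜ[k] γ : A ⊗[k] Γ) := by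
  change mulOp (a ⊗ₜ 1) (1 ⊗ₜ γ) = _
  simp [mulOp, D_one]

lemma inΓ_mul_inA (a : A) (γ : Γ) : inΓ k A Γ γ * inA k A Γ a = D (k := k) γ (a ⊗ₜ[k] (1 : Γ)) := by
  change mulOp (1 ⊗ₜ γ) (a ⊗ₜ 1) = _
  rw [mulOp, mm_tmul, la, LinearMap.comp_apply, lact_one]
  simp

lemma hom_ext {f g : Smash k A Γ →ₗ[k] W}
    (h : ∀ a γ, f (inA k A Γ a * inΓ k A Γ γ) = g (inA k A Γ a * inΓ k A Γ γ)) : f = g := by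
  refine TensorProduct.ext' fun a γ => ?_
  have := h a γ
  rwa [inA_mul_inΓ] at this

include hS in
-- With a bijective antipode the products γa span A#Γ just as the products aγ do. This order suits
-- left actions, where a meets the generator first.
lemma hom_ext' {f g : Smash k A Γ →ₗ[k] W}
    (h : ∀ γ a, f (inΓ k A Γ γ * inA k A Γ a) = g (inΓ k A Γ γ * inA k A Γ a)) : f = g := by
  refine hom_ext_diagOp hS (f := f) (g := g) fun γ a => ?_
  have := h γ a
  rwa [inΓ_mul_inA] at this

end Smash

variable [Module A Z] [Module Aᵐᵒᵖ Z] [IsBimod k A Z] [EqBimod k A Γ Z]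
  [AddCommGroup L] [Module k L] [Module Γᵐᵒᵖ L] [IsScalarTower k Γᵐᵒᵖ L]

namespace SmashMod

section
variable {Y : Type u} [AddCommGroup Y] [Module k Y] [Module Γ Y] [Module Γᵐᵒᵖ Y] [IsBimod k Γ Y]
  [HopfBimod k Γ Y]

lemma lS_one_tmul (γ : Γ) (z : Z ⊗[k] Y) :
    SmashOp.lS k A Γ Z Y (1 ⊗ₜ γ) z = SmashOp.lΓ k Z Y γ z := by
  rw [SmashOp.lS_tmul, SmashOp.lA, LinearMap.comp_apply, lact_one]
  simp

lemma lS_tmul_one (a : A) (z : Z ⊗[k] Y) :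
    SmashOp.lS k A Γ Z Y (a ⊗ₜ 1) z = SmashOp.lA k Z Y a z := by
  rw [SmashOp.lS_tmul, SmashOp.lΓ, diagOp_one lact_one lact_one]
  rfl

lemma rS_one_tmul (γ : Γ) (z : Z ⊗[k] Y) :
    SmashOp.rS k A Γ Z Y (1 ⊗ₜ γ) z = SmashOp.rΓ k Z Y γ z := by
  rw [SmashOp.rS_tmul, SmashOp.rA_one]
  rfl

lemma rS_tmul_one (a : A) (z : Z ⊗[k] Y) :
    SmashOp.rS k A Γ Z Y (a ⊗ₜ 1) z = SmashOp.rA k Γ Z Y a z := by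
  rw [SmashOp.rS_tmul, SmashOp.rΓ, LinearMap.comp_apply, ract_one]
  simp

lemma inΓ_smul (γ : Γ) (z : SmashMod k Z Y) :
    Smash.inΓ k A Γ γ • z = SmashOp.lΓ k Z Y γ z := lS_one_tmul γ z

lemma inA_smul (a : A) (z : SmashMod k Z Y) :
    Smash.inA k A Γ a • z = SmashOp.lA k Z Y a z := lS_tmul_one a z

lemma op_inΓ_smul (γ : Γ) (z : SmashMod k Z Y) :
    MulOpposite.op (Smash.inΓ k A Γ γ) • z = SmashOp.rΓ k Z Y γ z := rS_one_tmul γ z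

lemma op_inA_smul (a : A) (z : SmashMod k Z Y) :
    MulOpposite.op (Smash.inA k A Γ a) • z = SmashOp.rA k Γ Z Y a z := rS_tmul_one a z

end

lemma inA_smul_inKL (a : A) (x : Z) (l : L) :
    Smash.inA k A Γ a • inKL k Γ Z L x l = inKL k Γ Z L (a • x) l := by
  rw [inA_smul]; rfl

/-- The generator l ⊗ 1 ⊗ 1 is coinvariant: its coaction is 1 ⊗ (l ⊗ 1 ⊗ 1). Hence A passes to x
without a twist. -/
lemma op_inA_smul_inKL (a : A) (x : Z) (l : L) :
    MulOpposite.op (Smash.inA k A Γ a) • inKL k Γ Z L x l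
      = inKL k Γ Z L (MulOpposite.op a • x) l := by
  rw [op_inA_smul]
  change LinearMap.rTensor _ _ (LinearMap.lTensor Γ (Ind.mk l) (coact₀ k Γ (1 ⊗ₜ 1))) = _
  rw [coact₀_tmul, Bialgebra.comul_one]
  simp [Algebra.TensorProduct.one_def, inKL]
  rfl

lemma op_inΓ_smul_inKL (δ : Γ) (x : Z) (l : L) :
    MulOpposite.op (Smash.inΓ k A Γ δ) • inKL k Γ Z L x l
      = SmashMod.tmul k x (Ind.mk l (1 ⊗ₜ[k] δ)) := by
  rw [op_inΓ_smul]
  change x ⊗ₜ[k] (MulOpposite.op δ • Ind.mk l (1 ⊗ₜ 1)) = x ⊗ₜ[k] _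
  rw [Ind.op_smul_mk, outR_tmul, one_mul]

lemma inΓ_smul_tmul (γ α β : Γ) (x : Z) (l : L) :
    Smash.inΓ k A Γ γ • SmashMod.tmul k x (Ind.mk l (α ⊗ₜ[k] β))
      = LinearMap.lTensor Z (Ind.mk l ∘ₗ (TensorProduct.mk k Γ Γ).flip β)
        (diagOp (lact k Γ Z) (lact k Γ Γ) γ (x ⊗ₜ[k] α)) := by
  rw [inΓ_smul]
  exact (diagOp_nat (f := LinearMap.id) (g := Ind.mk l ∘ₗ (TensorProduct.mk k Γ Γ).flip β)
    (v := lact k Γ Γ) (v' := lact k Γ (Ind k Γ L)) (fun _ _ => rfl) (fun _ _ => rfl)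
    γ (x ⊗ₜ[k] α)).symm

include hS in
-- Acting on x ⊗ l by δ on the right and γ on the left gives γ₁x ⊗ (l ⊗ γ₂ ⊗ δ), and for fixed l and
-- δ these elements span by `hom_ext_diagOp`.
lemma eq_mk {f g : SmashMod k Z (Ind k Γ L) →ₗ[k] W} (l : L)
    (h : ∀ (γ δ : Γ) (x : Z),
      f (Smash.inΓ k A Γ γ • MulOpposite.op (Smash.inΓ k A Γ δ) • inKL k Γ Z L x l)
        = g (Smash.inΓ k A Γ γ • MulOpposite.op (Smash.inΓ k A Γ δ) • inKL k Γ Z L x l))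
    (x : Z) (t : Γ ⊗[k] Γ) :
    f (SmashMod.tmul k x (Ind.mk l t)) = g (SmashMod.tmul k x (Ind.mk l t)) := by
  have h1 : ∀ δ : Γ, f ∘ₗ LinearMap.lTensor Z (Ind.mk l ∘ₗ (TensorProduct.mk k Γ Γ).flip δ)
      = g ∘ₗ LinearMap.lTensor Z (Ind.mk l ∘ₗ (TensorProduct.mk k Γ Γ).flip δ) := by
    intro δ
    refine hom_ext_diagOp hS fun γ x => ?_
    have := h γ δ x
    rwa [op_inΓ_smul_inKL, inΓ_smul_tmul] at this
  refine LinearMap.congr_fun (f := f ∘ₗ TensorProduct.mk k Z (Ind k Γ L) x ∘ₗ Ind.mk l)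
    (g := g ∘ₗ TensorProduct.mk k Z (Ind k Γ L) x ∘ₗ Ind.mk l)
    (TensorProduct.ext' fun γ δ => ?_) t
  exact LinearMap.congr_fun (h1 δ) (x ⊗ₜ γ)

include hS in
/-- `Z # L↑` is generated as a bimodule by the elements `x ⊗ l` with `l` in a set that generates
`L`. -/
lemma hom_ext_gen {Λ : Set L} (hΛ : Submodule.span k {m | ∃ (γ : Γ), ∃ l ∈ Λ,
      m = MulOpposite.op γ • l} = ⊤) {f g : SmashMod k Z (Ind k Γ L) →ₗ[k] W}
    (h : ∀ (γ δ : Γ) (x : Z), ∀ l ∈ Λ,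
      f (Smash.inΓ k A Γ γ • MulOpposite.op (Smash.inΓ k A Γ δ) • inKL k Γ Z L x l)
        = g (Smash.inΓ k A Γ γ • MulOpposite.op (Smash.inΓ k A Γ δ) • inKL k Γ Z L x l)) :
    f = g := by
  refine TensorProduct.ext' fun x y => ?_
  refine LinearMap.congr_fun (f := f ∘ₗ TensorProduct.mk k Z (Ind k Γ L) x)
    (g := g ∘ₗ TensorProduct.mk k Z (Ind k Γ L) x) (Ind.hom_ext fun l t => ?_) y
  refine LinearMap.congr_fun (f := f ∘ₗ TensorProduct.mk k Z (Ind k Γ L) x ∘ₗ Ind.mkₗ.flip t)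
    (g := g ∘ₗ TensorProduct.mk k Z (Ind k Γ L) x ∘ₗ Ind.mkₗ.flip t)
    (LinearMap.ext_on (s := {m | ∃ (γ : Γ), ∃ l ∈ Λ, m = MulOpposite.op γ • l}) hΛ ?_) l
  rintro _ ⟨γ, l, hl, rfl⟩
  change f (SmashMod.tmul k x (Ind.mk (MulOpposite.op γ • l) t))
    = g (SmashMod.tmul k x (Ind.mk (MulOpposite.op γ • l) t))
  -- The factor γ moves from l into Γ ⊗ Γ, leaving a generator l in Λ.
  rw [Ind.mk_op]
  exact eq_mk (A := A) hS l (fun γ δ x => h γ δ x l hl) x _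

lemma span_univ : Submodule.span k {m : L | ∃ (γ : Γ), ∃ l ∈ (Set.univ : Set L),
    m = MulOpposite.op γ • l} = ⊤ :=
  eq_top_iff.2 fun l _ => Submodule.subset_span ⟨1, l, trivial, by simp⟩

end SmashMod
end Spanning

/-! ### The adjunction between Z#L↑ and twisted linear maps on L -/

section Extension
variable {k A Γ Z L M : Type u} [Field k] [Ring A] [Algebra k A] [Ring Γ] [HopfAlgebra k Γ]
  [Module Γ A] [IsScalarTower k Γ A] [ModuleAlgebra k A Γ]
  [AddCommGroup Z] [Module k Z] [Module A Z] [Module Aᵐᵒᵖ Z] [IsBimod k A Z]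
  [Module Γ Z] [IsScalarTower k Γ Z] [EqBimod k A Γ Z]
  [AddCommGroup L] [Module k L] [Module Γᵐᵒᵖ L] [IsScalarTower k Γᵐᵒᵖ L]
  [AddCommGroup M] [Module k M]
  (hS : Function.Bijective (HopfAlgebra.antipode k (A := Γ)))

namespace HomAct

variable (Z) in
/-- The operators `f ↦ (γ δ) ↦ γ₂ f(S⁻¹(γ₁) ·) δ`. -/
def adRho (b : BimAct k Γ M) : Γ ⊗[k] Γ →ₗ[k] Module.End k (Z →ₗ[k] M) :=
  TensorProduct.lift ((LinearMap.mul k (Module.End k (Z →ₗ[k] M))).compl₁₂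
    (ad Z hS b).toLinearMap (rho Z b))

@[simp] lemma adRho_tmul (b : BimAct k Γ M) (α β : Γ) (f : Z →ₗ[k] M) :
    adRho Z hS b (α ⊗ₜ β) f = ad Z hS b α (rho Z b β f) := rfl

lemma adRho_tw (b : BimAct k Γ M) (γ : Γ) (t : Γ ⊗[k] Γ) (f : Z →ₗ[k] M) :
    adRho Z hS b t (tw Z hS b γ f) = adRho Z hS b (twL k Γ γ t) f := by
  induction t using TensorProduct.induction_on with
  | zero => simp
  | add x y hx hy => simp only [map_add, LinearMap.add_apply, hx, hy]
  | tmul α β => exact tw_eq_twL Z hS b γ f α β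

/-- This identity and the next are inverse to each other: the first makes an extension left
Γ-linear, the second shows that every left Γ-linear map is such an extension. -/
lemma convAct_ad (b : BimAct k Γ M) (f : Z →ₗ[k] M) :
    convAct (μ Γ Z M) ((ad Z hS b).toLinearMap.flip f) = (lam Z b).toLinearMap.flip f := by
  rw [convAct_smul, μ_mul_ad]

lemma convAct_lam (b : BimAct k Γ M) (f : Z →ₗ[k] M) :
    convAct (ν Z M hS).toLinearMap ((lam Z b).toLinearMap.flip f)
      = (ad Z hS b).toLinearMap.flip f := by
  rw [convAct_smul, ν_mul_lam]

end HomAct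

open HomAct

variable (b : BimAct k (Smash k A Γ) M)

/-- The map `L↑ → Hom(Z, M)` defined by a twisted linear map `L → Hom(Z, M)`. -/
def extH (G : L →ₗ[k] (Z →ₗ[k] M)) (hG : ∀ (γ : Γ) l, G (MulOpposite.op γ • l)
    = tw Z hS (b.comap (Smash.inΓ k A Γ)) γ (G l)) : Ind k Γ L →ₗ[k] (Z →ₗ[k] M) :=
  Ind.lift ((adRho Z hS (b.comap (Smash.inΓ k A Γ))).flip ∘ₗ G) fun γ l t => by
    simp only [LinearMap.comp_apply, LinearMap.flip_apply, hG]
    exact adRho_tw hS _ γ t (G l)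

/-- The bimodule map `Z # L↑ → M` defined by a twisted linear map `L → Hom(Z, M)`. -/
def extF (G : L →ₗ[k] (Z →ₗ[k] M)) (hG : ∀ (γ : Γ) l, G (MulOpposite.op γ • l)
    = tw Z hS (b.comap (Smash.inΓ k A Γ)) γ (G l)) : SmashMod k Z (Ind k Γ L) →ₗ[k] M :=
  TensorProduct.lift (extH hS b G hG).flip

variable {b} {G : L →ₗ[k] (Z →ₗ[k] M)} (hG : ∀ (γ : Γ) l, G (MulOpposite.op γ • l)
    = tw Z hS (b.comap (Smash.inΓ k A Γ)) γ (G l))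

lemma extF_tmul (x : Z) (l : L) (α β : Γ) :
    extF hS b G hG (SmashMod.tmul k x (Ind.mk l (α ⊗ₜ β)))
      = ad Z hS (b.comap (Smash.inΓ k A Γ)) α (rho Z (b.comap (Smash.inΓ k A Γ)) β (G l)) x := rfl

lemma extF_inKL (x : Z) (l : L) : extF hS b G hG (inKL k Γ Z L x l) = G l x := by
  change extF hS b G hG (SmashMod.tmul k x (Ind.mk l (1 ⊗ₜ 1))) = _
  rw [extF_tmul, map_one, Module.End.one_apply, rho_apply, BimAct.r_one]
  rfl

/-- On x ⊗ (l ⊗ α ⊗ β) the left action produces γ₁x and γ₂α. Multiplicativity splits off the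
operator of γ₂, and the convolution of μ with `ad` leaves the plain left action on M. -/
lemma extF_inΓ_smul (γ : Γ) (z : SmashMod k Z (Ind k Γ L)) :
    extF hS b G hG (Smash.inΓ k A Γ γ • z) = b.l (Smash.inΓ k A Γ γ) (extF hS b G hG z) := by
  refine LinearMap.congr_fun (f := extF hS b G hG ∘ₗ lact k _ _ (Smash.inΓ k A Γ γ))
    (g := b.l (Smash.inΓ k A Γ γ) ∘ₗ extF hS b G hG) (TensorProduct.ext' fun x y => ?_) z
  refine LinearMap.congr_fun (f := extF hS b G hG ∘ₗ lact k _ _ (Smash.inΓ k A Γ γ) ∘ₗ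
      TensorProduct.mk k Z (Ind k Γ L) x)
    (g := b.l (Smash.inΓ k A Γ γ) ∘ₗ extF hS b G hG ∘ₗ TensorProduct.mk k Z (Ind k Γ L) x)
    (Ind.hom_ext fun l t => ?_) y
  refine LinearMap.congr_fun (f := extF hS b G hG ∘ₗ lact k _ _ (Smash.inΓ k A Γ γ) ∘ₗ
      TensorProduct.mk k Z (Ind k Γ L) x ∘ₗ Ind.mk l)
    (g := b.l (Smash.inΓ k A Γ γ) ∘ₗ extF hS b G hG ∘ₗ TensorProduct.mk k Z (Ind k Γ L) x ∘ₗ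
      Ind.mk l) (TensorProduct.ext' fun α β => ?_) t
  change extF hS b G hG (Smash.inΓ k A Γ γ • SmashMod.tmul k x (Ind.mk l (α ⊗ₜ β)))
    = b.l (Smash.inΓ k A Γ γ) (extF hS b G hG (SmashMod.tmul k x (Ind.mk l (α ⊗ₜ β))))
  rw [SmashMod.inΓ_smul_tmul, extF_tmul]
  have h := convAct_μ_curry (extF hS b G hG ∘ₗ LinearMap.lTensor Z (Ind.mk l ∘ₗ
    (TensorProduct.mk k Γ Γ).flip β)) γ x α
  refine h.symm.trans ?_
  have h2 : (TensorProduct.curry (extF hS b G hG ∘ₗ LinearMap.lTensor Z (Ind.mk l ∘ₗ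
      (TensorProduct.mk k Γ Γ).flip β))).flip ∘ₗ LinearMap.mulRight k α
      = (ad Z hS (b.comap (Smash.inΓ k A Γ))).toLinearMap.flip
        (ad Z hS (b.comap (Smash.inΓ k A Γ)) α (rho Z (b.comap (Smash.inΓ k A Γ)) β (G l))) := by
    refine LinearMap.ext fun c => LinearMap.ext fun x => ?_
    refine (extF_tmul hS hG x l (c * α) β).trans ?_
    rw [map_mul]
    rfl
  rw [h2, convAct_ad]
  rfl

/-- Right translation only changes β, and the operators attached to α and to β commute. -/
lemma extF_op_inΓ_smul (δ : Γ) (z : SmashMod k Z (Ind k Γ L)) :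
    extF hS b G hG (MulOpposite.op (Smash.inΓ k A Γ δ) • z)
      = b.r (Smash.inΓ k A Γ δ) (extF hS b G hG z) := by
  refine LinearMap.congr_fun (f := extF hS b G hG ∘ₗ ract k _ _ (Smash.inΓ k A Γ δ))
    (g := b.r (Smash.inΓ k A Γ δ) ∘ₗ extF hS b G hG) (TensorProduct.ext' fun x y => ?_) z
  refine LinearMap.congr_fun (f := extF hS b G hG ∘ₗ ract k _ _ (Smash.inΓ k A Γ δ) ∘ₗ
      TensorProduct.mk k Z (Ind k Γ L) x)
    (g := b.r (Smash.inΓ k A Γ δ) ∘ₗ extF hS b G hG ∘ₗ TensorProduct.mk k Z (Ind k Γ L) x)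
    (Ind.hom_ext fun l t => ?_) y
  refine LinearMap.congr_fun (f := extF hS b G hG ∘ₗ ract k _ _ (Smash.inΓ k A Γ δ) ∘ₗ
      TensorProduct.mk k Z (Ind k Γ L) x ∘ₗ Ind.mk l)
    (g := b.r (Smash.inΓ k A Γ δ) ∘ₗ extF hS b G hG ∘ₗ TensorProduct.mk k Z (Ind k Γ L) x ∘ₗ
      Ind.mk l) (TensorProduct.ext' fun α β => ?_) t
  change extF hS b G hG (MulOpposite.op (Smash.inΓ k A Γ δ) •
      SmashMod.tmul k x (Ind.mk l (α ⊗ₜ β)))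
    = b.r (Smash.inΓ k A Γ δ) (extF hS b G hG (SmashMod.tmul k x (Ind.mk l (α ⊗ₜ β))))
  rw [SmashMod.op_inΓ_smul]
  change extF hS b G hG (SmashMod.tmul k x (Ind.mk l (α ⊗ₜ (β * δ)))) = _
  rw [extF_tmul, extF_tmul]
  have h1 : rho Z (b.comap (Smash.inΓ k A Γ)) (β * δ) (G l)
      = rho Z (b.comap (Smash.inΓ k A Γ)) δ (rho Z (b.comap (Smash.inΓ k A Γ)) β (G l)) := by
    ext; simp [b.r_mul]
  rw [h1]
  exact LinearMap.congr_fun (LinearMap.congr_fun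
    (ad_rho Z hS (b.comap (Smash.inΓ k A Γ)) α δ) (rho Z (b.comap (Smash.inΓ k A Γ)) β (G l))) x

/-- `extF` is a bimodule map if the values of `G` on generators are `A`-bimodule maps. -/
lemma extF_isBiHom_of_gen {Λ : Set L} (hΛ : Submodule.span k {m | ∃ (γ : Γ), ∃ l ∈ Λ,
      m = MulOpposite.op γ • l} = ⊤)
    (hGA : ∀ l ∈ Λ, IsBiHom (BimAct.of k A Z) (b.comap (Smash.inA k A Γ)) (G l)) :
    IsBiHom (BimAct.of k (Smash k A Γ) (SmashMod k Z (Ind k Γ L))) b (extF hS b G hG) := by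
  have hl : ∀ (r : Smash k A Γ) (x : Z), ∀ l ∈ Λ, extF hS b G hG (r • inKL k Γ Z L x l)
      = b.l r (extF hS b G hG (inKL k Γ Z L x l)) := by
    intro r x l hl
    refine LinearMap.congr_fun (f := extF hS b G hG ∘ₗ (lact k _ _).flip (inKL k Γ Z L x l))
      (g := b.l.toLinearMap.flip (extF hS b G hG (inKL k Γ Z L x l)))
      -- In the order γa the factor a meets x ⊗ l first, where A-linearity of G(l) is known; the
      -- right-hand analogue below uses the order aγ.
      (Smash.hom_ext' hS fun γ a => ?_) r
    change extF hS b G hG ((Smash.inΓ k A Γ γ * Smash.inA k A Γ a) • inKL k Γ Z L x l)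
      = b.l (Smash.inΓ k A Γ γ * Smash.inA k A Γ a) (extF hS b G hG (inKL k Γ Z L x l))
    rw [mul_smul, SmashMod.inA_smul_inKL, extF_inΓ_smul, map_mul, Module.End.mul_apply, extF_inKL,
      extF_inKL]
    exact congrArg _ ((hGA l hl).left a x)
  have hr : ∀ (r : Smash k A Γ) (x : Z), ∀ l ∈ Λ,
      extF hS b G hG (MulOpposite.op r • inKL k Γ Z L x l)
      = b.r r (extF hS b G hG (inKL k Γ Z L x l)) := by
    intro r x l hl
    refine LinearMap.congr_fun (f := extF hS b G hG ∘ₗ (ract k _ _).flip (inKL k Γ Z L x l))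
      (g := b.r.flip (extF hS b G hG (inKL k Γ Z L x l))) (Smash.hom_ext fun a γ => ?_) r
    change extF hS b G hG (MulOpposite.op (Smash.inA k A Γ a * Smash.inΓ k A Γ γ) •
        inKL k Γ Z L x l)
      = b.r (Smash.inA k A Γ a * Smash.inΓ k A Γ γ) (extF hS b G hG (inKL k Γ Z L x l))
    rw [MulOpposite.op_mul, mul_smul, SmashMod.op_inA_smul_inKL, extF_op_inΓ_smul, b.r_mul,
      LinearMap.comp_apply, extF_inKL, extF_inKL]
    exact congrArg _ ((hGA l hl).right a x)
  constructor
  · intro r z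
    refine LinearMap.congr_fun (f := extF hS b G hG ∘ₗ lact k _ _ r)
      (g := b.l r ∘ₗ extF hS b G hG) (SmashMod.hom_ext_gen (A := A) hS hΛ fun γ δ x l hl' => ?_) z
    simp only [LinearMap.comp_apply, lact_apply]
    -- A spanning element has the form γ(x ⊗ l)δ. The factor γ is absorbed into r and δ is moved
    -- outside, which leaves the case of a generator.
    rw [← mul_smul r, lact_ract k, extF_op_inΓ_smul, hl _ _ _ hl', extF_inΓ_smul, extF_op_inΓ_smul,
      map_mul, Module.End.mul_apply, b.comm, b.comm]
  · intro r z
    refine LinearMap.congr_fun (f := extF hS b G hG ∘ₗ ract k _ _ r)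
      (g := b.r r ∘ₗ extF hS b G hG) (SmashMod.hom_ext_gen (A := A) hS hΛ fun γ δ x l hl' => ?_) z
    simp only [LinearMap.comp_apply, ract_apply]
    rw [← lact_ract k, ← mul_smul (MulOpposite.op r), ← MulOpposite.op_mul, extF_inΓ_smul,
      hr _ _ _ hl', extF_inΓ_smul, extF_op_inΓ_smul, b.r_mul, LinearMap.comp_apply, b.comm]

lemma extF_isBiHom
    (hGA : ∀ l, IsBiHom (BimAct.of k A Z) (b.comap (Smash.inA k A Γ)) (G l)) :
    IsBiHom (BimAct.of k (Smash k A Γ) (SmashMod k Z (Ind k Γ L))) b (extF hS b G hG) :=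
  extF_isBiHom_of_gen hS hG SmashMod.span_univ fun l _ => hGA l

include hS in
-- The elements x ⊗ l generate the bimodule under Γ on both sides; this is the uniqueness half of
-- the adjunction.
lemma SmashMod.hom_ext {F F' : SmashMod k Z (Ind k Γ L) →ₗ[k] M}
    (hF : IsBiHom (BimAct.of k (Smash k A Γ) _) b F)
    (hF' : IsBiHom (BimAct.of k (Smash k A Γ) _) b F')
    (h : ∀ x l, F (inKL k Γ Z L x l) = F' (inKL k Γ Z L x l)) : F = F' := by
  refine SmashMod.hom_ext_gen (A := A) hS SmashMod.span_univ fun γ δ x l _ => ?_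
  rw [← BimAct.of_r (k := k), ← BimAct.of_l (k := k), hF.left, hF.right, hF'.left, hF'.right, h]

/-- The restriction of a bimodule map to `L` is twisted linear. -/
lemma restrict_twisted {F : SmashMod k Z (Ind k Γ L) →ₗ[k] M}
    (hF : IsBiHom (BimAct.of k (Smash k A Γ) _) b F) (γ : Γ) (l : L) :
    F ∘ₗ (inKL k Γ Z L).flip (MulOpposite.op γ • l)
      = tw Z hS (b.comap (Smash.inΓ k A Γ)) γ (F ∘ₗ (inKL k Γ Z L).flip l) := by
  -- A bimodule map has no choice on x ⊗ (l ⊗ α ⊗ β): its value is the one prescribed by the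
  -- extension formula.
  have key : ∀ t : Γ ⊗[k] Γ, F ∘ₗ (TensorProduct.mk k Z (Ind k Γ L)).flip (Ind.mk l t)
      = adRho Z hS (b.comap (Smash.inΓ k A Γ)) t (F ∘ₗ (inKL k Γ Z L).flip l) := by
    intro t
    refine LinearMap.ext fun x => LinearMap.congr_fun
      (f := F ∘ₗ TensorProduct.mk k Z (Ind k Γ L) x ∘ₗ Ind.mk l)
      (g := LinearMap.applyₗ x ∘ₗ (adRho Z hS (b.comap (Smash.inΓ k A Γ))).flip
        (F ∘ₗ (inKL k Γ Z L).flip l)) (TensorProduct.ext' fun α β => ?_) t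
    let Q : Γ →ₗ[k] (Z →ₗ[k] M) := (TensorProduct.curry (F ∘ₗ LinearMap.lTensor Z
      (Ind.mk l ∘ₗ (TensorProduct.mk k Γ Γ).flip β))).flip
    have h1 : Q 1 = rho Z (b.comap (Smash.inΓ k A Γ)) β (F ∘ₗ (inKL k Γ Z L).flip l) := by
      refine LinearMap.ext fun x => ?_
      change F (SmashMod.tmul k x (Ind.mk l (1 ⊗ₜ β))) = _
      rw [← SmashMod.op_inΓ_smul_inKL (A := A)]
      exact hF.right _ _
    -- Left Γ-linearity of F on γ(x ⊗ (l ⊗ 1 ⊗ β)), written as a convolution identity.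
    have h2 : convAct (μ Γ Z M) Q = (lam Z (b.comap (Smash.inΓ k A Γ))).toLinearMap.flip (Q 1) := by
      refine LinearMap.ext fun γ => LinearMap.ext fun x => ?_
      have h3 := convAct_μ_curry (F ∘ₗ LinearMap.lTensor Z
        (Ind.mk l ∘ₗ (TensorProduct.mk k Γ Γ).flip β)) γ x 1
      rw [LinearMap.mulRight_one, LinearMap.comp_id] at h3
      refine h3.trans ?_
      refine (congrArg F (SmashMod.inΓ_smul_tmul (A := A) γ 1 β x l).symm).trans ?_
      exact hF.left (Smash.inΓ k A Γ γ) _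
    -- Solving that identity for Q by convolution with the inverse of μ.
    have h4 : Q = (ad Z hS (b.comap (Smash.inΓ k A Γ))).toLinearMap.flip (Q 1) := by
      rw [← convAct_lam, ← h2, convAct_convAct, ν_mul_μ, convAct_one]
    refine (LinearMap.congr_fun (LinearMap.congr_fun h4 α) x).trans ?_
    rw [h1]
    rfl
  -- Since lγ ⊗ (1 ⊗ 1) equals l ⊗ (S(γ₁) ⊗ γ₂), the formula at this element compares the
  -- restrictions of F at lγ and at l.
  have h5 := key (twL k Γ γ (1 ⊗ₜ 1))
  rw [← Ind.mk_op, ← adRho_tw, adRho_tmul, map_one, Module.End.one_apply] at h5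
  refine Eq.trans h5 ?_
  ext x
  simp [b.r_one]

section
variable {f : Z →ₗ[k] M} (hf : IsBiHom (BimAct.of k A Z) (b.comap (Smash.inA k A Γ)) f)

lemma span_one : Submodule.span k {m : Γ | ∃ (γ : Γ), ∃ l ∈ ({1} : Set Γ),
    m = MulOpposite.op γ • l} = ⊤ :=
  eq_top_iff.2 fun l _ => Submodule.subset_span ⟨l, 1, rfl, by simp⟩

variable (b f) in
lemma twGen (γ η : Γ) : (tw Z hS (b.comap (Smash.inΓ k A Γ))).flip f (MulOpposite.op γ • η)
    = tw Z hS (b.comap (Smash.inΓ k A Γ)) γ ((tw Z hS (b.comap (Smash.inΓ k A Γ))).flip f η) := by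
  simp [tw_mul]

include hf

/-- Take L = Γ, generated by 1. The map γ ↦ f·γ is known to take an A-bimodule map as value only at
1, which suffices for `extF_isBiHom_of_gen`. That all values f·γ are A-bimodule maps is then read
off from the extension, so no direct computation with S(γ₁) f(γ₂ ·) γ₃ is needed. -/
lemma extF_twGen : IsBiHom (BimAct.of k (Smash k A Γ) (SmashMod k Z (Ind k Γ Γ))) b
    (extF hS b _ (twGen hS b f)) := by
  refine extF_isBiHom_of_gen hS _ span_one ?_
  rintro _ rfl
  rw [LinearMap.flip_apply, tw_one]
  exact hf

/-- The twisted action preserves bimodule maps. -/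
lemma tw_isBiHom (γ : Γ) : IsBiHom (BimAct.of k A Z) (b.comap (Smash.inA k A Γ))
    (tw Z hS (b.comap (Smash.inΓ k A Γ)) γ f) := by
  have h := extF_twGen hS hf
  have h1 : ∀ x, tw Z hS (b.comap (Smash.inΓ k A Γ)) γ f x
    = extF hS b _ (twGen hS b f) (inKL k Γ Z Γ x γ) := fun x => (extF_inKL hS (twGen hS b f) x γ).symm
  refine ⟨fun a x => ?_, fun a x => ?_⟩
  · rw [h1, h1, BimAct.of_l, ← SmashMod.inA_smul_inKL]
    exact h.left (Smash.inA k A Γ a) _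
  · rw [h1, h1, BimAct.of_r, ← SmashMod.op_inA_smul_inKL]
    exact h.right (Smash.inA k A Γ a) _

/-- The twisted action is natural. -/
lemma comp_tw {N : Type u} [AddCommGroup N] [Module k N] {c : BimAct k (Smash k A Γ) N}
    {p : M →ₗ[k] N} (hp : IsBiHom b c p) (γ : Γ) :
    p ∘ₗ tw Z hS (b.comap (Smash.inΓ k A Γ)) γ f
      = tw Z hS (c.comap (Smash.inΓ k A Γ)) γ (p ∘ₗ f) := by
  -- Composing the extension of f with p gives a bimodule map on Z#Γ↑; its twisted linearity at 1 is
  -- the naturality claimed.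
  have h := restrict_twisted hS (hp.comp (extF_twGen hS hf)) γ (1 : Γ)
  have h1 : ∀ η : Γ, (p ∘ₗ extF hS b _ (twGen hS b f)) ∘ₗ (inKL k Γ Z Γ).flip η
      = p ∘ₗ tw Z hS (b.comap (Smash.inΓ k A Γ)) η f :=
    fun η => LinearMap.ext fun x => congrArg p (extF_inKL hS (twGen hS b f) x η)
  rw [h1, h1, tw_one] at h
  simpa using h

end

include hS in
/-- `Z # L↑` has the lifting property if `Z` has it and `L` is projective. -/
lemma LiftProp.smash (hZ : LiftProp (BimAct.of k A Z)) (hL : Module.Projective Γᵐᵒᵖ L) :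
    LiftProp (BimAct.of k (Smash k A Γ) (SmashMod k Z (Ind k Γ L))) := by
  intro M N _ _ _ _ b c p f hp hf hr
  -- Projectivity supplies a Γ-linear section of the canonical map from the free module on the set
  -- L.
  obtain ⟨s, hs⟩ := hL
  let Gf : L →ₗ[k] biHom (BimAct.of k A Z) (c.comap (Smash.inA k A Γ)) :=
    { toFun := fun l => ⟨f ∘ₗ (inKL k Γ Z L).flip l, fun a x => by
          change f (inKL k Γ Z L (a • x) l) = _
          rw [← SmashMod.inA_smul_inKL]; exact hf.left (Smash.inA k A Γ a) _, fun a x => by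
          change f (inKL k Γ Z L (MulOpposite.op a • x) l) = _
          rw [← SmashMod.op_inA_smul_inKL]; exact hf.right (Smash.inA k A Γ a) _⟩
      map_add' := fun l m => by ext; simp
      map_smul' := fun a l => by ext; simp }
  let P : biHom (BimAct.of k A Z) (b.comap (Smash.inA k A Γ)) →ₗ[k]
      biHom (BimAct.of k A Z) (c.comap (Smash.inA k A Γ)) :=
    (LinearMap.compRight k p).restrict fun g hg =>
      IsBiHom.comp (b := b.comap (Smash.inA k A Γ)) ⟨fun r => hp.left _, fun r => hp.right _⟩ hg
  have hP : ∀ l, ∃ g, P g = Gf l := by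
    intro l
    obtain ⟨g, hg, hpg⟩ := hZ (b.comap (Smash.inA k A Γ)) (c.comap (Smash.inA k A Γ)) p (Gf l).1
      ⟨fun r => hp.left _, fun r => hp.right _⟩ (Gf l).2 fun x => hr _
    exact ⟨⟨g, hg⟩, Subtype.ext (LinearMap.ext hpg)⟩
  -- This lift of the adjoint of f is only k-linear in l; the twisted linearity is imposed next.
  obtain ⟨h, hh⟩ := exists_linear_lift P Gf hP
  -- The twisted linear extension of h to the free module on L. It still lies over f, because p
  -- commutes with the twisted action by `comp_tw` and f restricts to a twisted linear map.
  let Φ : (L →₀ Γᵐᵒᵖ) →ₗ[k] (Z →ₗ[k] M) := Finsupp.lsum k fun l =>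
    (tw Z hS (b.comap (Smash.inΓ k A Γ))).flip (h l).1 ∘ₗ
      (MulOpposite.opLinearEquiv k).symm.toLinearMap
  have hΦ : ∀ l g, Φ (Finsupp.single l g)
      = tw Z hS (b.comap (Smash.inΓ k A Γ)) g.unop (h l).1 := fun l g => by simp [Φ]
  have hΦtw : ∀ (γ : Γ) v, Φ (MulOpposite.op γ • v)
      = tw Z hS (b.comap (Smash.inΓ k A Γ)) γ (Φ v) := by
    intro γ v
    induction v using Finsupp.induction_linear with
    | zero => simp
    | add v w hv hw => rw [smul_add, map_add, map_add, map_add, hv, hw]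
    | single l g =>
      rw [Finsupp.smul_single, hΦ, hΦ, smul_eq_mul, MulOpposite.unop_mul, MulOpposite.unop_op,
        tw_mul]
      rfl
  have hΦA : ∀ v, Φ v ∈ biHom (BimAct.of k A Z) (b.comap (Smash.inA k A Γ)) := by
    intro v
    induction v using Finsupp.induction_linear with
    | zero => rw [map_zero]; exact zero_mem _
    | add v w hv hw => rw [map_add]; exact add_mem hv hw
    | single l g => rw [hΦ]; exact tw_isBiHom hS (h l).2 _
  have hΦp : ∀ v, p ∘ₗ Φ v
      = f ∘ₗ (inKL k Γ Z L).flip (Finsupp.linearCombination Γᵐᵒᵖ id v) := by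
    intro v
    induction v using Finsupp.induction_linear with
    | zero => simp
    | add v w hv hw => rw [map_add, LinearMap.comp_add, hv, hw, map_add, map_add, LinearMap.comp_add]
    | single l g =>
      rw [hΦ, comp_tw hS (h l).2 hp, Finsupp.linearCombination_single, id_eq]
      have h1 : p ∘ₗ (h l).1 = f ∘ₗ (inKL k Γ Z L).flip l := congrArg Subtype.val (hh l)
      rw [h1, ← restrict_twisted hS hf]
      rfl
  have hG : ∀ (γ : Γ) l, (Φ ∘ₗ s.restrictScalars k) (MulOpposite.op γ • l)
      = tw Z hS (b.comap (Smash.inΓ k A Γ)) γ ((Φ ∘ₗ s.restrictScalars k) l) := by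
    intro γ l
    change Φ (s (MulOpposite.op γ • l)) = _
    rw [map_smul, hΦtw]
    rfl
  -- Composing with the section s gives a twisted linear map on L, hence a bimodule map by the
  -- adjunction.
  have hF := extF_isBiHom hS hG fun l => hΦA (s l)
  refine ⟨_, hF, LinearMap.congr_fun (SmashMod.hom_ext hS (hp.comp hF) hf fun x l => ?_)⟩
  rw [LinearMap.comp_apply, extF_inKL]
  refine (LinearMap.congr_fun (hΦp (s l)) x).trans ?_
  rw [hs l]
  rfl

end Extension

/-! ### Contractions of augmented complexes of vector spaces -/

section Contractions
variable {k X Y N N' : Type u} [Field k] [AddCommGroup X] [Module k X] [AddCommGroup Y] [Module k Y]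
  [AddCommGroup N] [Module k N] [AddCommGroup N'] [Module k N']

namespace GrCx

/-- A contraction of an augmented complex of vector spaces onto its augmentation. -/
structure Contraction (C : GrCx k X) (ε : X →ₗ[k] N) where
  s : X →ₗ[k] X
  η : N →ₗ[k] X
  s_mem : ∀ n, ∀ x ∈ C.gr n, s x ∈ C.gr (n + 1)
  η_mem : ∀ y, η y ∈ C.gr 0
  ε_η : ∀ y, ε (η y) = y
  d_s : ∀ x, C.d (s x) + s (C.d x) = x - η (ε x)

/-- Over a field the augmentation splits, and the identity minus the splitting idempotent is
null-homotopic by exactness, with no equivariance required. -/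
lemma exists_contraction (C : GrCx k X) (ε : X →ₗ[k] N) (hs : ∀ y, ∃ x ∈ C.gr 0, ε x = y)
    (hd : ∀ x, ε (C.d x) = 0) (hp : ∀ n, ∀ x ∈ C.gr (n + 1), ε x = 0)
    (h0 : ∀ x ∈ C.gr 0, ε x = 0 → ∃ y ∈ C.gr 1, C.d y = x)
    (h1 : ∀ n, ∀ x ∈ C.gr (n + 1), C.d x = 0 → ∃ y ∈ C.gr (n + 2), C.d y = x) :
    Nonempty (C.Contraction ε) := by
  obtain ⟨η, hη⟩ := exists_linear_lift (ε ∘ₗ (C.gr 0).subtype) LinearMap.id fun y => by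
    obtain ⟨x, hx, hxy⟩ := hs y
    exact ⟨⟨x, hx⟩, hxy⟩
  have hη' : ∀ y, ε (η y) = y := hη
  obtain ⟨s, -, hsg, hsd⟩ := C.exists_nullhomotopy (T := C.gr) (δ := C.d) (H := ⊤)
    (e := LinearMap.id - (C.gr 0).subtype ∘ₗ η ∘ₗ ε) (fun _ _ => trivial) (fun _ _ => trivial)
    (C.hasLifts_top _ _) h1 trivial (fun x => by simp [hd, C.d_gr_zero _ (η _).2])
    (fun n x hx => by
      rcases n with _ | n
      · exact sub_mem hx (η _).2
      · simpa [hp n x hx] using hx)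
    (fun x hx => h0 _ (sub_mem hx (η _).2) (by simp [hη']))
  exact ⟨⟨s, (C.gr 0).subtype ∘ₗ η, hsg, fun y => (η y).2, hη', hsd⟩⟩

/-- The contraction of a tensor product. -/
def Contraction.tensor {C : GrCx k X} {D : GrCx k Y} {ε : X →ₗ[k] N} {ε' : Y →ₗ[k] N'}
    (c : C.Contraction ε) (c' : D.Contraction ε') (hp : ∀ n, ∀ x ∈ C.gr (n + 1), ε x = 0)
    (hd : ∀ x, ε (C.d x) = 0) :
    (C.tensor D).Contraction (TensorProduct.map ε ε') where
  -- The usual homotopy: contract the first factor, and on what remains, namely the image of ηε in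
  -- degree zero, contract the second.
  s := TensorProduct.map c.s LinearMap.id + TensorProduct.map (c.η ∘ₗ ε) c'.s
  η := TensorProduct.map c.η c'.η
  s_mem n := by
    change C.tensorGr D n ≤ (C.tensorGr D (n + 1)).comap _
    refine Submodule.span_le.2 ?_
    rintro _ ⟨i, j, rfl, x, hx, y, hy, rfl⟩
    refine Submodule.add_mem (C.tensorGr D (i + j + 1))
      (Submodule.subset_span ⟨i + 1, j, by omega, _, c.s_mem i x hx, y, hy, rfl⟩) ?_
    rcases i with _ | i
    · exact Submodule.subset_span ⟨0, j + 1, by omega, _, c.η_mem _, _, c'.s_mem j y hy, rfl⟩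
    · simp [hp i x hx]
  η_mem t := by
    induction t using TensorProduct.induction_on with
    | zero => rw [map_zero]; exact zero_mem _
    | add x y hx hy => rw [map_add]; exact add_mem hx hy
    | tmul x y => exact Submodule.subset_span ⟨0, 0, rfl, _, c.η_mem x, _, c'.η_mem y, rfl⟩
  ε_η t := by
    refine LinearMap.congr_fun (f := TensorProduct.map ε ε' ∘ₗ TensorProduct.map c.η c'.η)
      (g := LinearMap.id) (TensorProduct.ext' fun x y => ?_) t
    simp [c.ε_η, c'.ε_η]
  d_s t := by
    -- The augmentation and its splitting live in degree zero, where the sign operator is trivial;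
    -- only the contraction of the first factor anticommutes with it.
    have hsgn : ∀ x, ε (C.sgn x) = ε x := fun x => LinearMap.congr_fun (f := ε ∘ₗ C.sgn) (g := ε)
      (ext_gr C.isInternal fun n x hx => by
        rcases n with _ | n
        · simp [C.sgn_mem hx, sg_zero]
        · simp [C.sgn_mem hx, hp n x hx]) x
    have hsgn' : ∀ y, C.sgn (c.η y) = c.η y := fun y => by
      simp [C.sgn_mem (c.η_mem y), sg_zero]
    have hss : ∀ x, C.sgn (c.s x) = - c.s (C.sgn x) := fun x => LinearMap.congr_fun
      (f := C.sgn ∘ₗ c.s) (g := - (c.s ∘ₗ C.sgn)) (ext_gr C.isInternal fun n x hx => by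
        simp [C.sgn_mem hx, C.sgn_mem (c.s_mem n x hx), sg_add, sg_one]) x
    refine LinearMap.congr_fun (f := C.tensorD D ∘ₗ (TensorProduct.map c.s LinearMap.id +
        TensorProduct.map (c.η ∘ₗ ε) c'.s) + (TensorProduct.map c.s LinearMap.id +
        TensorProduct.map (c.η ∘ₗ ε) c'.s) ∘ₗ C.tensorD D)
      (g := LinearMap.id - TensorProduct.map c.η c'.η ∘ₗ TensorProduct.map ε ε')
      (TensorProduct.ext' fun x y => ?_) t
    have h1 : C.d (c.s x) = x - c.η (ε x) - c.s (C.d x) := eq_sub_of_add_eq (c.d_s x)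
    have h2 : D.d (c'.s y) = y - c'.η (ε' y) - c'.s (D.d y) := eq_sub_of_add_eq (c'.d_s y)
    simp only [tensorD, LinearMap.add_apply, LinearMap.comp_apply, LinearMap.sub_apply,
      TensorProduct.map_tmul, LinearMap.id_coe, id_eq, map_add, hss, hsgn, hsgn', hd, map_zero,
      C.d_gr_zero _ (c.η_mem _), h1, h2, TensorProduct.zero_tmul, TensorProduct.sub_tmul,
      TensorProduct.tmul_sub, TensorProduct.neg_tmul]
    abel

end GrCx
end Contractions

/-! ### Untwisting L↑ into Γ ⊗ L, and its contraction -/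

section InducedContraction
variable {k Γ L : Type u} [Field k] [Ring Γ] [HopfAlgebra k Γ]
  [AddCommGroup L] [Module k L] [Module Γᵐᵒᵖ L] [IsScalarTower k Γᵐᵒᵖ L]

namespace Ind

section
variable {V : Type u} [AddCommGroup V] [Module k V]

/-- Composition with the passage to the opposite algebra. -/
def toOp (u : Γ →ₗ[k] Module.End k V) : WithConv (Γ →ₗ[k] (Module.End k V)ᵐᵒᵖ) :=
  WithConv.toConv ((MulOpposite.opLinearEquiv k).toLinearMap ∘ₗ u)

@[simp] lemma toOp_apply (u : Γ →ₗ[k] Module.End k V) (γ : Γ) :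
    (toOp u).ofConv γ = MulOpposite.op (u γ) := rfl

end

variable (Y : Type u) [AddCommGroup Y] [Module k Y]

variable (k Γ) in
/-- Right multiplication on the first factor of `Γ ⊗ Y`. -/
def r₁ : Γ →ₗ[k] Module.End k (Γ ⊗[k] Y) := LinearMap.rTensorHom Y ∘ₗ ract k Γ Γ

variable (k Γ) in
/-- `r₁` as an algebra map to the opposite algebra. -/
def r₁Op : Γ →ₐ[k] (Module.End k (Γ ⊗[k] Y))ᵐᵒᵖ :=
  AlgHom.ofLinearMap ((MulOpposite.opLinearEquiv k).toLinearMap ∘ₗ r₁ k Γ Y)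
    (congrArg MulOpposite.op (by ext; simp [r₁])) fun γ δ =>
      congrArg MulOpposite.op (by ext; simp [r₁, mul_assoc])

variable {Y}

/-- Right actions are antimultiplicative, so they become algebra maps, and diagonal actions become
convolution products, only in the opposite endomorphism algebra. -/
lemma toOp_diagOp (u : Γ →ₗ[k] Module.End k Γ) (v : Γ →ₗ[k] Module.End k Y) :
    toOp (diagOp u v) = toOp (LinearMap.rTensorHom Y ∘ₗ u) * toOp (LinearMap.lTensorHom Γ ∘ₗ v) := by
  refine WithConv.ext (LinearMap.ext fun γ => ?_)
  change MulOpposite.op (TensorProduct.map₂ u v (comul γ))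
    = LinearMap.mul' k _ (TensorProduct.map _ _ (comul γ))
  generalize (comul γ : Γ ⊗[k] Γ) = s
  induction s using TensorProduct.induction_on with
  | zero => simp
  | add x y hx hy => simp only [map_add, MulOpposite.op_add, hx, hy]
  | tmul x y =>
    simp only [TensorProduct.map₂_apply_tmul, TensorProduct.map_tmul, LinearMap.mul'_apply]
    simp only [toOp_apply, ← MulOpposite.op_mul]
    exact congrArg MulOpposite.op (by ext; simp)

lemma toOp_r₁ : toOp (r₁ k Γ Y) = WithConv.toConv (r₁Op k Γ Y).toLinearMap := rfl

lemma toOp_r₁_antipode : toOp (r₁ k Γ Y ∘ₗ HopfAlgebra.antipode k)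
    = WithConv.toConv ((r₁Op k Γ Y).toLinearMap ∘ₗ HopfAlgebra.antipode k) := rfl

/-- The right diagonal action on `Γ ⊗ L`. -/
abbrev dg : Γ →ₗ[k] Module.End k (Γ ⊗[k] L) := diagOp (ract k Γ Γ) (ract k Γ L)

lemma antipode_r₁_mul_r₁ :
    toOp (r₁ k Γ L ∘ₗ HopfAlgebra.antipode k) * toOp (r₁ k Γ L) = 1 := by
  have h := conv_psi' (E := (Module.End k (Γ ⊗[k] L))ᵐᵒᵖ) (r₁Op k Γ L)
  rw [← toOp_r₁, ← toOp_r₁_antipode] at h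
  exact h

/-- On g ⊗ l this reads g S(γ₁)γ₂ ⊗ lγ₃ = g ⊗ lγ: the antipode cancels the action on the first
factor. -/
lemma conv_antipode_dg :
    toOp (r₁ k Γ L ∘ₗ HopfAlgebra.antipode k) * toOp (dg (L := L))
      = toOp (LinearMap.lTensorHom Γ ∘ₗ ract k Γ L) := by
  rw [dg, toOp_diagOp, ← mul_assoc, show LinearMap.rTensorHom L ∘ₗ ract k Γ Γ = r₁ k Γ L from rfl,
    antipode_r₁_mul_r₁, one_mul]

/-- On g ⊗ g' this reads gγ₁S(γ₂) ⊗ γ₃g' = g ⊗ γg', the cancellation in the other order. -/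
lemma conv_r₁_twL : toOp (r₁ k Γ Γ) * toOp (twL k Γ) = toOp (LinearMap.lTensorHom Γ ∘ₗ lact k Γ Γ) := by
  rw [twL, toOp_diagOp, ← mul_assoc, show LinearMap.rTensorHom Γ ∘ₗ ract k Γ Γ ∘ₗ
    HopfAlgebra.antipode k = r₁ k Γ Γ ∘ₗ HopfAlgebra.antipode k from rfl,
    toOp_r₁, toOp_r₁_antipode, conv_psi, one_mul]

/-- The map `Γ ⊗ Γ → Γ ⊗ L`, `g ⊗ g' ↦ g g'₁ ⊗ l g'₂`. -/
def untwist₀ : L →ₗ[k] Γ ⊗[k] Γ →ₗ[k] Γ ⊗[k] L :=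
  TensorProduct.curry (TensorProduct.lift (dg (k := k) (L := L)).flip ∘ₗ
    (TensorProduct.comm k L Γ).toLinearMap.rTensor Γ ∘ₗ
      (TensorProduct.assoc k L Γ Γ).symm.toLinearMap)

lemma untwist₀_tmul (l : L) (g g' : Γ) : untwist₀ (k := k) l (g ⊗ₜ g') = dg g' (g ⊗ₜ l) := by
  simp [untwist₀]

/-- The element gS(γ₁) ⊗ γ₂g' is sent to the diagonal translate by g' of gS(γ₁)γ₂ ⊗ lγ₃, where the
antipode cancels. -/
lemma untwist₀_twL (γ : Γ) (l : L) (t : Γ ⊗[k] Γ) :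
    untwist₀ (k := k) (MulOpposite.op γ • l) t = untwist₀ l (twL k Γ γ t) := by
  refine LinearMap.congr_fun (f := untwist₀ (k := k) (MulOpposite.op γ • l))
    (g := untwist₀ l ∘ₗ twL k Γ γ) (TensorProduct.ext' fun g g' => ?_) t
  have h1 := congrArg (fun e : WithConv (Γ →ₗ[k] (Module.End k (Γ ⊗[k] L))ᵐᵒᵖ) =>
    (MulOpposite.unop (e.ofConv γ) : Module.End k (Γ ⊗[k] L)) (g ⊗ₜ l))
    (conv_antipode_dg (k := k) (Γ := Γ) (L := L))
  have h2 : ∀ s : Γ ⊗[k] Γ, untwist₀ l (TensorProduct.map₂ (ract k Γ Γ ∘ₗ HopfAlgebra.antipode k)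
      (lact k Γ Γ) s (g ⊗ₜ g')) = dg g' (MulOpposite.unop (LinearMap.mul' k _ (TensorProduct.map
        (toOp (r₁ k Γ L ∘ₗ HopfAlgebra.antipode k)).ofConv (toOp (dg (L := L))).ofConv s))
          (g ⊗ₜ l)) := by
    intro s
    induction s using TensorProduct.induction_on with
    | zero => simp
    | add x y hx hy => simp only [map_add, MulOpposite.unop_add, LinearMap.add_apply, hx, hy]
    | tmul a b =>
      have h3 : dg (k := k) (L := L) (b * g') = dg g' ∘ₗ dg b :=
        diagOp_antimul (fun a b => by ext; simp [mul_assoc])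
          (fun a b => by ext; simp [mul_smul]) b g'
      simp [untwist₀_tmul, h3, r₁]
  refine (untwist₀_tmul _ _ _).trans ?_
  refine Eq.trans ?_ (h2 (comul γ)).symm
  exact congrArg (dg g') h1.symm

variable (k Γ L) in
/-- The isomorphism `L ⊗_Γ (Γ ⊗ Γ) → Γ ⊗ L`. -/
def untwist : Ind k Γ L →ₗ[k] Γ ⊗[k] L := lift untwist₀ untwist₀_twL

variable (k Γ L) in
/-- The map `g ⊗ l ↦ l ⊗ (g ⊗ 1)`. -/
def retwist : Γ ⊗[k] L →ₗ[k] Ind k Γ L :=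
  TensorProduct.lift (mkₗ.compl₂ ((TensorProduct.mk k Γ Γ).flip 1)).flip

@[simp] lemma retwist_tmul (g : Γ) (l : L) : retwist k Γ L (g ⊗ₜ l) = mk l (g ⊗ₜ 1) := rfl

@[simp] lemma untwist_mk (l : L) (g g' : Γ) :
    untwist k Γ L (mk l (g ⊗ₜ g')) = dg g' (g ⊗ₜ l) := untwist₀_tmul l g g'

/-- The round trip of l ⊗ (g ⊗ g') is lg'₂ ⊗ (gg'₁ ⊗ 1). Moving g'₂ across ⊗_Γ gives gg'₁S(g'₂) ⊗
g'₃, that is, g ⊗ g'. This one-sided inverse is enough to transport a contraction. -/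
lemma retwist_untwist (y : Ind k Γ L) : retwist k Γ L (untwist k Γ L y) = y := by
  refine LinearMap.congr_fun (f := retwist k Γ L ∘ₗ untwist k Γ L) (g := LinearMap.id)
    (hom_ext fun l t => ?_) y
  refine LinearMap.congr_fun (f := retwist k Γ L ∘ₗ untwist k Γ L ∘ₗ mk l) (g := mk l)
    (TensorProduct.ext' fun g g' => ?_) t
  have h1 := congrArg (fun e : WithConv (Γ →ₗ[k] (Module.End k (Γ ⊗[k] Γ))ᵐᵒᵖ) =>
    (MulOpposite.unop (e.ofConv g') : Module.End k (Γ ⊗[k] Γ)) (g ⊗ₜ[k] (1 : Γ)))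
    (conv_r₁_twL (k := k) (Γ := Γ))
  have h2 : ∀ s : Γ ⊗[k] Γ, retwist k Γ L (TensorProduct.map₂ (ract k Γ Γ) (ract k Γ L) s (g ⊗ₜ l))
      = mk l (MulOpposite.unop (LinearMap.mul' k _ (TensorProduct.map
        (toOp (r₁ k Γ Γ)).ofConv (toOp (twL k Γ)).ofConv s)) (g ⊗ₜ 1)) := by
    intro s
    induction s using TensorProduct.induction_on with
    | zero => simp
    | add x y hx hy => simp only [map_add, MulOpposite.unop_add, LinearMap.add_apply, hx, hy]
    | tmul a b => simp [r₁, mk_op]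
  change retwist k Γ L (untwist k Γ L (mk l (g ⊗ₜ g'))) = _
  rw [untwist_mk]
  refine (h2 (comul g')).trans ?_
  refine (congrArg (mk l) h1).trans ?_
  simp

variable (C : AugRightCx k Γ L)

lemma untwist_d (y : Ind k Γ L) :
    untwist k Γ L (dInd C y) = LinearMap.lTensor Γ C.d (untwist k Γ L y) := by
  refine LinearMap.congr_fun (f := untwist k Γ L ∘ₗ dInd C)
    (g := LinearMap.lTensor Γ C.d ∘ₗ untwist k Γ L) (hom_ext fun l t => ?_) y
  refine LinearMap.congr_fun (f := untwist k Γ L ∘ₗ mk (C.d l))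
    (g := LinearMap.lTensor Γ C.d ∘ₗ untwist k Γ L ∘ₗ mk l)
    (TensorProduct.ext' fun g g' => ?_) t
  simp only [LinearMap.comp_apply, untwist_mk]
  exact (diagOp_nat (f := LinearMap.id) (g := C.d) (fun _ _ => rfl)
    (fun γ l => C.d_op_smul γ l) g' (g ⊗ₜ[k] l)).symm

lemma retwist_d (t : Γ ⊗[k] L) :
    retwist k Γ L (LinearMap.lTensor Γ C.d t) = dInd C (retwist k Γ L t) := by
  refine LinearMap.congr_fun (f := retwist k Γ L ∘ₗ LinearMap.lTensor Γ C.d)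
    (g := dInd C ∘ₗ retwist k Γ L) (TensorProduct.ext' fun g l => ?_) t
  rfl

lemma counit_untwist (y : Ind k Γ L) :
    TensorProduct.rid k Γ (LinearMap.lTensor Γ C.aug (untwist k Γ L y)) = augInd C y := by
  refine LinearMap.congr_fun (f := (TensorProduct.rid k Γ).toLinearMap ∘ₗ
    LinearMap.lTensor Γ C.aug ∘ₗ untwist k Γ L) (g := augInd C) (hom_ext fun l t => ?_) y
  refine LinearMap.congr_fun (f := (TensorProduct.rid k Γ).toLinearMap ∘ₗ
    LinearMap.lTensor Γ C.aug ∘ₗ untwist k Γ L ∘ₗ mk l) (g := augInd C ∘ₗ mk l)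
    (TensorProduct.ext' fun g g' => ?_) t
  simp only [LinearMap.comp_apply, untwist_mk]
  have h := diagOp_nat (f := LinearMap.id) (g := C.aug) (u := ract k Γ Γ) (u' := ract k Γ Γ)
    (v := ract k Γ L) (v' := triv k Γ k) (fun _ _ => rfl)
    (fun γ l => C.aug_op_smul γ l) g' (g ⊗ₜ[k] l)
  refine (congrArg (TensorProduct.rid k Γ) h).trans ?_
  rw [TensorProduct.map_tmul, diagOp_triv_right]
  simp

/-- The contraction of `L ⊗_Γ (Γ ⊗ Γ)` induced by one of `L`. -/
def contraction (c : C.toGrCx.Contraction C.aug) :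
    (cx C).toGrCx.Contraction (augInd C) where
  s := retwist k Γ L ∘ₗ LinearMap.lTensor Γ c.s ∘ₗ untwist k Γ L
  -- The contraction of L chooses an element over 1 in k; its translates by Γ split the augmentation
  -- of L↑.
  η := retwist k Γ L ∘ₗ (TensorProduct.mk k Γ L).flip (c.η 1)
  s_mem n y hy := by
    refine gr_le (S := (gr C (n + 1)).comap (retwist k Γ L ∘ₗ LinearMap.lTensor Γ c.s ∘ₗ
      untwist k Γ L)) C (fun l hl t => ?_) hy
    refine TensorProduct.induction_on t ?_ (fun g g' => ?_) fun x y hx hy => ?_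
    · rw [map_zero]; exact zero_mem _
    · rw [Submodule.mem_comap, LinearMap.comp_apply, LinearMap.comp_apply, untwist_mk]
      change retwist k Γ L (LinearMap.lTensor Γ c.s (TensorProduct.map₂ _ _ (comul g') (g ⊗ₜ l))) ∈ _
      generalize (comul g' : Γ ⊗[k] Γ) = s
      induction s using TensorProduct.induction_on with
      | zero => simp
      | add x y hx hy => simp only [map_add, LinearMap.add_apply]; exact add_mem hx hy
      | tmul a b => exact mk_mem C (c.s_mem n _ (C.op_smul_mem n b l hl)) _
    · rw [map_add]; exact add_mem hx hy
  η_mem g := mk_mem C (c.η_mem 1) _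
  ε_η g := by
    change augInd C (mk (c.η 1) (g ⊗ₜ 1)) = g
    rw [augInd_mk, c.ε_η]
    simp
  d_s y := by
    change dInd C (retwist k Γ L (LinearMap.lTensor Γ c.s (untwist k Γ L y)))
      + retwist k Γ L (LinearMap.lTensor Γ c.s (untwist k Γ L (dInd C y)))
      = y - retwist k Γ L (augInd C y ⊗ₜ c.η 1)
    rw [← retwist_d, untwist_d, ← map_add]
    have h : ∀ t : Γ ⊗[k] L, LinearMap.lTensor Γ C.d (LinearMap.lTensor Γ c.s t)
        + LinearMap.lTensor Γ c.s (LinearMap.lTensor Γ C.d t)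
        = t - TensorProduct.rid k Γ (LinearMap.lTensor Γ C.aug t) ⊗ₜ c.η 1 := by
      intro t
      refine LinearMap.congr_fun (f := LinearMap.lTensor Γ C.d ∘ₗ LinearMap.lTensor Γ c.s +
        LinearMap.lTensor Γ c.s ∘ₗ LinearMap.lTensor Γ C.d) (g := LinearMap.id -
          (TensorProduct.mk k Γ L).flip (c.η 1) ∘ₗ (TensorProduct.rid k Γ).toLinearMap ∘ₗ
            LinearMap.lTensor Γ C.aug) (TensorProduct.ext' fun g l => ?_) t
      have h1 := c.d_s l
      have h2 : c.η (C.aug l) = C.aug l • c.η 1 := by rw [← map_smul, smul_eq_mul, mul_one]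
      simp only [LinearMap.add_apply, LinearMap.comp_apply, LinearMap.lTensor_tmul,
        ← TensorProduct.tmul_add, h1, h2, TensorProduct.tmul_sub]
      simp [TensorProduct.smul_tmul']
    rw [h, map_sub, retwist_untwist, counit_untwist]

end Ind
end InducedContraction

/-! ### Exactness of Z#L↑ -/

section SmashResolution
variable {k A Γ Z L : Type u} [Field k] [Ring A] [Algebra k A] [Ring Γ] [HopfAlgebra k Γ]
  [Module Γ A] [IsScalarTower k Γ A] [ModuleAlgebra k A Γ]
  [AddCommGroup Z] [Module k Z] [Module A Z] [Module Aᵐᵒᵖ Z] [IsBimod k A Z]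
  [Module Γ Z] [IsScalarTower k Γ Z] [EqBimod k A Γ Z]
  [AddCommGroup L] [Module k L] [Module Γᵐᵒᵖ L] [IsScalarTower k Γᵐᵒᵖ L]

/-- `Z # L↑` is a resolution of `A # Γ`. -/
lemma AugBimodCx.IsResolution.smash {C : AugBimodCx k A Z} (hC : C.IsEquivariant Γ)
    (hr : C.IsResolution) {CL : AugRightCx k Γ L} (hL : CL.IsProjRes) :
    (smashRes C hC CL).IsResolution := by
  obtain ⟨c⟩ := C.exists_contraction C.aug hr.surj C.aug_d C.aug_pos hr.exact_zero hr.exact_succ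
  obtain ⟨c'⟩ := CL.exists_contraction CL.aug hL.surj CL.aug_d CL.aug_pos hL.exact_zero
    hL.exact_succ
  let c'' : (smashRes C hC CL).toGrCx.Contraction (smashRes C hC CL).aug :=
    c.tensor (Ind.contraction CL c') C.aug_pos C.aug_d
  refine ⟨fun r => ⟨c''.η r, c''.η_mem r, c''.ε_η r⟩, fun x hx h => ⟨c''.s x, c''.s_mem 0 x hx, ?_⟩,
    fun n x hx h => ⟨c''.s x, c''.s_mem _ x hx, ?_⟩⟩
  · have := c''.d_s x
    rwa [(smashRes C hC CL).d_gr_zero x hx, h, map_zero, map_zero, add_zero, sub_zero] at this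
  · have := c''.d_s x
    rwa [h, (smashRes C hC CL).aug_pos n x hx, map_zero, map_zero, add_zero, sub_zero] at this

end SmashResolution

/-! ### Sweedler calculus and an antipode-free form of twisted linearity -/

section Sweedler
variable {k Γ V W : Type u} [Field k] [Ring Γ] [HopfAlgebra k Γ] [AddCommGroup V] [Module k V]
  [AddCommGroup W] [Module k W]

/-- The linear map `γ ↦ f(γ₁, γ₂)`. -/
def sw : (Γ →ₗ[k] Γ →ₗ[k] V) →ₗ[k] (Γ →ₗ[k] V) where
  toFun f := TensorProduct.lift f ∘ₗ comul
  map_add' f g := by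
    have h : TensorProduct.lift (f + g) = TensorProduct.lift f + TensorProduct.lift g := by
      ext; simp
    rw [h, LinearMap.add_comp]
  map_smul' c f := by
    have h : TensorProduct.lift (c • f) = c • TensorProduct.lift f := by ext; simp
    rw [h, LinearMap.smul_comp]; rfl

lemma sw_apply (f : Γ →ₗ[k] Γ →ₗ[k] V) (γ : Γ) : sw f γ = TensorProduct.lift f (comul γ) := rfl

lemma sw_compr₂ (f : Γ →ₗ[k] Γ →ₗ[k] V) (q : V →ₗ[k] W) : sw (f.compr₂ q) = q ∘ₗ sw f := by
  have h : TensorProduct.lift (f.compr₂ q) = q ∘ₗ TensorProduct.lift f := by ext; simp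
  change TensorProduct.lift (f.compr₂ q) ∘ₗ comul = _
  rw [h]; rfl

/-- Coassociativity: the last two or the first two of three Sweedler arguments may be contracted
first. -/
lemma sw_assoc (F : Γ →ₗ[k] Γ →ₗ[k] Γ →ₗ[k] V) : sw (sw ∘ₗ F) = sw (sw F) := by
  let Φ : Γ ⊗[k] (Γ ⊗[k] Γ) →ₗ[k] V :=
    TensorProduct.lift ((TensorProduct.lift.equiv (.id k) Γ Γ V).toLinearMap ∘ₗ F)
  have h1 : TensorProduct.lift (sw ∘ₗ F) = Φ ∘ₗ comul.lTensor Γ := by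
    refine TensorProduct.ext' fun a g => ?_
    rfl
  have h2 : TensorProduct.lift (sw F)
      = Φ ∘ₗ (TensorProduct.assoc k Γ Γ Γ).toLinearMap ∘ₗ comul.rTensor Γ := by
    refine TensorProduct.ext' fun g c => ?_
    simp only [TensorProduct.lift.tmul, sw_apply, LinearMap.comp_apply, LinearMap.rTensor_tmul,
      LinearEquiv.coe_coe]
    generalize (comul g : Γ ⊗[k] Γ) = s
    induction s using TensorProduct.induction_on with
    | zero => simp
    | add x y hx hy => simp only [map_add, LinearMap.add_apply, hx, hy, TensorProduct.add_tmul]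
    | tmul a b => simp [Φ]
  refine LinearMap.ext fun γ => ?_
  rw [sw_apply, sw_apply, h1, h2]
  simp only [LinearMap.comp_apply, LinearEquiv.coe_coe, coassoc_apply]

namespace HomAct
variable {Z M : Type u} [AddCommGroup Z] [Module k Z] [Module Γ Z] [IsScalarTower k Γ Z]
  [AddCommGroup M] [Module k M] (hS : Function.Bijective (HopfAlgebra.antipode k (A := Γ)))

/-- The twisted action is λS convolved with μ * ρ, and λS is the convolution inverse of λ, so it can
be moved to the other side. -/
lemma eq_tw_iff_convAct (b : BimAct k Γ M) (h : Γ →ₗ[k] (Z →ₗ[k] M)) (f : Z →ₗ[k] M) :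
    h = (tw Z hS b).flip f ↔ convAct (lam Z b).toLinearMap h
      = (WithConv.toConv (μ Γ Z M) * WithConv.toConv (rho Z b)).ofConv.flip f := by
  have h2 : ((tw Z hS b).flip f) = convAct ((lam Z b).toLinearMap ∘ₗ HopfAlgebra.antipode k)
      ((WithConv.toConv (μ Γ Z M) * WithConv.toConv (rho Z b)).ofConv.flip f) := by
    rw [convAct_smul]
    have h1 := toConv_tw' Z hS b
    rw [mul_assoc] at h1
    exact congrArg (fun e : WithConv (Γ →ₗ[k] Module.End k (Z →ₗ[k] M)) => e.ofConv.flip f) h1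
  constructor
  · rintro rfl
    rw [h2, convAct_convAct, conv_psi, convAct_one]
  · intro hh
    rw [h2, ← hh, convAct_convAct, conv_psi', convAct_one]

/-- The twisted linearity `h(γ) = S(γ₁) f(γ₂ ·) γ₃` is equivalent to
`γ₁ h(γ₂) = f(γ₁ ·) γ₂`. -/
lemma eq_tw_iff (b : BimAct k Γ M) (h : Γ →ₗ[k] (Z →ₗ[k] M)) (f : Z →ₗ[k] M) :
    h = (tw Z hS b).flip f ↔ ∀ x, sw (b.l.toLinearMap.compl₂ (h.flip x))
      = sw (b.r.flip ∘ₗ f ∘ₗ (lact k Γ Z).flip x) := by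
  have h1 : ∀ γ x, convAct (lam Z b).toLinearMap h γ x
      = sw (b.l.toLinearMap.compl₂ (h.flip x)) γ := by
    intro γ x
    change (TensorProduct.lift (lam Z b).toLinearMap (h.lTensor Γ (comul γ))) x
      = TensorProduct.lift _ (comul γ)
    generalize (comul γ : Γ ⊗[k] Γ) = s
    induction s using TensorProduct.induction_on with
    | zero => simp
    | add x y hx hy => simp only [map_add, LinearMap.add_apply, hx, hy]
    | tmul a b => simp
  have h2 : ∀ γ x, (WithConv.toConv (μ Γ Z M) * WithConv.toConv (rho Z b)).ofConv.flip f γ x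
      = sw (b.r.flip ∘ₗ f ∘ₗ (lact k Γ Z).flip x) γ := by
    intro γ x
    change (LinearMap.mul' k _ (TensorProduct.map (μ Γ Z M) (rho Z b) (comul γ))) f x
      = TensorProduct.lift _ (comul γ)
    generalize (comul γ : Γ ⊗[k] Γ) = s
    induction s using TensorProduct.induction_on with
    | zero => simp
    | add x y hx hy => simp only [map_add, LinearMap.add_apply, hx, hy]
    | tmul a b => simp
  rw [eq_tw_iff_convAct]
  constructor
  · intro hh x
    ext γ
    rw [← h1, ← h2, hh]
  · intro hh
    ext γ x
    rw [h1, h2, hh]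

end HomAct
end Sweedler

/-! ### Twisted linearity of the shuffle map -/

section ShuffleTwist
variable {k A Γ K L : Type u} [Field k] [Ring A] [Algebra k A] [Ring Γ] [HopfAlgebra k Γ]
  [Module Γ A] [IsScalarTower k Γ A] [ModuleAlgebra k A Γ]
  [AddCommGroup K] [Module k K] [Module A K] [Module Aᵐᵒᵖ K] [IsBimod k A K]
  [Module Γ K] [IsScalarTower k Γ K] [EqBimod k A Γ K]
  [AddCommGroup L] [Module k L] [Module Γᵐᵒᵖ L] [IsScalarTower k Γᵐᵒᵖ L]
  (hS : Function.Bijective (HopfAlgebra.antipode k (A := Γ)))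

open HomAct

variable (k A Γ K L) in
/-- The restriction of the bimodule structure of `K # L↑` to `Γ`. -/
abbrev smashΓ : BimAct k Γ (SmashMod k K (Ind k Γ L)) :=
  (BimAct.of k (Smash k A Γ) (SmashMod k K (Ind k Γ L))).comap (Smash.inΓ k A Γ)

variable (k A Γ K L) in
/-- The restriction of the bimodule structure of `(K # L↑) ⊗ (K # L↑)` to `Γ`. -/
abbrev smashSqΓ : BimAct k Γ (Sq k (Smash k A Γ) (SmashMod k K (Ind k Γ L))) :=
  (sqAct k (Smash k A Γ) (SmashMod k K (Ind k Γ L))).comap (Smash.inΓ k A Γ)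

include hS in
-- In K#L↑ one has γ₁(x ⊗ lγ₂) = (γ₁x ⊗ l)γ₂. It is the twisted linearity of the inclusion of the
-- generators, obtained by restricting the identity map, in the form without antipode.
lemma sw_inKL (x : K) (l : L) :
    sw ((smashΓ k A Γ K L).l.toLinearMap.compl₂ (inKL k Γ K L x ∘ₗ (ract k Γ L).flip l))
      = sw ((smashΓ k A Γ K L).r.flip ∘ₗ (inKL k Γ K L).flip l ∘ₗ (lact k Γ K).flip x) := by
  refine (eq_tw_iff hS (smashΓ k A Γ K L) ((inKL k Γ K L).flip ∘ₗ (ract k Γ L).flip l)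
    ((inKL k Γ K L).flip l)).1 (LinearMap.ext fun γ => ?_) x
  exact restrict_twisted hS (F := LinearMap.id)
    (b := BimAct.of k (Smash k A Γ) (SmashMod k K (Ind k Γ L))) ⟨fun _ _ => rfl, fun _ _ => rfl⟩ γ l

variable (k A Γ K L) in
/-- `shuffle₀` as a bilinear map. -/
abbrev shuf₀ : K ⊗[k] K →ₗ[k] L ⊗[k] L →ₗ[k] Sq k (Smash k A Γ) (SmashMod k K (Ind k Γ L)) :=
  TensorProduct.curry (shuffle₀ k A Γ K L)

lemma shuf₀_tmul (x y : K) (l m : L) : shuf₀ k A Γ K L (x ⊗ₜ y) (l ⊗ₜ m)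
    = sqMk k (Smash k A Γ) _ (inKL k Γ K L x l ⊗ₜ inKL k Γ K L y m) := by
  simp [shuf₀, shuffle₀]

include hS in
-- The computation is γ₁(x ⊗ lγ₂) ⊗ (y ⊗ mγ₃) = (γ₁x ⊗ l)γ₂ ⊗ (y ⊗ mγ₃) = (γ₁x ⊗ l) ⊗ γ₂(y ⊗ mγ₃) =
-- (γ₁x ⊗ l) ⊗ (γ₂y ⊗ m)γ₃. It applies `sw_inKL` in each factor, with the balancing over Γ ⊆ A#Γ in
-- between, and coassociativity regroups the three Sweedler indices.
lemma sw_shuf₀ (t : K ⊗[k] K) (s : L ⊗[k] L) :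
    sw ((smashSqΓ k A Γ K L).l.toLinearMap.compl₂
        (shuf₀ k A Γ K L t ∘ₗ (diagOp (ract k Γ L) (ract k Γ L)).flip s))
      = sw ((smashSqΓ k A Γ K L).r.flip ∘ₗ (shuf₀ k A Γ K L).flip s ∘ₗ
        (diagOp (lact k Γ K) (lact k Γ K)).flip t) := by
  induction t using TensorProduct.induction_on with
  | zero =>
    refine Eq.trans (b := sw 0) (congrArg sw (by ext; simp)) (congrArg sw (by ext; simp))
  | add x y hx hy =>
    refine (congrArg sw ?_).trans ((map_add sw _ _).trans ((congrArg₂ (· + ·) hx hy).trans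
      ((map_add sw _ _).symm.trans (congrArg sw ?_))))
    · ext; simp only [map_add, LinearMap.compl₂_apply, LinearMap.add_apply, LinearMap.comp_apply]
    · ext; simp only [map_add, LinearMap.add_apply, LinearMap.comp_apply]
  | tmul x y =>
    induction s using TensorProduct.induction_on with
    | zero =>
      refine Eq.trans (b := sw 0) (congrArg sw (by ext; simp)) (congrArg sw (by ext; simp))
    | add s s' hx hy =>
      refine (congrArg sw ?_).trans ((map_add sw _ _).trans ((congrArg₂ (· + ·) hx hy).trans
        ((map_add sw _ _).symm.trans (congrArg sw ?_))))
      · ext; simp only [map_add, LinearMap.compl₂_apply, LinearMap.add_apply, LinearMap.comp_apply]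
      · ext; simp only [map_add, LinearMap.add_apply, LinearMap.comp_apply]
    | tmul l m =>
      let X := SmashMod k K (Ind k Γ L)
      let R := Smash k A Γ
      let p : X →ₗ[k] X →ₗ[k] Sq k R X := TensorProduct.curry (sqMk k R X)
      let u : K → L → Γ →ₗ[k] Γ →ₗ[k] X := fun x l =>
        (smashΓ k A Γ K L).l.toLinearMap.compl₂ (inKL k Γ K L x ∘ₗ (ract k Γ L).flip l)
      let v : K → L → Γ →ₗ[k] Γ →ₗ[k] X := fun x l =>
        (smashΓ k A Γ K L).r.flip ∘ₗ (inKL k Γ K L).flip l ∘ₗ (lact k Γ K).flip x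
      have huv : ∀ x l, sw (u x l) = sw (v x l) := sw_inKL hS
      let q : X →ₗ[k] Γ →ₗ[k] Sq k R X :=
        (LinearMap.lcomp k _ (inKL k Γ K L y ∘ₗ (ract k Γ L).flip m)) ∘ₗ p
      let r : Γ →ₗ[k] X := (inKL k Γ K L).flip l ∘ₗ (lact k Γ K).flip x
      -- The family in which the first index has already acted on x and the other two are to act on
      -- the second factor through w.
      let F (w : Γ →ₗ[k] Γ →ₗ[k] X) : Γ →ₗ[k] Γ →ₗ[k] Γ →ₗ[k] Sq k R X :=
        { toFun := fun a => w.compr₂ (p (r a))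
          map_add' := fun a b => by ext; simp
          map_smul' := fun a b => by ext; simp }
      have e1 : sw ∘ₗ (u x l).compr₂ q = (smashSqΓ k A Γ K L).l.toLinearMap.compl₂
          (shuf₀ k A Γ K L (x ⊗ₜ y) ∘ₗ (diagOp (ract k Γ L) (ract k Γ L)).flip (l ⊗ₜ m)) := by
        refine LinearMap.ext fun a => LinearMap.ext fun g => ?_
        change TensorProduct.lift ((u x l).compr₂ q a) (comul g) = sqL X (Smash.inΓ k A Γ a)
          (shuf₀ k A Γ K L (x ⊗ₜ y) (TensorProduct.map₂ _ _ (comul g) (l ⊗ₜ m)))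
        generalize (comul g : Γ ⊗[k] Γ) = s
        induction s using TensorProduct.induction_on with
        | zero => simp
        | add x y hx hy => simp only [map_add, LinearMap.add_apply, hx, hy]
        | tmul b c =>
          rw [TensorProduct.map₂_apply_tmul, TensorProduct.map_tmul, shuf₀_tmul]
          rfl
      -- Here the middle index crosses the tensor product over A#Γ.
      have e2 : (v x l).compr₂ q = F (u y m) := by
        refine LinearMap.ext fun a => LinearMap.ext fun b => LinearMap.ext fun c => ?_
        exact BTen.mk_bal (Smash.inΓ k A Γ b) _ _
      have e3 : sw ∘ₗ F (u y m) = sw ∘ₗ F (v y m) := by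
        refine LinearMap.ext fun a => ?_
        change sw ((u y m).compr₂ (p (r a))) = sw ((v y m).compr₂ (p (r a)))
        rw [sw_compr₂, sw_compr₂, huv]
      have e4 : sw (F (v y m)) = (smashSqΓ k A Γ K L).r.flip ∘ₗ (shuf₀ k A Γ K L).flip (l ⊗ₜ m) ∘ₗ
          (diagOp (lact k Γ K) (lact k Γ K)).flip (x ⊗ₜ y) := by
        refine LinearMap.ext fun g => LinearMap.ext fun c => ?_
        change TensorProduct.lift (F (v y m)) (comul g) c = sqR X (Smash.inΓ k A Γ c)
          (shuf₀ k A Γ K L (TensorProduct.map₂ _ _ (comul g) (x ⊗ₜ y)) (l ⊗ₜ m))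
        generalize (comul g : Γ ⊗[k] Γ) = s
        induction s using TensorProduct.induction_on with
        | zero => simp
        | add x y hx hy => simp only [map_add, LinearMap.add_apply, hx, hy]
        | tmul a b =>
          rw [TensorProduct.map₂_apply_tmul, TensorProduct.map_tmul, shuf₀_tmul]
          rfl
      have e5 : sw ((u x l).compr₂ q) = sw ((v x l).compr₂ q) := by
        rw [sw_compr₂, sw_compr₂, huv]
      -- The chain regroups so that the first two indices are contracted for the first factor, then
      -- the last two for the second, then back.
      exact (congrArg sw e1).symm.trans <| (sw_assoc _).trans <| (congrArg sw (e5.trans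
        (congrArg sw e2))).trans <| (sw_assoc _).symm.trans <| (congrArg sw e3).trans <|
        (sw_assoc _).trans (congrArg sw e4)

end ShuffleTwist

/-! ### The diagonal map of K#L↑ -/

section SmashDiag
variable {k A Γ K L : Type u} [Field k] [Ring A] [Algebra k A] [Ring Γ] [HopfAlgebra k Γ]
  [Module Γ A] [IsScalarTower k Γ A] [ModuleAlgebra k A Γ]
  [AddCommGroup K] [Module k K] [Module A K] [Module Aᵐᵒᵖ K] [IsBimod k A K]
  [Module Γ K] [IsScalarTower k Γ K] [EqBimod k A Γ K]
  [AddCommGroup L] [Module k L] [Module Γᵐᵒᵖ L] [IsScalarTower k Γᵐᵒᵖ L]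
  (hS : Function.Bijective (HopfAlgebra.antipode k (A := Γ)))

open HomAct

lemma AugBimodCx.isBiHom_sqAug {R X : Type u} [Ring R] [Algebra k R] [AddCommGroup X] [Module k X]
    [Module R X] [Module Rᵐᵒᵖ X] [IsBimod k R X] (C : AugBimodCx k R X) :
    IsBiHom (sqAct k R X) (BimAct.self k R) C.sqAug := by
  constructor
  · intro r
    refine LinearMap.congr_fun (f := C.sqAug ∘ₗ sqL X r) (g := (BimAct.self k R).l r ∘ₗ C.sqAug)
      (BTen.hom_ext fun x y => ?_)
    change C.aug (r • x) * C.aug y = r * (C.aug x * C.aug y)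
    rw [C.aug_smul, mul_assoc]
  · intro r
    refine LinearMap.congr_fun (f := C.sqAug ∘ₗ sqR X r) (g := (BimAct.self k R).r r ∘ₗ C.sqAug)
      (BTen.hom_ext fun x y => ?_)
    change C.aug x * C.aug (MulOpposite.op r • y) = (C.aug x * C.aug y) * r
    rw [C.aug_op_smul, mul_assoc]

lemma AugBimodCx.isBiHom_aug {R X : Type u} [Ring R] [Algebra k R] [AddCommGroup X] [Module k X]
    [Module R X] [Module Rᵐᵒᵖ X] [IsBimod k R X] (C : AugBimodCx k R X) :
    IsBiHom (BimAct.of k R X) (BimAct.self k R) C.aug :=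
  ⟨C.aug_smul, C.aug_op_smul⟩

lemma HomAct.ad_mem {Z M : Type u} [AddCommGroup Z] [Module k Z] [Module Γ Z]
    [IsScalarTower k Γ Z] [AddCommGroup M] [Module k M] (b : BimAct k Γ M) {T : Submodule k Z}
    {S : Submodule k M} (hT : ∀ (γ : Γ), ∀ x ∈ T, γ • x ∈ T) (hl : ∀ γ, ∀ m ∈ S, b.l γ m ∈ S)
    {f : Z →ₗ[k] M} (hf : ∀ x ∈ T, f x ∈ S) (γ : Γ) : ∀ x ∈ T, ad Z hS b γ f x ∈ S := by
  intro x hx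
  change Algebra.TensorProduct.lift (ν Z M hS) (lam Z b) (ν_lam_comm Z hS b) (comul γ) f x ∈ S
  generalize (comul γ : Γ ⊗[k] Γ) = s
  induction s using TensorProduct.induction_on with
  | zero => simp
  | add x y hx hy => simp only [map_add, LinearMap.add_apply]; exact add_mem hx hy
  | tmul c e =>
    rw [Algebra.TensorProduct.lift_tmul]
    exact hl _ _ (hf _ (hT _ x hx))

/-- The extension uses only the action of Γ on K, which preserves degrees, and the actions on M,
which preserve S. With S a homogeneous component this controls degrees; with S = 0 it shows
vanishing. -/
lemma extF_mem {M : Type u} [AddCommGroup M] [Module k M] {b : BimAct k (Smash k A Γ) M}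
    {G : L →ₗ[k] (K →ₗ[k] M)} (hG : ∀ (γ : Γ) l, G (MulOpposite.op γ • l)
      = tw K hS (b.comap (Smash.inΓ k A Γ)) γ (G l)) {CK : AugBimodCx k A K}
    (hK : CK.IsEquivariant Γ) {CL : AugRightCx k Γ L} {S : Submodule k M} {n : ℕ}
    (hl : ∀ r, ∀ m ∈ S, b.l r m ∈ S) (hr : ∀ r, ∀ m ∈ S, b.r r m ∈ S)
    (h : ∀ i p, i + p = n → ∀ x ∈ CK.gr i, ∀ l ∈ CL.gr p, G l x ∈ S)
    {z : SmashMod k K (Ind k Γ L)} (hz : z ∈ (smashRes CK hK CL).gr n) :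
    extF hS b G hG z ∈ S := by
  refine Submodule.span_le (p := S.comap (extF hS b G hG)) |>.2 ?_ hz
  rintro _ ⟨i, p, hip, x, hx, y, hy, rfl⟩
  refine Ind.gr_le (S := S.comap (extF hS b G hG ∘ₗ TensorProduct.mk k K (Ind k Γ L) x)) CL
    (fun l hl' t => ?_) hy
  induction t using TensorProduct.induction_on with
  | zero => rw [map_zero]; exact zero_mem _
  | add s t hs ht => rw [map_add]; exact add_mem hs ht
  | tmul α β =>
    exact HomAct.ad_mem (T := CK.gr i) hS _ (fun γ x hx => hK.smul_mem i γ x hx)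
      (fun γ m hm => hl _ m hm) (fun x hx => hr _ _ (h i p hip x hx l hl')) α x hx

variable (CK : AugBimodCx k A K) (CL : AugRightCx k Γ L)

lemma AugRightCx.sgn_op_smul (γ : Γ) (l : L) :
    CL.sgn (MulOpposite.op γ • l) = MulOpposite.op γ • CL.sgn l :=
  (CL.scale_comm CL.toGrCx _ (f := ract k Γ L γ) (fun n x hx => CL.op_smul_mem n γ x hx) l).symm

variable {CK} in
lemma AugBimodCx.IsEquivariant.scale_smul (hK : CK.IsEquivariant Γ) (c : ℕ → ℤ) (γ : Γ) (x : K) :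
    scaleOf CK.isInternal c (γ • x) = γ • scaleOf CK.isInternal c x :=
  (CK.scale_comm CK.toGrCx c (f := lact k Γ K γ) (fun n x hx => hK.smul_mem n γ x hx) x).symm

/-- `shuffle` as a bilinear map. -/
abbrev shuf : K ⊗[k] K →ₗ[k] L ⊗[k] L →ₗ[k] Sq k (Smash k A Γ) (SmashMod k K (Ind k Γ L)) :=
  TensorProduct.curry (shuffle CK CL)

lemma shuf_eq (t : K ⊗[k] K) (s : L ⊗[k] L) : shuf CK CL t s
    = shuf₀ k A Γ K L (TensorProduct.map LinearMap.id CK.even t) s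
      + shuf₀ k A Γ K L (TensorProduct.map LinearMap.id CK.odd t)
        (TensorProduct.map CL.sgn LinearMap.id s) := by
  simp [shuf, shuffle]

lemma shuf_tmul {j p : ℕ} (x : K) {y : K} (hy : y ∈ CK.gr j) {l : L} (hl : l ∈ CL.gr p) (m : L) :
    shuf CK CL (x ⊗ₜ y) (l ⊗ₜ m) = sg (j * p) •
      sqMk k (Smash k A Γ) _ (inKL k Γ K L x l ⊗ₜ inKL k Γ K L y m) := by
  rw [shuf_eq, TensorProduct.map_tmul, TensorProduct.map_tmul, TensorProduct.map_tmul, shuf₀_tmul,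
    shuf₀_tmul, CL.sgn_mem hl, GrCx.even, GrCx.odd, scaleOf_mem _ _ hy, scaleOf_mem _ _ hy]
  simp only [LinearMap.id_coe, id_eq]
  by_cases h : Even j
  · rw [sg_even ((Int.even_coe_nat j).2 h |>.mul_right _)]
    simp [h]
  · have ho : Odd (j : ℤ) := by exact_mod_cast Nat.not_even_iff_odd.1 h
    obtain ⟨q, hq⟩ := ho
    have : sg (j * p) = sg p := by
      rw [hq, add_mul, one_mul, sg_add, sg_even (by rw [mul_assoc]; exact even_two_mul _), one_mul]
    rw [this]
    simp only [h, if_false, zero_smul, map_zero, TensorProduct.tmul_zero, one_smul, zero_add,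
      LinearMap.zero_apply, map_zsmul]
    rw [← TensorProduct.smul_tmul', map_zsmul]

/-- Both actions of A on generators fall on K alone, so the factor a crosses ⊗ over A#Γ exactly as
it crosses ⊗_A. The sign operators are A-linear. -/
lemma shuf_bal (a : A) (x y : K) : shuf CK CL (ract k A K a x ⊗ₜ y)
    = shuf CK CL (x ⊗ₜ lact k A K a y) := by
  have h : ∀ y, shuf₀ k A Γ K L ((MulOpposite.op a • x) ⊗ₜ y)
      = shuf₀ k A Γ K L (x ⊗ₜ (a • y)) := by
    intro y
    refine TensorProduct.ext' fun l m => ?_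
    rw [shuf₀_tmul, shuf₀_tmul, ← SmashMod.op_inA_smul_inKL, ← SmashMod.inA_smul_inKL (A := A)]
    exact BTen.mk_bal (Smash.inA k A Γ a) _ _
  refine LinearMap.ext fun s => ?_
  simp only [shuf_eq, TensorProduct.map_tmul, LinearMap.id_coe, id_eq, ract_apply, lact_apply,
    GrCx.even, GrCx.odd, CK.scale_smul, h]

lemma shuf_left (a : A) (t : K ⊗[k] K) (s : L ⊗[k] L) :
    shuf CK CL (TensorProduct.map (lact k A K a) LinearMap.id t) s
      = sqL _ (Smash.inA k A Γ a) (shuf CK CL t s) := by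
  have h : ∀ t s, shuf₀ k A Γ K L (TensorProduct.map (lact k A K a) LinearMap.id t) s
      = sqL _ (Smash.inA k A Γ a) (shuf₀ k A Γ K L t s) := by
    intro t s
    refine LinearMap.congr_fun (LinearMap.congr_fun (f := shuf₀ k A Γ K L ∘ₗ
      TensorProduct.map (lact k A K a) LinearMap.id)
      (g := LinearMap.compRight k (sqL _ (Smash.inA k A Γ a)) ∘ₗ shuf₀ k A Γ K L)
      (TensorProduct.ext' fun x y => TensorProduct.ext' fun l m => ?_) t) s
    change shuf₀ k A Γ K L ((a • x) ⊗ₜ y) (l ⊗ₜ m)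
      = sqL _ (Smash.inA k A Γ a) (shuf₀ k A Γ K L (x ⊗ₜ y) (l ⊗ₜ m))
    rw [shuf₀_tmul, shuf₀_tmul, ← SmashMod.inA_smul_inKL]
    rfl
  have hc : ∀ (f : K →ₗ[k] K) (t : K ⊗[k] K), TensorProduct.map LinearMap.id f
      (TensorProduct.map (lact k A K a) LinearMap.id t)
      = TensorProduct.map (lact k A K a) LinearMap.id (TensorProduct.map LinearMap.id f t) := by
    intro f t
    induction t using TensorProduct.induction_on with
    | zero => simp
    | add x y hx hy => simp only [map_add, hx, hy]
    | tmul x y => simp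
  rw [shuf_eq, shuf_eq, hc, hc, h, h, map_add]

lemma shuf_right (a : A) (t : K ⊗[k] K) (s : L ⊗[k] L) :
    shuf CK CL (TensorProduct.map LinearMap.id (ract k A K a) t) s
      = sqR _ (Smash.inA k A Γ a) (shuf CK CL t s) := by
  have h : ∀ t s, shuf₀ k A Γ K L (TensorProduct.map LinearMap.id (ract k A K a) t) s
      = sqR _ (Smash.inA k A Γ a) (shuf₀ k A Γ K L t s) := by
    intro t s
    refine LinearMap.congr_fun (LinearMap.congr_fun (f := shuf₀ k A Γ K L ∘ₗ
      TensorProduct.map LinearMap.id (ract k A K a))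
      (g := LinearMap.compRight k (sqR _ (Smash.inA k A Γ a)) ∘ₗ shuf₀ k A Γ K L)
      (TensorProduct.ext' fun x y => TensorProduct.ext' fun l m => ?_) t) s
    change shuf₀ k A Γ K L (x ⊗ₜ (MulOpposite.op a • y)) (l ⊗ₜ m)
      = sqR _ (Smash.inA k A Γ a) (shuf₀ k A Γ K L (x ⊗ₜ y) (l ⊗ₜ m))
    rw [shuf₀_tmul, shuf₀_tmul, ← SmashMod.op_inA_smul_inKL]
    rfl
  have hc : ∀ (c : ℕ → ℤ) (t : K ⊗[k] K), TensorProduct.map LinearMap.id (scaleOf CK.isInternal c)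
      (TensorProduct.map LinearMap.id (ract k A K a) t)
      = TensorProduct.map LinearMap.id (ract k A K a)
        (TensorProduct.map LinearMap.id (scaleOf CK.isInternal c) t) := by
    intro f t
    induction t using TensorProduct.induction_on with
    | zero => simp
    | add x y hx hy => simp only [map_add, hx, hy]
    | tmul x y => simp [CK.scale_op]
  rw [shuf_eq, shuf_eq, GrCx.even, GrCx.odd, hc, hc, h, h, map_add]

variable {CK} in
include hS in
-- The signs are produced by degree operators, which commute with Γ, so the claim splits into two
-- instances of the unsigned one.
lemma sw_shuf (hK : CK.IsEquivariant Γ) (t : K ⊗[k] K) (s : L ⊗[k] L) :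
    sw ((smashSqΓ k A Γ K L).l.toLinearMap.compl₂
        (shuf CK CL t ∘ₗ (diagOp (ract k Γ L) (ract k Γ L)).flip s))
      = sw ((smashSqΓ k A Γ K L).r.flip ∘ₗ (shuf CK CL).flip s ∘ₗ
        (diagOp (lact k Γ K) (lact k Γ K)).flip t) := by
  have h1 : ∀ g : Γ, TensorProduct.map CL.sgn LinearMap.id
      (diagOp (ract k Γ L) (ract k Γ L) g s) = diagOp (ract k Γ L) (ract k Γ L) g
        (TensorProduct.map CL.sgn LinearMap.id s) := fun g =>
    diagOp_nat (fun γ l => CL.sgn_op_smul γ l) (fun _ _ => rfl) g s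
  have h2 : ∀ (c : ℕ → ℤ) (g : Γ), TensorProduct.map LinearMap.id (scaleOf CK.isInternal c)
      (diagOp (lact k Γ K) (lact k Γ K) g t) = diagOp (lact k Γ K) (lact k Γ K) g
        (TensorProduct.map LinearMap.id (scaleOf CK.isInternal c) t) := fun c g =>
    diagOp_nat (fun _ _ => rfl) (fun γ l => hK.scale_smul c γ l) g t
  refine (congrArg sw ?_).trans ((map_add sw _ _).trans ((congrArg₂ (· + ·)
    (sw_shuf₀ hS (TensorProduct.map LinearMap.id CK.even t) s)
    (sw_shuf₀ hS (TensorProduct.map LinearMap.id CK.odd t)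
        (TensorProduct.map CL.sgn LinearMap.id s))).trans
      ((map_add sw _ _).symm.trans (congrArg sw ?_))))
  · refine LinearMap.ext fun a => LinearMap.ext fun g => ?_
    simp only [LinearMap.compl₂_apply, LinearMap.add_apply, LinearMap.comp_apply,
      LinearMap.flip_apply]
    rw [← map_add, shuf_eq, h1]
  · refine LinearMap.ext fun a => LinearMap.ext fun g => ?_
    simp only [LinearMap.add_apply, LinearMap.comp_apply, LinearMap.flip_apply]
    rw [← map_add, shuf_eq, GrCx.even, GrCx.odd, h2, h2]

variable {CK CL}

lemma inKL_mem (hK : CK.IsEquivariant Γ) {i p : ℕ} {x : K} (hx : x ∈ CK.gr i) {l : L}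
    (hl : l ∈ CL.gr p) : inKL k Γ K L x l ∈ (smashRes CK hK CL).gr (i + p) :=
  Submodule.subset_span (R := k) (M := K ⊗[k] Ind k Γ L)
    ⟨i, p, rfl, x, hx, _, Ind.mk_mem CL hl _, rfl⟩

lemma d_inKL (hK : CK.IsEquivariant Γ) (x : K) (l : L) :
    (smashRes CK hK CL).d (inKL k Γ K L x l)
      = inKL k Γ K L (CK.d x) l + inKL k Γ K L (CK.sgn x) (CL.d l) := rfl

lemma aug_inKL (hK : CK.IsEquivariant Γ) (x : K) (l : L) :
    (smashRes CK hK CL).aug (inKL k Γ K L x l) = CL.aug l • Smash.inA k A Γ (CK.aug x) := by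
  change CK.aug x ⊗ₜ[k] Ind.augInd CL (Ind.mk l (1 ⊗ₜ 1)) = _
  have h : Ind.augInd CL (Ind.mk l (1 ⊗ₜ 1)) = CL.aug l • (1 : Γ) := by
    rw [Ind.augInd_mk]
    simp
  rw [h, TensorProduct.tmul_smul]
  rfl

lemma shuf_mem (hK : CK.IsEquivariant Γ) {i n : ℕ} {t : K ⊗[k] K}
    (ht : t ∈ CK.tensorGr CK.toGrCx i) {s : L ⊗[k] L} (hs : s ∈ CL.tensorGr CL.toGrCx n) :
    shuf CK CL t s ∈ (smashRes CK hK CL).sqGr (i + n) := by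
  refine Submodule.span_le (p := ((smashRes CK hK CL).sqGr (i + n)).comap
    ((shuf CK CL).flip s)) |>.2 ?_ ht
  rintro _ ⟨a, b, rfl, x, hx, y, hy, rfl⟩
  refine Submodule.span_le (p := ((smashRes CK hK CL).sqGr (a + b + n)).comap
    (shuf CK CL (x ⊗ₜ y))) |>.2 ?_ hs
  rintro _ ⟨p, q, rfl, l, hl, m, hm, rfl⟩
  rw [SetLike.mem_coe, Submodule.mem_comap, shuf_tmul CK CL x hy hl]
  exact zsmul_mem (AugBimodCx.sqMk_mem (by omega) (inKL_mem hK hx hl) (inKL_mem hK hy hm)) _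

/-- The sign (-1)^{|l||y|} makes the shuffle a chain map from the tensor product of K ⊗ K and L ⊗ L.
Both sides are linear, so it is checked on homogeneous tensors. -/
lemma sqD_shuf (hK : CK.IsEquivariant Γ) {i : ℕ} {t : K ⊗[k] K}
    (ht : t ∈ CK.tensorGr CK.toGrCx i) (s : L ⊗[k] L) :
    (smashRes CK hK CL).sqD (shuf CK CL t s) = shuf CK CL (CK.tensorD CK.toGrCx t) s
      + sg i • shuf CK CL t (CL.tensorD CL.toGrCx s) := by
  refine LinearMap.congr_fun (f := (smashRes CK hK CL).sqD ∘ₗ shuf CK CL t)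
    (g := shuf CK CL (CK.tensorD CK.toGrCx t) + sg i • (shuf CK CL t ∘ₗ CL.tensorD CL.toGrCx))
    (TensorProduct.ext' fun l m => ?_) s
  refine LinearMap.congr_fun (f := (smashRes CK hK CL).sqD ∘ₗ shuf CK CL t ∘ₗ
      (TensorProduct.mk k L L).flip m)
    (g := (shuf CK CL (CK.tensorD CK.toGrCx t) + sg i • (shuf CK CL t ∘ₗ CL.tensorD CL.toGrCx)) ∘ₗ
      (TensorProduct.mk k L L).flip m) (ext_gr CL.isInternal fun p l hl => ?_) l
  refine Submodule.span_le (p := LinearMap.eqLocus ((smashRes CK hK CL).sqD ∘ₗ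
    (shuf CK CL).flip (l ⊗ₜ m)) ((shuf CK CL).flip (l ⊗ₜ m) ∘ₗ CK.tensorD CK.toGrCx
      + sg i • ((shuf CK CL).flip (CL.tensorD CL.toGrCx (l ⊗ₜ m))))) |>.2 ?_ ht
  rintro _ ⟨a, b, rfl, x, hx, y, hy, rfl⟩
  change (smashRes CK hK CL).sqD (shuf CK CL (x ⊗ₜ y) (l ⊗ₜ m)) =
    shuf CK CL (CK.tensorD CK.toGrCx (x ⊗ₜ y)) (l ⊗ₜ m)
      + sg (a + b : ℕ) • shuf CK CL (x ⊗ₜ y) (CL.tensorD CL.toGrCx (l ⊗ₜ m))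
  -- Writing the sign of the lowered degree as a product of signs of the original degrees keeps the
  -- formula valid for b = 0, where both sides vanish.
  have h1 : shuf CK CL (x ⊗ₜ CK.d y) (l ⊗ₜ m) = (sg (b * p) * sg p) •
      sqMk k (Smash k A Γ) _ (inKL k Γ K L x l ⊗ₜ inKL k Γ K L (CK.d y) m) := by
    rcases b with _ | b
    · simp [CK.d_gr_zero y hy]
    · rw [shuf_tmul CK CL x (CK.d_mem b y hy) hl, ← sg_add]
      congr 1
      push_cast
      rw [show ((b : ℤ) + 1) * p + p = b * p + (p + p) by ring, sg_add, sg_even (Even.add_self _),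
        mul_one]
  have h2 : shuf CK CL (x ⊗ₜ y) (CL.d l ⊗ₜ m) = (sg (b * p) * sg b) •
      sqMk k (Smash k A Γ) _ (inKL k Γ K L x (CL.d l) ⊗ₜ inKL k Γ K L y m) := by
    rcases p with _ | p
    · simp [CL.d_gr_zero l hl]
    · rw [shuf_tmul CK CL x hy (CL.d_mem p l hl), ← sg_add]
      congr 1
      push_cast
      rw [show (b : ℤ) * (p + 1) + b = b * p + (b + b) by ring, sg_add, sg_even (Even.add_self _),
        mul_one]
  have h3 := (smashRes CK hK CL).sgn_mem (inKL_mem hK hx hl)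
  simp only [GrCx.tensorD, LinearMap.add_apply, TensorProduct.map_tmul, LinearMap.id_coe, id_eq,
    map_add, CK.sgn_mem hx, CL.sgn_mem hl, ← TensorProduct.smul_tmul', map_zsmul,
    LinearMap.smul_apply, h1, h2, shuf_tmul CK CL _ hy hl]
  rw [AugBimodCx.sqD_mk, h3, d_inKL, d_inKL, CK.sgn_mem hx, CK.sgn_mem hy]
  simp only [TensorProduct.add_tmul, TensorProduct.tmul_add, map_add,
    LinearMap.smul_apply, map_zsmul, ← TensorProduct.smul_tmul', TensorProduct.tmul_smul]
  push_cast
  rw [sg_add, sg_add]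
  -- Each of the four terms of the differential occurs on both sides, so only a comparison of signs
  -- remains.
  generalize sqMk k (Smash k A Γ) (SmashMod k K (Ind k Γ L)) _ = e1
  generalize sqMk k (Smash k A Γ) (SmashMod k K (Ind k Γ L)) _ = e2
  generalize sqMk k (Smash k A Γ) (SmashMod k K (Ind k Γ L)) _ = e3
  generalize sqMk k (Smash k A Γ) (SmashMod k K (Ind k Γ L)) _ = e4
  rcases sg_cases b with h | h <;> rw [h] <;> module

/-- The augmentation of K kills odd degrees, so the signed summand disappears and the unsigned one
is multiplicative. -/
lemma sqAug_shuf (hK : CK.IsEquivariant Γ) (t : K ⊗[k] K) (s : L ⊗[k] L) :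
    (smashRes CK hK CL).sqAug (shuf CK CL t s)
      = LinearMap.mul' k k (TensorProduct.map CL.aug CL.aug s) •
        Smash.inA k A Γ (LinearMap.mul' k A (TensorProduct.map CK.aug CK.aug t)) := by
  have he : ∀ y, CK.aug (CK.even y) = CK.aug y := LinearMap.congr_fun (f := CK.aug ∘ₗ CK.even)
    (ext_gr CK.isInternal fun n y hy => by
      rw [LinearMap.comp_apply, GrCx.even, scaleOf_mem _ _ hy]
      rcases n with _ | n
      · simp
      · rw [map_zsmul, CK.aug_pos n y hy, smul_zero])
  have ho : ∀ y, CK.aug (CK.odd y) = 0 := LinearMap.congr_fun (f := CK.aug ∘ₗ CK.odd) (g := 0)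
    (ext_gr CK.isInternal fun n y hy => by
      rw [LinearMap.comp_apply, GrCx.odd, scaleOf_mem _ _ hy]
      rcases n with _ | n
      · simp
      · rw [map_zsmul, CK.aug_pos n y hy, smul_zero]; rfl)
  have h : ∀ x y l m, (smashRes CK hK CL).sqAug (shuf₀ k A Γ K L (x ⊗ₜ y) (l ⊗ₜ m))
      = (CL.aug l * CL.aug m) • Smash.inA k A Γ (CK.aug x * CK.aug y) := by
    intro x y l m
    rw [shuf₀_tmul]
    change (smashRes CK hK CL).aug (inKL k Γ K L x l) * (smashRes CK hK CL).aug (inKL k Γ K L y m)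
      = _
    rw [aug_inKL, aug_inKL, map_mul, smul_mul_smul_comm]
  induction t using TensorProduct.induction_on with
  | zero => simp
  | add x y hx hy => simp only [map_add, LinearMap.add_apply, hx, hy, smul_add]
  | tmul x y =>
    induction s using TensorProduct.induction_on with
    | zero => simp
    | add x y hx hy => simp only [map_add, hx, hy, add_smul]
    | tmul l m =>
      rw [shuf_eq]
      simp only [TensorProduct.map_tmul, LinearMap.id_coe, id_eq, map_add, h, he, ho, mul_zero,
        map_zero, smul_zero, add_zero, LinearMap.mul'_apply]

variable (CK CL) in
/-- `shuffle` on the balanced tensor product. -/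
def sqShuf : Sq k A K →ₗ[k] L ⊗[k] L →ₗ[k] Sq k (Smash k A Γ) (SmashMod k K (Ind k Γ L)) :=
  BTen.lift (shuf CK CL) (shuf_bal CK CL)

variable (ω : CK.Diagonal) (σ : CL.Diagonal)

/-- The restriction to `L` of the diagonal map of `K # L↑`. -/
def smashGen : L →ₗ[k] (K →ₗ[k] Sq k (Smash k A Γ) (SmashMod k K (Ind k Γ L))) :=
  (sqShuf CK CL ∘ₗ ω.toFun).flip ∘ₗ σ.toFun

lemma smashGen_apply (l : L) (x : K) :
    smashGen ω σ l x = sqShuf CK CL (ω.toFun x) (σ.toFun l) := rfl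

lemma smashGen_eq {x : K} {t : K ⊗[k] K} (ht : sqMk k A K t = ω.toFun x) (l : L) :
    smashGen ω σ l x = shuf CK CL t (σ.toFun l) := by
  rw [smashGen_apply, ← ht]; rfl

/-- In the antipode-free form, Γ-linearity of ω and of σ turns both sides into Sweedler sums of
shuffles, and these agree by `sw_shuf`. A representative t of ω(x) suffices, because the diagonal
action on the balanced product is induced from K ⊗ K. -/
lemma smashGen_twisted (hK : CK.IsEquivariant Γ) (hω : ω.IsEquivariant Γ) (γ : Γ) (l : L) :
    smashGen ω σ (MulOpposite.op γ • l) = tw K hS ((sqAct k (Smash k A Γ)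
      (SmashMod k K (Ind k Γ L))).comap (Smash.inΓ k A Γ)) γ (smashGen ω σ l) := by
  refine LinearMap.congr_fun ((eq_tw_iff hS (smashSqΓ k A Γ K L)
    (smashGen ω σ ∘ₗ (ract k Γ L).flip l) (smashGen ω σ l)).2 fun x => ?_) γ
  obtain ⟨t, ht⟩ := BTen.mk_surj (ω.toFun x)
  have h1 : (smashGen ω σ ∘ₗ (ract k Γ L).flip l).flip x
      = shuf CK CL t ∘ₗ (diagOp (ract k Γ L) (ract k Γ L)).flip (σ.toFun l) := by
    refine LinearMap.ext fun g => ?_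
    refine (smashGen_eq ω σ ht _).trans ?_
    exact congrArg _ (σ.lin g l)
  have h2 : smashGen ω σ l ∘ₗ (lact k Γ K).flip x = (shuf CK CL).flip (σ.toFun l) ∘ₗ
      (diagOp (lact k Γ K) (lact k Γ K)).flip t := by
    refine LinearMap.ext fun g => ?_
    refine smashGen_eq ω σ ?_ _
    exact ((hω g x).trans (congrArg (sqΓ g) ht.symm)).symm
  rw [h1, h2]
  exact sw_shuf hS CL hK t _

lemma smashGen_isBiHom (l : L) : IsBiHom (BimAct.of k A K) ((sqAct k (Smash k A Γ)
    (SmashMod k K (Ind k Γ L))).comap (Smash.inA k A Γ)) (smashGen ω σ l) := by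
  constructor
  · intro a x
    obtain ⟨t, ht⟩ := BTen.mk_surj (ω.toFun x)
    refine (smashGen_eq ω σ (t := TensorProduct.map (lact k A K a) LinearMap.id t) ?_ l).trans ?_
    · exact ((ω.left_lin a x).trans (congrArg (sqL K a) ht.symm)).symm
    · rw [shuf_left, smashGen_eq ω σ ht]; rfl
  · intro a x
    obtain ⟨t, ht⟩ := BTen.mk_surj (ω.toFun x)
    refine (smashGen_eq ω σ (t := TensorProduct.map LinearMap.id (ract k A K a) t) ?_ l).trans ?_
    · exact ((ω.right_lin a x).trans (congrArg (sqR K a) ht.symm)).symm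
    · rw [shuf_right, smashGen_eq ω σ ht]; rfl

lemma smashGen_mem (hK : CK.IsEquivariant Γ) {i p : ℕ} {x : K} (hx : x ∈ CK.gr i) {l : L}
    (hl : l ∈ CL.gr p) : smashGen ω σ l x ∈ (smashRes CK hK CL).sqGr (i + p) := by
  obtain ⟨t, ht, htx⟩ := ω.map_gr i x hx
  rw [smashGen_eq ω σ htx]
  exact shuf_mem hK ht (σ.map_gr p l hl)

/-- The underlying map of the diagonal map of `K # L↑`. -/
def smashDiagFun (hK : CK.IsEquivariant Γ) (hω : ω.IsEquivariant Γ) :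
    SmashMod k K (Ind k Γ L) →ₗ[k] Sq k (Smash k A Γ) (SmashMod k K (Ind k Γ L)) :=
  extF hS (sqAct k (Smash k A Γ) (SmashMod k K (Ind k Γ L))) (smashGen ω σ)
    (smashGen_twisted hS ω σ hK hω)

variable (hK : CK.IsEquivariant Γ) (hω : ω.IsEquivariant Γ)

lemma smashDiagFun_inKL (x : K) (l : L) :
    smashDiagFun hS ω σ hK hω (inKL k Γ K L x l) = smashGen ω σ l x :=
  extF_inKL hS _ x l

lemma smashDiagFun_isBiHom : IsBiHom (BimAct.of k (Smash k A Γ) (SmashMod k K (Ind k Γ L)))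
    (sqAct k (Smash k A Γ) (SmashMod k K (Ind k Γ L))) (smashDiagFun hS ω σ hK hω) :=
  extF_isBiHom hS _ (smashGen_isBiHom ω σ)

lemma smashDiagFun_mem {n : ℕ} {z : SmashMod k K (Ind k Γ L)}
    (hz : z ∈ (smashRes CK hK CL).gr n) :
    smashDiagFun hS ω σ hK hω z ∈ (smashRes CK hK CL).sqGr n := by
  refine extF_mem hS _ hK ?_ ?_ (fun i p hip x hx l hl => ?_) hz
  · exact fun γ m hm => AugBimodCx.sqL_mem _ _ m hm
  · exact fun γ m hm => AugBimodCx.sqR_mem _ _ m hm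
  · exact hip ▸ smashGen_mem ω σ hK hx hl

/-- Both sides are bimodule maps, so they are compared on elements x ⊗ l with x homogeneous, where ω
and σ are chain maps and the shuffle is one. -/
lemma smashDiagFun_d (z : SmashMod k K (Ind k Γ L)) :
    smashDiagFun hS ω σ hK hω ((smashRes CK hK CL).d z)
      = (smashRes CK hK CL).sqD (smashDiagFun hS ω σ hK hω z) := by
  refine LinearMap.congr_fun (f := smashDiagFun hS ω σ hK hω ∘ₗ (smashRes CK hK CL).d)
    (g := (smashRes CK hK CL).sqD ∘ₗ smashDiagFun hS ω σ hK hω)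
    (SmashMod.hom_ext hS
      ((smashDiagFun_isBiHom hS ω σ hK hω).comp (smashRes CK hK CL).isBiHom_d)
      ((smashRes CK hK CL).isBiHom_sqD.comp (smashDiagFun_isBiHom hS ω σ hK hω))
      fun x l => ?_) z
  refine LinearMap.congr_fun (f := smashDiagFun hS ω σ hK hω ∘ₗ (smashRes CK hK CL).d ∘ₗ
      (inKL k Γ K L).flip l)
    (g := (smashRes CK hK CL).sqD ∘ₗ smashDiagFun hS ω σ hK hω ∘ₗ (inKL k Γ K L).flip l)
    (ext_gr CK.isInternal fun i x hx => ?_) x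
  change smashDiagFun hS ω σ hK hω ((smashRes CK hK CL).d (inKL k Γ K L x l))
    = (smashRes CK hK CL).sqD (smashDiagFun hS ω σ hK hω (inKL k Γ K L x l))
  obtain ⟨t, ht, htx⟩ := ω.map_gr i x hx
  rw [d_inKL, map_add, smashDiagFun_inKL, smashDiagFun_inKL, smashDiagFun_inKL, CK.sgn_mem hx,
    map_zsmul, smashGen_eq ω σ htx, smashGen_eq ω σ htx, σ.map_d, sqD_shuf hK ht]
  congr 1
  exact smashGen_eq ω σ ((ω.map_d x).trans (congrArg CK.sqD htx.symm)).symm l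

lemma smashDiagFun_aug (z : SmashMod k K (Ind k Γ L)) :
    (smashRes CK hK CL).sqAug (smashDiagFun hS ω σ hK hω z) = (smashRes CK hK CL).aug z := by
  refine LinearMap.congr_fun (f := (smashRes CK hK CL).sqAug ∘ₗ smashDiagFun hS ω σ hK hω)
    (g := (smashRes CK hK CL).aug) (SmashMod.hom_ext hS
      ((smashRes CK hK CL).isBiHom_sqAug.comp (smashDiagFun_isBiHom hS ω σ hK hω))
      (smashRes CK hK CL).isBiHom_aug fun x l => ?_) z
  obtain ⟨t, ht⟩ := BTen.mk_surj (ω.toFun x)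
  rw [LinearMap.comp_apply, smashDiagFun_inKL, smashGen_eq ω σ ht, sqAug_shuf, σ.aug_comp,
    aug_inKL, ← ω.aug_comp, ← ht]
  rfl

/-- The diagonal map of `K # L↑` defined by diagonal maps of `K` and `L`. -/
def smashDiagonal : (smashRes CK hK CL).Diagonal where
  toFun := smashDiagFun hS ω σ hK hω
  left_lin := (smashDiagFun_isBiHom hS ω σ hK hω).left
  right_lin := (smashDiagFun_isBiHom hS ω σ hK hω).right
  map_gr _ _ hz := smashDiagFun_mem hS ω σ hK hω hz
  map_d := smashDiagFun_d hS ω σ hK hω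
  aug_comp := smashDiagFun_aug hS ω σ hK hω

lemma isSmashDiagonal_smashDiagonal :
    IsSmashDiagonal hK ω σ (smashDiagonal hS ω σ hK hω) := fun x l _ ht =>
  (smashDiagFun_inKL hS ω σ hK hω x l).trans (smashGen_eq ω σ ht l)

include hS in
-- The prescribed values are those on the generators x ⊗ l, and a diagonal map is a bimodule map.
lemma IsSmashDiagonal.unique {Δ Δ' : (smashRes CK hK CL).Diagonal}
    (h : IsSmashDiagonal hK ω σ Δ) (h' : IsSmashDiagonal hK ω σ Δ') : Δ = Δ' := by
  have e : Δ.toFun = Δ'.toFun := SmashMod.hom_ext hS Δ.isBiHom Δ'.isBiHom fun x l => by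
    obtain ⟨t, ht⟩ := BTen.mk_surj (ω.toFun x)
    rw [h x l t ht, h' x l t ht]
  cases Δ
  cases Δ'
  congr

include hS in
lemma existsUnique_smashDiagonal (hω : ω.IsEquivariant Γ) :
    ∃! Δ : (smashRes CK hK CL).Diagonal, IsSmashDiagonal hK ω σ Δ :=
  ⟨smashDiagonal hS ω σ hK hω, isSmashDiagonal_smashDiagonal hS ω σ hK hω,
    fun _ h => h.unique hS ω σ hK (isSmashDiagonal_smashDiagonal hS ω σ hK hω)⟩

end SmashDiag

/-! ### Hom(P#L↑, B) as the total complex, with signs -/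

section TotalComparison
variable {k A Γ P L B : Type u} [Field k] [Ring A] [Algebra k A] [Ring Γ] [HopfAlgebra k Γ]
  [Module Γ A] [IsScalarTower k Γ A] [ModuleAlgebra k A Γ] [Ring B] [Algebra k B]
  [AddCommGroup P] [Module k P] [Module A P] [Module Aᵐᵒᵖ P] [IsBimod k A P]
  [Module Γ P] [IsScalarTower k Γ P] [EqBimod k A Γ P]
  [AddCommGroup L] [Module k L] [Module Γᵐᵒᵖ L] [IsScalarTower k Γᵐᵒᵖ L]
  (hS : Function.Bijective (HopfAlgebra.antipode k (A := Γ)))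

open HomAct

/-- The bimodule structure of `B` defined by an algebra map `R → B`. -/
abbrev extAct {R : Type u} [Ring R] [Algebra k R] (φ : R →ₐ[k] B) : BimAct k R B :=
  (BimAct.self k B).comap φ

lemma sg_congr {a b c : ℤ} (h : a = b + 2 * c) : sg a = sg b := by
  rw [h, sg_add, sg_even (even_two_mul c), mul_one]

lemma extAct_comap {R R' : Type u} [Ring R] [Algebra k R] [Ring R'] [Algebra k R']
    (φ : R →ₐ[k] B) (χ : R' →ₐ[k] R) : (extAct φ).comap χ = extAct (φ.comp χ) := rfl

lemma BHom.zsmul_apply {R X : Type u} [Ring R] [Algebra k R] [AddCommGroup X] [Module k X]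
    [Module R X] [Module Rᵐᵒᵖ X] [IsBimod k R X] {ψ : R →ₐ[k] B} (c : ℤ) (f : BHom X ψ) (x : X) :
    ((c • f : BHom X ψ) : X →ₗ[k] B) x = c • (f : X →ₗ[k] B) x := rfl

/-- The action in the definition of the total complex is a convolution product with values in B,
formed at each x; `tw` is one with values in operators. They are matched in two stages, first the
product of the last two factors. -/
lemma twAct_eq_tw (ψ : Γ →ₐ[k] B) (f : P →ₗ[k] B) (γ : Γ) (x : P) :
    twAct ψ f γ x = tw P hS (extAct ψ) γ f x := by
  have h1 : ∀ g, (WithConv.toConv (f ∘ₗ (lact k Γ P).flip x) * WithConv.toConv ψ.toLinearMap).ofConv g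
      = (WithConv.toConv (μ Γ P B) * WithConv.toConv (rho P (extAct ψ))).ofConv g f x := by
    intro g
    change LinearMap.mul' k B (TensorProduct.map _ _ (comul g))
      = LinearMap.mul' k _ (TensorProduct.map (μ Γ P B) (rho P (extAct ψ)) (comul g)) f x
    generalize (comul g : Γ ⊗[k] Γ) = s
    induction s using TensorProduct.induction_on with
    | zero => simp
    | add x y hx hy => simp only [map_add, LinearMap.add_apply, hx, hy]
    | tmul a b => rfl
  have h2 := congrArg (fun e : WithConv (Γ →ₗ[k] Module.End k (P →ₗ[k] B)) => e.ofConv γ f x)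
    ((toConv_tw' P hS (extAct ψ)).trans (mul_assoc _ _ _))
  refine Eq.trans ?_ h2.symm
  rw [twAct, conjConv, mul_assoc]
  generalize WithConv.toConv (f ∘ₗ (lact k Γ P).flip x) * WithConv.toConv ψ.toLinearMap = u at h1
  generalize WithConv.toConv (μ Γ P B) * WithConv.toConv (rho P (extAct ψ)) = v at h1
  change LinearMap.mul' k B (TensorProduct.map _ _ (comul γ))
    = LinearMap.mul' k (Module.End k (P →ₗ[k] B)) (TensorProduct.map _ _ (comul γ)) f x
  generalize (comul γ : Γ ⊗[k] Γ) = s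
  induction s using TensorProduct.induction_on with
  | zero => simp
  | add x y hx hy => simp only [map_add, LinearMap.add_apply, hx, hy]
  | tmul a b => exact congrArg (fun c => ψ (HopfAlgebra.antipode k a) * c) (h1 b)

variable (CP : AugBimodCx k A P) (CL : AugRightCx k Γ L)

section
variable {φ : A →ₐ[k] B}

/-- The operator `H ↦ (l ↦ (x ↦ (-1)^{|x||l|} H(l)(x)))`. -/
def signOp : (L →ₗ[k] BHom P φ) →ₗ[k] (L →ₗ[k] BHom P φ) :=
  LinearMap.lcomp k _ CL.even + LinearMap.compRight k CP.sHom ∘ₗ LinearMap.lcomp k _ CL.odd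

lemma signOp_apply (H : L →ₗ[k] BHom P φ) (l : L) :
    signOp CP CL H l = H (CL.even l) + CP.sHom (H (CL.odd l)) := rfl

variable {CP CL}

lemma signOp_mem {i j : ℕ} {l : L} (hl : l ∈ CL.gr i) {x : P} (hx : x ∈ CP.gr j)
    (H : L →ₗ[k] BHom P φ) :
    (signOp CP CL H l : P →ₗ[k] B) x = sg (i * j) • (H l : P →ₗ[k] B) x := by
  rw [signOp_apply, Submodule.coe_add, LinearMap.add_apply, AugBimodCx.sHom_apply, CP.sgn_mem hx,
    GrCx.even, GrCx.odd, scaleOf_mem _ _ hl, scaleOf_mem _ _ hl]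
  by_cases h : Even i
  · rw [sg_even ((Int.even_coe_nat i).2 h |>.mul_right _)]
    simp [h]
  · have ho : Odd (i : ℤ) := by exact_mod_cast Nat.not_even_iff_odd.1 h
    obtain ⟨q, hq⟩ := ho
    have : sg (i * j) = sg j := by
      rw [hq, add_mul, one_mul, sg_add, sg_even (by rw [mul_assoc]; exact even_two_mul _), one_mul]
    rw [this]
    simp only [h, if_false, zero_smul, map_zero, one_smul, zero_add, map_zsmul,
      ZeroMemClass.coe_zero, LinearMap.zero_apply]

lemma homL_ext {F G : L →ₗ[k] BHom P φ} (h : ∀ i, ∀ l ∈ CL.gr i, ∀ j, ∀ x ∈ CP.gr j,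
    (F l : P →ₗ[k] B) x = (G l : P →ₗ[k] B) x) : F = G :=
  ext_gr CL.isInternal fun i l hl => Subtype.ext (ext_gr CP.isInternal fun j x hx => h i l hl j x hx)

lemma signOp_signOp (H : L →ₗ[k] BHom P φ) : signOp CP CL (signOp CP CL H) = H := by
  refine homL_ext (CP := CP) (CL := CL) fun i l hl j x hx => ?_
  rw [signOp_mem hl hx, signOp_mem hl hx, smul_smul, sg_mul_self, one_smul]

/-- The parity projections of L commute with Γ, and so does the sign operator of P, so the twisted
action passes through both summands. -/
lemma signOp_twisted (hP : CP.IsEquivariant Γ) {ψ : Γ →ₐ[k] B} {H : L →ₗ[k] BHom P φ}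
    (hH : ∀ (γ : Γ) l x, (H (MulOpposite.op γ • l) : P →ₗ[k] B) x = twAct ψ (H l) γ x)
    (γ : Γ) (l : L) (x : P) : (signOp CP CL H (MulOpposite.op γ • l) : P →ₗ[k] B) x
      = twAct ψ (signOp CP CL H l) γ x := by
  have h : twAct ψ (H (CL.odd l)) γ (CP.sgn x) = twAct ψ (CP.sHom (H (CL.odd l))) γ x := by
    have e : (H (CL.odd l) : P →ₗ[k] B) ∘ₗ (lact k Γ P).flip (CP.sgn x)
        = (CP.sHom (H (CL.odd l)) : P →ₗ[k] B) ∘ₗ (lact k Γ P).flip x :=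
      LinearMap.ext fun δ => congrArg _ (hP.scale_smul _ δ x).symm
    rw [twAct, twAct, e]
  rw [signOp_apply, signOp_apply, GrCx.even, GrCx.odd, CL_scale_op, CL_scale_op, Submodule.coe_add,
    LinearMap.add_apply, AugBimodCx.sHom_apply, hH, hH, ← GrCx.even, ← GrCx.odd, h,
    Submodule.coe_add, twAct_add]

end

variable (φ : Smash k A Γ →ₐ[k] B)

lemma IsBiHom.of_mem_BHom {R X : Type u} [Ring R] [Algebra k R] [AddCommGroup X] [Module k X]
    [Module R X] [Module Rᵐᵒᵖ X] [IsBimod k R X] {ψ : R →ₐ[k] B} {f : X →ₗ[k] B}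
    (hf : f ∈ BHom X ψ) : IsBiHom (BimAct.of k R X) (extAct ψ) f := ⟨hf.1, hf.2⟩

variable (P L) in
/-- The restriction `f ↦ (l ↦ f(- ⊗ l))` of bimodule maps. -/
def resL : BHom (SmashMod k P (Ind k Γ L)) φ →ₗ[k]
    (L →ₗ[k] BHom P (φ.comp (Smash.inA k A Γ))) where
  toFun f :=
    { toFun := fun l => ⟨f.1 ∘ₗ (inKL k Γ P L).flip l,
        fun a x => by
          change f.1 (inKL k Γ P L (a • x) l) = _
          rw [← SmashMod.inA_smul_inKL]; exact f.2.1 _ _,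
        fun a x => by
          change f.1 (inKL k Γ P L (MulOpposite.op a • x) l) = _
          rw [← SmashMod.op_inA_smul_inKL]; exact f.2.2 _ _⟩
      map_add' := fun l m => by ext; simp
      map_smul' := fun c l => by ext; simp }
  map_add' f g := by ext; rfl
  map_smul' c f := by ext; rfl

lemma resL_apply (f : BHom (SmashMod k P (Ind k Γ L)) φ) (l : L) (x : P) :
    (resL P L φ f l : P →ₗ[k] B) x = f.1 (inKL k Γ P L x l) := rfl

include hS in
-- The case M = B of the adjunction, read with the action used in the total complex.
lemma resL_twisted (f : BHom (SmashMod k P (Ind k Γ L)) φ) (γ : Γ) (l : L) (x : P) :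
    (resL P L φ f (MulOpposite.op γ • l) : P →ₗ[k] B) x
      = twAct (φ.comp (Smash.inΓ k A Γ)) (resL P L φ f l) γ x := by
  have h := restrict_twisted hS (b := extAct φ) (IsBiHom.of_mem_BHom f.2) γ l
  rw [extAct_comap] at h
  exact (LinearMap.congr_fun h x).trans (twAct_eq_tw hS _ _ γ x).symm

variable {CP CL} (hP : CP.IsEquivariant Γ)

include hS in
lemma resL_injective : Function.Injective (resL P L φ) := fun f g h =>
  Subtype.ext (SmashMod.hom_ext hS (IsBiHom.of_mem_BHom f.2) (IsBiHom.of_mem_BHom g.2)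
    fun x l => LinearMap.congr_fun (congrArg Subtype.val (LinearMap.congr_fun h l)) x)

include hS in
-- Surjectivity is the extension half of the adjunction. Vanishing outside degree n passes from
-- generators to all of P#L↑ through `extF_mem` with S = 0.
lemma exists_resL_eq {n : ℤ} {F : L →ₗ[k] BHom P (φ.comp (Smash.inA k A Γ))}
    (hF : F ∈ totDeg CL CP (φ.comp (Smash.inA k A Γ)) (φ.comp (Smash.inΓ k A Γ)) n) :
    ∃ f ∈ (smashRes CP hP CL).homDeg φ n, resL P L φ f = F := by
  have hG : ∀ (γ : Γ) l, ((BHom P (φ.comp (Smash.inA k A Γ))).subtype ∘ₗ F) (MulOpposite.op γ • l)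
      = tw P hS ((extAct φ).comap (Smash.inΓ k A Γ)) γ
        (((BHom P (φ.comp (Smash.inA k A Γ))).subtype ∘ₗ F) l) := fun γ l =>
    LinearMap.ext fun x => (hF.1 γ l x).trans (twAct_eq_tw hS _ _ γ x)
  have hb := extF_isBiHom (b := extAct φ) hS hG fun l => ⟨(F l).2.1, (F l).2.2⟩
  refine ⟨⟨extF hS (extAct φ) _ hG, hb.left, hb.right⟩, fun i hi z hz => ?_, ?_⟩
  · refine extF_mem (S := ⊥) hS hG hP ?_ ?_ (fun j p hjp x hx l hl => ?_) hz
    · rintro r _ rfl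
      exact map_zero ((extAct φ).l r)
    · rintro r _ rfl
      exact map_zero ((extAct φ).r r)
    · exact hF.2 p j (by omega) l hl x hx
  · ext l x
    exact extF_inKL hS hG x l

include hS in
lemma signOp_resL_mem {n : ℤ} {f : BHom (SmashMod k P (Ind k Γ L)) φ}
    (hf : f ∈ (smashRes CP hP CL).homDeg φ n) : signOp CP CL (resL P L φ f) ∈
      totDeg CL CP (φ.comp (Smash.inA k A Γ)) (φ.comp (Smash.inΓ k A Γ)) n := by
  refine ⟨signOp_twisted hP (resL_twisted hS φ f), fun i j hij l hl x hx => ?_⟩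
  rw [signOp_mem hl hx, resL_apply, hf (j + i) (by push_cast; omega) _ (inKL_mem hP hx hl),
    smul_zero]

include hP in
lemma signOp_mem_totDeg {n : ℤ} {F : L →ₗ[k] BHom P (φ.comp (Smash.inA k A Γ))}
    (hF : F ∈ totDeg CL CP (φ.comp (Smash.inA k A Γ)) (φ.comp (Smash.inΓ k A Γ)) n) :
    signOp CP CL F ∈ totDeg CL CP (φ.comp (Smash.inA k A Γ)) (φ.comp (Smash.inΓ k A Γ)) n := by
  refine ⟨signOp_twisted hP hF.1, fun i j hij l hl x hx => ?_⟩
  rw [signOp_mem hl hx, hF.2 i j hij l hl x hx, smul_zero]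

/-- On P#L↑ the differential passes P before L, while in the total complex F is evaluated on l
first. Exchanging x and l costs (-1)^{|x||l|}, and with this correction the two differentials agree;
the term with dl survives only for |x| + |dl| = n, which trades (-1)^n for local degrees. -/
lemma totD_signOp_resL {n : ℤ} {f : BHom (SmashMod k P (Ind k Γ L)) φ}
    (hf : f ∈ (smashRes CP hP CL).homDeg φ n) :
    signOp CP CL (resL P L φ ((smashRes CP hP CL).dHom φ f))
      = totD CL CP _ n (signOp CP CL (resL P L φ f)) := by
  refine homL_ext (CP := CP) (CL := CL) fun p l hl i x hx => ?_
  have h1 : (signOp CP CL (resL P L φ f) l : P →ₗ[k] B) (CP.d x)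
      = (sg (p * i) * sg p) • f.1 (inKL k Γ P L (CP.d x) l) := by
    rcases i with _ | i
    · simp [CP.d_gr_zero x hx]
    · rw [signOp_mem hl (CP.d_mem i x hx), ← sg_add, resL_apply]
      congr 1
      push_cast
      rw [show (p : ℤ) * (i + 1) + p = p * i + (p + p) by ring, sg_add, sg_even (Even.add_self _),
        mul_one]
  have h2 : sg n • (signOp CP CL (resL P L φ f) (CL.d l) : P →ₗ[k] B) x
      = -(sg (p * i) * sg p) • f.1 (inKL k Γ P L x (CL.d l)) := by
    rcases p with _ | p
    · simp [CL.d_gr_zero l hl]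
    · rw [signOp_mem (CL.d_mem p l hl) hx, resL_apply]
      by_cases hn : (i + p : ℤ) = n
      · rw [smul_smul, ← hn]
        congr 1
        push_cast
        rw [add_mul, one_mul, sg_add, sg_add (p * i), sg_add p, sg_one]
        rcases sg_cases i with h | h <;> rw [h] <;> ring
      · rw [hf (i + p) (by push_cast; exact hn) _ (inKL_mem hP hx (CL.d_mem p l hl))]
        simp
  rw [signOp_mem hl hx, resL_apply, AugBimodCx.dHom_apply,
    (smashRes CP hP CL).sgn_mem (inKL_mem hP hx hl), map_zsmul, map_zsmul, d_inKL, CP.sgn_mem hx,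
    totD_apply, Submodule.coe_sub, LinearMap.sub_apply, AugBimodCx.dHom_apply, CP.sgn_mem hx,
    map_zsmul, map_zsmul, map_zsmul, h1, BHom.zsmul_apply, h2]
  push_cast
  simp only [map_add, map_zsmul, LinearMap.smul_apply]
  rw [sg_add]
  rcases sg_cases i with h | h <;> rw [h] <;> module

variable (ΔP : CP.Diagonal) (hΔP : ΔP.IsEquivariant Γ) (σ : CL.Diagonal)

/-- The Koszul signs on the two sides agree on homogeneous tensors: for degrees c, e in P and a, b
in L the exponents differ by 2(bc + ae), provided e + b = q. Otherwise g vanishes on y ⊗ m and both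
sides are zero. -/
lemma pair_shuf {q : ℤ} {f g : BHom (SmashMod k P (Ind k Γ L)) φ}
    (hg : g ∈ (smashRes CP hP CL).homDeg φ q) {j p : ℕ} {x : P} {t : P ⊗[k] P}
    (ht : t ∈ CP.tensorGr CP.toGrCx j) (htx : sqMk k A P t = ΔP.toFun x) {s : L ⊗[k] L}
    (hs : s ∈ CL.tensorGr CL.toGrCx p) :
    sg (p * j) • (smashRes CP hP CL).pair f g (shuf CP CL t s)
      = (cupT ΔP (signOp CP CL (resL P L φ f) ∘ₗ scaleOf CL.isInternal fun i => sg (q * i))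
        (signOp CP CL (resL P L φ g)) s : P →ₗ[k] B) x := by
  induction hs using Submodule.span_induction with
  | zero => simp
  | add w w' _ _ h h' => simp only [map_add, smul_add, h, h', Submodule.coe_add, LinearMap.add_apply]
  | smul c w _ h => rw [map_smul, map_smul, map_smul, Submodule.coe_smul, LinearMap.smul_apply, ← h,
      smul_comm]
  | mem w hw =>
    obtain ⟨a, b, rfl, l, hl, m, hm, rfl⟩ := hw
    change _ = CP.pair _ _ (ΔP.toFun x)
    rw [← htx, AugBimodCx.pair_mk]
    clear htx
    induction ht using Submodule.span_induction with
    | zero => simp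
    | add x y _ _ hx hy => simp only [map_add, LinearMap.add_apply, smul_add, hx, hy]
    | smul c x _ hx => rw [map_smul, map_smul, LinearMap.smul_apply, map_smul, ← hx, smul_comm]
    | mem t ht =>
      obtain ⟨c, e, rfl, x, hx, y, hy, rfl⟩ := ht
      rw [CP.pairAux_hom _ _ hx hy, shuf_tmul CP CL x hy hl, map_zsmul, AugBimodCx.pair_mk,
        AugBimodCx.pairAux_hom _ _ _ (inKL_mem hP hx hl) (inKL_mem hP hy hm), LinearMap.comp_apply,
        scaleOf_mem _ _ hl, map_zsmul, BHom.zsmul_apply, signOp_mem hl hx,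
        signOp_mem hm hy, resL_apply, resL_apply]
      by_cases hq : (e + b : ℤ) = q
      · subst hq
        simp only [smul_mul_assoc, mul_smul_comm, smul_smul, ← sg_add]
        congr 1
        push_cast
        exact sg_congr (c := b * c + a * e) (by ring)
      · rw [hg (e + b) (by push_cast; exact hq) _ (inKL_mem hP hy hm)]
        simp

/-- The isomorphism of complexes from bimodule maps on `P # L↑` to the total complex. -/
def totMap (ΔP : CP.Diagonal) (hΔP : ΔP.IsEquivariant Γ) (σ : CL.Diagonal)
    (Δ : (smashRes CP hP CL).Diagonal) :
    DGAlg.CxMap (Δ.homDGAlg φ) (totDGAlg σ hP ΔP hΔP (φ.comp (Smash.inA k A Γ))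
      (φ.comp (Smash.inΓ k A Γ))) where
  f n := (signOp CP CL ∘ₗ resL P L φ).restrict (p := (smashRes CP hP CL).homDeg φ n)
    (q := totDeg CL CP (φ.comp (Smash.inA k A Γ)) (φ.comp (Smash.inΓ k A Γ)) n)
    fun _ hf => signOp_resL_mem hS φ hP hf
  comm _ f := Subtype.ext (totD_signOp_resL φ hP f.2)

/-- The sign operator is an involution preserving the total complex, so bijectivity is that of the
restriction, which is the adjunction. -/
lemma totMap_bijective (Δ : (smashRes CP hP CL).Diagonal) (n : ℤ) :
    Function.Bijective ((totMap hS φ hP ΔP hΔP σ Δ).f n) := by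
  constructor
  · intro f g h
    have h1 : signOp CP CL (resL P L φ f.1) = signOp CP CL (resL P L φ g.1) :=
      congrArg Subtype.val h
    have h2 := congrArg (signOp CP CL) h1
    rw [signOp_signOp, signOp_signOp] at h2
    exact Subtype.ext (resL_injective hS φ h2)
  · rintro ⟨F, hF⟩
    obtain ⟨f, hf, hfF⟩ := exists_resL_eq hS φ hP (signOp_mem_totDeg φ hP hF)
    refine ⟨⟨f, hf⟩, Subtype.ext ?_⟩
    change signOp CP CL (resL P L φ f) = F
    rw [hfF, signOp_signOp]

/-- Because the diagonal is given on generators by the shuffle formula, compatibility with products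
holds strictly and not merely up to homotopy. This is why the smash diagonal is used on P#L↑. -/
lemma totMap_mul {Δ : (smashRes CP hP CL).Diagonal} (hΔ : IsSmashDiagonal hP ΔP σ Δ)
    {p q r : ℤ} (hr : p + q = r) (f : (Δ.homDGAlg φ).X p) (g : (Δ.homDGAlg φ).X q) :
    (totMap hS φ hP ΔP hΔP σ Δ).f r ((Δ.homDGAlg φ).mul hr f g)
      = (totDGAlg σ hP ΔP hΔP _ _).mul hr ((totMap hS φ hP ΔP hΔP σ Δ).f p f)
        ((totMap hS φ hP ΔP hΔP σ Δ).f q g) := by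
  refine Subtype.ext (homL_ext (CP := CP) (CL := CL) fun i l hl j x hx => ?_)
  obtain ⟨t, ht, htx⟩ := ΔP.map_gr j x hx
  refine Eq.trans ?_ (pair_shuf φ hP ΔP g.2 ht htx (σ.map_gr i l hl))
  refine (signOp_mem hl hx _).trans (congrArg (fun b => sg (i * j) • b) ?_)
  exact congrArg _ (hΔ x l t htx)

end TotalComparison


end SmashHH

end

/-! ### Assembly of the zigzag -/

theorem mainTheorem11 {k A Γ K L P B : Type u} [Field k]
    [Ring A] [Algebra k A] [Ring Γ] [HopfAlgebra k Γ]
    (hS : Function.Bijective (HopfAlgebra.antipode k (A := Γ)))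
    [Module Γ A] [IsScalarTower k Γ A] [ModuleAlgebra k A Γ]
    [Ring B] [Algebra k B] (φ : Smash k A Γ →ₐ[k] B)
    [AddCommGroup K] [Module k K] [Module A K] [Module Aᵐᵒᵖ K] [IsBimod k A K]
    [Module Γ K] [IsScalarTower k Γ K] [EqBimod k A Γ K]
    (CK : AugBimodCx k A K) (hK : CK.IsEquivariant Γ) (hKres : CK.IsResolution)
    (hKfree : CK.IsFreeOnΓ Γ) (ω : CK.Diagonal) (hω : ω.IsEquivariant Γ)
    [AddCommGroup L] [Module k L] [Module Γᵐᵒᵖ L] [IsScalarTower k Γᵐᵒᵖ L]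
    (CL : AugRightCx k Γ L) (hL : CL.IsProjRes) (σ : CL.Diagonal)
    [AddCommGroup P] [Module k P] [Module A P] [Module Aᵐᵒᵖ P] [IsBimod k A P]
    [Module Γ P] [IsScalarTower k Γ P] [EqBimod k A Γ P]
    (CP : AugBimodCx k A P) (hP : CP.IsEquivariant Γ) (hPres : CP.IsResolution)
    (hPproj : CP.IsProjective) (ΔP : CP.Diagonal) (hΔP : ΔP.IsEquivariant Γ) :
    (∃! Δ : (smashRes CK hK CL).Diagonal, IsSmashDiagonal hK ω σ Δ) ∧
    ∀ Δ : (smashRes CK hK CL).Diagonal, IsSmashDiagonal hK ω σ Δ →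
      ∃ (𝒜 : DGAlg k) (η₁ : DGAlg.CxMap (Δ.homDGAlg φ) 𝒜)
        (η₂ : DGAlg.CxMap (totDGAlg σ hP ΔP hΔP (φ.comp (Smash.inA k A Γ))
          (φ.comp (Smash.inΓ k A Γ))) 𝒜),
        η₁.IsQuasiIso ∧ η₁.IsMulUpToHomotopy ∧ η₂.IsQuasiIso ∧ η₂.IsMulUpToHomotopy ∧
        ∀ (Q : Type u) [AddCommGroup Q] [Module k Q] [Module (Smash k A Γ) Q]
          [Module (Smash k A Γ)ᵐᵒᵖ Q] [IsBimod k (Smash k A Γ) Q]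
          (CQ : AugBimodCx k (Smash k A Γ) Q) (_ : CQ.IsResolution) (_ : CQ.IsProjective)
          (ΔQ : CQ.Diagonal),
          Nonempty (CQ.Hom (smashRes CK hK CL)) ∧
          ∃ (Ψ₁ : DGAlg.HIso (Δ.homDGAlg φ) (ΔQ.homDGAlg φ))
            (Ψ₂ : DGAlg.HIso (totDGAlg σ hP ΔP hΔP (φ.comp (Smash.inA k A Γ))
              (φ.comp (Smash.inΓ k A Γ))) (ΔQ.homDGAlg φ)),
            (∀ (c : CQ.Hom (smashRes CK hK CL)) n u, Ψ₁.iso n u = (c.pullback Δ ΔQ φ).H n u) ∧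
            ∀ n u v, η₁.H n u = η₂.H n v → Ψ₁.iso n u = Ψ₂.iso n v := by
  refine ⟨existsUnique_smashDiagonal hS ω σ hK hω, fun Δ hΔ => ?_⟩
  -- Both K#L↑ and P#L↑ behave as projective bimodule resolutions of A#Γ, through freeness of K in
  -- one case and projectivity of P in the other.
  have lK : LiftProp (BimAct.of k (Smash k A Γ) (SmashMod k K (Ind k Γ L))) :=
    LiftProp.smash hS hKfree.liftProp hL.proj
  have lP : LiftProp (BimAct.of k (Smash k A Γ) (SmashMod k P (Ind k Γ L))) :=
    LiftProp.smash hS hPproj.liftProp hL.proj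
  have rK : (smashRes CK hK CL).IsResolution := hKres.smash hK hL
  have rP : (smashRes CP hP CL).IsResolution := hPres.smash hP hL
  -- The middle term of the zigzag is the Hom algebra of P#L↑: it shares the type of resolution with
  -- K#L↑ and the adjunction with the total complex.
  let Δ' := smashDiagonal hS ΔP σ hP hΔP
  have hΔ' : IsSmashDiagonal hP ΔP σ Δ' := isSmashDiagonal_smashDiagonal hS ΔP σ hP hΔP
  -- No compatibility of this comparison map with the diagonals is imposed; it holds up to homotopy
  -- automatically.
  obtain ⟨c₁⟩ := (smashRes CP hP CL).exists_hom lP rK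
  let η₁ := c₁.pullback Δ Δ' φ
  let ρ := totMap hS φ hP ΔP hΔP σ Δ'
  have hρ : ∀ n, Function.Bijective (ρ.f n) := totMap_bijective hS φ hP ΔP hΔP σ Δ'
  -- The adjunction isomorphism points towards the total complex, while the required arrow points
  -- away from it, hence the inverse.
  let η₂ := ρ.ofBijective hρ
  have q₁ : η₁.IsQuasiIso := c₁.pullback_isQuasiIso lP rP lK rK Δ Δ'
  have m₁ : η₁.IsMulUpToHomotopy := c₁.pullback_isMulUpToHomotopy lP lK rK Δ Δ'
  have q₂ : η₂.IsQuasiIso := ρ.ofBijective_isQuasiIso hρ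
  have m₂ : η₂.IsMulUpToHomotopy :=
    ρ.ofBijective_isMul hρ fun hr x y => totMap_mul hS φ hP ΔP hΔP σ hΔ' hr x y
  refine ⟨Δ'.homDGAlg φ, η₁, η₂, q₁, m₁, q₂, m₂, ?_⟩
  intro Q _ _ _ _ _ CQ rQ pQ ΔQ
  -- One comparison map defines Ψ₁; any other is homotopic to it and induces the same map on
  -- cohomology.
  obtain ⟨c⟩ := CQ.exists_hom pQ.liftProp rK
  let Ψ₁ := (c.pullback Δ ΔQ φ).toHIso (c.pullback_isQuasiIso pQ.liftProp rQ lK rK Δ ΔQ)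
    (c.pullback_isMulUpToHomotopy pQ.liftProp lK rK Δ ΔQ)
  -- Setting Ψ₂ = Ψ₁ ∘ H(η₁)⁻¹ ∘ H(η₂) makes the required compatibility of Ψ₁ and Ψ₂ formal.
  refine ⟨⟨c⟩, Ψ₁, (η₂.toHIso q₂ m₂).trans ((η₁.toHIso q₁ m₁).symm.trans Ψ₁),
    fun c' n u => LinearMap.congr_fun
      (AugBimodCx.Hom.pullback_H_eq pQ.liftProp rK c c' Δ ΔQ n) u, fun n u v h => ?_⟩
  refine congrArg (Ψ₁.iso n) ?_
  exact (LinearEquiv.eq_symm_apply _).2 h
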